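/- **Setting.** Let $m\ge 0$ and let $\Phi^{(\alpha)}(z,y_0,\dots,y_m)=\sum_{h,k}\phi^{(\alpha)}_{h;k}\,z^h\prod_\beta y_\beta^{k_\beta}$ ($0\le\alpha\le m$) be polynomials with non-negative real coefficients, with $\phi^{(\alpha)}_{0;0}=0$ and such that the linear part of $\Phi(0,y)$ is a nilpotent matrix. They specify weighted coloured rooted trees: an internal node of colour $\alpha$ with $h$ leaves and $k_\beta$ children of colour $\beta$ (for all $\beta$) has weight $\phi^{(\alpha)}_{h;k}$, the weight $W(T)$ of a tree is the product of the weights of its internal nodes, and its size is its number of leaves. Assume the hypotheses of the Drmota–Lalley–Woods theorem: some $\Phi^{(\alpha)}$ has degree at least $2$ in $y$; the dependency graph (an edge $\alpha\to\beta$ when $y_\beta$ occurs in $\Phi^{(\alpha)}$) is strongly connected; and no generating function $Y^{(\alpha)}(z)$ of the trees with root colour $\alpha$ has its support in an arithmetic progression $r+d\mathbb Z$ with $d\ge2$. Colour $0$ is called $A$; $A_n$ is the total weight of the trees with root colour $A$ and size $n$; $\mu_n(T)=W(T)/A_n$ on these trees. Cutting such a tree at all its nodes of colour $A$ gives a list $(t_1,\dots,t_k)$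 of pieces in depth-first order: each has root $A$, leaves labelled $z$ or $A$, and its other internal nodes have colours in $\{1,\dots,m\}$. A piece $t$ has $v(t)$ leaves $z$, $\ell(t)$ leaves $A$, weight $W(t)$ and step $(v(t),\ell(t)-1)$. A list is a bridge (of size $n$) if its steps sum to $(n,-1)$, and an excursion if moreover the ordinate is $\ge0$ at all earlier times. Let $\mu_n^{\rm(cyc)}(t_1,\dots,t_k)=\frac1{A_n}\frac{\prod_jW(t_j)}{k}$ on bridges. Let $A(z,u)=\sum_tW(t)z^{v(t)}u^{\ell(t)}$; a critical point is a pair $\zeta,\theta>0$ with $A(\zeta,\theta)/\theta=1$ and $\partial_\theta(A(\zeta,\theta)/\theta)=0$. Let $v_0$ be the least $v(t)$ over the pieces of positive weight with $\ell(t)=0$, $\mathcal T_{v_0,0}$ the set of the pieces with $v=v_0$, $\ell=0$, $T_0$ its total weight, $\mu_0=W/T_0$ on it, $A_0=T_0\zeta^{v_0}/\theta$, $A_{\neq}=A(\zeta,\theta)/\theta-A_0$, $\tilde u(x,y)=x+v_0y$, $\tilde u_j=\tilde u(v(t_j),\ell(t_j)-1)$. **Algorithm** (parameters $\varepsilon,\kappa>0$,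 size $n$). Put $\xi_\pm=\pm\varepsilon/\sqrt{n-v_0}$, $(z_\pm,u_\pm)=(\zeta e^{\xi_\pm},\theta e^{v_0\xi_\pm})$, and let $\mu_{\neq}=\pi_+\mu_{\neq}(\cdot\,;z_+,u_+)+\pi_-\mu_{\neq}(\cdot\,;z_-,u_-)$, where $\mu_{\neq}(t;z,u)=\frac{W(t)z^{v(t)}u^{\ell(t)-1}}{(A(z,u)-T_0z^{v_0})/u}$ for $t\notin\mathcal T_{v_0,0}$, $\pi_++\pi_-=1$, and $\pi_\pm$ are chosen so that $\tilde\pi_+=\tilde\pi_-$ for $\tilde\pi_\pm=\pi_\pm A_{\neq}u_\pm/(A(z_\pm,u_\pm)-T_0z_\pm^{v_0})$. Let $F(x)=\sum_\pm\tilde\pi_\pm e^{\xi_\pm x}$. 1. Sample independent pieces $t_1,t_2,\dots$ from $\mu_{\neq}$ (choose the sign with law $\pi$, then run the stochastic rewriting process with parameters $(z_\pm,u_\pm)$ until its outcome is not in $\mathcal T_{v_0,0}$), until the sum $\vec u$ of the steps satisfies $\tilde u(\vec u)\ge n-v_0$. Let $k$ be the number of pieces. If $\vec u$ is not on the landing diagonal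 $D_n=\{(i,j): i\ge 0,\ j\ge-1,\ i+v_0j=n-v_0\}$, restart. Otherwise let $q=\vec u_2+1$, and restart unless a uniform random number in $[0,1]$ is less than $$r_n=\kappa\,n^{3/2}\,\frac{(k+q-1)!}{k!\,q!}\,A_{\neq}^k\,A_0^{q}\prod_{j=1}^kF(\tilde u_j)^{-1}.$$ 2. Sample $q$ independent pieces from $\mu_0$, and interleave the two lists according to a uniformly random string with $k$ symbols of one type and $q$ of the other, produced by the BBHL (BalancedShuffle) algorithm of Bacher, Bodini, Hollender and Lumbroso: random bits with parameter $k/(k+q)$ until one is in excess, then random swaps. This is the output for bridges. 3. For trees, apply moreover the cyclic shift at the first minimum of the ordinate. The cost is the number of elementary steps: real arithmetic operations (including exponentials), list operations, draws from a distribution on a finite set of outcomes depending only on the specification, and comparisons of a uniform number with a computed real cost one step per bounded number of operations; a uniform random integer in $\{1,\dots,j\}$ costs $\lfloor\log_2j\rfloor+1$; the cost of rewriting is proportional to the number of nodes and leaves generated. The numbers $\zeta$, $\theta$, $\kappa$, $T_0$, $z_\pm$, $u_\pm$, $\pi_\pm$, the table of $\mathcal T_{v_0,0}$ and the offspring probabilities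 are given. **Theorem.** Under these assumptions, $T\mapsto(t_1,\dots,t_k)$ is a bijection from the trees of size $n$ with root $A$ to the excursions of size $n$, for every $n$, with $W(T)=\prod_jW(t_j)$, and there is exactly one critical point $(\zeta,\theta)$. For this point and for every $\varepsilon>0$ there are $\kappa>0$, $c,C>0$ and $n_0$ such that for all $n\ge n_0$: $A_n>0$; the sampler of single pieces has law $\mu_{\neq}$; and * (acceptance rate) $0\le r_n\le1$ for all lists of pieces of positive weight outside $\mathcal T_{v_0,0}$ whose endpoint is in $D_n$; * (exactness) the algorithm halts almost surely, the output for bridges has law exactly $\mu_n^{\rm(cyc)}$, and the output for trees has law exactly $\mu_n$ (transported to excursions by the bijection); * (acceptance is $\Theta(1)$) the probability that a run of step 1 reaches $D_n$, and the mean $\mathbb E(r_n)$ of the acceptance rate over the runs that reach $D_n$, are both in $[c,1]$; * (linear complexity, optimal up to a constant) the average cost of the algorithm, with all the rejected runs, the evaluations of $r_n$, the shuffle and the cyclic shift included, is at most $Cn$, and it is at most $C\,S[\mu_n]$, where $S[\mu_n]=-\sum_T\mu_n(T)\ln\mu_n(T)$ is the Shannon entropy. -/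

import Mathlib

open scoped ENNReal

noncomputable section

namespace CF

/-! ### Coloured trees, context-free specifications -/

/-- Rooted trees whose internal nodes are coloured by `0, …, m` (colour `0` is the colour `A`).
A node of colour `α` has `h` leaves (labelled `z`) and, for every colour `β`, an ordered family of
`k β` children of colour `β`; these are the trees in bijection with the structures of type `α`. -/
inductive Tree (m : ℕ) : Fin (m + 1) → Type
  | node (α : Fin (m + 1)) (h : ℕ) (k : Fin (m + 1) → ℕ)
      (ch : ∀ β : Fin (m + 1), Fin (k β) → Tree m β) : Tree m α

/-- The pieces obtained by cutting trees at the nodes of colour `0`: the root is arbitrary, all the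
other internal nodes have colours in `{1, …, m}`, and there are two types of leaves: a node with
data `(h, k)` has `h` leaves labelled `z` and `k 0` leaves labelled `A`. -/
inductive Piece (m : ℕ) : Fin (m + 1) → Type
  | node (α : Fin (m + 1)) (h : ℕ) (k : Fin (m + 1) → ℕ)
      (ch : ∀ β : Fin m, Fin (k β.succ) → Piece m β.succ) : Piece m α

/-- A context-free specification with colours `0, …, m`, given by the polynomials
`Φ^α(z, y) = ∑_{h,k} φ α h k * z ^ h * ∏ β, y β ^ k β`. -/
structure Spec (m : ℕ) where
  φ : Fin (m + 1) → ℕ → (Fin (m + 1) → ℕ) → ℝ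
  nonneg : ∀ α h k, 0 ≤ φ α h k
  finite : ∀ α, {p : ℕ × (Fin (m + 1) → ℕ) | φ α p.1 p.2 ≠ 0}.Finite
  /-- every internal node has at least one child (so that every tree has leaves) -/
  no_empty_node : ∀ α, φ α 0 0 = 0
  /-- the linear part of `Φ(0, y)` is nilpotent -/
  nilpotent : IsNilpotent (Matrix.of fun α β : Fin (m + 1) => φ α 0 (Pi.single β 1))

variable {m : ℕ}

/-- Number of leaves. -/
def Tree.size : ∀ {α : Fin (m + 1)}, Tree m α → ℕ
  | _, .node _ h _ ch => h + ∑ β, ∑ i, (ch β i).size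

/-- `W(T)`: the product of the coefficients `φ` over the internal nodes. -/
def Tree.weight (S : Spec m) : ∀ {α : Fin (m + 1)}, Tree m α → ℝ
  | _, .node α h k ch => S.φ α h k * ∏ β, ∏ i, (ch β i).weight S

/-- `v(t)`: the number of leaves labelled `z`. -/
def Piece.zl : ∀ {α : Fin (m + 1)}, Piece m α → ℕ
  | _, .node _ h _ ch => h + ∑ β, ∑ i, (ch β i).zl

/-- `ℓ(t)`: the number of leaves labelled `A`. -/
def Piece.al : ∀ {α : Fin (m + 1)}, Piece m α → ℕ
  | _, .node _ _ k ch => k 0 + ∑ β, ∑ i, (ch β i).al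

/-- `W(t)`. -/
def Piece.weight (S : Spec m) : ∀ {α : Fin (m + 1)}, Piece m α → ℝ
  | _, .node α h k ch => S.φ α h k * ∏ β, ∏ i, (ch β i).weight S

/-- The piece containing the root of a tree. -/
def Tree.top : ∀ {α : Fin (m + 1)}, Tree m α → Piece m α
  | _, .node α h k ch => .node α h k fun β i => (ch β.succ i).top

/-- The pieces other than the one containing the root, in depth-first order. -/
def Tree.rest : ∀ {α : Fin (m + 1)}, Tree m α → List (Piece m 0)
  | _, .node _ _ k ch =>
      (List.ofFn fun i : Fin (k 0) => (ch 0 i).top :: (ch 0 i).rest).flatten ++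
      (List.ofFn fun β : Fin m =>
        (List.ofFn fun i : Fin (k β.succ) => (ch β.succ i).rest).flatten).flatten

/-- The list of pieces `(t_1, …, t_k)` of a tree with root colour `A`, in depth-first order. -/
def Tree.cut (T : Tree m 0) : List (Piece m 0) := T.top :: T.rest

open scoped Classical in
/-- `[z^n] Y^α(z)`: the total weight of the trees with root colour `α` and `n` leaves. -/
def coeff (S : Spec m) (α : Fin (m + 1)) (n : ℕ) : ℝ :=
  ∑' T : Tree m α, if T.size = n then T.weight S else 0

/-- Some polynomial `Φ^α` has degree at least `2` in `y`. -/
def Nonlinear (S : Spec m) : Prop :=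
  ∃ α h k, S.φ α h k ≠ 0 ∧ 2 ≤ ∑ β, k β

/-- The dependency graph (an edge from `α` to `β` when `y β` occurs in `Φ^α`) is strongly
connected. -/
def Irreducible (S : Spec m) : Prop :=
  ∀ α β, Relation.ReflTransGen (fun a b => ∃ h k, S.φ a h k ≠ 0 ∧ k b ≠ 0) α β

/-- No series `Y^α(z)` has its support contained in a proper arithmetic progression `r + d ℤ`. -/
def Aperiodic (S : Spec m) : Prop :=
  ∀ (α : Fin (m + 1)) (d r : ℕ), 2 ≤ d → ∃ n, coeff S α n ≠ 0 ∧ ¬ n ≡ r [MOD d]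

/-! ### Target measures -/

open scoped Classical in
/-- `μ_n` on trees with root colour `A`. -/
def mu (S : Spec m) (n : ℕ) (T : Tree m 0) : ℝ :=
  if T.size = n then T.weight S / coeff S 0 n else 0

/-- The Shannon entropy `S[μ_n]`. -/
def entropy (S : Spec m) (n : ℕ) : ℝ := ∑' T : Tree m 0, Real.negMulLog (mu S n T)

/-- The vector `(v(t), ℓ(t) - 1)` of a piece. -/
def Piece.vec (t : Piece m 0) : ℤ × ℤ := ((t.zl : ℤ), (t.al : ℤ) - 1)

/-- Endpoint of the walk from the origin whose steps are the vectors of the pieces. -/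
def endpoint (t : List (Piece m 0)) : ℤ × ℤ := (t.map Piece.vec).sum

/-- Generalised Łukasiewicz bridges: walks from `(0, 0)` to `(n, -1)`. -/
def IsBridge (n : ℕ) (t : List (Piece m 0)) : Prop := endpoint t = ((n : ℤ), -1)

/-- Generalised Łukasiewicz excursions. -/
def IsExcursion (n : ℕ) (t : List (Piece m 0)) : Prop :=
  IsBridge n t ∧ ∀ j < t.length, 0 ≤ (endpoint (t.take j)).2

open scoped Classical in
/-- The measure `μ_n^(cyc)` on bridges. -/
def muCyc (S : Spec m) (n : ℕ) (t : List (Piece m 0)) : ℝ :=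
  if IsBridge n t then (t.map (Piece.weight S)).prod / (coeff S 0 n * t.length) else 0

/-! ### Generating functions of the pieces, critical point -/

/-- `Y^α(z, u)`, in particular `A(z, u)` for `α = 0`. -/
def Y (S : Spec m) (α : Fin (m + 1)) (z u : ℝ) : ℝ :=
  ∑' t : Piece m α, t.weight S * z ^ t.zl * u ^ t.al

/-- The critical point: `A(ζ, θ) / θ = 1` and `∂_θ (A(ζ, θ) / θ) = 0`. -/
def IsCritical (S : Spec m) (ζ θ : ℝ) : Prop :=
  0 < ζ ∧ 0 < θ ∧ Y S 0 ζ θ / θ = 1 ∧ HasDerivAt (fun u => Y S 0 ζ u / u) 0 θ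

/-- `v_0`: the smallest number of `z`-leaves of a piece without `A`-leaves. -/
def v0 (S : Spec m) : ℕ :=
  sInf {v | ∃ t : Piece m 0, 0 < t.weight S ∧ t.zl = v ∧ t.al = 0}

/-- The class `𝒯_{v_0,0}`. -/
def IsFinal (S : Spec m) (t : Piece m 0) : Prop := t.zl = v0 S ∧ t.al = 0

open scoped Classical in
/-- `T_0`: the total weight of `𝒯_{v_0,0}`. -/
def T0 (S : Spec m) : ℝ := ∑' t : Piece m 0, if IsFinal S t then t.weight S else 0

/-- `ũ = v + v_0 (ℓ - 1)`. -/
def tilde (S : Spec m) (u : ℤ × ℤ) : ℤ := u.1 + v0 S * u.2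

/-- The landing diagonal `D_n`. -/
def landing (S : Spec m) (n : ℕ) : Set (ℤ × ℤ) :=
  {u | 0 ≤ u.1 ∧ -1 ≤ u.2 ∧ tilde S u = (n : ℤ) - v0 S}

/-- The final region `F_n`. -/
def finalRegion (S : Spec m) (n : ℕ) : Set (ℤ × ℤ) :=
  {u | (n : ℤ) - v0 S ≤ tilde S u}

/-! ### Randomised programs with a step count -/

/-- A randomised computation with outputs in `X`: `x a c` is the probability that it halts with
output `a` after exactly `c` elementary steps. The total mass is less than one when the computation
may run forever. -/
def Run (X : Type) : Type := X → ℕ → ℝ≥0∞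

namespace Run

open scoped Classical in
instance : Monad Run where
  pure a := fun a' c => if a' = a ∧ c = 0 then 1 else 0
  bind x f := fun b c => ∑' a, ∑ p ∈ Finset.HasAntidiagonal.antidiagonal c, x a p.1 * f a b p.2

variable {X Z : Type}

/-- The computation that never halts. -/
def diverge : Run X := fun _ _ => 0

/-- Spend `k` steps. -/
def tick (k : ℕ) : Run Unit := fun _ c => if c = k then 1 else 0

/-- One random draw, in one step. Used for distributions on finite sets only. -/
def draw (p : X → ℝ) : Run X := fun a c => if c = 1 then ENNReal.ofReal (p a) else 0

/-- The test `rand_[0,1] < r`. -/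
def flip (r : ℝ) : Run Bool := draw fun b => if b then min r 1 else 1 - min r 1

/-- A uniform element of `{0, …, j}`, at the price of its number of random bits. -/
def randInt (j : ℕ) : Run ℕ := fun h c =>
  if h ≤ j ∧ c = Nat.log 2 (j + 1) + 1 then ((j : ℝ≥0∞) + 1)⁻¹ else 0

/-- At most `d` iterations of a loop: `inl` continues with a new state, `inr` exits. -/
def loopUpTo (body : Z → Run (Z ⊕ X)) : ℕ → Z → Run X
  | 0, _ => diverge
  | d + 1, s => do
      match ← body s with
      | .inl s' => loopUpTo body d s'
      | .inr a => pure a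

/-- The unbounded loop. -/
def loop (body : Z → Run (Z ⊕ X)) (s : Z) : Run X :=
  fun a c => ⨆ d, loopUpTo body d s a c

/-- Run finitely many computations, one after the other, and collect the outputs. -/
def seqFin : ∀ {n : ℕ} {B : Fin n → Type}, (∀ i, Run (B i)) → Run (∀ i, B i)
  | 0, _, _ => pure fun i => i.elim0
  | _ + 1, _, x => do
      let a ← x 0
      let r ← seqFin fun i => x i.succ
      pure (Fin.cons a r)

/-- `n` independent runs. -/
def replicate (x : Run X) : ℕ → Run (List X)
  | 0 => pure []
  | n + 1 => do
      let a ← x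
      let l ← replicate x n
      pure (a :: l)

/-- The product of a list of numbers, one step per factor. -/
def mulAll : List ℝ → Run ℝ
  | [] => pure 1
  | x :: l => do
      let y ← mulAll l
      tick 1
      pure (x * y)

/-- The law of the output: `law x a` is the probability of halting with output `a`. -/
def law (x : Run X) (a : X) : ℝ≥0∞ := ∑' c, x a c

/-- The average number of steps (of a computation that halts almost surely). -/
def cost (x : Run X) : ℝ≥0∞ := ∑' a, ∑' c, x a c * c

end Run

/-! ### The shuffle -/

/-- Append `x` to `ν`, then swap the last entry and the entry of index `h`. -/
def swapIn (ν : List Bool) (x : Bool) (h : ℕ) : List Bool :=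
  match ν[h]? with
  | some y => ν.set h x ++ [y]
  | none => ν ++ [x]

/-- First phase of the BBHL shuffle: draw independent bits until there is one in excess, which is
discarded. The state holds the bits so far, and how many `true` and `false` are still available;
on exit, the other value is returned with the bits. -/
def bbhlDraw (β : ℝ) (s : List Bool × ℕ × ℕ) : Run ((List Bool × ℕ × ℕ) ⊕ (List Bool × Bool)) := do
  let x ← Run.flip β
  match x, s with
  | true, (ν, a + 1, b) => pure (.inl (ν ++ [true], a, b))
  | true, (ν, 0, _) => pure (.inr (ν, false))
  | false, (ν, a, b + 1) => pure (.inl (ν ++ [false], a, b))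
  | false, (ν, _, 0) => pure (.inr (ν, true))

/-- Second phase of the BBHL shuffle: `r` random swaps. -/
def bbhlFill (x : Bool) : ℕ → List Bool → Run (List Bool)
  | 0, ν => pure ν
  | r + 1, ν => do
      let h ← Run.randInt ν.length
      Run.tick 1
      bbhlFill x r (swapIn ν x h)

/-- The BBHL shuffle of `a` symbols `true` and `b` symbols `false`. -/
def bbhl (a b : ℕ) : Run (List Bool) := do
  let s ← Run.loop (bbhlDraw ((a : ℝ) / (a + b))) ([], a, b)
  bbhlFill s.2 (a + b - s.1.length) s.1

/-- Interleave two lists, without changing the order inside each of them: `true` takes the next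
entry of the first list, `false` the next entry of the second one. -/
def interleave {X : Type} : List Bool → List X → List X → Run (List X)
  | true :: ν, a :: s, t => do
      Run.tick 1
      let l ← interleave ν s t
      pure (a :: l)
  | false :: ν, s, b :: t => do
      Run.tick 1
      let l ← interleave ν s t
      pure (b :: l)
  | _, _, _ => pure []

/-! ### The cyclic shift -/

/-- One pass over the walk, computing the first time at which its ordinate is minimal: `y` is the
present ordinate, `i` the present time, `b` the smallest ordinate so far, first reached at `j`. -/
def firstMin : List (Piece m 0) → (y : ℤ) → (i : ℕ) → (b : ℤ) → (j : ℕ) → Run ℕ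
  | [], _, _, _, j => pure j
  | s :: t, y, i, b, j => do
      Run.tick 1
      if y + s.vec.2 < b then firstMin t (y + s.vec.2) (i + 1) (y + s.vec.2) (i + 1)
      else firstMin t (y + s.vec.2) (i + 1) b j

/-- The operator `Cyc`, in linear time. -/
def cyc (t : List (Piece m 0)) : Run (List (Piece m 0)) := do
  let j ← firstMin t 0 0 0 0
  Run.tick t.length
  pure (t.rotate j)

/-! ### The algorithm -/

/-- The distribution of the offspring of a node of colour `α` in the stochastic rewriting process
of the pieces with parameters `(z, u)`. -/
def offspring (S : Spec m) (z u : ℝ) (α : Fin (m + 1)) (p : ℕ × (Fin (m + 1) → ℕ)) : ℝ :=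
  S.φ α p.1 p.2 * z ^ p.1 * u ^ p.2 0 * (∏ β : Fin m, Y S β.succ z u ^ p.2 β.succ) / Y S α z u

/-- The stochastic rewriting process with parameters `(z, u)`, stopped at depth `d`. -/
def rewriteUpTo (S : Spec m) (z u : ℝ) : ℕ → (α : Fin (m + 1)) → Run (Piece m α)
  | 0, _ => Run.diverge
  | d + 1, α => do
      let p ← Run.draw (offspring S z u α)
      Run.tick (p.1 + ∑ β, p.2 β)
      let ch ← Run.seqFin fun β : Fin m => Run.seqFin fun _ : Fin (p.2 β.succ) =>
        rewriteUpTo S z u d β.succ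
      pure (.node α p.1 p.2 ch)

/-- The stochastic rewriting process, started from a node of colour `A`. -/
def rewrite (S : Spec m) (z u : ℝ) : Run (Piece m 0) :=
  fun t c => ⨆ d, rewriteUpTo S z u d 0 t c

/-- The data of an instance of the algorithm: a specification, a point `(ζ, θ)`, the constants `ε`
and `κ` in `ξ = ε / √(n - v_0)` and `K_n = κ n^(3/2)`, and the target size `n`. -/
structure Setup (m : ℕ) where
  S : Spec m
  ζ : ℝ
  θ : ℝ
  ε : ℝ
  κ : ℝ
  n : ℕ

namespace Setup

variable (P : Setup m)

/-- `A_0 = T_0 ζ^v_0 / θ`. -/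
def A0 : ℝ := T0 P.S * P.ζ ^ v0 P.S / P.θ

/-- `A_≠ = A(ζ, θ) / θ - A_0`. -/
def Ane : ℝ := Y P.S 0 P.ζ P.θ / P.θ - P.A0

/-- `ξ_± = ± ε / √(n - v_0)`. -/
def ξ (a : Bool) : ℝ := (if a then 1 else -1) * (P.ε / √((P.n : ℝ) - v0 P.S))

/-- `z_± = ζ exp ξ_±`. -/
def z (a : Bool) : ℝ := P.ζ * Real.exp (P.ξ a)

/-- `u_± = θ exp (v_0 ξ_±)`. -/
def u (a : Bool) : ℝ := P.θ * Real.exp (v0 P.S * P.ξ a)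

/-- `A(z_a, u_a) / u_a - T_0 z_a^v_0 / u_a`, the total weight of the pieces outside
`𝒯_{v_0,0}`. -/
def massNe (a : Bool) : ℝ :=
  Y P.S 0 (P.z a) (P.u a) / P.u a - T0 P.S * P.z a ^ v0 P.S / P.u a

open scoped Classical in
/-- `μ_≠(t; z_a, u_a)`: the Boltzmann measure conditioned to be outside `𝒯_{v_0,0}`. -/
def muNeAt (a : Bool) (t : Piece m 0) : ℝ :=
  if IsFinal P.S t then 0
  else t.weight P.S * P.z a ^ t.zl * P.u a ^ ((t.al : ℤ) - 1) / P.massNe a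

/-- The probabilities `π_±`; they are the ones for which the mixture is balanced, that is
`π̃_+ = π̃_-`. -/
def prob (a : Bool) : ℝ := P.massNe a / ∑ b, P.massNe b

/-- The two-point mixture `μ_≠`. -/
def muNe (t : Piece m 0) : ℝ := ∑ a, P.prob a * P.muNeAt a t

/-- `π̃_a`. -/
def probTilde (a : Bool) : ℝ := P.prob a * P.Ane / P.massNe a

/-- `F(ũ) = ∑_a π̃_a exp (ξ_a ũ)`. -/
def F (x : ℤ) : ℝ := ∑ a, P.probTilde a * Real.exp (P.ξ a * x)

/-- `K_n = κ n^(3/2)`. -/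
def K : ℝ := P.κ * (P.n : ℝ) ^ (3 / 2 : ℝ)

/-- The acceptance rate `r_n`, for a list of `k` pieces landing at the ordinate `q - 1`. -/
def rate (t : List (Piece m 0)) : ℝ :=
  let k := t.length
  let q := ((endpoint t).2 + 1).toNat
  P.K * ((Nat.factorial (k + q - 1) : ℝ) / (Nat.factorial k * Nat.factorial q)) * P.Ane ^ k * P.A0 ^ q *
    (t.map fun s => (P.F (tilde P.S s.vec))⁻¹).prod

open scoped Classical in
/-- `μ_0`: the natural measure on the finite set `𝒯_{v_0,0}`. -/
def drawFinal : Run (Piece m 0) :=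
  Run.draw fun t => if IsFinal P.S t then t.weight P.S / T0 P.S else 0

open scoped Classical in
/-- Sampling a step: choose the component of the mixture, then run the rewriting process until the
outcome is outside `𝒯_{v_0,0}`. -/
def step : Run (Piece m 0) := do
  let a ← Run.draw P.prob
  Run.loop (fun _ : Unit => do
    let t ← rewrite P.S (P.z a) (P.u a)
    Run.tick 1
    pure (if IsFinal P.S t then .inl () else .inr t)) ()

open scoped Classical in
/-- The walk up to the final region; the second component is the position. -/
def walk : Run (List (Piece m 0) × (ℤ × ℤ)) :=
  Run.loop (fun s => do
    Run.tick 1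
    if s.2 ∈ finalRegion P.S P.n then pure (.inr s)
    else do
      let t ← P.step
      Run.tick 1
      pure (.inl (s.1 ++ [t], s.2 + t.vec))) ([], 0)

/-- Evaluation of the acceptance rate, through
`(k+q-1)! / (k! q!) = (k+q)⁻¹ ∏_{i < q} (k+1+i) / (1+i)`. -/
def evalRate (t : List (Piece m 0)) (q : ℕ) : Run ℝ := do
  let x ← Run.mulAll (t.map fun s => P.Ane / P.F (tilde P.S s.vec))
  let y ← Run.mulAll ((List.range q).map fun i : ℕ => P.A0 * ((t.length + 1 + i : ℝ) / (1 + i)))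
  Run.tick 1
  pure (P.K * x * y / (t.length + q))

open scoped Classical in
/-- One run of the body of the rejection loop; returns the walk and the number `q` of final pieces
to be added, or nothing in case of rejection. -/
def trial : Run (Option (List (Piece m 0) × ℕ)) := do
  let s ← P.walk
  if s.2 ∈ landing P.S P.n then do
    let q := (s.2.2 + 1).toNat
    let r ← P.evalRate s.1 q
    let b ← Run.flip r
    pure (if b then some (s.1, q) else none)
  else pure none

/-- The accelerated Boltzmann method for generalised Łukasiewicz bridges. -/
def bridgeSampler : Run (List (Piece m 0)) := do
  let s ← Run.loop (fun _ : Unit => do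
    match ← P.trial with
    | some s => pure (.inr s)
    | none => pure (.inl ())) ()
  let f ← Run.replicate P.drawFinal s.2
  let ν ← bbhl s.1.length s.2
  interleave ν s.1 f

/-- The accelerated Boltzmann method for excursions, that is for trees. -/
def treeSampler : Run (List (Piece m 0)) := do
  let t ← P.bridgeSampler
  cyc t

open scoped Classical in
/-- The probability of reaching the landing diagonal. -/
def reachProb : ℝ≥0∞ := ∑' s, if s.2 ∈ landing P.S P.n then P.walk.law s else 0

open scoped Classical in
/-- `𝔼(r_n)`: the mean acceptance rate of the walks that reach the landing diagonal. -/
def meanRate : ℝ≥0∞ :=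
  (∑' s, if s.2 ∈ landing P.S P.n then P.walk.law s * ENNReal.ofReal (P.rate s.1) else 0) /
    P.reachProb

end Setup

end CF

end

/-!
# Exact sampling of multitype trees in linear time

**The critical point.** The generating functions of the trees are controlled through the positive
supersolutions `Φ(z, y) ≤ y` of the system. For small `z` they exist by nilpotence (`CF.exists_feas`), and
for `z` bounded away from `0` they stay in a compact set (`CF.feas_bounds`), so there is a largest such `z`,
called `ζ`. At `ζ` the supersolution `y` is unique, because the geometric mean of two of them would be a
strict one (`CF.IsMaxZ.unique`), and it is a solution. A Perron-like eigenvector of the Jacobian matrix,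
obtained as a limit of normalised differences, is strictly contracted after the row of the colour `0` is
erased; this gives a point above `y` at which all the other equations are strict inequalities
(`CF.exists_strict_above`). Hence `A(z, u)` converges beyond `(ζ, y₀)`, and uniqueness of the supersolution
says that `A(ζ, u) / u` has its minimum `1` at `θ = y₀`: this is the critical point (`CF.exists_critical`).
Convexity of `A(ζ, ·)` makes it the only one (`CF.IsCritical.unique`). Convergence beyond the critical point
is kept in the form of exponential moments (`CF.Env`, `CF.exists_env`).

**Exactness.** Every piece that is not final increases `ũ = x + v₀ y` by at least `1`, so the walk takes at
most `n` steps, and the law of a walk that ends on the landing diagonal is the product of the laws of its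
pieces (`CF.Setup.Reg.tsum_walk_landing`). The parameters `(z_±, u_±)` multiply the critical weight of
a piece by `exp (ξ_± ũ)`, so the law of a piece is its critical weight times `F(ũ)`, and the acceptance rate
cancels `F`. Because the shuffle is uniform (`CF.law_bbhl`), the binomial coefficient in the rate cancels
too, and a bridge is obtained with a probability proportional to `∏ W / k` (`CF.Setup.Reg.accW_mul`,
`CF.Setup.Reg.law_bridgeSampler`). The cyclic shift is `k` to one on the rotations of bridges
(`CF.tsum_cyc`). The constant of proportionality need not be computed: since the algorithm halts almost
surely, it is `1 / A_n` (`CF.Setup.Reg.accProb_eq_coeff`).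

**The acceptance rate.** Up to the factors `F`, the rate is `κ n ^ (3 / 2)` times a binomial probability of
order `(k + q) ^ (-1/2)`, divided by `k + q`. It is not bounded for walks with few pieces, but then the
`ũ_j` are large on average, and the product of the `F(ũ_j)`, which is a product of hyperbolic cosines up to
a bounded factor, makes up for it (`CF.Setup.exists_rate_le`). For the lower bound on the acceptance
probability, the walk hits a given diagonal with a probability bounded from below by a renewal argument,
Chebyshev's inequality keeps the numbers of pieces of the two types within `O(√n)` of their means, and there
the binomial probability is of order `n ^ (-1/2)` (`CF.exists_le_hits`, `CF.Setup.Reg.le_accW`,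
`CF.Setup.exists_le_accProb`).

**The cost.** Average costs are bounded through the expected value `CF.Run.ert` of the number of steps plus
a function of the output, which obeys loop invariants (`CF.Run.ert_loop_le`). By the exponential moments
a piece has a bounded average cost, and the rejections multiply the cost of a trial by a bounded factor.
When both types are frequent, the first phase of the shuffle stops at `O(√n)` of the end, so that the
logarithmic cost of the random integers does not matter; the unbalanced cases, where the shuffle may cost
`n log n`, have a rate smaller by a factor `n` (`CF.Setup.mul_cost_bbhl_le`,
`CF.Setup.exists_cost_treeSampler_le`).

**Entropy.** The weight of a single tree is exponentially small compared with `ζ ^ (-n)`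
(`CF.Env.exists_weight_le`), whereas `A_n` is not, by the lower bound on the acceptance probability. So all
the trees have exponentially small probabilities, and the entropy is at least linear
(`CF.Setup.exists_le_entropy`).
-/

noncomputable section

/-! ### Calculus of randomised programs -/

namespace CF

theorem ENNReal.tsum_antidiagonal (g : ℕ → ℕ → ℝ≥0∞) :
    ∑' c, ∑ p ∈ Finset.HasAntidiagonal.antidiagonal c, g p.1 p.2 = ∑' i, ∑' j, g i j := by
  rw [← ENNReal.tsum_prod, ← Finset.HasAntidiagonal.sigmaAntidiagonalEquivProd.tsum_eq, ENNReal.tsum_sigma']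
  refine tsum_congr fun c => ?_
  rw [tsum_fintype, ← Finset.sum_coe_sort]
  rfl

theorem ENNReal.tsum_iSup_of_monotone {X : Type*} {f : ℕ → X → ℝ≥0∞}
    (hf : ∀ a, Monotone fun d => f d a) : ∑' a, ⨆ d, f d a = ⨆ d, ∑' a, f d a := by
  simp only [ENNReal.tsum_eq_iSup_sum]
  rw [iSup_comm]
  refine iSup_congr fun s => ?_
  exact ENNReal.finsetSum_iSup_of_monotone fun a => hf a

/-- In `ℝ≥0∞`, a product of sums over a finite index type is a sum over the product type. -/
theorem ENNReal.prod_tsum_fin : ∀ {n : ℕ} {B : Fin n → Type*} (g : ∀ i, B i → ℝ≥0∞),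
    ∑' r : ∀ i, B i, ∏ i, g i (r i) = ∏ i, ∑' b, g i b
  | 0, B, g => by simp
  | n + 1, B, g => by
      rw [← (Fin.consEquiv B).tsum_eq, ENNReal.tsum_prod', Fin.prod_univ_succ,
        ← ENNReal.prod_tsum_fin, ← ENNReal.tsum_mul_right]
      refine tsum_congr fun a => ?_
      rw [← ENNReal.tsum_mul_left]
      refine tsum_congr fun r => ?_
      simp [Fin.prod_univ_succ, Fin.consEquiv]

namespace Run

variable {X Z : Type}

theorem pure_apply (a b : X) (c : ℕ) [Decidable (b = a ∧ c = 0)] :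
    (pure a : Run X) b c = if b = a ∧ c = 0 then 1 else 0 := by
  change @ite ℝ≥0∞ (b = a ∧ c = 0)
    (@instDecidableAnd _ _ (Classical.propDecidable _) _) 1 0 = _
  congr

theorem bind_apply (x : Run Z) (f : Z → Run X) (b : X) (c : ℕ) :
    (x >>= f) b c = ∑' a, ∑ p ∈ Finset.HasAntidiagonal.antidiagonal c, x a p.1 * f a b p.2 := rfl

theorem law_bind (x : Run Z) (f : Z → Run X) (b : X) :
    (x >>= f).law b = ∑' a, x.law a * (f a).law b := by
  simp only [law, bind_apply]
  rw [ENNReal.tsum_comm]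
  refine tsum_congr fun a => ?_
  rw [ENNReal.tsum_antidiagonal fun i j => x a i * f a b j, ← ENNReal.tsum_mul_right]
  exact tsum_congr fun i => ENNReal.tsum_mul_left

open scoped Classical in
theorem law_pure (a b : X) : (pure a : Run X).law b = if b = a then 1 else 0 := by
  simp only [law, pure_apply]
  by_cases h : b = a <;> simp [h]

theorem law_pure_self (a : X) : (pure a : Run X).law a = 1 := by simp [law_pure]

theorem law_pure_of_ne {a b : X} (h : b ≠ a) : (pure a : Run X).law b = 0 := by simp [law_pure, h]

theorem law_pure_bind (a : Z) (f : Z → Run X) (b : X) :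
    ((pure a : Run Z) >>= f).law b = (f a).law b := by
  rw [law_bind, tsum_eq_single a fun a' h => by rw [law_pure_of_ne h, zero_mul], law_pure_self,
    one_mul]

theorem law_tick (k : ℕ) (a : Unit) : (tick k).law a = 1 := by
  simp [law, tick]

theorem law_tick_bind (k : ℕ) (f : Unit → Run X) (b : X) :
    (tick k >>= f).law b = (f ()).law b := by
  rw [law_bind, tsum_fintype]; simp [law_tick]

theorem law_draw (p : X → ℝ) (a : X) : (draw p).law a = ENNReal.ofReal (p a) := by
  simp [law, draw]

theorem law_diverge (a : X) : (diverge : Run X).law a = 0 := by simp [law, diverge]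

/-- The total mass of a program: the probability that it halts. -/
def mass (x : Run X) : ℝ≥0∞ := ∑' a, x.law a

theorem mass_bind (x : Run Z) (f : Z → Run X) :
    (x >>= f).mass = ∑' a, x.law a * (f a).mass := by
  simp only [mass, law_bind]
  rw [ENNReal.tsum_comm]
  exact tsum_congr fun a => ENNReal.tsum_mul_left

theorem mass_pure (a : X) : (pure a : Run X).mass = 1 := by
  classical
  simp [mass, law_pure]

theorem mass_tick_bind (k : ℕ) (f : Unit → Run X) : (tick k >>= f).mass = (f ()).mass := by
  simp only [mass, law_tick_bind]

theorem mass_diverge : (diverge : Run X).mass = 0 := by simp [mass, law_diverge]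

theorem mass_draw (p : X → ℝ) : (draw p).mass = ∑' a, ENNReal.ofReal (p a) := by
  simp [mass, law_draw]

theorem mass_bind_le {x : Run Z} {f : Z → Run X} (hx : x.mass ≤ 1)
    (hf : ∀ a, (f a).mass ≤ 1) : (x >>= f).mass ≤ 1 := by
  rw [mass_bind]
  calc _ ≤ ∑' a, x.law a * 1 := ENNReal.tsum_le_tsum fun a => mul_le_mul_right (hf a) _
    _ ≤ 1 := by simpa [mass] using hx

theorem mass_bind_eq {x : Run Z} {f : Z → Run X} (hx : x.mass = 1)
    (hf : ∀ a, x.law a ≠ 0 → (f a).mass = 1) : (x >>= f).mass = 1 := by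
  rw [mass_bind, ← hx, mass]
  refine tsum_congr fun a => ?_
  by_cases h : x.law a = 0
  · simp [h]
  · rw [hf a h, mul_one]

/-- `ert x φ` is the mean, over the runs of `x` that halt, of the number of steps plus `φ` of the
output: the average cost of `x` when the continuation costs `φ`. -/
def ert (x : Run X) (φ : X → ℝ≥0∞) : ℝ≥0∞ := ∑' a, ∑' c : ℕ, x a c * (c + φ a)

theorem ert_eq (x : Run X) (φ : X → ℝ≥0∞) : ert x φ = cost x + ∑' a, x.law a * φ a := by
  simp only [ert, cost, law, mul_add, ENNReal.tsum_add, ENNReal.tsum_mul_right]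

theorem cost_eq_ert (x : Run X) : cost x = ert x fun _ => 0 := by simp [ert_eq]

theorem ert_mono (x : Run X) {φ ψ : X → ℝ≥0∞} (h : ∀ a, φ a ≤ ψ a) : ert x φ ≤ ert x ψ := by
  rw [ert_eq, ert_eq]
  gcongr
  exact h _

theorem ert_mono_of_law (x : Run X) {φ ψ : X → ℝ≥0∞} (h : ∀ a, x.law a ≠ 0 → φ a ≤ ψ a) :
    ert x φ ≤ ert x ψ := by
  rw [ert_eq, ert_eq]
  refine add_le_add le_rfl (ENNReal.tsum_le_tsum fun a => ?_)
  by_cases h0 : x.law a = 0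
  · simp [h0]
  · exact mul_le_mul_right (h a h0) _

theorem ert_add_const_le (x : Run X) (hx : x.mass ≤ 1) (φ : X → ℝ≥0∞) (k : ℝ≥0∞) :
    ert x (fun a => φ a + k) ≤ ert x φ + k := by
  rw [ert_eq, ert_eq]
  simp only [mul_add, ENNReal.tsum_add, ENNReal.tsum_mul_right]
  rw [← add_assoc]
  exact add_le_add le_rfl ((mul_le_mul_left hx k).trans_eq (one_mul k))

theorem ert_const_le (x : Run X) (hx : x.mass ≤ 1) (k : ℝ≥0∞) :
    ert x (fun _ => k) ≤ cost x + k := by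
  have := ert_add_const_le x hx (fun _ => 0) k
  simpa [cost_eq_ert] using this

/-- The cost of a sequence of two programs. -/
theorem ert_bind_le {x : Run Z} {f : Z → Run X} (hf : ∀ a, x.law a ≠ 0 → (f a).mass ≤ 1)
    (φ : X → ℝ≥0∞) : ert (x >>= f) φ ≤ ert x fun a => ert (f a) φ := by
  have h1 : ert (x >>= f) φ =
      ∑' a, ∑' i : ℕ, ∑' j : ℕ, ∑' b, x a i * f a b j * ((i + j : ℕ) + φ b) := by
    simp only [ert, bind_apply]
    have : ∀ b, (∑' c : ℕ, (∑' a, ∑ p ∈ Finset.HasAntidiagonal.antidiagonal c,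
        x a p.1 * f a b p.2) * (c + φ b)) =
        ∑' a, ∑' i : ℕ, ∑' j : ℕ, x a i * f a b j * ((i + j : ℕ) + φ b) := by
      intro b
      simp only [← ENNReal.tsum_mul_right, Finset.sum_mul]
      rw [ENNReal.tsum_comm]
      refine tsum_congr fun a => ?_
      rw [← ENNReal.tsum_antidiagonal fun i j => x a i * f a b j * ((i + j : ℕ) + φ b)]
      refine tsum_congr fun c => Finset.sum_congr rfl fun p hp => ?_
      rw [Finset.HasAntidiagonal.mem_antidiagonal] at hp
      rw [hp]
    simp only [this]
    rw [ENNReal.tsum_comm]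
    refine tsum_congr fun a => ?_
    rw [ENNReal.tsum_comm]
    refine tsum_congr fun i => ?_
    rw [ENNReal.tsum_comm]
  rw [h1, ert]
  refine ENNReal.tsum_le_tsum fun a => ENNReal.tsum_le_tsum fun i => ?_
  by_cases h0 : x.law a = 0
  · have : x a i = 0 := by
      rw [law, ENNReal.tsum_eq_zero] at h0; exact h0 i
    simp [this]
  have h2 : (∑' j : ℕ, ∑' b, x a i * f a b j * ((i + j : ℕ) + φ b)) =
      x a i * (i * (f a).mass + ert (f a) φ) := by
    have : ∀ (j : ℕ) b, x a i * f a b j * ((i + j : ℕ) + φ b) =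
        x a i * (f a b j * i) + x a i * (f a b j * (j + φ b)) := by
      intro j b; push_cast; ring
    simp only [this, ENNReal.tsum_add, ENNReal.tsum_mul_left, ENNReal.tsum_mul_right]
    rw [mul_add, ert, mass]
    congr 1
    · rw [mul_comm (i : ℝ≥0∞)]
      simp only [law]
      rw [ENNReal.tsum_comm]
    · rw [ENNReal.tsum_comm]
  rw [h2]
  gcongr
  calc (i : ℝ≥0∞) * (f a).mass ≤ i * 1 := mul_le_mul_right (hf a h0) _
    _ = i := mul_one _

theorem ert_pure (a : X) (φ : X → ℝ≥0∞) : ert (pure a) φ = φ a := by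
  classical
  have : cost (pure a : Run X) = 0 := by
    simp only [cost, pure_apply, ENNReal.tsum_eq_zero, mul_eq_zero]
    intro b c
    by_cases h : b = a ∧ c = 0 <;> simp [h]
  rw [ert_eq, this, zero_add, tsum_eq_single a fun a' h => by rw [law_pure_of_ne h, zero_mul],
    law_pure_self, one_mul]

theorem ert_tick (k : ℕ) (φ : Unit → ℝ≥0∞) : ert (tick k) φ = k + φ () := by
  simp [ert, tick]

theorem ert_tick_bind_le (k : ℕ) {f : Unit → Run X} (hf : (f ()).mass ≤ 1) (φ : X → ℝ≥0∞) :
    ert (tick k >>= f) φ ≤ k + ert (f ()) φ :=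
  (ert_bind_le (fun _ _ => hf) φ).trans_eq (ert_tick _ _)

theorem ert_diverge (φ : X → ℝ≥0∞) : ert diverge φ = 0 := by simp [ert, diverge]

theorem cost_draw (p : X → ℝ) : cost (draw p) = (draw p).mass := by
  simp only [cost, mass, law_draw]
  refine tsum_congr fun a => ?_
  rw [tsum_eq_single 1 (by intro c hc; simp [draw, hc])]
  simp [draw]

theorem ert_draw_le (p : X → ℝ) (h : (draw p).mass ≤ 1) (φ : X → ℝ≥0∞) :
    ert (draw p) φ ≤ 1 + ∑' a, ENNReal.ofReal (p a) * φ a := by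
  rw [ert_eq, cost_draw]
  simp only [law_draw]
  exact add_le_add h le_rfl

theorem mass_flip {r : ℝ} (h0 : 0 ≤ r) : (flip r).mass = 1 := by
  rw [flip, mass_draw, tsum_fintype]
  simp only [Fintype.univ_bool, Finset.mem_singleton, Bool.true_eq_false, not_false_eq_true,
    Finset.sum_insert, if_true, Finset.sum_singleton]
  simp only [Bool.false_eq_true, if_false]
  rw [← ENNReal.ofReal_add (le_min h0 zero_le_one) (sub_nonneg.2 (min_le_right _ _))]
  simp

theorem law_flip_true {r : ℝ} (h1 : r ≤ 1) : (flip r).law true = ENNReal.ofReal r := by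
  rw [flip, law_draw]; simp [h1]

theorem law_flip_false {r : ℝ} (h1 : r ≤ 1) : (flip r).law false = ENNReal.ofReal (1 - r) := by
  rw [flip, law_draw]; simp [h1]

theorem bind_mono {x y : Run Z} {f g : Z → Run X} (hx : ∀ a c, x a c ≤ y a c)
    (hf : ∀ a b c, f a b c ≤ g a b c) (b : X) (c : ℕ) : (x >>= f) b c ≤ (y >>= g) b c := by
  rw [bind_apply, bind_apply]
  exact ENNReal.tsum_le_tsum fun a => Finset.sum_le_sum fun p _ => mul_le_mul' (hx _ _) (hf _ _ _)

/-! ### Suprema of approximations, loops -/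

theorem law_iSup {x : ℕ → Run X} (hx : ∀ a c, Monotone fun d => x d a c) (a : X) :
    law (fun a c => ⨆ d, x d a c) a = ⨆ d, (x d).law a := by
  simp only [law]
  exact ENNReal.tsum_iSup_of_monotone fun c => hx a c

theorem ert_iSup {x : ℕ → Run X} (hx : ∀ a c, Monotone fun d => x d a c) (φ : X → ℝ≥0∞) :
    ert (fun a c => ⨆ d, x d a c) φ = ⨆ d, ert (x d) φ := by
  simp only [ert, ENNReal.iSup_mul]
  have h : ∀ (a : X) (c : ℕ), Monotone fun d => x d a c * ((c : ℝ≥0∞) + φ a) := fun a c d e hde =>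
    mul_le_mul_left (hx a c hde) _
  rw [← ENNReal.tsum_iSup_of_monotone]
  · exact tsum_congr fun a => ENNReal.tsum_iSup_of_monotone fun c => h a c
  · exact fun a d e hde => ENNReal.tsum_le_tsum fun c => h a c hde

theorem mass_iSup {x : ℕ → Run X} (hx : ∀ a c, Monotone fun d => x d a c) :
    mass (fun a c => ⨆ d, x d a c) = ⨆ d, (x d).mass := by
  simp only [mass, law_iSup hx]
  exact ENNReal.tsum_iSup_of_monotone fun a d e hde => ENNReal.tsum_le_tsum fun c => hx a c hde

variable (body : Z → Run (Z ⊕ X))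

theorem loopUpTo_succ (d : ℕ) (s : Z) : loopUpTo body (d + 1) s =
    (body s >>= Sum.elim (loopUpTo body d) pure) := by
  rw [loopUpTo]
  congr 1
  funext r
  cases r <;> rfl

theorem loopUpTo_le_succ (d : ℕ) : ∀ s a c, loopUpTo body d s a c ≤ loopUpTo body (d + 1) s a c := by
  induction d with
  | zero => intro s a c; exact zero_le
  | succ d ih =>
    intro s a c
    rw [loopUpTo_succ, loopUpTo_succ body (d + 1)]
    refine bind_mono (fun _ _ => le_rfl) ?_ a c
    rintro (s' | b) a' c'
    · exact ih s' a' c'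
    · exact le_rfl

theorem loopUpTo_mono (s : Z) (a : X) (c : ℕ) : Monotone fun d => loopUpTo body d s a c :=
  monotone_nat_of_le_succ fun d => loopUpTo_le_succ body d s a c

theorem law_loop (s : Z) (a : X) : (loop body s).law a = ⨆ d, (loopUpTo body d s).law a :=
  law_iSup (loopUpTo_mono body s) a

theorem law_loopUpTo_mono (s : Z) (a : X) : Monotone fun d => (loopUpTo body d s).law a :=
  fun _ _ h => ENNReal.tsum_le_tsum fun c => loopUpTo_mono body s a c h

theorem mass_loop (s : Z) : (loop body s).mass = ⨆ d, (loopUpTo body d s).mass :=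
  mass_iSup (loopUpTo_mono body s)

theorem law_sum_elim_bind (x : Run (Z ⊕ X)) (f : Z → Run X) (a : X) :
    (x >>= Sum.elim f pure).law a = (∑' s, x.law (.inl s) * (f s).law a) + x.law (.inr a) := by
  classical
  rw [law_bind, ← (Equiv.refl (Z ⊕ X)).tsum_eq]
  rw [Summable.tsum_sum (by exact ENNReal.summable) (by exact ENNReal.summable)]
  congr 1
  simp only [Equiv.refl_apply, Sum.elim_inr]
  rw [tsum_eq_single a fun a' h => by rw [law_pure_of_ne h.symm, mul_zero], law_pure_self, mul_one]

theorem mass_sum (x : Run (Z ⊕ X)) :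
    x.mass = (∑' s, x.law (.inl s)) + ∑' a, x.law (.inr a) := by
  rw [mass, Summable.tsum_sum (by exact ENNReal.summable) (by exact ENNReal.summable)]

theorem mass_loopUpTo_le (h : ∀ s, (body s).mass ≤ 1) (d : ℕ) : ∀ s, (loopUpTo body d s).mass ≤ 1 := by
  induction d with
  | zero => intro s; rw [loopUpTo, mass_diverge]; exact zero_le
  | succ d ih =>
    intro s
    rw [loopUpTo_succ]
    refine mass_bind_le (h s) ?_
    rintro (s' | a)
    · exact ih s'
    · exact (mass_pure a).le

theorem mass_loop_le (h : ∀ s, (body s).mass ≤ 1) (s : Z) : (loop body s).mass ≤ 1 := by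
  rw [mass_loop]
  exact iSup_le fun d => mass_loopUpTo_le body h d s

/-- A loop whose state carries a bounded number of remaining iterations halts almost surely. -/
theorem mass_loop_eq_one (hle : ∀ s, (body s).mass ≤ 1) (Q : Z → Prop) (V : Z → ℕ)
    (h : ∀ s, Q s → (body s).mass = 1)
    (hQ : ∀ s s', Q s → (body s).law (.inl s') ≠ 0 → Q s' ∧ V s' < V s) (s : Z) (hs : Q s) :
    (loop body s).mass = 1 := by
  refine le_antisymm (mass_loop_le body hle s) ?_
  have key : ∀ d s, Q s → V s < d → (loopUpTo body d s).mass = 1 := by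
    intro d
    induction d with
    | zero => intro s _ h; omega
    | succ d ih =>
      intro s hs hd
      rw [loopUpTo_succ]
      refine mass_bind_eq (h s hs) ?_
      rintro (s' | a) h0
      · have := hQ s s' hs h0
        exact ih s' this.1 (by omega)
      · exact mass_pure a
  rw [mass_loop, ← key (V s + 1) s hs (by omega)]
  exact le_iSup (fun d => (loopUpTo body d s).mass) (V s + 1)

/-- Invariants bound the cost of a loop. -/
theorem ert_loop_le (hle : ∀ s, (body s).mass ≤ 1) (φ : X → ℝ≥0∞) (I : Z → ℝ≥0∞)
    (h : ∀ s, ert (body s) (Sum.elim I φ) ≤ I s) (s : Z) : ert (loop body s) φ ≤ I s := by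
  have key : ∀ d s, ert (loopUpTo body d s) φ ≤ I s := by
    intro d
    induction d with
    | zero => intro s; rw [loopUpTo, ert_diverge]; exact zero_le
    | succ d ih =>
      intro s
      rw [loopUpTo_succ]
      refine (ert_bind_le ?_ φ).trans (le_trans (ert_mono _ ?_) (h s))
      · rintro (s' | a) -
        · exact mass_loopUpTo_le body hle d s'
        · exact (mass_pure a).le
      · rintro (s' | a)
        · exact ih s'
        · exact (ert_pure a φ).le
  refine (ert_iSup (loopUpTo_mono body s) φ).trans_le ?_
  exact iSup_le fun d => key d s

/-- The law of a rejection loop: the law of the body, conditioned on leaving the loop. -/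
theorem law_loop_unit (body : Unit → Run (Unit ⊕ X)) (h : (body ()).mass = 1) (a : X) :
    (loop body ()).law a = (body ()).law (.inr a) / ∑' b, (body ()).law (.inr b) := by
  set r := (body ()).law (.inl ()) with hr
  set p := ∑' b, (body ()).law (.inr b) with hpdef
  have hrp : r + p = 1 := by
    rw [← h, mass_sum, tsum_fintype]; simp [hr, hpdef]
  have hr1 : r ≤ 1 := hrp ▸ le_self_add
  have hp1 : p ≤ 1 := hrp ▸ le_add_self
  have step : ∀ d, (loopUpTo body (d + 1) ()).law a =
      r * (loopUpTo body d ()).law a + (body ()).law (.inr a) := by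
    intro d
    rw [loopUpTo_succ, law_sum_elim_bind, tsum_fintype]
    simp [hr]
  have hpow : ∀ d, (loopUpTo body d ()).law a =
      (∑ i ∈ Finset.range d, r ^ i) * (body ()).law (.inr a) := by
    intro d
    induction d with
    | zero => simp [loopUpTo, law_diverge]
    | succ d ih =>
      rw [step, ih, Finset.sum_range_succ']
      simp only [pow_succ', ← Finset.mul_sum]
      ring
  rw [law_loop]
  simp only [hpow]
  rw [← ENNReal.iSup_mul, ← ENNReal.tsum_eq_iSup_nat, ENNReal.tsum_geometric,
    ENNReal.div_eq_inv_mul]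
  congr 2
  rw [← hrp, ENNReal.add_sub_cancel_left (ne_top_of_le_ne_top ENNReal.one_ne_top hr1)]

/-! ### Finite sequences of programs -/

theorem seqFin_succ {n : ℕ} {B : Fin (n + 1) → Type} (x : ∀ i, Run (B i)) :
    seqFin x = (x 0 >>= fun a => seqFin (fun i => x i.succ) >>= fun r => pure (Fin.cons a r)) := rfl

theorem law_seqFin : ∀ {n : ℕ} {B : Fin n → Type} (x : ∀ i, Run (B i)) (r : ∀ i, B i),
    (seqFin x).law r = ∏ i, (x i).law (r i)
  | 0, B, x, r => by
      have : (seqFin x) = (pure fun i => i.elim0) := rfl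
      rw [this]
      simp only [Finset.univ_eq_empty, Finset.prod_empty]
      rw [show r = fun i => i.elim0 from funext fun i => i.elim0]
      exact law_pure_self _
  | n + 1, B, x, r => by
      rw [seqFin_succ, law_bind, tsum_eq_single (r 0), law_bind, tsum_eq_single (Fin.tail r),
        Fin.cons_self_tail, law_pure_self, mul_one, law_seqFin, Fin.prod_univ_succ]
      · rfl
      · intro r' h
        rw [law_pure_of_ne, mul_zero]
        intro h'
        exact h (by rw [h']; simp)
      · intro a h
        rw [law_bind, ENNReal.tsum_eq_zero.2, mul_zero]
        intro r'
        rw [law_pure_of_ne, mul_zero]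
        rintro rfl
        exact h (by simp)

theorem seqFin_mono : ∀ {n : ℕ} {B : Fin n → Type} {x y : ∀ i, Run (B i)}
    (_ : ∀ i a c, x i a c ≤ y i a c) (r : ∀ i, B i) (c : ℕ), seqFin x r c ≤ seqFin y r c
  | 0, _, _, _, _, _, _ => le_rfl
  | n + 1, B, x, y, h, r, c => by
      rw [seqFin_succ, seqFin_succ]
      refine bind_mono (h 0) (fun a => ?_) r c
      refine bind_mono (seqFin_mono fun i => h i.succ) fun _ _ _ => le_rfl

/-! ### Programs whose number of steps is a function of the output -/

/-- The number of steps is the function `f` of the output. -/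
def Det (x : Run X) (f : X → ℕ) : Prop := ∀ a c, x a c ≠ 0 → c = f a

theorem Det.pure (a : X) (f : X → ℕ) (h : f a = 0) : Det (pure a) f := by
  classical
  intro b c hb
  rw [pure_apply] at hb
  by_cases hc : b = a ∧ c = 0
  · rw [hc.1, hc.2, h]
  · rw [if_neg hc] at hb; exact absurd rfl hb

theorem Det.bind {x : Run Z} {y : Z → Run X} {f : Z → ℕ} {g : X → ℕ} (hx : Det x f)
    (hy : ∀ a b c, (∃ c', x a c' ≠ 0) → y a b c ≠ 0 → f a + c = g b) : Det (x >>= y) g := by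
  intro b c h
  rw [bind_apply, Ne, ENNReal.tsum_eq_zero] at h
  push Not at h
  obtain ⟨a, ha⟩ := h
  obtain ⟨p, hp, hne⟩ := Finset.exists_ne_zero_of_sum_ne_zero ha
  rw [Finset.HasAntidiagonal.mem_antidiagonal] at hp
  have h1 := left_ne_zero_of_mul hne
  rw [← hp, hx a p.1 h1]
  exact hy a b p.2 ⟨_, h1⟩ (right_ne_zero_of_mul hne)

theorem Det.seqFin : ∀ {n : ℕ} {B : Fin n → Type} {x : ∀ i, Run (B i)} {f : ∀ i, B i → ℕ}
    (_ : ∀ i, Det (x i) (f i)), Det (seqFin x) fun r => ∑ i, f i (r i)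
  | 0, B, x, f, h => Det.pure _ _ (by simp)
  | n + 1, B, x, f, h => by
      rw [seqFin_succ]
      refine Det.bind (h 0) fun a b c _ hc => ?_
      have h2 := Det.bind (y := fun r => (Pure.pure (Fin.cons a r) : Run (∀ i, B i)))
        (g := fun r => ∑ i : Fin n, f i.succ (r i.succ))
        (Det.seqFin fun i => h i.succ) (fun r b' c' _ h' => by
          classical
          rw [pure_apply] at h'
          by_cases hh : b' = Fin.cons a r ∧ c' = 0
          · rw [hh.1, hh.2]; simp
          · rw [if_neg hh] at h'; exact absurd rfl h')
      have h3 := h2 b c hc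
      rw [h3, Fin.sum_univ_succ]
      congr 2
      rw [bind_apply, Ne, ENNReal.tsum_eq_zero] at hc
      push Not at hc
      obtain ⟨r, hr⟩ := hc
      obtain ⟨p, -, hne⟩ := Finset.exists_ne_zero_of_sum_ne_zero hr
      classical
      have h4 := right_ne_zero_of_mul hne
      rw [pure_apply] at h4
      by_cases hh : b = Fin.cons a r ∧ p.2 = 0
      · rw [hh.1]; simp
      · rw [if_neg hh] at h4; exact absurd rfl h4

theorem Det.cost {x : Run X} {f : X → ℕ} (h : Det x f) : cost x = ∑' a, x.law a * f a := by
  simp only [Run.cost, law, ← ENNReal.tsum_mul_right]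
  refine tsum_congr fun a => tsum_congr fun c => ?_
  by_cases h0 : x a c = 0
  · simp [h0]
  · rw [← h a c h0]

end Run

end CF

/-! ### Generating functions of pieces -/

namespace CF

variable {m : ℕ}

/-- A piece is the data of its root node and of the pieces below it. -/
def Piece.equivSigma (α : Fin (m + 1)) :
    (Σ p : ℕ × (Fin (m + 1) → ℕ), ∀ β : Fin m, Fin (p.2 β.succ) → Piece m β.succ) ≃ Piece m α where
  toFun x := .node α x.1.1 x.1.2 x.2
  invFun t := match t with
    | .node _ h k ch => ⟨(h, k), ch⟩
  left_inv x := rfl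
  right_inv t := by cases t; rfl

/-- Height of a piece. -/
def Piece.depth : ∀ {α : Fin (m + 1)}, Piece m α → ℕ
  | _, .node _ _ _ ch =>
      (Finset.univ.sup fun β => Finset.univ.sup fun i => (ch β i).depth) + 1

/-- The multiplicative functional on pieces given by the weights `c` of the nodes. -/
def Piece.gw (c : Fin (m + 1) → ℕ × (Fin (m + 1) → ℕ) → ℝ≥0∞) :
    ∀ {α : Fin (m + 1)}, Piece m α → ℝ≥0∞
  | _, .node α h k ch => c α (h, k) * ∏ β, ∏ i, (ch β i).gw c

/-- Number of elementary steps used by the rewriting process in order to generate a piece. -/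
def Piece.ct : ∀ {α : Fin (m + 1)}, Piece m α → ℕ
  | _, .node _ h k ch => 1 + (h + ∑ β, k β) + ∑ β, ∑ i, (ch β i).ct

/-- Functional equation for sums of multiplicative functionals over the pieces. -/
theorem Piece.tsum_node {α : Fin (m + 1)} (c : ℕ × (Fin (m + 1) → ℕ) → ℝ≥0∞)
    (g : ∀ β : Fin m, Piece m β.succ → ℝ≥0∞) (G : Piece m α → ℝ≥0∞)
    (hG : ∀ h k ch, G (.node α h k ch) = c (h, k) * ∏ β, ∏ i, g β (ch β i)) :
    ∑' t, G t = ∑' p, c p * ∏ β : Fin m, (∑' t, g β t) ^ p.2 β.succ := by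
  rw [← (Piece.equivSigma α).tsum_eq, ENNReal.tsum_sigma']
  refine tsum_congr fun p => ?_
  have : ∀ ch : (∀ β : Fin m, Fin (p.2 β.succ) → Piece m β.succ),
      G (Piece.equivSigma α ⟨p, ch⟩) = c p * ∏ β, ∏ i, g β (ch β i) := fun ch => hG _ _ _
  simp only [this, ENNReal.tsum_mul_left]
  congr 1
  rw [ENNReal.prod_tsum_fin fun β (r : Fin (p.2 β.succ) → Piece m β.succ) => ∏ i, g β (r i)]
  refine Finset.prod_congr rfl fun β _ => ?_
  rw [ENNReal.prod_tsum_fin fun _ => g β]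
  simp

theorem Piece.tsum_gw (c : Fin (m + 1) → ℕ × (Fin (m + 1) → ℕ) → ℝ≥0∞) (α : Fin (m + 1)) :
    ∑' t : Piece m α, t.gw c =
      ∑' p, c α p * ∏ β : Fin m, (∑' t : Piece m β.succ, t.gw c) ^ p.2 β.succ :=
  Piece.tsum_node _ _ _ fun _ _ _ => rfl

/-- A supersolution of the system for the pieces bounds the generating functions. -/
theorem Piece.tsum_gw_le (c : Fin (m + 1) → ℕ × (Fin (m + 1) → ℕ) → ℝ≥0∞) (y : Fin m → ℝ≥0∞)
    (hy : ∀ β : Fin m, ∑' p, c β.succ p * ∏ γ : Fin m, y γ ^ p.2 γ.succ ≤ y β) (β : Fin m) :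
    ∑' t : Piece m β.succ, t.gw c ≤ y β := by
  have key : ∀ d (β : Fin m),
      ∑' t : Piece m β.succ, (if t.depth ≤ d then t.gw c else 0) ≤ y β := by
    intro d
    induction d with
    | zero =>
      intro β
      rw [ENNReal.tsum_eq_zero.2]
      · exact zero_le
      · rintro ⟨_, h, k, ch⟩
        simp [Piece.depth]
    | succ d ih =>
      intro β
      rw [Piece.tsum_node (c β.succ) (fun γ t => if t.depth ≤ d then t.gw c else 0)]
      · refine le_trans ?_ (hy β)
        gcongr
        exact ih _
      · intro h k ch
        by_cases hd : (Piece.node β.succ h k ch).depth ≤ d + 1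
        · rw [if_pos hd]
          simp only [Piece.depth, Nat.add_le_add_iff_right, Finset.sup_le_iff] at hd
          rw [Piece.gw]
          congr 1
          refine Finset.prod_congr rfl fun γ _ => Finset.prod_congr rfl fun i _ => ?_
          rw [if_pos (hd γ (Finset.mem_univ _) i (Finset.mem_univ _))]
        · rw [if_neg hd]
          simp only [Piece.depth, Nat.add_le_add_iff_right, Finset.sup_le_iff] at hd
          push Not at hd
          obtain ⟨γ, -, i, -, h'⟩ := hd
          rw [Finset.prod_eq_zero (Finset.mem_univ γ), mul_zero]
          rw [Finset.prod_eq_zero (Finset.mem_univ i)]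
          rw [if_neg (not_le.2 h')]
  rw [ENNReal.tsum_eq_iSup_sum]
  refine iSup_le fun s => ?_
  refine le_trans ?_ (key (s.sup Piece.depth) β)
  refine le_trans (Finset.sum_le_sum fun t ht => ?_) (ENNReal.sum_le_tsum s)
  rw [if_pos (Finset.le_sup ht)]

theorem Piece.weight_nonneg (S : Spec m) : ∀ {α : Fin (m + 1)} (t : Piece m α), 0 ≤ t.weight S
  | _, .node _ _ _ ch => mul_nonneg (S.nonneg _ _ _)
      (Finset.prod_nonneg fun β _ => Finset.prod_nonneg fun i _ => (ch β i).weight_nonneg S)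

theorem Tree.weight_nonneg (S : Spec m) : ∀ {α : Fin (m + 1)} (T : Tree m α), 0 ≤ T.weight S
  | _, .node _ _ _ ch => mul_nonneg (S.nonneg _ _ _)
      (Finset.prod_nonneg fun β _ => Finset.prod_nonneg fun i _ => (ch β i).weight_nonneg S)

/-- The node weights of the generating functions `Y^α(z, u)`, with an extra variable `x` marking
the number of steps of the rewriting process. -/
def nodeW (S : Spec m) (x z u : ℝ) (α : Fin (m + 1)) (p : ℕ × (Fin (m + 1) → ℕ)) : ℝ≥0∞ :=
  ENNReal.ofReal (S.φ α p.1 p.2 * z ^ p.1 * u ^ p.2 0 * x ^ (1 + (p.1 + ∑ β, p.2 β)))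

theorem Piece.gw_nodeW (S : Spec m) {x z u : ℝ} (hx : 0 ≤ x) (hz : 0 ≤ z) (hu : 0 ≤ u) :
    ∀ {α : Fin (m + 1)} (t : Piece m α),
      t.gw (nodeW S x z u) = ENNReal.ofReal (t.weight S * z ^ t.zl * u ^ t.al * x ^ t.ct)
  | _, .node α h k ch => by
      have ih := fun β i => Piece.gw_nodeW S hx hz hu (ch β i)
      have hn : ∀ β i, 0 ≤ (ch β i).weight S * z ^ (ch β i).zl * u ^ (ch β i).al * x ^ (ch β i).ct :=
        fun β i => mul_nonneg (mul_nonneg (mul_nonneg (Piece.weight_nonneg S _) (pow_nonneg hz _))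
          (pow_nonneg hu _)) (pow_nonneg hx _)
      rw [Piece.gw]
      simp only [ih]
      simp only [← ENNReal.ofReal_prod_of_nonneg fun i _ => hn _ i]
      rw [← ENNReal.ofReal_prod_of_nonneg fun β _ => Finset.prod_nonneg fun i _ => hn β i, nodeW,
        ← ENNReal.ofReal_mul (mul_nonneg (mul_nonneg (mul_nonneg (S.nonneg _ _ _) (pow_nonneg hz _))
          (pow_nonneg hu _)) (pow_nonneg hx _))]
      congr 1
      simp only [Piece.weight, Piece.zl, Piece.al, Piece.ct, Finset.prod_mul_distrib, pow_add,
        Finset.prod_pow_eq_pow_sum]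
      ring

/-- The generating function of the pieces with root colour `α`, with values in `[0, ∞]`. -/
def Ye (S : Spec m) (α : Fin (m + 1)) (z u : ℝ) : ℝ≥0∞ :=
  ∑' t : Piece m α, ENNReal.ofReal (t.weight S * z ^ t.zl * u ^ t.al)

theorem term_nonneg (S : Spec m) {z u : ℝ} (hz : 0 ≤ z) (hu : 0 ≤ u) {α : Fin (m + 1)}
    (t : Piece m α) : 0 ≤ t.weight S * z ^ t.zl * u ^ t.al :=
  mul_nonneg (mul_nonneg (Piece.weight_nonneg S _) (pow_nonneg hz _)) (pow_nonneg hu _)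

theorem Y_eq_toReal (S : Spec m) (α : Fin (m + 1)) {z u : ℝ} (hz : 0 ≤ z) (hu : 0 ≤ u) :
    Y S α z u = (Ye S α z u).toReal := by
  rw [Ye, ENNReal.tsum_toReal_eq fun _ => ENNReal.ofReal_ne_top]
  exact tsum_congr fun t => (ENNReal.toReal_ofReal (term_nonneg S hz hu t)).symm

theorem Ye_eq_gw (S : Spec m) (α : Fin (m + 1)) {z u : ℝ} (hz : 0 ≤ z) (hu : 0 ≤ u) :
    Ye S α z u = ∑' t : Piece m α, t.gw (nodeW S 1 z u) := by
  simp only [Piece.gw_nodeW S zero_le_one hz hu, one_pow, mul_one, Ye]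

theorem Ye_mono (S : Spec m) (α : Fin (m + 1)) {z u z' u' : ℝ} (hz : 0 ≤ z) (hu : 0 ≤ u)
    (hz' : z ≤ z') (hu' : u ≤ u') : Ye S α z u ≤ Ye S α z' u' := by
  refine ENNReal.tsum_le_tsum fun t => ENNReal.ofReal_le_ofReal ?_
  have := Piece.weight_nonneg S t
  have hz'' : 0 ≤ z' := hz.trans hz'
  gcongr

theorem Y_nonneg (S : Spec m) (α : Fin (m + 1)) {z u : ℝ} (hz : 0 ≤ z) (hu : 0 ≤ u) :
    0 ≤ Y S α z u := tsum_nonneg fun t => term_nonneg S hz hu t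

theorem Ye_eq_ofReal (S : Spec m) {α : Fin (m + 1)} {z u : ℝ} (hz : 0 ≤ z) (hu : 0 ≤ u)
    (h : Ye S α z u ≠ ⊤) : Ye S α z u = ENNReal.ofReal (Y S α z u) := by
  rw [Y_eq_toReal S α hz hu, ENNReal.ofReal_toReal h]

theorem Ye_ne_top_of_pos (S : Spec m) {α : Fin (m + 1)} {z u : ℝ} (hz : 0 ≤ z) (hu : 0 ≤ u)
    (h : 0 < Y S α z u) : Ye S α z u ≠ ⊤ := by
  intro h'
  rw [Y_eq_toReal S α hz hu, h'] at h
  simp at h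

theorem summable_of_Ye (S : Spec m) {α : Fin (m + 1)} {z u : ℝ} (hz : 0 ≤ z) (hu : 0 ≤ u)
    (h : Ye S α z u ≠ ⊤) : Summable fun t : Piece m α => t.weight S * z ^ t.zl * u ^ t.al := by
  have := ENNReal.summable_toReal h
  refine this.congr fun t => ?_
  exact ENNReal.toReal_ofReal (term_nonneg S hz hu t)

/-! ### The rewriting process -/

theorem rewriteUpTo_mono (S : Spec m) (z u : ℝ) : ∀ (d : ℕ) (α : Fin (m + 1)) (t : Piece m α) (c : ℕ),
    rewriteUpTo S z u d α t c ≤ rewriteUpTo S z u (d + 1) α t c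
  | 0, _, _, _ => zero_le
  | d + 1, α, t, c => by
      rw [rewriteUpTo, rewriteUpTo]
      refine Run.bind_mono (fun _ _ => le_rfl) (fun p => ?_) t c
      refine Run.bind_mono (fun _ _ => le_rfl) (fun _ => ?_)
      refine Run.bind_mono (Run.seqFin_mono fun β => Run.seqFin_mono fun _ =>
        rewriteUpTo_mono S z u d β.succ) (fun _ _ _ => le_rfl)

/-- Boltzmann weight of a piece. -/
def boltz (S : Spec m) (z u : ℝ) {α : Fin (m + 1)} (t : Piece m α) : ℝ :=
  t.weight S * z ^ t.zl * u ^ t.al / Y S α z u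

theorem boltz_nonneg (S : Spec m) {z u : ℝ} (hz : 0 ≤ z) (hu : 0 ≤ u) {α : Fin (m + 1)}
    (t : Piece m α) : 0 ≤ boltz S z u t :=
  div_nonneg (term_nonneg S hz hu t) (Y_nonneg S α hz hu)

theorem offspring_mul_boltz (S : Spec m) {z u : ℝ} (hY : ∀ β, Y S β z u ≠ 0) (α : Fin (m + 1)) (h : ℕ)
    (k : Fin (m + 1) → ℕ) (ch : ∀ β : Fin m, Fin (k β.succ) → Piece m β.succ) :
    offspring S z u α (h, k) * ∏ β, ∏ i, boltz S z u (ch β i) = boltz S z u (.node α h k ch) := by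
  simp only [offspring, boltz, Piece.weight, Piece.zl, Piece.al, Finset.prod_div_distrib,
    Finset.prod_mul_distrib, pow_add, Finset.prod_pow_eq_pow_sum, Finset.prod_const,
    Finset.card_univ, Fintype.card_fin]
  have : ∏ β : Fin m, Y S β.succ z u ^ k β.succ ≠ 0 :=
    Finset.prod_ne_zero_iff.2 fun β _ => pow_ne_zero _ (hY _)
  have h0 := hY α
  field_simp

theorem law_rewriteUpTo (S : Spec m) {z u : ℝ} (hz : 0 ≤ z) (hu : 0 ≤ u) (hY : ∀ β, Y S β z u ≠ 0) :
    ∀ {α : Fin (m + 1)} (t : Piece m α), ∃ d₀, ∀ d, d₀ ≤ d →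
      (rewriteUpTo S z u d α).law t = ENNReal.ofReal (boltz S z u t)
  | _, .node α h k ch => by
      choose D hD using fun β i => law_rewriteUpTo S hz hu hY (ch β i)
      refine ⟨(Finset.univ.sup fun β => Finset.univ.sup fun i => D β i) + 1, fun d hd => ?_⟩
      obtain ⟨d, rfl⟩ : ∃ d', d = d' + 1 := ⟨d - 1, by omega⟩
      simp only [Nat.add_le_add_iff_right, Finset.sup_le_iff] at hd
      rw [rewriteUpTo, Run.law_bind, tsum_eq_single (h, k), Run.law_draw, Run.law_tick_bind,
        Run.law_bind, tsum_eq_single ch, Run.law_pure_self, mul_one]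
      · simp only [Run.law_seqFin]
        rw [← offspring_mul_boltz S hY, ENNReal.ofReal_mul, ENNReal.ofReal_prod_of_nonneg]
        · congr 1
          refine Finset.prod_congr rfl fun β _ => ?_
          rw [ENNReal.ofReal_prod_of_nonneg fun i _ => boltz_nonneg S hz hu _]
          refine Finset.prod_congr rfl fun i _ => ?_
          exact hD β i d (hd β (Finset.mem_univ _) i (Finset.mem_univ _))
        · exact fun β _ => Finset.prod_nonneg fun i _ => boltz_nonneg S hz hu _
        · exact div_nonneg (mul_nonneg (mul_nonneg (mul_nonneg (S.nonneg _ _ _) (pow_nonneg hz _))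
            (pow_nonneg hu _)) (Finset.prod_nonneg fun β _ => pow_nonneg (Y_nonneg S _ hz hu) _))
            (Y_nonneg S _ hz hu)
      · intro ch' hne
        rw [Run.law_pure_of_ne, mul_zero]
        intro h'
        simp only [Piece.node.injEq, heq_eq_eq, true_and] at h'
        exact hne h'.symm
      · rintro ⟨h', k'⟩ hne
        rw [Run.law_tick_bind, Run.law_bind, ENNReal.tsum_eq_zero.2, mul_zero]
        intro ch'
        rw [Run.law_pure_of_ne, mul_zero]
        intro h'
        simp only [Piece.node.injEq] at h'
        exact hne (by rw [h'.1, h'.2.1])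

theorem law_rewrite (S : Spec m) {z u : ℝ} (hz : 0 ≤ z) (hu : 0 ≤ u) (hY : ∀ β, Y S β z u ≠ 0)
    (t : Piece m 0) : (rewrite S z u).law t = ENNReal.ofReal (boltz S z u t) := by
  have hm : ∀ (a : Piece m 0) c, Monotone fun d => rewriteUpTo S z u d 0 a c := fun a c =>
    monotone_nat_of_le_succ fun d => rewriteUpTo_mono S z u d 0 a c
  obtain ⟨d₀, hd⟩ := law_rewriteUpTo S hz hu hY t
  have h1 : (rewrite S z u).law t = ⨆ d, (rewriteUpTo S z u d 0).law t := Run.law_iSup hm t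
  rw [h1]
  refine le_antisymm (iSup_le fun d => ?_) ?_
  · rw [← hd (max d d₀) (le_max_right _ _)]
    exact ENNReal.tsum_le_tsum fun c => hm t c (le_max_left _ _)
  · rw [← hd d₀ le_rfl]
    exact le_iSup (fun d => (rewriteUpTo S z u d 0).law t) d₀

theorem det_rewriteUpTo (S : Spec m) (z u : ℝ) : ∀ (d : ℕ) (α : Fin (m + 1)),
    Run.Det (rewriteUpTo S z u d α) Piece.ct
  | 0, _ => fun _ _ h => absurd rfl h
  | d + 1, α => by
      classical
      rw [rewriteUpTo]
      refine Run.Det.bind (f := fun _ => 1) ?_ ?_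
      · intro a c h
        by_contra hc
        simp [Run.draw, hc] at h
      · rintro p t c - h
        rw [Run.bind_apply, Ne, ENNReal.tsum_eq_zero] at h
        push Not at h
        obtain ⟨_, h⟩ := h
        obtain ⟨q, hq, h⟩ := Finset.exists_ne_zero_of_sum_ne_zero h
        rw [Finset.HasAntidiagonal.mem_antidiagonal] at hq
        have h1 : q.1 = p.1 + ∑ β, p.2 β := by
          by_contra hc
          exact left_ne_zero_of_mul h (by simp [Run.tick, hc])
        have h2 := right_ne_zero_of_mul h
        rw [Run.bind_apply, Ne, ENNReal.tsum_eq_zero] at h2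
        push Not at h2
        obtain ⟨ch, h2⟩ := h2
        obtain ⟨r, hr, h2⟩ := Finset.exists_ne_zero_of_sum_ne_zero h2
        rw [Finset.HasAntidiagonal.mem_antidiagonal] at hr
        have h3 := Run.Det.seqFin (fun β : Fin m => Run.Det.seqFin fun _ : Fin (p.2 β.succ) =>
          det_rewriteUpTo S z u d β.succ) ch r.1 (left_ne_zero_of_mul h2)
        have h4 := right_ne_zero_of_mul h2
        rw [Run.pure_apply] at h4
        have h5 : t = Piece.node α p.1 p.2 ch ∧ r.2 = 0 := by
          by_contra hc
          rw [if_neg hc] at h4; exact h4 rfl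
        rw [h5.1, Piece.ct]
        have := h5.2
        simp only at h3
        omega

theorem det_rewrite (S : Spec m) (z u : ℝ) : Run.Det (rewrite S z u) Piece.ct := by
  intro t c h
  rw [rewrite, Ne, ENNReal.iSup_eq_zero] at h
  push Not at h
  obtain ⟨d, h⟩ := h
  exact det_rewriteUpTo S z u d 0 t c h

theorem cost_rewrite (S : Spec m) {z u : ℝ} (hz : 0 ≤ z) (hu : 0 ≤ u) (hY : ∀ β, Y S β z u ≠ 0) :
    (rewrite S z u).cost = ∑' t : Piece m 0, ENNReal.ofReal (boltz S z u t) * t.ct := by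
  rw [(det_rewrite S z u).cost]
  exact tsum_congr fun t => by rw [law_rewrite S hz hu hY]

theorem mass_rewrite (S : Spec m) {z u : ℝ} (hz : 0 ≤ z) (hu : 0 ≤ u) (hY : ∀ β, 0 < Y S β z u) :
    (rewrite S z u).mass = 1 := by
  rw [Run.mass]
  simp only [law_rewrite S hz hu fun β => (hY β).ne', boltz]
  simp only [fun x => ENNReal.ofReal_div_of_pos (x := x) (hY 0)]
  simp only [div_eq_mul_inv, ENNReal.tsum_mul_right]
  change Ye S 0 z u * _ = 1
  rw [Ye_eq_ofReal S hz hu (Ye_ne_top_of_pos S hz hu (hY 0))]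
  exact ENNReal.mul_inv_cancel (by simpa using hY 0) ENNReal.ofReal_ne_top

end CF

/-! ### The system of equations and its supersolutions -/

namespace CF

open Filter Topology

variable {m : ℕ}

/-- The finite support of the polynomial `Φ^α`. -/
def supp (S : Spec m) (α : Fin (m + 1)) : Finset (ℕ × (Fin (m + 1) → ℕ)) := (S.finite α).toFinset

theorem mem_supp {S : Spec m} {α : Fin (m + 1)} {p : ℕ × (Fin (m + 1) → ℕ)} :
    p ∈ supp S α ↔ S.φ α p.1 p.2 ≠ 0 := by simp [supp]

/-- The polynomials `Φ^α(z, y)`. -/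
def Phi (S : Spec m) (z : ℝ) (y : Fin (m + 1) → ℝ) (α : Fin (m + 1)) : ℝ :=
  ∑ p ∈ supp S α, S.φ α p.1 p.2 * z ^ p.1 * ∏ β, y β ^ p.2 β

/-- The edges of the dependency graph. -/
def Edge (S : Spec m) (a b : Fin (m + 1)) : Prop := ∃ h k, S.φ a h k ≠ 0 ∧ k b ≠ 0

theorem monom_nonneg (S : Spec m) {z : ℝ} (hz : 0 ≤ z) {y : Fin (m + 1) → ℝ} (hy : ∀ β, 0 ≤ y β)
    (α : Fin (m + 1)) (p : ℕ × (Fin (m + 1) → ℕ)) :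
    0 ≤ S.φ α p.1 p.2 * z ^ p.1 * ∏ β, y β ^ p.2 β :=
  mul_nonneg (mul_nonneg (S.nonneg _ _ _) (pow_nonneg hz _))
    (Finset.prod_nonneg fun β _ => pow_nonneg (hy β) _)

theorem Phi_nonneg (S : Spec m) {z : ℝ} (hz : 0 ≤ z) {y : Fin (m + 1) → ℝ} (hy : ∀ β, 0 ≤ y β)
    (α : Fin (m + 1)) : 0 ≤ Phi S z y α :=
  Finset.sum_nonneg fun p _ => monom_nonneg S hz hy α p

theorem le_Phi (S : Spec m) {z : ℝ} (hz : 0 ≤ z) {y : Fin (m + 1) → ℝ} (hy : ∀ β, 0 ≤ y β)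
    (α : Fin (m + 1)) (h : ℕ) (k : Fin (m + 1) → ℕ) :
    S.φ α h k * z ^ h * ∏ β, y β ^ k β ≤ Phi S z y α := by
  by_cases h0 : S.φ α h k = 0
  · rw [h0, zero_mul, zero_mul]; exact Phi_nonneg S hz hy α
  · exact Finset.single_le_sum
      (f := fun p : ℕ × (Fin (m + 1) → ℕ) => S.φ α p.1 p.2 * z ^ p.1 * ∏ β, y β ^ p.2 β)
      (fun p _ => monom_nonneg S hz hy α p) (mem_supp.2 h0 : (h, k) ∈ supp S α)

theorem monom_mono (S : Spec m) {z z' : ℝ} (hz : 0 ≤ z) (hz' : z ≤ z') {y y' : Fin (m + 1) → ℝ}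
    (hy : ∀ β, 0 ≤ y β) (hy' : ∀ β, y β ≤ y' β) (α : Fin (m + 1)) (p : ℕ × (Fin (m + 1) → ℕ)) :
    S.φ α p.1 p.2 * z ^ p.1 * ∏ β, y β ^ p.2 β ≤ S.φ α p.1 p.2 * z' ^ p.1 * ∏ β, y' β ^ p.2 β := by
  have := S.nonneg α p.1 p.2
  have h2 : 0 ≤ ∏ β, y β ^ p.2 β := Finset.prod_nonneg fun β _ => pow_nonneg (hy β) _
  have h4 : 0 ≤ z' := hz.trans hz'
  have h3 : ∏ β, y β ^ p.2 β ≤ ∏ β, y' β ^ p.2 β := Finset.prod_le_prod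
    (fun β _ => pow_nonneg (hy β) _) fun β _ => pow_le_pow_left₀ (hy β) (hy' β) _
  gcongr

theorem Phi_mono (S : Spec m) {z z' : ℝ} (hz : 0 ≤ z) (hz' : z ≤ z') {y y' : Fin (m + 1) → ℝ}
    (hy : ∀ β, 0 ≤ y β) (hy' : ∀ β, y β ≤ y' β) (α : Fin (m + 1)) :
    Phi S z y α ≤ Phi S z' y' α :=
  Finset.sum_le_sum fun p _ => monom_mono S hz hz' hy hy' α p

theorem Phi_strict (S : Spec m) {z : ℝ} (hz : 0 < z) {y y' : Fin (m + 1) → ℝ}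
    (hy : ∀ β, 0 ≤ y β) (hy' : ∀ β, y β ≤ y' β) (hpos : ∀ β, 0 < y' β) {α β : Fin (m + 1)}
    (he : Edge S α β) (hlt : y β < y' β) : Phi S z y α < Phi S z y' α := by
  obtain ⟨h, k, hφ, hk⟩ := he
  refine Finset.sum_lt_sum (fun p _ => monom_mono S hz.le le_rfl hy hy' α p)
    ⟨(h, k), mem_supp.2 hφ, ?_⟩
  have hφ' : 0 < S.φ α h k := lt_of_le_of_ne (S.nonneg _ _ _) (Ne.symm hφ)
  refine mul_lt_mul_of_pos_left ?_ (mul_pos hφ' (pow_pos hz _))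
  rw [← Finset.mul_prod_erase _ _ (Finset.mem_univ β), ← Finset.mul_prod_erase _ _ (Finset.mem_univ β)]
  have h1 : ∏ γ ∈ Finset.univ.erase β, y γ ^ k γ ≤ ∏ γ ∈ Finset.univ.erase β, y' γ ^ k γ :=
    Finset.prod_le_prod (fun γ _ => pow_nonneg (hy γ) _) fun γ _ => pow_le_pow_left₀ (hy γ) (hy' γ) _
  have h2 : 0 < ∏ γ ∈ Finset.univ.erase β, y' γ ^ k γ :=
    Finset.prod_pos fun γ _ => pow_pos (hpos γ) _
  have h3 : y β ^ k β < y' β ^ k β := pow_lt_pow_left₀ hlt (hy β) hk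
  calc _ ≤ y β ^ k β * ∏ γ ∈ Finset.univ.erase β, y' γ ^ k γ :=
        mul_le_mul_of_nonneg_left h1 (pow_nonneg (hy β) _)
    _ < _ := mul_lt_mul_of_pos_right h3 h2

theorem continuous_Phi (S : Spec m) (α : Fin (m + 1)) :
    Continuous fun q : ℝ × (Fin (m + 1) → ℝ) => Phi S q.1 q.2 α := by
  unfold Phi; fun_prop

/-- For a monotone map, a supersolution which is strict at one place can be improved to a
supersolution which is strict at all the places that depend on it: the iterates of
`y ↦ (y + Ψ y) / 2` propagate strictness backwards along the edges. -/
theorem exists_strict_supersolution {ι : Type*} [Finite ι] (Ψ : (ι → ℝ) → ι → ℝ)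
    (R : ι → ι → Prop) (hnn : ∀ y, (∀ a, 0 < y a) → ∀ a, 0 ≤ Ψ y a)
    (hmono : ∀ x y, (∀ a, 0 < x a) → (∀ a, x a ≤ y a) → ∀ a, Ψ x a ≤ Ψ y a)
    (hstrict : ∀ x y a b, (∀ a, 0 < x a) → (∀ a, x a ≤ y a) → R a b → x b < y b → Ψ x a < Ψ y a)
    (y : ι → ℝ) (hy : ∀ a, 0 < y a) (hle : ∀ a, Ψ y a ≤ y a) (b : ι) (hb : Ψ y b < y b)
    (hR : ∀ a, Relation.ReflTransGen R a b) :
    ∃ x : ι → ℝ, (∀ a, 0 < x a) ∧ (∀ a, x a ≤ y a) ∧ ∀ a, Ψ x a < x a := by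
  let T : (ι → ℝ) → ι → ℝ := fun x a => (x a + Ψ x a) / 2
  have hT : ∀ n, (∀ a, 0 < T^[n] y a) ∧ (∀ a, T^[n] y a ≤ y a) ∧ ∀ a, Ψ (T^[n] y) a ≤ T^[n] y a := by
    intro n
    induction n with
    | zero => exact ⟨hy, fun a => le_rfl, hle⟩
    | succ n ih =>
      rw [Function.iterate_succ_apply']
      set x := T^[n] y
      obtain ⟨h1, h2, h3⟩ := ih
      have hpos : ∀ a, 0 < T x a := fun a => by have := h1 a; have := hnn x h1 a; simp only [T]; linarith
      have hle' : ∀ a, T x a ≤ x a := fun a => by have := h3 a; simp only [T]; linarith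
      refine ⟨hpos, fun a => (hle' a).trans (h2 a), fun a => ?_⟩
      have := hmono _ _ hpos hle' a
      have := h3 a
      simp only [T] at *; linarith
  have hstep : ∀ n a, (Ψ (T^[n] y) a < T^[n] y a ∨ ∃ b, R a b ∧ Ψ (T^[n] y) b < T^[n] y b) →
      Ψ (T^[n + 1] y) a < T^[n + 1] y a := by
    intro n a h
    obtain ⟨h1, h2, h3⟩ := hT n
    have hpos := (hT (n + 1)).1
    rw [Function.iterate_succ_apply'] at hpos ⊢
    set x := T^[n] y
    have hle' : ∀ a, T x a ≤ x a := fun a => by have := h3 a; simp only [T]; linarith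
    rcases h with h | ⟨b, hab, h⟩
    · have := hmono _ _ hpos hle' a
      simp only [T] at *; linarith
    · have := hstrict (T x) x a b hpos hle' hab (by simp only [T]; linarith)
      have := h3 a
      simp only [T] at *; linarith
  have hev : ∀ a, ∃ N, ∀ n, N ≤ n → Ψ (T^[n] y) a < T^[n] y a := by
    intro a
    have mono : ∀ a N, Ψ (T^[N] y) a < T^[N] y a → ∀ n, N ≤ n → Ψ (T^[n] y) a < T^[n] y a := by
      intro a N hN n hn
      induction n, hn using Nat.le_induction with
      | base => exact hN
      | succ n _ ih => exact hstep n a (Or.inl ih)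
    refine Relation.ReflTransGen.head_induction_on (hR a) ⟨0, mono b 0 hb⟩ ?_
    rintro a c hac - ⟨N, hN⟩
    exact ⟨N + 1, mono a (N + 1) (hstep N a (Or.inr ⟨c, hac, hN N le_rfl⟩))⟩
  have hev' : ∀ᶠ n in atTop, ∀ a, Ψ (T^[n] y) a < T^[n] y a :=
    eventually_all.2 fun a => eventually_atTop.2 (hev a)
  obtain ⟨n, hn⟩ := hev'.exists
  exact ⟨T^[n] y, (hT n).1, (hT n).2.1, hn⟩

/-- Positive supersolutions of the system `y = Φ(z, y)`. -/
def Feas (S : Spec m) (z : ℝ) (y : Fin (m + 1) → ℝ) : Prop :=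
  (∀ α, 0 < y α) ∧ ∀ α, Phi S z y α ≤ y α

/-- A supersolution dominates the weight of every tree. -/
theorem Tree.weight_mul_pow_le (S : Spec m) {z : ℝ} (hz : 0 ≤ z) {y : Fin (m + 1) → ℝ}
    (hy : ∀ β, 0 ≤ y β) (hle : ∀ α, Phi S z y α ≤ y α) :
    ∀ {α : Fin (m + 1)} (T : Tree m α), T.weight S * z ^ T.size ≤ y α
  | _, .node α h k ch => by
      refine le_trans ?_ (hle α)
      refine le_trans ?_ (le_Phi S hz hy α h k)
      have ih := fun β i => Tree.weight_mul_pow_le S hz hy hle (ch β i)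
      rw [Tree.weight, Tree.size, pow_add]
      have h1 : (∏ β, ∏ i, (ch β i).weight S) * z ^ (∑ β, ∑ i, (ch β i).size) ≤ ∏ β, y β ^ k β := by
        simp only [← Finset.prod_pow_eq_pow_sum, ← Finset.prod_mul_distrib]
        have hn : ∀ β i, 0 ≤ (ch β i).weight S * z ^ (ch β i).size := fun β i =>
          mul_nonneg (Tree.weight_nonneg S _) (pow_nonneg hz _)
        refine Finset.prod_le_prod (fun β _ => Finset.prod_nonneg fun i _ => hn β i) fun β _ => ?_
        calc _ ≤ ∏ _i : Fin (k β), y β := Finset.prod_le_prod (fun i _ => hn β i) fun i _ => ih β i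
          _ = _ := by simp
      calc _ = (S.φ α h k * z ^ h) *
            ((∏ β, ∏ i, (ch β i).weight S) * z ^ (∑ β, ∑ i, (ch β i).size)) := by ring
        _ ≤ _ := mul_le_mul_of_nonneg_left h1 (mul_nonneg (S.nonneg _ _ _) (pow_nonneg hz _))

theorem exists_tree_of_coeff_ne_zero {S : Spec m} {α : Fin (m + 1)} {n : ℕ} (h : coeff S α n ≠ 0) :
    ∃ T : Tree m α, T.size = n ∧ 0 < T.weight S := by
  by_contra hc
  push Not at hc
  refine h ?_
  rw [coeff]
  convert tsum_zero with T
  split_ifs with hT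
  · exact le_antisymm (hc T hT) (Tree.weight_nonneg S T)
  · rfl

theorem exists_tree {S : Spec m} (haper : Aperiodic S) (α : Fin (m + 1)) :
    ∃ T : Tree m α, 0 < T.weight S ∧ 1 ≤ T.size := by
  obtain ⟨n, hn, hr⟩ := haper α 2 0 le_rfl
  obtain ⟨T, hT, hw⟩ := exists_tree_of_coeff_ne_zero hn
  refine ⟨T, hw, ?_⟩
  rcases Nat.eq_zero_or_pos T.size with h | h
  · rw [← hT, h] at hr; exact absurd rfl hr
  · exact h

/-- For small `z` there are supersolutions, because the linear part of `Φ(0, y)` is nilpotent. -/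
theorem exists_feas (S : Spec m) : ∃ z y, 0 < z ∧ Feas S z y := by
  -- `w = (∑ i, L ^ i) 1` satisfies `L w = w - 1`, hence `L w < w`
  set L : Matrix (Fin (m + 1)) (Fin (m + 1)) ℝ :=
    Matrix.of fun α β : Fin (m + 1) => S.φ α 0 (Pi.single β 1) with hL
  obtain ⟨N, hN⟩ := S.nilpotent
  set G := ∑ i ∈ Finset.range N, L ^ i with hG
  have hLG : L * G = G - 1 := by
    have := mul_geom_sum L N
    rw [hN] at this
    rw [← hG] at this
    rw [sub_mul, one_mul] at this
    have h2 : L * G = (L * G - G) + G := by abel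
    rw [h2, this]; abel
  set w : Fin (m + 1) → ℝ := G.mulVec 1 with hw
  have hLn : ∀ i a b, 0 ≤ (L ^ i) a b := by
    intro i
    induction i with
    | zero => intro a b; rw [pow_zero, Matrix.one_apply]; split_ifs <;> norm_num
    | succ i ih =>
      intro a b
      rw [pow_succ, Matrix.mul_apply]
      exact Finset.sum_nonneg fun c _ => mul_nonneg (ih a c) (S.nonneg _ _ _)
  have hw0 : ∀ a, 0 ≤ w a := by
    intro a
    simp only [hw, Matrix.mulVec, dotProduct, Pi.one_apply, mul_one, hG, Matrix.sum_apply]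
    exact Finset.sum_nonneg fun b _ => Finset.sum_nonneg fun i _ => hLn i a b
  have hLw : ∀ a, L.mulVec w a = w a - 1 := by
    intro a
    rw [hw, Matrix.mulVec_mulVec, hLG, Matrix.sub_mulVec, Matrix.one_mulVec]
    rfl
  have hw1 : ∀ a, 1 ≤ w a := by
    intro a
    have : 0 ≤ ∑ b, L a b * w b :=
      Finset.sum_nonneg fun b _ => mul_nonneg (S.nonneg a 0 (Pi.single b 1)) (hw0 b)
    change 0 ≤ L.mulVec w a at this
    rw [hLw] at this; linarith
  -- after division by `δ`, the value of `Φ(δ ^ 2, δ w)` is a polynomial in `δ`, equal to `L w` at `0`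
  let C : Fin (m + 1) → ℕ × (Fin (m + 1) → ℕ) → ℝ := fun α p => S.φ α p.1 p.2 * ∏ β, w β ^ p.2 β
  let e : ℕ × (Fin (m + 1) → ℕ) → ℕ := fun p => 2 * p.1 + ∑ β, p.2 β
  let g : Fin (m + 1) → ℝ → ℝ := fun α δ => ∑ p ∈ supp S α, C α p * δ ^ (e p - 1)
  have hC : ∀ α p, 0 ≤ C α p := fun α p => mul_nonneg (S.nonneg _ _ _)
    (Finset.prod_nonneg fun β _ => pow_nonneg (hw0 β) _)
  have hPhi : ∀ α δ, Phi S (δ ^ 2) (fun β => δ * w β) α = δ * g α δ := by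
    intro α δ
    rw [Phi, Finset.mul_sum]
    refine Finset.sum_congr rfl fun p hp => ?_
    have he : e p ≠ 0 := by
      intro h0
      rw [mem_supp] at hp
      have h1 : p.1 = 0 := by simp only [e] at h0; omega
      have h2 : ∑ β, p.2 β = 0 := by simp only [e] at h0; omega
      rw [Finset.sum_eq_zero_iff] at h2
      have h3 : p.2 = 0 := funext fun β => h2 β (Finset.mem_univ _)
      rw [h1, h3] at hp
      exact hp (S.no_empty_node α)
    have : δ * (C α p * δ ^ (e p - 1)) = C α p * δ ^ (e p) := by
      rw [← Nat.sub_add_cancel (Nat.one_le_iff_ne_zero.2 he), pow_succ]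
      simp only [Nat.add_sub_cancel]; ring
    rw [this]
    simp only [C, e, mul_pow, Finset.prod_mul_distrib, Finset.prod_pow_eq_pow_sum, pow_add, pow_mul]
    ring
  have hg0 : ∀ α, g α 0 < w α := by
    intro α
    have h1 : g α 0 = ∑ p ∈ (supp S α).filter (fun p => e p ≤ 1), C α p := by
      rw [Finset.sum_filter]
      refine Finset.sum_congr rfl fun p _ => ?_
      split_ifs with h
      · rw [Nat.sub_eq_zero_of_le h]; simp
      · rw [zero_pow (by omega), mul_zero]
    have h2 : (supp S α).filter (fun p => e p ≤ 1) ⊆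
        Finset.univ.image fun β : Fin (m + 1) => ((0 : ℕ), (Pi.single β 1 : Fin (m + 1) → ℕ)) := by
      intro p hp
      rw [Finset.mem_filter, mem_supp] at hp
      have h1 : p.1 = 0 := by have := hp.2; simp only [e] at this; omega
      have h3 : ∑ β, p.2 β ≤ 1 := by have := hp.2; simp only [e] at this; omega
      have h4 : p.2 ≠ 0 := by
        intro h
        rw [h1, h] at hp
        exact hp.1 (S.no_empty_node α)
      obtain ⟨β, hβ⟩ := Function.ne_iff.1 h4
      rw [Finset.mem_image]
      refine ⟨β, Finset.mem_univ _, Prod.ext h1.symm (funext fun γ => ?_)⟩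
      rw [← Finset.add_sum_erase _ _ (Finset.mem_univ β)] at h3
      simp only [Pi.zero_apply] at hβ
      by_cases hγ : γ = β
      · subst hγ; simp only [Pi.single_eq_same]; omega
      · change (Pi.single β 1 : Fin (m + 1) → ℕ) γ = p.2 γ
        rw [Pi.single_eq_of_ne hγ]
        have := Finset.single_le_sum (f := p.2) (fun _ _ => Nat.zero_le _)
          (Finset.mem_erase.2 ⟨hγ, Finset.mem_univ γ⟩)
        omega
    have h3 : g α 0 ≤ ∑ β, C α (0, Pi.single β 1) := by
      rw [h1]
      refine (Finset.sum_le_sum_of_subset_of_nonneg h2 fun p _ _ => hC α p).trans_eq ?_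
      rw [Finset.sum_image]
      intro a _ b _ hab
      have := congrFun (Prod.ext_iff.1 hab).2 a
      by_contra hne
      simp [Pi.single_eq_of_ne hne] at this
    have h4 : ∀ β, C α (0, Pi.single β 1) = L α β * w β := by
      intro β
      simp only [C, hL, Matrix.of_apply]
      congr 1
      rw [Finset.prod_eq_single β]
      · simp
      · intro γ _ hγ; simp [Pi.single_eq_of_ne hγ]
      · simp
    have h5 := hLw α
    rw [Matrix.mulVec, dotProduct] at h5
    simp only [h4] at h3
    linarith
  have hev : ∀ᶠ δ in 𝓝[>] (0 : ℝ), ∀ α, g α δ < w α := by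
    refine eventually_all.2 fun α => ?_
    have hc : Continuous (g α) := by simp only [g]; fun_prop
    exact (hc.continuousAt.eventually_lt continuousAt_const (hg0 α)).filter_mono nhdsWithin_le_nhds
  obtain ⟨δ, hδ, hδ0⟩ := (hev.and self_mem_nhdsWithin).exists
  have hδ0' : 0 < δ := hδ0
  refine ⟨δ ^ 2, fun β => δ * w β, by positivity, fun β => ?_, fun α => ?_⟩
  · have := hw1 β; positivity
  · rw [hPhi]; exact mul_le_mul_of_nonneg_left (hδ α).le hδ0'.le

/-- For `z` bounded away from `0`, the supersolutions stay in a compact set: single trees bound them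
from below, irreducibility makes the components comparable, and a monomial of degree at least `2` bounds
them from above. -/
theorem feas_bounds {S : Spec m} (hnl : Nonlinear S) (hirr : Irreducible S) (haper : Aperiodic S)
    {z₀ : ℝ} (hz₀ : 0 < z₀) : ∃ b B : ℝ, 0 < b ∧ ∀ z y, z₀ ≤ z → Feas S z y →
      z ≤ B ∧ ∀ α, b ≤ y α ∧ y α ≤ B := by
  choose T hT hsize using exists_tree haper
  -- lower bounds, given by single trees
  obtain ⟨b, hb0, hb1, hb⟩ : ∃ b : ℝ, 0 < b ∧ b ≤ 1 ∧ ∀ z y, z₀ ≤ z → Feas S z y → ∀ α, b ≤ y α := by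
    have hpos : ∀ α, 0 < (T α).weight S * z₀ ^ (T α).size := fun α => mul_pos (hT α) (pow_pos hz₀ _)
    refine ⟨min 1 (Finset.univ.inf' Finset.univ_nonempty
      fun α => (T α).weight S * z₀ ^ (T α).size), ?_, min_le_left _ _, ?_⟩
    · exact lt_min one_pos ((Finset.lt_inf'_iff _).2 fun α _ => hpos α)
    · intro z y hz hf α
      refine (min_le_right _ _).trans ((Finset.inf'_le _ (Finset.mem_univ α)).trans ?_)
      refine le_trans ?_ (Tree.weight_mul_pow_le S (hz₀.le.trans hz) (fun β => (hf.1 β).le) hf.2 (T α))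
      have := (hT α).le
      gcongr
  -- comparison of the components along the edges
  have hcmp : ∀ a c, ∃ e : ℝ, 0 < e ∧ ∀ z y, z₀ ≤ z → Feas S z y → e * y c ≤ y a := by
    intro a c
    refine Relation.ReflTransGen.head_induction_on (hirr a c) ⟨1, one_pos, fun z y _ _ => by simp⟩ ?_
    rintro a d ⟨h, k, hφ, hk⟩ - ⟨e, he, hed⟩
    have hφ' : 0 < S.φ a h k := lt_of_le_of_ne (S.nonneg _ _ _) (Ne.symm hφ)
    refine ⟨S.φ a h k * z₀ ^ h * (∏ γ, b ^ k γ) * e, by positivity, fun z y hz hf => ?_⟩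
    have h1 := le_Phi S (hz₀.le.trans hz) (fun β => (hf.1 β).le) a h k
    have h2 : (∏ γ, b ^ k γ) * y d ≤ ∏ γ, y γ ^ k γ := by
      rw [← Finset.mul_prod_erase _ _ (Finset.mem_univ d),
        ← Finset.mul_prod_erase _ (fun γ => y γ ^ k γ) (Finset.mem_univ d)]
      have h3 : b ^ k d * y d ≤ y d ^ k d := by
        obtain ⟨j, hj⟩ := Nat.exists_eq_succ_of_ne_zero hk
        rw [hj, Nat.succ_eq_add_one, pow_succ, pow_succ]
        have h4 : b ^ j ≤ y d ^ j := pow_le_pow_left₀ hb0.le (hb z y hz hf d) j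
        have h5 := (hf.1 d).le
        calc b ^ j * b * y d ≤ b ^ j * 1 * y d := by gcongr
          _ = b ^ j * y d := by ring
          _ ≤ _ := by gcongr
      have h6 : ∏ γ ∈ Finset.univ.erase d, b ^ k γ ≤ ∏ γ ∈ Finset.univ.erase d, y γ ^ k γ :=
        Finset.prod_le_prod (fun γ _ => by positivity)
          fun γ _ => pow_le_pow_left₀ hb0.le (hb z y hz hf γ) _
      have h7 := (hf.1 d)
      calc _ = (b ^ k d * y d) * ∏ γ ∈ Finset.univ.erase d, b ^ k γ := by ring
        _ ≤ _ := mul_le_mul h3 h6 (Finset.prod_nonneg fun γ _ => by positivity) (by positivity)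
    calc _ = S.φ a h k * z₀ ^ h * (∏ γ, b ^ k γ) * (e * y c) := by ring
      _ ≤ S.φ a h k * z₀ ^ h * (∏ γ, b ^ k γ) * y d :=
        mul_le_mul_of_nonneg_left (hed z y hz hf) (by positivity)
      _ = S.φ a h k * z₀ ^ h * ((∏ γ, b ^ k γ) * y d) := by ring
      _ ≤ S.φ a h k * z ^ h * ∏ γ, y γ ^ k γ := by
        have := (hf.1 d).le
        have := hz₀.trans_le hz
        gcongr
      _ ≤ y a := h1.trans (hf.2 a)
  choose e he hcmp using hcmp
  -- the nonlinear monomial gives an upper bound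
  obtain ⟨B₀, hB₀⟩ : ∃ B₀ : ℝ, ∀ z y, z₀ ≤ z → Feas S z y → y 0 ≤ B₀ := by
    obtain ⟨α, h, k, hφ, hk⟩ := hnl
    have hφ' : 0 < S.φ α h k := lt_of_le_of_ne (S.nonneg _ _ _) (Ne.symm hφ)
    set C := e 0 α * (S.φ α h k * z₀ ^ h * ∏ γ, e γ 0 ^ k γ) with hC
    have hC0 : 0 < C := by
      have := he 0 α
      have := Finset.prod_pos fun γ (_ : γ ∈ Finset.univ) => pow_pos (he γ 0) (k γ)
      positivity
    refine ⟨max 1 C⁻¹, fun z y hz hf => ?_⟩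
    by_contra hlt
    rw [not_le, max_lt_iff] at hlt
    have h1 := le_Phi S (hz₀.le.trans hz) (fun β => (hf.1 β).le) α h k
    have h2 : (∏ γ, e γ 0 ^ k γ) * y 0 ^ (∑ γ, k γ) ≤ ∏ γ, y γ ^ k γ := by
      rw [← Finset.prod_pow_eq_pow_sum, ← Finset.prod_mul_distrib]
      refine Finset.prod_le_prod (fun γ _ => ?_) fun γ _ => ?_
      · have := (he γ 0); have := hf.1 0; positivity
      · rw [← mul_pow]
        have := (he γ 0); have := hf.1 0
        exact pow_le_pow_left₀ (by positivity) (hcmp γ 0 z y hz hf) _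
    have h3 : y 0 ^ 2 ≤ y 0 ^ (∑ γ, k γ) := pow_le_pow_right₀ hlt.1.le hk
    have h4 : C * y 0 ^ 2 ≤ y 0 := by
      refine le_trans ?_ (hcmp 0 α z y hz hf)
      rw [hC, mul_assoc]
      refine mul_le_mul_of_nonneg_left ?_ (he 0 α).le
      have hp : 0 < ∏ γ, e γ 0 ^ k γ := Finset.prod_pos fun γ _ => pow_pos (he γ 0) (k γ)
      calc _ = S.φ α h k * z₀ ^ h * ((∏ γ, e γ 0 ^ k γ) * y 0 ^ 2) := by ring
        _ ≤ S.φ α h k * z₀ ^ h * ((∏ γ, e γ 0 ^ k γ) * y 0 ^ (∑ γ, k γ)) := by gcongr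
        _ ≤ S.φ α h k * z ^ h * ∏ γ, y γ ^ k γ := by
          have := pow_pos (hf.1 0) (∑ γ, k γ)
          have := hz₀.trans_le hz
          gcongr
        _ ≤ y α := h1.trans (hf.2 α)
    have h5 : C * y 0 ≤ 1 := by
      have := hf.1 0
      have h6 : y 0 * (C * y 0) ≤ y 0 * 1 := by nlinarith
      exact le_of_mul_le_mul_left h6 this
    have h7 : y 0 ≤ C⁻¹ := by rw [← one_div, le_div_iff₀ hC0]; linarith
    linarith [hlt.2]
  have hB₁ : ∀ z y, z₀ ≤ z → Feas S z y → ∀ α, y α ≤ ∑ γ, B₀ / e 0 γ := by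
    intro z y hz hf α
    have h1 : y α ≤ B₀ / e 0 α := by
      rw [le_div_iff₀ (he 0 α), mul_comm]
      exact (hcmp 0 α z y hz hf).trans (hB₀ z y hz hf)
    have h0 : 0 ≤ B₀ := (hf.1 0).le.trans (hB₀ z y hz hf)
    exact h1.trans (Finset.single_le_sum (f := fun γ => B₀ / e 0 γ)
      (fun γ _ => div_nonneg h0 (he 0 γ).le) (Finset.mem_univ α))
  refine ⟨b, max (max 1 (B₀ / (T 0).weight S)) (∑ γ, B₀ / e 0 γ), hb0, fun z y hz hf =>
    ⟨le_max_of_le_left ?_, fun α => ⟨hb z y hz hf α, le_max_of_le_right (hB₁ z y hz hf α)⟩⟩⟩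
  rcases le_or_gt z 1 with h1 | h1
  · exact le_max_of_le_left h1
  · refine le_max_of_le_right ?_
    rw [le_div_iff₀ (hT 0), mul_comm]
    refine le_trans ?_ ((Tree.weight_mul_pow_le S (hz₀.le.trans hz) (fun β => (hf.1 β).le) hf.2
      (T 0)).trans (hB₀ z y hz hf))
    refine mul_le_mul_of_nonneg_left ?_ (hT 0).le
    exact le_self_pow₀ h1.le (by have := hsize 0; omega)

/-- `ζ` is the largest `z` for which the system has a positive supersolution. -/
def IsMaxZ (S : Spec m) (ζ : ℝ) : Prop := 0 < ζ ∧ ∀ z y, 0 < z → Feas S z y → z ≤ ζ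

theorem exists_isMaxZ {S : Spec m} (hnl : Nonlinear S) (hirr : Irreducible S) (haper : Aperiodic S) :
    ∃ ζ y, IsMaxZ S ζ ∧ Feas S ζ y := by
  obtain ⟨z₀, y₀, hz₀, hf₀⟩ := exists_feas S
  obtain ⟨b, B, hb, hbd⟩ := feas_bounds hnl hirr haper hz₀
  let K : Set (ℝ × (Fin (m + 1) → ℝ)) :=
    (Set.Icc z₀ B ×ˢ Set.Icc (fun _ => b) (fun _ => B)) ∩ {q | ∀ α, Phi S q.1 q.2 α ≤ q.2 α}
  have hK : IsCompact K := by
    refine (isCompact_Icc.prod isCompact_Icc).inter_right ?_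
    simp only [Set.ofPred_forall]
    exact isClosed_iInter fun α => isClosed_le (continuous_Phi S α) (by fun_prop)
  have hmem : ∀ z y, z₀ ≤ z → Feas S z y → (z, y) ∈ K := fun z y hz hf => by
    obtain ⟨h1, h2⟩ := hbd z y hz hf
    exact ⟨⟨⟨hz, h1⟩, fun α => (h2 α).1, fun α => (h2 α).2⟩, hf.2⟩
  obtain ⟨q, hq, hmax⟩ := hK.exists_isMaxOn ⟨_, hmem z₀ y₀ le_rfl hf₀⟩ continuous_fst.continuousOn
  refine ⟨q.1, q.2, ⟨lt_of_lt_of_le hz₀ hq.1.1.1, fun z y hz hf => ?_⟩,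
    fun α => lt_of_lt_of_le hb (hq.1.2.1 α), hq.2⟩
  rcases le_total z₀ z with h | h
  · exact hmax (hmem z y h hf)
  · exact h.trans hq.1.1.1

theorem IsMaxZ.not_strict {S : Spec m} {ζ : ℝ} (hζ : IsMaxZ S ζ) {y : Fin (m + 1) → ℝ}
    (hy : ∀ α, 0 < y α) : ¬ ∀ α, Phi S ζ y α < y α := by
  intro h
  have hev : ∀ᶠ z in 𝓝[>] ζ, ∀ α, Phi S z y α < y α := by
    refine eventually_all.2 fun α => ?_
    have hc : Continuous fun z => Phi S z y α := by unfold Phi; fun_prop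
    exact (hc.continuousAt.eventually_lt continuousAt_const (h α)).filter_mono nhdsWithin_le_nhds
  obtain ⟨z, hz, hz'⟩ := (hev.and self_mem_nhdsWithin).exists
  have : ζ < z := hz'
  exact absurd (hζ.2 z y (hζ.1.trans this) ⟨hy, fun α => (hz α).le⟩) (not_le.2 this)

/-- At the largest `z`, the supersolutions are solutions. -/
theorem IsMaxZ.eq {S : Spec m} (hirr : Irreducible S) {ζ : ℝ} (hζ : IsMaxZ S ζ)
    {y : Fin (m + 1) → ℝ} (hf : Feas S ζ y) (α : Fin (m + 1)) : Phi S ζ y α = y α := by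
  by_contra hne
  obtain ⟨x, hx, -, hs⟩ := exists_strict_supersolution (Phi S ζ) (Edge S)
    (fun y hy a => Phi_nonneg S hζ.1.le (fun β => (hy β).le) a)
    (fun x y hx hxy a => Phi_mono S hζ.1.le le_rfl (fun β => (hx β).le) hxy a)
    (fun x y a b hx hxy he hlt => Phi_strict S hζ.1 (fun β => (hx β).le) hxy
      (fun β => (hx β).trans_le (hxy β)) he hlt) y hf.1 hf.2 α (lt_of_le_of_ne (hf.2 α) hne)
    (fun a => hirr a α)
  exact hζ.not_strict hx hs

/-- At the largest `z`, the supersolution is unique: the geometric mean of two of them is again a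
supersolution, and it is not a solution unless all the monomials are multiplied by the same factor;
then the ratio of the two is `1`, by induction on a tree. -/
theorem IsMaxZ.unique {S : Spec m} (hirr : Irreducible S) (haper : Aperiodic S) {ζ : ℝ}
    (hζ : IsMaxZ S ζ) {y y' : Fin (m + 1) → ℝ} (hf : Feas S ζ y) (hf' : Feas S ζ y') : y' = y := by
  -- `g` is the geometric mean of `y` and `y'`, `M α p` the monomials of `Φ` at `y`, and `ρ p` the factor
  -- by which a monomial is multiplied when `y` is replaced by `y'`
  set r : Fin (m + 1) → ℝ := fun α => y' α / y α with hr
  have hr0 : ∀ α, 0 < r α := fun α => div_pos (hf'.1 α) (hf.1 α)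
  have hy' : ∀ α, y' α = r α * y α := fun α => (div_mul_cancel₀ _ (hf.1 α).ne').symm
  set g : Fin (m + 1) → ℝ := fun α => √(r α) * y α with hg
  have hg0 : ∀ α, 0 < g α := fun α => mul_pos (Real.sqrt_pos.2 (hr0 α)) (hf.1 α)
  let M : Fin (m + 1) → ℕ × (Fin (m + 1) → ℕ) → ℝ :=
    fun α p => S.φ α p.1 p.2 * ζ ^ p.1 * ∏ β, y β ^ p.2 β
  let ρ : ℕ × (Fin (m + 1) → ℕ) → ℝ := fun p => ∏ β, r β ^ p.2 β
  have hρ0 : ∀ p, 0 < ρ p := fun p => Finset.prod_pos fun β _ => pow_pos (hr0 β) _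
  have hM0 : ∀ α p, p ∈ supp S α → 0 < M α p := fun α p hp =>
    mul_pos (mul_pos (lt_of_le_of_ne (S.nonneg _ _ _) (Ne.symm (mem_supp.1 hp))) (pow_pos hζ.1 _))
      (Finset.prod_pos fun β _ => pow_pos (hf.1 β) _)
  have hMy' : ∀ α, Phi S ζ y' α = ∑ p ∈ supp S α, M α p * ρ p := by
    intro α
    refine Finset.sum_congr rfl fun p _ => ?_
    simp only [M, ρ, hy', mul_pow, Finset.prod_mul_distrib]; ring
  have hMg : ∀ α, Phi S ζ g α = ∑ p ∈ supp S α, M α p * √(ρ p) := by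
    intro α
    refine Finset.sum_congr rfl fun p _ => ?_
    have : √(ρ p) = ∏ β, √(r β) ^ p.2 β := by
      rw [Real.sqrt_eq_iff_mul_self_eq (hρ0 p).le (Finset.prod_nonneg fun β _ => by positivity),
        ← Finset.prod_mul_distrib]
      refine Finset.prod_congr rfl fun β _ => ?_
      rw [← mul_pow, Real.mul_self_sqrt (hr0 β).le]
    simp only [M, hg, this, mul_pow, Finset.prod_mul_distrib]; ring
  -- the arithmetic-geometric inequality, with its defect
  have key : ∀ α p, 2 * √(ρ p) = √(r α) * (1 + ρ p / r α) - (√(ρ p) - √(r α)) ^ 2 / √(r α) := by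
    intro α p
    have h1 := Real.sqrt_pos.2 (hr0 α)
    have h2 := Real.mul_self_sqrt (hr0 α).le
    have h3 := Real.mul_self_sqrt (hρ0 p).le
    have h4 := hr0 α
    set s := √(r α)
    set t := √(ρ p)
    rw [← h2, ← h3]
    field_simp
    ring
  have hgle : ∀ α, Phi S ζ g α ≤ g α ∧ (Phi S ζ g α = g α → ∀ p ∈ supp S α, ρ p = r α) := by
    intro α
    have h1 := Real.sqrt_pos.2 (hr0 α)
    have e1 : ∑ p ∈ supp S α, M α p = y α := hζ.eq hirr hf α
    have e2 : ∑ p ∈ supp S α, M α p * ρ p = y' α := by rw [← hMy', hζ.eq hirr hf' α]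
    have e3 : 2 * Phi S ζ g α = 2 * g α -
        ∑ p ∈ supp S α, M α p * ((√(ρ p) - √(r α)) ^ 2 / √(r α)) := by
      rw [hMg, Finset.mul_sum]
      have : ∀ p ∈ supp S α, 2 * (M α p * √(ρ p)) = √(r α) * M α p + (√(r α) / r α) * (M α p * ρ p)
          - M α p * ((√(ρ p) - √(r α)) ^ 2 / √(r α)) := by
        intro p _
        have := key α p
        have h5 : 2 * (M α p * √(ρ p)) = M α p * (2 * √(ρ p)) := by ring
        rw [h5, this]; ring
      rw [Finset.sum_congr rfl this, Finset.sum_sub_distrib, Finset.sum_add_distrib, ← Finset.mul_sum,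
        ← Finset.mul_sum, e1, e2, hy']
      have := (hr0 α).ne'
      simp only [hg]
      field_simp
      ring
    have hnn : ∀ p ∈ supp S α, 0 ≤ M α p * ((√(ρ p) - √(r α)) ^ 2 / √(r α)) := fun p hp =>
      mul_nonneg (hM0 α p hp).le (by positivity)
    refine ⟨by linarith [Finset.sum_nonneg hnn], fun heq p hp => ?_⟩
    have hz : ∑ p ∈ supp S α, M α p * ((√(ρ p) - √(r α)) ^ 2 / √(r α)) = 0 := by linarith
    have := (Finset.sum_eq_zero_iff_of_nonneg hnn).1 hz p hp
    have h6 : (√(ρ p) - √(r α)) ^ 2 / √(r α) = 0 :=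
      (mul_eq_zero.1 this).resolve_left (hM0 α p hp).ne'
    have h7 : √(ρ p) - √(r α) = 0 := by
      have := (div_eq_zero_iff.1 h6).resolve_right h1.ne'
      exact pow_eq_zero_iff (two_ne_zero) |>.1 this
    rw [← Real.sq_sqrt (hρ0 p).le, ← Real.sq_sqrt (hr0 α).le, sub_eq_zero.1 h7]
  -- `g` is a supersolution, hence a solution, so the defects vanish
  have hfg : Feas S ζ g := ⟨hg0, fun α => (hgle α).1⟩
  have hall : ∀ α, ∀ p ∈ supp S α, ρ p = r α := fun α => (hgle α).2 (hζ.eq hirr hfg α)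
  have htree : ∀ (α : Fin (m + 1)) (T : Tree m α), 0 < T.weight S → r α = 1 := by
    intro α T
    induction T with
    | node α h k ch ih =>
      intro hT
      rw [Tree.weight] at hT
      have hφ : S.φ α h k ≠ 0 := fun h0 => by rw [h0, zero_mul] at hT; exact lt_irrefl _ hT
      have hw : ∀ β i, 0 < (ch β i).weight S := by
        intro β i
        refine lt_of_le_of_ne (Tree.weight_nonneg S _) fun h0 => ?_
        rw [Finset.prod_eq_zero (Finset.mem_univ β) (Finset.prod_eq_zero (Finset.mem_univ i) h0.symm),
          mul_zero] at hT
        exact lt_irrefl _ hT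
      rw [← hall α (h, k) (mem_supp.2 hφ)]
      refine Finset.prod_eq_one fun β _ => ?_
      rcases Nat.eq_zero_or_pos (k β) with h0 | h0
      · simp [h0]
      · rw [ih β ⟨0, h0⟩ (hw β _), one_pow]
  funext α
  obtain ⟨T, hT, -⟩ := exists_tree haper α
  rw [hy', htree α T hT, one_mul]

end CF

/-! ### The critical point -/

namespace CF

open Filter Topology

variable {m : ℕ}

theorem hasFDerivAt_Phi (S : Spec m) (z : ℝ) (y : Fin (m + 1) → ℝ) (α : Fin (m + 1)) :
    ∃ f' : (Fin (m + 1) → ℝ) →L[ℝ] ℝ, HasFDerivAt (fun y => Phi S z y α) f' y ∧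
      ∀ v, f' v = ∑ p ∈ supp S α, S.φ α p.1 p.2 * z ^ p.1 *
        ∑ i, (∏ j ∈ Finset.univ.erase i, y j ^ p.2 j) * ((p.2 i * y i ^ (p.2 i - 1)) * v i) := by
  have hpow : ∀ (i : Fin (m + 1)) (n : ℕ), HasFDerivAt (fun y : Fin (m + 1) → ℝ => y i ^ n)
      (((n : ℝ) * y i ^ (n - 1)) • (ContinuousLinearMap.proj i : (Fin (m + 1) → ℝ) →L[ℝ] ℝ)) y :=
    fun i n => (hasDerivAt_pow n (y i)).comp_hasFDerivAt y (hasFDerivAt_apply i y)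
  have hmon : ∀ p : ℕ × (Fin (m + 1) → ℕ), HasFDerivAt
      (fun y : Fin (m + 1) → ℝ => S.φ α p.1 p.2 * z ^ p.1 * ∏ β, y β ^ p.2 β)
      ((S.φ α p.1 p.2 * z ^ p.1) • ∑ i, (∏ j ∈ Finset.univ.erase i, y j ^ p.2 j) •
        (((p.2 i : ℝ) * y i ^ (p.2 i - 1)) •
          (ContinuousLinearMap.proj i : (Fin (m + 1) → ℝ) →L[ℝ] ℝ))) y := by
    intro p
    exact (HasFDerivAt.finsetProd (u := Finset.univ) fun i _ => hpow i (p.2 i)).const_mul _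
  refine ⟨_, HasFDerivAt.fun_sum fun p _ => hmon p, fun v => ?_⟩
  simp

theorem exists_edge {S : Spec m} (hnl : Nonlinear S) (hirr : Irreducible S) (a : Fin (m + 1)) :
    ∃ b, Edge S a b := by
  obtain ⟨α, h, k, hφ, hk⟩ := hnl
  have : ∃ b, k b ≠ 0 := by
    by_contra hc
    push Not at hc
    simp [hc] at hk
  obtain ⟨b, hb⟩ := this
  rcases Relation.ReflTransGen.cases_head (hirr a α) with h' | ⟨c, hc, -⟩
  · exact ⟨b, h, k, by rw [h']; exact hφ, hb⟩
  · exact ⟨c, hc⟩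

/-- At the largest `z`, there is a point above the solution at which all the equations, except the
one of the colour `0`, hold with strict inequalities: the renormalised differences between the solution
and its approximations by iteration converge to a vector `w` with `J w ≤ w`, `J` being the Jacobian
matrix, and this vector is improved after removing the row of the colour `0`. -/
theorem exists_strict_above {S : Spec m} (hnl : Nonlinear S) (hirr : Irreducible S)
    (haper : Aperiodic S) {ζ : ℝ} (hζ : IsMaxZ S ζ) {y : Fin (m + 1) → ℝ} (hf : Feas S ζ y) :
    ∃ y₁ : Fin (m + 1) → ℝ, (∀ α, y α < y₁ α) ∧ ∀ α, α ≠ 0 → Phi S ζ y₁ α < y₁ α := by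
  choose J hJ hJv using hasFDerivAt_Phi S ζ y
  have hJnn : ∀ α v, (∀ β, 0 ≤ v β) → 0 ≤ J α v := by
    intro α v hv
    rw [hJv]
    refine Finset.sum_nonneg fun p _ => mul_nonneg (mul_nonneg (S.nonneg _ _ _)
      (pow_nonneg hζ.1.le _)) (Finset.sum_nonneg fun i _ => mul_nonneg (Finset.prod_nonneg fun j _ =>
        pow_nonneg (hf.1 j).le _) (mul_nonneg (mul_nonneg (Nat.cast_nonneg _)
          (pow_nonneg (hf.1 i).le _)) (hv i)))
  have hJpos : ∀ α β v, (∀ β, 0 ≤ v β) → Edge S α β → 0 < v β → 0 < J α v := by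
    rintro α β v hv ⟨h, k, hφ, hk⟩ hvβ
    rw [hJv]
    have hnn : ∀ (p : ℕ × (Fin (m + 1) → ℕ)) i, 0 ≤ (∏ j ∈ Finset.univ.erase i, y j ^ p.2 j) *
        ((p.2 i * y i ^ (p.2 i - 1)) * v i) := fun p i => mul_nonneg (Finset.prod_nonneg fun j _ =>
        pow_nonneg (hf.1 j).le _) (mul_nonneg (mul_nonneg (Nat.cast_nonneg _)
          (pow_nonneg (hf.1 i).le _)) (hv i))
    refine Finset.sum_pos' (fun p _ => mul_nonneg (mul_nonneg (S.nonneg _ _ _)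
      (pow_nonneg hζ.1.le _)) (Finset.sum_nonneg fun i _ => hnn p i)) ⟨(h, k), mem_supp.2 hφ, ?_⟩
    have hφ' : 0 < S.φ α h k := lt_of_le_of_ne (S.nonneg _ _ _) (Ne.symm hφ)
    refine mul_pos (mul_pos hφ' (pow_pos hζ.1 _)) (Finset.sum_pos' (fun i _ => hnn (h, k) i)
      ⟨β, Finset.mem_univ _, ?_⟩)
    have : (0 : ℝ) < k β := Nat.cast_pos.2 (Nat.pos_of_ne_zero hk)
    exact mul_pos (Finset.prod_pos fun j _ => pow_pos (hf.1 j) _)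
      (mul_pos (mul_pos this (pow_pos (hf.1 β) _)) hvβ)
  -- the iterates of `Φ(ζ, ·)` from `0` increase to a solution, which is `y` by uniqueness
  let Y : ℕ → Fin (m + 1) → ℝ := fun n => (Phi S ζ)^[n] 0
  have hYs : ∀ n, Y (n + 1) = Phi S ζ (Y n) := fun n => Function.iterate_succ_apply' _ _ _
  have hY0 : ∀ n α, 0 ≤ Y n α := by
    intro n
    induction n with
    | zero => intro α; exact le_rfl
    | succ n ih => intro α; rw [hYs]; exact Phi_nonneg S hζ.1.le ih α
  have hYlt : ∀ n α, Y n α < y α := by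
    intro n
    induction n with
    | zero => intro α; exact hf.1 α
    | succ n ih =>
      intro α
      rw [hYs]
      obtain ⟨β, hβ⟩ := exists_edge hnl hirr α
      exact (Phi_strict S hζ.1 (hY0 n) (fun β => (ih β).le) hf.1 hβ (ih β)).trans_le (hf.2 α)
  have hYmono : ∀ n α, Y n α ≤ Y (n + 1) α := by
    intro n
    induction n with
    | zero => intro α; exact hY0 1 α
    | succ n ih => intro α; rw [hYs, hYs (n + 1)]; exact Phi_mono S hζ.1.le le_rfl (hY0 n) ih α
  have hlim : ∃ l : Fin (m + 1) → ℝ, Tendsto Y atTop (𝓝 l) := by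
    refine ⟨fun α => ⨆ n, Y n α, tendsto_pi_nhds.2 fun α => ?_⟩
    refine tendsto_atTop_ciSup (monotone_nat_of_le_succ fun n => hYmono n α) ⟨y α, ?_⟩
    rintro _ ⟨n, rfl⟩
    exact (hYlt n α).le
  obtain ⟨l, hl⟩ := hlim
  have hl' := tendsto_pi_nhds.1 hl
  have hl0 : ∀ α, 0 ≤ l α := fun α => ge_of_tendsto' (hl' α) fun n => hY0 n α
  have hlfix : ∀ α, Phi S ζ l α = l α := by
    intro α
    have hc : Continuous fun x : Fin (m + 1) → ℝ => Phi S ζ x α := by unfold Phi; fun_prop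
    refine tendsto_nhds_unique ((hc.tendsto l).comp hl) ?_
    have := (tendsto_add_atTop_iff_nat 1).2 (hl' α)
    simp only [hYs] at this
    exact this
  have hlpos : ∀ α, 0 < l α := by
    intro α
    obtain ⟨T, hT, -⟩ := exists_tree haper α
    exact (mul_pos hT (pow_pos hζ.1 _)).trans_le
      (Tree.weight_mul_pow_le S hζ.1.le hl0 (fun α => (hlfix α).le) T)
  have hly : l = y := hζ.unique hirr haper hf ⟨hlpos, fun α => (hlfix α).le⟩
  rw [hly] at hl hl'
  -- the unit vectors `(y - Y n) / ‖y - Y n‖` have a limit point `w ≥ 0`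
  set d : ℕ → Fin (m + 1) → ℝ := fun n => Y n - y with hd
  have hd0 : ∀ n, d n ≠ 0 := fun n h => by
    have := congrFun h 0
    simp only [hd, Pi.sub_apply, Pi.zero_apply] at this
    linarith [hYlt n 0]
  set c : ℕ → ℝ := fun n => -‖d n‖⁻¹ with hc
  have hcneg : ∀ n, c n < 0 := fun n => neg_lt_zero.2 (inv_pos.2 (norm_pos_iff.2 (hd0 n)))
  have hsph : ∀ n, c n • d n ∈ Metric.sphere (0 : Fin (m + 1) → ℝ) 1 := by
    intro n
    rw [mem_sphere_zero_iff_norm, norm_smul, hc]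
    simp only [norm_neg, norm_inv, norm_norm]
    exact inv_mul_cancel₀ (norm_ne_zero_iff.2 (hd0 n))
  obtain ⟨w, hw1, ψ, hψ, hw⟩ := (isCompact_sphere (0 : Fin (m + 1) → ℝ) 1).tendsto_subseq hsph
  have hdlim : Tendsto (fun n => d (ψ n)) atTop (𝓝 0) := by
    have : Tendsto d atTop (𝓝 (y - y)) := hl.sub_const y
    rw [sub_self] at this
    exact this.comp hψ.tendsto_atTop
  have hw' := tendsto_pi_nhds.1 hw
  have hw0 : ∀ α, 0 ≤ w α := by
    intro α
    refine ge_of_tendsto' (hw' α) fun n => ?_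
    have h1 := hcneg (ψ n)
    have h2 := hYlt (ψ n) α
    simp only [Function.comp, Pi.smul_apply, smul_eq_mul, hd, Pi.sub_apply]
    exact mul_nonneg_of_nonpos_of_nonpos h1.le (by linarith)
  -- `Y n ≤ Y (n + 1) = Φ(ζ, Y n)` reads `c (Φ(ζ, Y n) - y) ≤ c (Y n - y)` with `c < 0`; the left side tends to `J w`
  have hJw : ∀ α, J α w ≤ w α := by
    intro α
    have h1 := ((hasFDerivWithinAt_univ.2 (hJ α))).lim (c := fun n => c (ψ n)) hdlim
      (Eventually.of_forall fun _ => Set.mem_univ _) hw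
    refine le_of_tendsto_of_tendsto' h1 (hw' α) fun n => ?_
    have e1 : y + d (ψ n) = Y (ψ n) := by simp [hd]
    rw [e1, hζ.eq hirr hf α, ← hYs]
    change c (ψ n) * (Y (ψ n + 1) α - y α) ≤ c (ψ n) * (Y (ψ n) α - y α)
    exact mul_le_mul_of_nonpos_left (by linarith [hYmono (ψ n) α]) (hcneg _).le
  have hwne : ∃ β, 0 < w β := by
    by_contra hcon
    push Not at hcon
    have : w = 0 := funext fun β => le_antisymm (hcon β) (hw0 β)
    rw [this] at hw1
    simp at hw1
  obtain ⟨β₀, hβ₀⟩ := hwne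
  have hwpos : ∀ α, 0 < w α := by
    intro α
    refine Relation.ReflTransGen.head_induction_on (hirr α β₀) hβ₀ ?_
    rintro a b hab - hb
    exact (hJpos a b w hw0 hab hb).trans_le (hJw a)
  -- with the row of the colour `0` erased, the inequality is strict there, and strictness spreads along
  -- the edges; a small multiple of the resulting vector is added to `y`
  obtain ⟨x, hx, -, hs⟩ := exists_strict_supersolution
    (fun v a => if a = 0 then 0 else J a v) (fun a b => Edge S a b ∧ a ≠ 0)
    (fun v hv a => by
      show 0 ≤ if a = 0 then 0 else J a v
      split_ifs
      · exact le_rfl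
      · exact hJnn a v fun β => (hv β).le)
    (fun v v' _ h a => by
      show (if a = 0 then 0 else J a v) ≤ if a = 0 then 0 else J a v'
      split_ifs
      · exact le_rfl
      · have := hJnn a (v' - v) fun β => sub_nonneg.2 (h β)
        rw [map_sub] at this; linarith)
    (fun v v' a b _ h hR hlt => by
      show (if a = 0 then 0 else J a v) < if a = 0 then 0 else J a v'
      rw [if_neg hR.2, if_neg hR.2]
      have := hJpos a b (v' - v) (fun β => sub_nonneg.2 (h β)) hR.1 (sub_pos.2 hlt)
      rw [map_sub] at this; linarith)
    w hwpos (fun a => by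
      show (if a = 0 then 0 else J a w) ≤ w a
      split_ifs
      · exact hw0 a
      · exact hJw a) 0 (by
      show (if (0 : Fin (m + 1)) = 0 then 0 else J 0 w) < w 0
      rw [if_pos rfl]; exact hwpos 0)
    (fun a => by
      refine Relation.ReflTransGen.head_induction_on (hirr a 0) .refl ?_
      intro a b hab _ ih
      by_cases ha : a = 0
      · rw [ha]
      · exact .head ⟨hab, ha⟩ ih)
  have hev : ∀ᶠ ε in 𝓝[>] (0 : ℝ), ∀ α, α ≠ 0 → Phi S ζ (y + ε • x) α < (y + ε • x) α := by
    refine eventually_all.2 fun α => ?_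
    by_cases hα : α = 0
    · exact Eventually.of_forall fun _ h => absurd hα h
    · have hsα : J α x < x α := by simpa [hα] using hs α
      have hline : HasDerivAt (fun ε : ℝ => Phi S ζ (y + ε • x) α) (J α x) 0 := by
        have h1 : HasDerivAt (fun ε : ℝ => y + ε • x) x 0 := by
          simpa using ((hasDerivAt_id (0 : ℝ)).smul_const x).const_add y
        have h2 : HasFDerivAt (fun y => Phi S ζ y α) (J α) (y + (0 : ℝ) • x) := by
          rw [zero_smul, add_zero]; exact hJ α
        exact h2.comp_hasDerivAt (0 : ℝ) h1
      have h4 : Tendsto (slope (fun ε : ℝ => Phi S ζ (y + ε • x) α) 0) (𝓝[>] 0) (𝓝 (J α x)) :=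
        (hasDerivAt_iff_tendsto_slope.1 hline).mono_left
          (nhdsWithin_mono _ fun ε (hε : 0 < ε) => hε.ne')
      filter_upwards [h4.eventually_lt_const hsα, self_mem_nhdsWithin] with ε hε hε0 _
      have hε0' : 0 < ε := hε0
      rw [slope_def_field, sub_zero, div_lt_iff₀ hε0', zero_smul, add_zero, hζ.eq hirr hf α] at hε
      simp only [Pi.add_apply, Pi.smul_apply, smul_eq_mul]
      linarith
  obtain ⟨ε, hε, hε0⟩ := (hev.and self_mem_nhdsWithin).exists
  have hε0' : 0 < ε := hε0
  refine ⟨y + ε • x, fun α => ?_, hε⟩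
  have := mul_pos hε0' (hx α)
  simp only [Pi.add_apply, Pi.smul_apply, smul_eq_mul]
  linarith

theorem Piece.weight_pos_node {S : Spec m} {α : Fin (m + 1)} {h : ℕ} {k : Fin (m + 1) → ℕ}
    {ch : ∀ β : Fin m, Fin (k β.succ) → Piece m β.succ} :
    0 < (Piece.node α h k ch).weight S ↔ S.φ α h k ≠ 0 ∧ ∀ β i, 0 < (ch β i).weight S := by
  rw [Piece.weight]
  constructor
  · intro hT
    refine ⟨fun h0 => by rw [h0, zero_mul] at hT; exact lt_irrefl _ hT, fun β i => ?_⟩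
    refine lt_of_le_of_ne (Piece.weight_nonneg S _) fun h0 => ?_
    rw [Finset.prod_eq_zero (Finset.mem_univ β) (Finset.prod_eq_zero (Finset.mem_univ i) h0.symm),
      mul_zero] at hT
    exact lt_irrefl _ hT
  · rintro ⟨h1, h2⟩
    exact mul_pos (lt_of_le_of_ne (S.nonneg _ _ _) (Ne.symm h1))
      (Finset.prod_pos fun β _ => Finset.prod_pos fun i _ => h2 β i)

theorem Piece.one_le_leaves {S : Spec m} : ∀ {α : Fin (m + 1)} (t : Piece m α),
    0 < t.weight S → 1 ≤ t.zl + t.al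
  | _, .node α h k ch, hT => by
      rw [Piece.weight_pos_node] at hT
      by_contra hcon
      simp only [Piece.zl, Piece.al] at hcon
      have h0 : h = 0 := by omega
      have h1 : ∑ β, ∑ i, (ch β i).zl = 0 := by omega
      have h2 : ∑ β, ∑ i, (ch β i).al = 0 := by omega
      have hk : k = 0 := by
        funext γ
        refine Fin.cases (by simp only [Pi.zero_apply]; omega) (fun β => ?_) γ
        by_contra hne
        have h3 := Piece.one_le_leaves _ (hT.2 β ⟨0, Nat.pos_of_ne_zero hne⟩)
        have h4 := Finset.sum_eq_zero_iff.1 (Finset.sum_eq_zero_iff.1 h1 β (Finset.mem_univ _))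
          ⟨0, Nat.pos_of_ne_zero hne⟩ (Finset.mem_univ _)
        have h5 := Finset.sum_eq_zero_iff.1 (Finset.sum_eq_zero_iff.1 h2 β (Finset.mem_univ _))
          ⟨0, Nat.pos_of_ne_zero hne⟩ (Finset.mem_univ _)
        omega
      exact hT.1 (by rw [h0, hk]; exact S.no_empty_node α)

/-- A piece with a single leaf is a chain of nodes, whose weight enters a power of the linear part
of the system. -/
theorem Piece.exists_pow_pos {S : Spec m} : ∀ {α : Fin (m + 1)} (t : Piece m α),
    0 < t.weight S → t.zl = 0 → t.al = 1 →
      ∃ j, 0 < ((Matrix.of fun α β : Fin (m + 1) => S.φ α 0 (Pi.single β 1)) ^ (j + 1)) α 0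
  | _, .node α h k ch, hT, hz, ha => by
      set L := Matrix.of fun α β : Fin (m + 1) => S.φ α 0 (Pi.single β 1) with hL
      have hLn : ∀ i a b, 0 ≤ (L ^ i) a b := by
        intro i
        induction i with
        | zero => intro a b; rw [pow_zero, Matrix.one_apply]; split_ifs <;> norm_num
        | succ i ih =>
          intro a b
          rw [pow_succ, Matrix.mul_apply]
          exact Finset.sum_nonneg fun c _ => mul_nonneg (ih a c) (S.nonneg _ _ _)
      rw [Piece.weight_pos_node] at hT
      simp only [Piece.zl, Piece.al] at hz ha
      have h0 : h = 0 := by omega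
      have h1 : ∑ β, ∑ i, (ch β i).zl = 0 := by omega
      have hz' : ∀ β i, (ch β i).zl = 0 := fun β i =>
        Finset.sum_eq_zero_iff.1 (Finset.sum_eq_zero_iff.1 h1 β (Finset.mem_univ _)) i
          (Finset.mem_univ _)
      have ha' : ∀ β i, 1 ≤ (ch β i).al := fun β i => by
        have := Piece.one_le_leaves _ (hT.2 β i)
        have := hz' β i
        omega
      have hle : ∑ β : Fin m, k β.succ ≤ ∑ β, ∑ i, (ch β i).al := by
        refine Finset.sum_le_sum fun β _ => ?_
        calc k β.succ = ∑ _i : Fin (k β.succ), 1 := by simp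
          _ ≤ _ := Finset.sum_le_sum fun i _ => ha' β i
      have hk1 : ∑ γ, k γ ≤ 1 := by rw [Fin.sum_univ_succ]; omega
      have hk0 : k ≠ 0 := by
        rintro rfl
        rw [h0] at hT
        exact hT.1 (S.no_empty_node α)
      obtain ⟨γ, hγ⟩ := Function.ne_iff.1 hk0
      simp only [Pi.zero_apply] at hγ
      have hks : k = Pi.single γ 1 := by
        rw [← Finset.add_sum_erase _ _ (Finset.mem_univ γ)] at hk1
        funext δ
        by_cases hδ : δ = γ
        · subst hδ; rw [Pi.single_eq_same]; omega
        · rw [Pi.single_eq_of_ne hδ]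
          have := Finset.single_le_sum (f := k) (fun _ _ => Nat.zero_le _)
            (Finset.mem_erase.2 ⟨hδ, Finset.mem_univ δ⟩)
          omega
      have hLpos : 0 < L α γ := by
        rw [hL, Matrix.of_apply, ← hks, ← h0]
        exact lt_of_le_of_ne (S.nonneg _ _ _) (Ne.symm hT.1)
      rcases Fin.eq_zero_or_eq_succ γ with rfl | ⟨β, rfl⟩
      · exact ⟨0, by simpa using hLpos⟩
      · have hc : (ch β ⟨0, Nat.pos_of_ne_zero hγ⟩).al ≤ 1 := by
          have h5 := Finset.single_le_sum (f := fun i => (ch β i).al) (fun _ _ => Nat.zero_le _)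
            (Finset.mem_univ (⟨0, Nat.pos_of_ne_zero hγ⟩ : Fin (k β.succ)))
          have h6 := Finset.single_le_sum (f := fun β => ∑ i, (ch β i).al) (fun _ _ => Nat.zero_le _)
            (Finset.mem_univ β)
          omega
        obtain ⟨j, hj⟩ := Piece.exists_pow_pos _ (hT.2 β ⟨0, Nat.pos_of_ne_zero hγ⟩) (hz' _ _)
          (le_antisymm hc (ha' _ _))
        refine ⟨j + 1, ?_⟩
        rw [pow_succ' L (j + 1), Matrix.mul_apply]
        exact Finset.sum_pos' (fun c _ => mul_nonneg (S.nonneg _ _ _) (hLn _ _ _))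
          ⟨β.succ, Finset.mem_univ _, mul_pos hLpos hj⟩

/-- No piece of positive weight consists of a chain with a single leaf, labelled `A`. -/
theorem Piece.not_unit {S : Spec m} (t : Piece m 0) (ht : 0 < t.weight S) :
    ¬ (t.zl = 0 ∧ t.al = 1) := by
  rintro ⟨hz, ha⟩
  obtain ⟨j, hj⟩ := t.exists_pow_pos ht hz ha
  obtain ⟨N, hN⟩ := S.nilpotent
  set L := Matrix.of fun α β : Fin (m + 1) => S.φ α 0 (Pi.single β 1) with hL
  have hLn : ∀ i a b, 0 ≤ (L ^ i) a b := by
    intro i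
    induction i with
    | zero => intro a b; rw [pow_zero, Matrix.one_apply]; split_ifs <;> norm_num
    | succ i ih =>
      intro a b
      rw [pow_succ, Matrix.mul_apply]
      exact Finset.sum_nonneg fun c _ => mul_nonneg (ih a c) (S.nonneg _ _ _)
  have key : ∀ n, 0 < ((L ^ (j + 1)) ^ n) 0 0 := by
    intro n
    induction n with
    | zero => simp
    | succ n ih =>
      rw [pow_succ, Matrix.mul_apply]
      refine Finset.sum_pos' (fun c _ => mul_nonneg ?_ (hLn _ _ _)) ⟨0, Finset.mem_univ _, mul_pos ih hj⟩
      rw [← pow_mul]; exact hLn _ _ _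
  have := key N
  rw [← pow_mul, mul_comm, pow_mul, hN, zero_pow (Nat.succ_ne_zero j)] at this
  simp at this

theorem Tree.weight_pos_node {S : Spec m} {α : Fin (m + 1)} {h : ℕ} {k : Fin (m + 1) → ℕ}
    {ch : ∀ β : Fin (m + 1), Fin (k β) → Tree m β} :
    0 < (Tree.node α h k ch).weight S ↔ S.φ α h k ≠ 0 ∧ ∀ β i, 0 < (ch β i).weight S := by
  rw [Tree.weight]
  constructor
  · intro hT
    refine ⟨fun h0 => by rw [h0, zero_mul] at hT; exact lt_irrefl _ hT, fun β i => ?_⟩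
    refine lt_of_le_of_ne (Tree.weight_nonneg S _) fun h0 => ?_
    rw [Finset.prod_eq_zero (Finset.mem_univ β) (Finset.prod_eq_zero (Finset.mem_univ i) h0.symm),
      mul_zero] at hT
    exact lt_irrefl _ hT
  · rintro ⟨h1, h2⟩
    exact mul_pos (lt_of_le_of_ne (S.nonneg _ _ _) (Ne.symm h1))
      (Finset.prod_pos fun β _ => Finset.prod_pos fun i _ => h2 β i)

theorem Tree.top_weight_pos {S : Spec m} : ∀ {α : Fin (m + 1)} (T : Tree m α),
    0 < T.weight S → 0 < T.top.weight S
  | _, .node α h k ch, hT => by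
      rw [Tree.weight_pos_node] at hT
      rw [Tree.top, Piece.weight_pos_node]
      exact ⟨hT.1, fun β i => Tree.top_weight_pos _ (hT.2 β.succ i)⟩

theorem exists_piece {S : Spec m} (haper : Aperiodic S) (α : Fin (m + 1)) :
    ∃ t : Piece m α, 0 < t.weight S := by
  obtain ⟨T, hT, -⟩ := exists_tree haper α
  exact ⟨T.top, T.top_weight_pos hT⟩

theorem Y_pos {S : Spec m} (haper : Aperiodic S) {α : Fin (m + 1)} {z u : ℝ} (hz : 0 < z) (hu : 0 < u)
    (h : Ye S α z u ≠ ⊤) : 0 < Y S α z u := by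
  obtain ⟨t, ht⟩ := exists_piece haper α
  refine (summable_of_Ye S hz.le hu.le h).tsum_pos (fun t => term_nonneg S hz.le hu.le t) t ?_
  positivity

/-- The weights of `Φ^α`, with the variable `x` marking the number of steps. -/
def PhiX (S : Spec m) (x z : ℝ) (y : Fin (m + 1) → ℝ) (α : Fin (m + 1)) : ℝ :=
  ∑ p ∈ supp S α, S.φ α p.1 p.2 * z ^ p.1 * (∏ β, y β ^ p.2 β) * x ^ (1 + (p.1 + ∑ β, p.2 β))

theorem PhiX_one (S : Spec m) (z : ℝ) (y : Fin (m + 1) → ℝ) (α : Fin (m + 1)) :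
    PhiX S 1 z y α = Phi S z y α := by simp [PhiX, Phi]

theorem tsum_nodeW (S : Spec m) {x z : ℝ} (hx : 0 ≤ x) (hz : 0 ≤ z) {y : Fin (m + 1) → ℝ}
    (hy : ∀ β, 0 ≤ y β) (α : Fin (m + 1)) :
    ∑' p, nodeW S x z (y 0) α p * ∏ γ : Fin m, ENNReal.ofReal (y γ.succ) ^ p.2 γ.succ =
      ENNReal.ofReal (PhiX S x z y α) := by
  have hn : ∀ p : ℕ × (Fin (m + 1) → ℕ), 0 ≤ S.φ α p.1 p.2 * z ^ p.1 * (∏ β, y β ^ p.2 β) *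
      x ^ (1 + (p.1 + ∑ β, p.2 β)) := fun p => mul_nonneg (monom_nonneg S hz hy α p) (pow_nonneg hx _)
  have h1 : ∀ p : ℕ × (Fin (m + 1) → ℕ),
      nodeW S x z (y 0) α p * ∏ γ : Fin m, ENNReal.ofReal (y γ.succ) ^ p.2 γ.succ =
      ENNReal.ofReal (S.φ α p.1 p.2 * z ^ p.1 * (∏ β, y β ^ p.2 β) *
        x ^ (1 + (p.1 + ∑ β, p.2 β))) := by
    intro p
    rw [nodeW]
    simp only [← ENNReal.ofReal_pow (hy _)]
    rw [← ENNReal.ofReal_prod_of_nonneg fun γ _ => pow_nonneg (hy _) _, ← ENNReal.ofReal_mul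
      (mul_nonneg (mul_nonneg (mul_nonneg (S.nonneg _ _ _) (pow_nonneg hz _)) (pow_nonneg (hy 0) _))
        (pow_nonneg hx _)), Fin.prod_univ_succ]
    congr 1; ring
  simp only [h1]
  rw [PhiX, ENNReal.ofReal_sum_of_nonneg fun p _ => hn p, tsum_eq_sum]
  intro p hp
  rw [mem_supp, not_not] at hp
  rw [hp]; simp

/-- A supersolution of the equations of the colours other than `0` bounds the generating functions of
the pieces. -/
theorem tsum_gw_le_of_PhiX_le (S : Spec m) {x z : ℝ} (hx : 0 ≤ x) (hz : 0 ≤ z) {y : Fin (m + 1) → ℝ}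
    (hy : ∀ β, 0 ≤ y β) (hle : ∀ α, α ≠ 0 → PhiX S x z y α ≤ y α) (β : Fin m) :
    ∑' t : Piece m β.succ, t.gw (nodeW S x z (y 0)) ≤ ENNReal.ofReal (y β.succ) := by
  refine Piece.tsum_gw_le _ (fun β => ENNReal.ofReal (y β.succ)) (fun β => ?_) β
  rw [tsum_nodeW S hx hz hy]
  exact ENNReal.ofReal_le_ofReal (hle _ (Fin.succ_ne_zero β))

theorem tsum_gw_zero_le_of_PhiX_le (S : Spec m) {x z : ℝ} (hx : 0 ≤ x) (hz : 0 ≤ z)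
    {y : Fin (m + 1) → ℝ} (hy : ∀ β, 0 ≤ y β) (hle : ∀ α, α ≠ 0 → PhiX S x z y α ≤ y α)
    (α : Fin (m + 1)) :
    ∑' t : Piece m α, t.gw (nodeW S x z (y 0)) ≤ ENNReal.ofReal (PhiX S x z y α) := by
  rw [Piece.tsum_gw, ← tsum_nodeW S hx hz hy]
  gcongr
  exact tsum_gw_le_of_PhiX_le S hx hz hy hle _

/-- The vector of the generating functions. -/
def Yvec (S : Spec m) (z u : ℝ) : Fin (m + 1) → ℝ := Fin.cons u fun β => Y S β.succ z u

theorem Ye_eq_Phi (S : Spec m) {z u : ℝ} (hz : 0 ≤ z) (hu : 0 ≤ u)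
    (h : ∀ β : Fin m, Ye S β.succ z u ≠ ⊤) (α : Fin (m + 1)) :
    Ye S α z u = ENNReal.ofReal (Phi S z (Yvec S z u) α) := by
  have hy : ∀ β, 0 ≤ Yvec S z u β := Fin.cases hu fun β => Y_nonneg S _ hz hu
  rw [← PhiX_one, ← tsum_nodeW S zero_le_one hz hy, Ye_eq_gw S α hz hu, Piece.tsum_gw]
  refine tsum_congr fun p => ?_
  congr 1
  refine Finset.prod_congr rfl fun β _ => ?_
  rw [← Ye_eq_gw S _ hz hu, Ye_eq_ofReal S hz hu (h β)]
  rfl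

theorem nat_mul_pow_le {r s : ℝ} (hr : 0 ≤ r) (hrs : r ≤ s) (n : ℕ) :
    n * r ^ (n - 1) * (s - r) + r ^ n ≤ s ^ n := by
  induction n with
  | zero => simp
  | succ n ih =>
    have hs : 0 ≤ s := hr.trans hrs
    have h2 : n * r ^ (n - 1) * r = n * r ^ n := by
      cases n with
      | zero => simp
      | succ n => rw [Nat.add_sub_cancel]; ring
    have h3 : 0 ≤ n * r ^ (n - 1) * (s - r) := mul_nonneg (by positivity) (by linarith)
    calc _ = (n * r ^ (n - 1) * r) * (s - r) + r ^ n * s := by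
          rw [h2, Nat.add_sub_cancel]; push_cast; ring
      _ = (n * r ^ (n - 1) * (s - r)) * r + r ^ n * s := by ring
      _ ≤ (n * r ^ (n - 1) * (s - r)) * s + r ^ n * s := by gcongr
      _ = (n * r ^ (n - 1) * (s - r) + r ^ n) * s := by ring
      _ ≤ s ^ n * s := by gcongr
      _ = _ := by ring

theorem hasDerivAt_tsum_pow {ι : Type*} {a : ι → ℝ} (ha : ∀ i, 0 ≤ a i) (n : ι → ℕ) {θ s : ℝ}
    (hθ : 0 < θ) (hs : θ < s) (hsum : Summable fun i => a i * s ^ n i) :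
    Summable (fun i => a i * (n i * θ ^ (n i - 1))) ∧
    HasDerivAt (fun u => ∑' i, a i * u ^ n i) (∑' i, a i * (n i * θ ^ (n i - 1))) θ := by
  obtain ⟨r, hr1, hr2⟩ := exists_between hs
  have hr0 : 0 < r := hθ.trans hr1
  have hb : ∀ i, ∀ u ∈ Set.Ioo 0 r, ‖a i * (n i * u ^ (n i - 1))‖ ≤ (s - r)⁻¹ * (a i * s ^ n i) := by
    intro i u hu
    have h1 := nat_mul_pow_le hr0.le hr2.le (n i)
    have h2 : (n i : ℝ) * r ^ (n i - 1) ≤ (s - r)⁻¹ * s ^ n i := by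
      rw [inv_mul_eq_div, le_div_iff₀ (sub_pos.2 hr2)]
      linarith [pow_pos hr0 (n i)]
    have h3 : (n i : ℝ) * u ^ (n i - 1) ≤ n i * r ^ (n i - 1) := by
      have := hu.1.le; have := hu.2.le; gcongr
    have h0 := hu.1.le
    have h4 := ha i
    rw [Real.norm_of_nonneg (by positivity)]
    calc _ ≤ a i * ((s - r)⁻¹ * s ^ n i) := mul_le_mul_of_nonneg_left (h3.trans h2) (ha i)
      _ = _ := by ring
  have hsum' : Summable fun i => (s - r)⁻¹ * (a i * s ^ n i) := hsum.mul_left _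
  refine ⟨Summable.of_norm_bounded hsum' fun i => hb i θ ⟨hθ, hr1⟩, ?_⟩
  refine hasDerivAt_tsum_of_isPreconnected (y₀ := θ) hsum' isOpen_Ioo isPreconnected_Ioo
    (fun i u _ => (hasDerivAt_pow (n i) u).const_mul (a i)) hb ⟨hθ, hr1⟩ ?_ ⟨hθ, hr1⟩
  refine Summable.of_nonneg_of_le (fun i => mul_nonneg (ha i) (pow_nonneg hθ.le _)) (fun i => ?_) hsum
  have := ha i
  gcongr

theorem pow_tangent {u θ : ℝ} (hu : 0 < u) (hθ : 0 < θ) (n : ℕ) :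
    θ ^ n + n * θ ^ (n - 1) * (u - θ) ≤ u ^ n ∧
    (2 ≤ n → u ≠ θ → θ ^ n + n * θ ^ (n - 1) * (u - θ) < u ^ n) := by
  have step : ∀ n : ℕ, θ ^ n + n * θ ^ (n - 1) * (u - θ) ≤ u ^ n →
      θ ^ (n + 1) + (n + 1 : ℕ) * θ ^ n * (u - θ) + n * θ ^ (n - 1) * (u - θ) ^ 2 ≤ u ^ (n + 1) := by
    intro n h
    have h2 : n * θ ^ (n - 1) * θ = n * θ ^ n := by
      cases n with
      | zero => simp
      | succ n => rw [Nat.add_sub_cancel]; ring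
    calc _ = (θ ^ n + n * θ ^ (n - 1) * (u - θ)) * u := by
          push_cast
          linear_combination (-(u - θ)) * h2
      _ ≤ u ^ n * u := by gcongr
      _ = _ := by ring
  have h1 : ∀ n : ℕ, θ ^ n + n * θ ^ (n - 1) * (u - θ) ≤ u ^ n := by
    intro n
    induction n with
    | zero => simp
    | succ n ih =>
      have := step n ih
      have h3 : 0 ≤ n * θ ^ (n - 1) * (u - θ) ^ 2 := by positivity
      simp only [Nat.add_sub_cancel]
      linarith
  refine ⟨h1 n, fun hn hne => ?_⟩
  obtain ⟨j, rfl⟩ : ∃ j, n = j + 1 := ⟨n - 1, by omega⟩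
  have := step j (h1 j)
  have h4 : (0 : ℝ) < j := by exact_mod_cast (by omega : 0 < j)
  have h5 : 0 < (u - θ) ^ 2 := by have := sub_ne_zero.2 hne; positivity
  have h3 : 0 < j * θ ^ (j - 1) * (u - θ) ^ 2 := by positivity
  simp only [Nat.add_sub_cancel]
  linarith

/-- At a critical point, the mean of `ℓ` over the pieces is one. -/
theorem IsCritical.sum_al {S : Spec m} {ζ θ : ℝ} (hc : IsCritical S ζ θ) :
    Summable (fun t : Piece m 0 => t.weight S * ζ ^ t.zl * (t.al * θ ^ (t.al - 1))) ∧
    ∑' t : Piece m 0, t.weight S * ζ ^ t.zl * (t.al * θ ^ (t.al - 1)) = 1 := by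
  obtain ⟨hζ, hθ, h1, hd⟩ := hc
  have hev : ∀ᶠ u in 𝓝[>] θ, 0 < Y S 0 ζ u / u := by
    have := hd.continuousAt.eventually_const_lt (show (0 : ℝ) < Y S 0 ζ θ / θ by rw [h1]; norm_num)
    exact this.filter_mono nhdsWithin_le_nhds
  obtain ⟨s, hs, hs'⟩ := (hev.and self_mem_nhdsWithin).exists
  have hs' : θ < s := hs'
  have hs0 : 0 < s := hθ.trans hs'
  have hY : 0 < Y S 0 ζ s := by
    have := mul_pos hs hs0
    rwa [div_mul_cancel₀ _ hs0.ne'] at this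
  have hsum := summable_of_Ye S hζ.le hs0.le (Ye_ne_top_of_pos S hζ.le hs0.le hY)
  obtain ⟨h2, h3⟩ := hasDerivAt_tsum_pow (a := fun t : Piece m 0 => t.weight S * ζ ^ t.zl)
    (fun t => mul_nonneg (Piece.weight_nonneg S t) (pow_nonneg hζ.le _)) Piece.al hθ hs' hsum
  refine ⟨h2, ?_⟩
  have h4 := h3.div (hasDerivAt_id θ) hθ.ne'
  have h5 : HasDerivAt (fun u => Y S 0 ζ u / u) _ θ := h4
  have h6 := hd.unique h5
  simp only [id, mul_one] at h6
  have h7 : (∑' t : Piece m 0, t.weight S * ζ ^ t.zl * θ ^ t.al) = θ := by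
    rw [div_eq_one_iff_eq hθ.ne'] at h1; exact h1
  rw [h7, eq_comm, div_eq_zero_iff] at h6
  have h8 := h6.resolve_right (by positivity)
  have : (∑' t : Piece m 0, t.weight S * ζ ^ t.zl * (t.al * θ ^ (t.al - 1))) * θ = 1 * θ := by
    linarith
  exact mul_right_cancel₀ hθ.ne' this

theorem IsCritical.Y_eq {S : Spec m} {ζ θ : ℝ} (hc : IsCritical S ζ θ) : Y S 0 ζ θ = θ :=
  (div_eq_one_iff_eq hc.2.1.ne').1 hc.2.2.1

theorem IsCritical.summable {S : Spec m} {ζ θ : ℝ} (hc : IsCritical S ζ θ) :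
    Summable fun t : Piece m 0 => t.weight S * ζ ^ t.zl * θ ^ t.al :=
  summable_of_Ye S hc.1.le hc.2.1.le
    (Ye_ne_top_of_pos S hc.1.le hc.2.1.le (by rw [hc.Y_eq]; exact hc.2.1))

/-- By strict convexity, the graph of `u ↦ A(ζ, u)` lies above the diagonal, which is its tangent at the
critical point. -/
theorem IsCritical.lt_Y {S : Spec m} (hfin : ∃ t : Piece m 0, 0 < t.weight S ∧ t.al = 0) {ζ θ : ℝ}
    (hc : IsCritical S ζ θ) {u : ℝ} (hu : 0 < u) (h : Ye S 0 ζ u ≠ ⊤) (hne : u ≠ θ) :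
    u < Y S 0 ζ u := by
  obtain ⟨hD, hD1⟩ := hc.sum_al
  have hs := hc.summable
  have hζ := hc.1
  have hθ := hc.2.1
  have hw := fun t : Piece m 0 => Piece.weight_nonneg S t
  have e2 : ∑' t : Piece m 0, t.weight S * ζ ^ t.zl * θ ^ t.al = θ := hc.Y_eq
  have hT := (hs.hasSum.add (hD.hasSum.mul_right (u - θ)))
  rw [e2, hD1] at hT
  have hlt : ∃ t : Piece m 0, 0 < t.weight S ∧ 2 ≤ t.al := by
    by_contra hcon
    push Not at hcon
    obtain ⟨t₀, ht₀, hal₀⟩ := hfin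
    have hd := hs.hasSum.sub (hD.hasSum.mul_right θ)
    rw [e2, hD1, one_mul, sub_self] at hd
    have hnn : ∀ t : Piece m 0, 0 ≤ t.weight S * ζ ^ t.zl * θ ^ t.al -
        t.weight S * ζ ^ t.zl * (t.al * θ ^ (t.al - 1)) * θ := by
      intro t
      rcases (hw t).eq_or_lt with h0 | h0
      · rw [← h0]; simp
      · have := hcon t h0
        interval_cases h : t.al
        · simp; positivity
        · simp
    have := (hasSum_zero_iff_of_nonneg hnn).1 hd
    have := congrFun this t₀
    rw [hal₀] at this
    simp at this
    rcases this with h | h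
    · exact ht₀.ne' h
    · exact hζ.ne' h.1
  obtain ⟨t, ht, hal⟩ := hlt
  have hle : ∀ t : Piece m 0, t.weight S * ζ ^ t.zl * θ ^ t.al +
      t.weight S * ζ ^ t.zl * (t.al * θ ^ (t.al - 1)) * (u - θ) ≤ t.weight S * ζ ^ t.zl * u ^ t.al := by
    intro t
    have := mul_le_mul_of_nonneg_left (pow_tangent hu hθ t.al).1
      (mul_nonneg (hw t) (pow_nonneg hζ.le t.zl))
    linarith
  have := hasSum_lt hle (i := t) (by
    have := mul_lt_mul_of_pos_left ((pow_tangent hu hθ t.al).2 hal hne)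
      (mul_pos ht (pow_pos hζ t.zl))
    show _ < _
    linarith) hT (summable_of_Ye S hζ.le hu.le h).hasSum
  have h9 : θ + 1 * (u - θ) = u := by ring
  rw [h9] at this
  exact this

/-- Of two critical points, the one with the smaller `ζ` has its curve `u ↦ A(ζ, u)` above the diagonal
except at `θ`, and the other curve lies higher still, so they touch the diagonal at the same place. -/
theorem IsCritical.unique {S : Spec m} (hfin : ∃ t : Piece m 0, 0 < t.weight S ∧ t.al = 0)
    {ζ θ ζ' θ' : ℝ} (hc : IsCritical S ζ θ) (hc' : IsCritical S ζ' θ') : ζ' = ζ ∧ θ' = θ := by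
  have key : ∀ {ζ θ ζ' θ' : ℝ}, IsCritical S ζ θ → IsCritical S ζ' θ' → ζ ≤ ζ' → θ' = θ := by
    intro ζ θ ζ' θ' hc hc' hle
    by_contra hne
    have h1 : Ye S 0 ζ' θ' ≠ ⊤ := Ye_ne_top_of_pos S hc'.1.le hc'.2.1.le
      (by rw [hc'.Y_eq]; exact hc'.2.1)
    have h2 := Ye_mono S 0 hc.1.le hc'.2.1.le hle (le_refl θ')
    have h3 := ne_top_of_le_ne_top h1 h2
    have h4 := hc.lt_Y hfin hc'.2.1 h3 hne
    have h5 : Y S 0 ζ θ' ≤ Y S 0 ζ' θ' := by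
      rw [Y_eq_toReal S 0 hc.1.le hc'.2.1.le, Y_eq_toReal S 0 hc'.1.le hc'.2.1.le]
      exact ENNReal.toReal_mono h1 h2
    rw [hc'.Y_eq] at h5
    linarith
  have hθ : θ' = θ := by
    rcases le_total ζ ζ' with h | h
    · exact key hc hc' h
    · exact (key hc' hc h).symm
  subst hθ
  refine ⟨?_, rfl⟩
  have hmono : ∀ {ζ ζ' : ℝ}, IsCritical S ζ θ' → IsCritical S ζ' θ' → ¬ ζ < ζ' := by
    intro ζ ζ' hc hc' hlt
    obtain ⟨hD, hD1⟩ := hc.sum_al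
    obtain ⟨hD', hD1'⟩ := hc'.sum_al
    have hs := hc.summable.hasSum
    have hs' := hc'.summable.hasSum
    have e1 : ∑' t : Piece m 0, t.weight S * ζ ^ t.zl * θ' ^ t.al = θ' := hc.Y_eq
    have e2 : ∑' t : Piece m 0, t.weight S * ζ' ^ t.zl * θ' ^ t.al = θ' := hc'.Y_eq
    rw [e1] at hs
    rw [e2] at hs'
    have hζ := hc.1
    have hθ := hc.2.1
    have hle : ∀ t : Piece m 0, t.weight S * ζ ^ t.zl * θ' ^ t.al ≤
        t.weight S * ζ' ^ t.zl * θ' ^ t.al := by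
      intro t
      have := Piece.weight_nonneg S t
      gcongr
    have heq := hs'.sub hs
    rw [sub_self] at heq
    have h0 := (hasSum_zero_iff_of_nonneg fun t => sub_nonneg.2 (hle t)).1 heq
    -- all the pieces of positive weight would have no leaf `z`, in particular those without leaf `A`
    obtain ⟨t₀, ht₀, hal₀⟩ := hfin
    have h1 := congrFun h0 t₀
    simp only [hal₀, pow_zero, mul_one, Pi.zero_apply] at h1
    have h2 : ζ ^ t₀.zl = ζ' ^ t₀.zl := by
      have : t₀.weight S * ζ' ^ t₀.zl = t₀.weight S * ζ ^ t₀.zl := by linarith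
      exact (mul_left_cancel₀ ht₀.ne' this).symm
    have h3 : t₀.zl ≠ 0 := by
      have := t₀.one_le_leaves ht₀
      omega
    exact absurd h2 (pow_lt_pow_left₀ hlt hζ.le h3).ne
  rcases lt_trichotomy ζ ζ' with h | h | h
  · exact absurd h (hmono hc hc')
  · exact h.symm
  · exact absurd h (hmono hc' hc)

theorem Ye_le_tsum_gw (S : Spec m) {x z u z' u' : ℝ} (hx : 1 ≤ x) (hz : 0 ≤ z) (hu : 0 ≤ u)
    (hz' : z ≤ z') (hu' : u ≤ u') (α : Fin (m + 1)) :
    Ye S α z u ≤ ∑' t : Piece m α, t.gw (nodeW S x z' u') := by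
  refine (Ye_mono S α hz hu hz' hu').trans ?_
  refine ENNReal.tsum_le_tsum fun t => ?_
  rw [Piece.gw_nodeW S (zero_le_one.trans hx) (hz.trans hz') (hu.trans hu')]
  refine ENNReal.ofReal_le_ofReal ?_
  exact le_mul_of_one_le_right (term_nonneg S (hz.trans hz') (hu.trans hu') t) (one_le_pow₀ hx)

/-- There is a critical point, and the generating functions, with a variable marking the number of steps
of the rewriting process, are finite beyond it. -/
theorem exists_critical {S : Spec m} (hnl : Nonlinear S) (hirr : Irreducible S) (haper : Aperiodic S) :
    ∃ ζ θ z₁ u₁ x₁ : ℝ, IsCritical S ζ θ ∧ ζ < z₁ ∧ θ < u₁ ∧ 1 < x₁ ∧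
      ∀ α, ∑' t : Piece m α, t.gw (nodeW S x₁ z₁ u₁) ≠ ⊤ := by
  obtain ⟨ζ, y, hζ, hf⟩ := exists_isMaxZ hnl hirr haper
  obtain ⟨y₁, hy₁, hs⟩ := exists_strict_above hnl hirr haper hζ hf
  have hev : ∀ᶠ s in 𝓝[>] (0 : ℝ), ∀ α, α ≠ 0 → PhiX S (1 + s) (ζ + s) y₁ α < y₁ α := by
    refine eventually_all.2 fun α => ?_
    by_cases hα : α = 0
    · exact Eventually.of_forall fun _ h => absurd hα h
    · have hc : Continuous fun s : ℝ => PhiX S (1 + s) (ζ + s) y₁ α := by unfold PhiX; fun_prop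
      have h0 : PhiX S (1 + 0) (ζ + 0) y₁ α < y₁ α := by
        rw [add_zero, add_zero, PhiX_one]; exact hs α hα
      filter_upwards [(hc.continuousAt.eventually_lt continuousAt_const h0).filter_mono
        nhdsWithin_le_nhds] with s hs _ using hs
  obtain ⟨s, hs', hs0⟩ := (hev.and self_mem_nhdsWithin).exists
  have hs0 : 0 < s := hs0
  have hζ0 := hζ.1
  have hfin : ∀ α, ∑' t : Piece m α, t.gw (nodeW S (1 + s) (ζ + s) (y₁ 0)) ≠ ⊤ := fun α =>
    ne_top_of_le_ne_top ENNReal.ofReal_ne_top (tsum_gw_zero_le_of_PhiX_le S (by positivity)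
      (by positivity) (fun β => ((hf.1 β).trans (hy₁ β)).le) (fun α hα => (hs' α hα).le) α)
  have hYfin : ∀ α u, 0 ≤ u → u ≤ y₁ 0 → Ye S α ζ u ≠ ⊤ := fun α u hu hu' =>
    ne_top_of_le_ne_top (hfin α) (Ye_le_tsum_gw S (by linarith) hζ0.le hu (by linarith) hu' α)
  have hθ := hf.1 0
  -- a point `u` with `A(ζ, u) ≤ u` gives a supersolution
  have hfeas : ∀ u, 0 < u → u ≤ y₁ 0 → Y S 0 ζ u ≤ u → Yvec S ζ u = y := by
    intro u hu hu' hle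
    refine hζ.unique hirr haper hf ⟨Fin.cases hu fun β => ?_, Fin.cases ?_ fun β => ?_⟩
    · exact Y_pos haper hζ0 hu (hYfin _ u hu.le hu')
    all_goals
      refine (ENNReal.ofReal_le_ofReal_iff ?_).1 ?_
      rotate_left
      rw [← Ye_eq_Phi S hζ0.le hu.le fun β => hYfin _ u hu.le hu',
        Ye_eq_ofReal S hζ0.le hu.le (hYfin _ u hu.le hu')]
    · exact ENNReal.ofReal_le_ofReal hle
    · exact hu.le
    · exact le_rfl
    · exact Y_nonneg S _ hζ0.le hu.le
  have hYθ : Y S 0 ζ (y 0) ≤ y 0 := by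
    refine (ENNReal.ofReal_le_ofReal_iff hθ.le).1 ?_
    rw [← Ye_eq_ofReal S hζ0.le hθ.le (hYfin 0 _ hθ.le (hy₁ 0).le), Ye_eq_gw S 0 hζ0.le hθ.le]
    refine (tsum_gw_zero_le_of_PhiX_le S zero_le_one hζ0.le (fun β => (hf.1 β).le)
      (fun α _ => by rw [PhiX_one]; exact hf.2 α) 0).trans (ENNReal.ofReal_le_ofReal ?_)
    rw [PhiX_one]; exact hf.2 0
  -- the solution `y` itself gives the point `u = y 0`, where `A(ζ, u) = u`
  have hYθ' : Y S 0 ζ (y 0) = y 0 := by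
    have h1 := hfeas (y 0) hθ (hy₁ 0).le hYθ
    have h2 := Ye_eq_Phi S hζ0.le hθ.le (fun β => hYfin _ _ hθ.le (hy₁ 0).le) 0
    rw [h1, hζ.eq hirr hf, Ye_eq_ofReal S hζ0.le hθ.le (hYfin 0 _ hθ.le (hy₁ 0).le)] at h2
    exact (ENNReal.ofReal_eq_ofReal_iff (Y_nonneg S _ hζ0.le hθ.le) hθ.le).1 h2
  refine ⟨ζ, y 0, ζ + s, y₁ 0, 1 + s, ⟨hζ0, hθ, by rw [hYθ']; exact div_self hθ.ne', ?_⟩,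
    by linarith, hy₁ 0, by linarith, hfin⟩
  have hsum := summable_of_Ye S hζ0.le (hθ.trans (hy₁ 0)).le
    (hYfin 0 _ (hθ.trans (hy₁ 0)).le le_rfl)
  obtain ⟨-, h3⟩ := hasDerivAt_tsum_pow (a := fun t : Piece m 0 => t.weight S * ζ ^ t.zl)
    (fun t => mul_nonneg (Piece.weight_nonneg S t) (pow_nonneg hζ0.le _)) Piece.al hθ (hy₁ 0) hsum
  have h4 := h3.div (hasDerivAt_id (y 0)) hθ.ne'
  have h5 : HasDerivAt (fun u => Y S 0 ζ u / u) _ (y 0) := h4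
  -- by uniqueness of the supersolution `A(ζ, u) / u ≥ 1` nearby, so the derivative vanishes at `u = y 0`
  have hmin : IsLocalMin (fun u => Y S 0 ζ u / u) (y 0) := by
    filter_upwards [Ioo_mem_nhds hθ (hy₁ 0)] with u hu
    rw [hYθ', div_self hθ.ne', le_div_iff₀ hu.1, one_mul]
    by_contra hlt
    rw [not_le] at hlt
    have h6 := congrFun (hfeas u hu.1 hu.2.le hlt.le) 0
    have h7 : u = y 0 := h6
    rw [h7, hYθ'] at hlt
    exact lt_irrefl _ hlt
  rw [hmin.hasDerivAt_eq_zero h5] at h5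
  exact h5

end CF

/-! ### Cutting trees into pieces -/

namespace CF

variable {m : ℕ}

theorem endpoint_nil : endpoint ([] : List (Piece m 0)) = 0 := rfl

theorem endpoint_cons (t : Piece m 0) (l : List (Piece m 0)) :
    endpoint (t :: l) = t.vec + endpoint l := by simp [endpoint]

theorem endpoint_append (l l' : List (Piece m 0)) :
    endpoint (l ++ l') = endpoint l + endpoint l' := by simp [endpoint]

theorem endpoint_fst (l : List (Piece m 0)) : (endpoint l).1 = ((l.map Piece.zl).sum : ℕ) := by
  induction l with
  | nil => rfl
  | cons t l ih => rw [endpoint_cons, Prod.fst_add, ih]; simp [Piece.vec]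

/-- The lists of pieces that encode forests of `q` trees with root colour `A`. -/
def Forest : ℕ → List (Piece m 0) → Prop
  | 0, [] => True
  | 0, _ :: _ => False
  | _ + 1, [] => False
  | q + 1, t :: l => Forest (q + t.al) l

theorem forest_iff (q : ℕ) (l : List (Piece m 0)) :
    Forest q l ↔ (endpoint l).2 = -q ∧ ∀ j < l.length, -(q : ℤ) < (endpoint (l.take j)).2 := by
  induction l generalizing q with
  | nil => cases q <;> simp [Forest, endpoint_nil]; omega
  | cons t l ih =>
    cases q with
    | zero =>
      simp only [Forest, false_iff, not_and, not_forall]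
      intro _
      exact ⟨0, by simp, by simp [endpoint_nil]⟩
    | succ q =>
      rw [Forest, ih, endpoint_cons]
      simp only [Prod.snd_add, Piece.vec]
      constructor
      · rintro ⟨h1, h2⟩
        refine ⟨by push_cast at h1 ⊢; omega, fun j hj => ?_⟩
        cases j with
        | zero => simp only [List.take_zero, endpoint_nil]; push_cast; simp; omega
        | succ j =>
          have := h2 j (by simpa using hj)
          rw [List.take_succ_cons, endpoint_cons]
          simp only [Prod.snd_add, Piece.vec]
          push_cast at this ⊢; omega
      · rintro ⟨h1, h2⟩
        refine ⟨by push_cast at h1 ⊢; omega, fun j hj => ?_⟩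
        have := h2 (j + 1) (by simpa using hj)
        rw [List.take_succ_cons, endpoint_cons] at this
        simp only [Prod.snd_add, Piece.vec] at this
        push_cast at this ⊢; omega

theorem isExcursion_iff (n : ℕ) (l : List (Piece m 0)) :
    IsExcursion n l ↔ (l.map Piece.zl).sum = n ∧ Forest 1 l := by
  rw [forest_iff, IsExcursion, IsBridge, Prod.ext_iff, endpoint_fst]
  simp only [Nat.cast_inj, Nat.cast_one]
  tauto

theorem Forest.append {p q : ℕ} {a b : List (Piece m 0)} (ha : Forest p a) (hb : Forest q b) :
    Forest (p + q) (a ++ b) := by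
  induction a generalizing p with
  | nil =>
    cases p with
    | zero => simpa using hb
    | succ p => exact absurd ha (by simp [Forest])
  | cons t a ih =>
    cases p with
    | zero => exact absurd ha (by simp [Forest])
    | succ p =>
      have := ih ha
      rw [show p + 1 + q = (p + q) + 1 by omega, List.cons_append, Forest]
      rwa [show p + q + t.al = p + t.al + q by omega]

theorem Forest.split {p q : ℕ} {l : List (Piece m 0)} (h : Forest (p + q) l) :
    ∃ a b, l = a ++ b ∧ Forest p a ∧ Forest q b := by
  induction l generalizing p with
  | nil =>
    cases p with
    | zero => exact ⟨[], [], rfl, by simp [Forest], by simpa using h⟩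
    | succ p =>
      rw [show p + 1 + q = (p + q) + 1 by omega] at h
      exact absurd h (by simp [Forest])
  | cons t l ih =>
    cases p with
    | zero => exact ⟨[], t :: l, rfl, by simp [Forest], by simpa using h⟩
    | succ p =>
      rw [show p + 1 + q = (p + q) + 1 by omega, Forest,
        show p + q + t.al = p + t.al + q by omega] at h
      obtain ⟨a, b, rfl, ha, hb⟩ := ih h
      exact ⟨t :: a, b, rfl, ha, hb⟩

theorem Forest.append_inj {p : ℕ} {a a' b b' : List (Piece m 0)} (ha : Forest p a)
    (ha' : Forest p a') (h : a ++ b = a' ++ b') : a = a' ∧ b = b' := by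
  induction a generalizing p a' with
  | nil =>
    cases p with
    | zero =>
      cases a' with
      | nil => exact ⟨rfl, h⟩
      | cons _ _ => exact absurd ha' (by simp [Forest])
    | succ p => exact absurd ha (by simp [Forest])
  | cons t a ih =>
    cases p with
    | zero => exact absurd ha (by simp [Forest])
    | succ p =>
      cases a' with
      | nil => exact absurd ha' (by simp [Forest])
      | cons t' a' =>
        simp only [List.cons_append, List.cons.injEq] at h
        obtain ⟨rfl, h⟩ := h
        obtain ⟨rfl, h'⟩ := ih ha ha' h
        exact ⟨rfl, h'⟩

theorem Forest.flatten : ∀ {n : ℕ} {q : Fin n → ℕ} {f : Fin n → List (Piece m 0)}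
    (_ : ∀ i, Forest (q i) (f i)), Forest (∑ i, q i) (List.ofFn f).flatten
  | 0, q, f, h => by simp [Forest]
  | n + 1, q, f, h => by
      rw [Fin.sum_univ_succ, List.ofFn_succ, List.flatten_cons]
      exact (h 0).append (Forest.flatten fun i => h i.succ)

theorem Forest.exists_flatten : ∀ {n : ℕ} {q : Fin n → ℕ} {l : List (Piece m 0)}
    (_ : Forest (∑ i, q i) l), ∃ f : Fin n → List (Piece m 0),
      l = (List.ofFn f).flatten ∧ ∀ i, Forest (q i) (f i)
  | 0, q, l, h => by
      refine ⟨fun i => i.elim0, ?_, fun i => i.elim0⟩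
      cases l with
      | nil => simp
      | cons _ _ => exact absurd h (by simp [Forest])
  | n + 1, q, l, h => by
      rw [Fin.sum_univ_succ] at h
      obtain ⟨a, b, rfl, ha, hb⟩ := h.split
      obtain ⟨f, rfl, hf⟩ := Forest.exists_flatten hb
      exact ⟨Fin.cons a f, by simp [List.ofFn_succ], Fin.cases ha hf⟩

theorem Forest.flatten_inj : ∀ {n : ℕ} {q : Fin n → ℕ} {f f' : Fin n → List (Piece m 0)}
    (_ : ∀ i, Forest (q i) (f i)) (_ : ∀ i, Forest (q i) (f' i))
    (_ : (List.ofFn f).flatten = (List.ofFn f').flatten), f = f'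
  | 0, _, _, _, _, _, _ => funext fun i => i.elim0
  | n + 1, q, f, f', h, h', he => by
      rw [List.ofFn_succ, List.flatten_cons, List.ofFn_succ, List.flatten_cons] at he
      obtain ⟨h1, h2⟩ := (h 0).append_inj (h' 0) he
      have h3 := Forest.flatten_inj (fun i => h i.succ) (fun i => h' i.succ) h2
      funext i
      exact Fin.cases h1 (fun j => congrFun h3 j) i

theorem Tree.forest_rest : ∀ {α : Fin (m + 1)} (T : Tree m α), Forest T.top.al T.rest
  | _, .node α h k ch => by
      rw [Tree.top, Piece.al, Tree.rest]
      refine Forest.append ?_ (Forest.flatten fun β => Forest.flatten fun i =>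
        Tree.forest_rest (ch β.succ i))
      have := Forest.flatten (q := fun _ : Fin (k 0) => 1)
        (f := fun i => (ch 0 i).top :: (ch 0 i).rest) fun i => by
          rw [Forest, zero_add]; exact Tree.forest_rest (ch 0 i)
      simpa using this

theorem Tree.forest_cut (T : Tree m 0) : Forest 1 T.cut := by
  rw [Tree.cut, Forest, zero_add]; exact T.forest_rest

theorem Tree.eq_of_top_rest : ∀ {α : Fin (m + 1)} (T T' : Tree m α), T.top = T'.top →
    T.rest = T'.rest → T = T'
  | _, .node α h k ch, .node _ h' k' ch', ht, hr => by
      simp only [Tree.top, Piece.node.injEq] at ht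
      obtain ⟨rfl, rfl, ht⟩ := ht
      rw [heq_eq_eq] at ht
      have ht' : ∀ (β : Fin m) i, (ch β.succ i).top = (ch' β.succ i).top := fun β i =>
        congrFun (congrFun ht β) i
      rw [Tree.rest, Tree.rest] at hr
      have f1 : ∀ (ch : ∀ β : Fin (m + 1), Fin (k β) → Tree m β) (i : Fin (k 0)),
          Forest 1 ((ch 0 i).top :: (ch 0 i).rest) := fun ch i => (ch 0 i).forest_cut
      obtain ⟨h1, h2⟩ := (Forest.flatten (f1 ch)).append_inj (Forest.flatten (f1 ch')) hr
      have h3 := Forest.flatten_inj (f1 ch) (f1 ch') h1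
      have f2 : ∀ β : Fin m, Forest (∑ i, (ch β.succ i).top.al)
          (List.ofFn fun i : Fin (k β.succ) => (ch' β.succ i).rest).flatten := fun β => by
        have := Forest.flatten fun i => (ch' β.succ i).forest_rest
        simpa only [ht' β] using this
      have h4 := Forest.flatten_inj (fun β => Forest.flatten fun i => (ch β.succ i).forest_rest) f2 h2
      have h5 : ∀ β : Fin m, (fun i => (ch β.succ i).rest) = fun i => (ch' β.succ i).rest := fun β =>
        Forest.flatten_inj (fun i => (ch β.succ i).forest_rest)
          (fun i => by rw [ht' β i]; exact (ch' β.succ i).forest_rest) (congrFun h4 β)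
      have hch : ch = ch' := by
        funext γ i
        rcases Fin.eq_zero_or_eq_succ γ with rfl | ⟨β, rfl⟩
        · have := congrFun h3 i
          simp only [List.cons.injEq] at this
          exact Tree.eq_of_top_rest _ _ this.1 this.2
        · exact Tree.eq_of_top_rest _ _ (ht' β i) (congrFun (h5 β) i)
      rw [hch]

theorem Forest.length_le_of_flatten {n : ℕ} (f : Fin n → List (Piece m 0)) (i : Fin n) :
    (f i).length ≤ (List.ofFn f).flatten.length := by
  rw [List.length_flatten, List.map_ofFn, List.sum_ofFn]
  exact Finset.single_le_sum (f := fun i => (f i).length) (fun _ _ => Nat.zero_le _)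
    (Finset.mem_univ i)

/-- Conversely to `Tree.forest_rest`, a piece and a list that codes as many trees as it has leaves `A` can
be glued together. The outer induction is on the length of the list, for the trees grafted on the leaves
`A`, and the inner one on the piece. -/
theorem Tree.exists_of_forest (n : ℕ) : ∀ {α : Fin (m + 1)} (t : Piece m α) (l : List (Piece m 0)),
    l.length ≤ n → Forest t.al l → ∃ T : Tree m α, T.top = t ∧ T.rest = l := by
  induction n using Nat.strong_induction_on with
  | _ n ihn =>
    intro α t
    induction t with
    | node α h k ch ih =>
      intro l hl hf
      rw [Piece.al] at hf
      obtain ⟨a, b, rfl, ha, hb⟩ := hf.split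
      have ha' : Forest (∑ _i : Fin (k 0), 1) a := by simpa using ha
      obtain ⟨f, rfl, hf1⟩ := ha'.exists_flatten
      obtain ⟨g, rfl, hg⟩ := hb.exists_flatten
      choose g' hg' hg'' using fun β => (hg β).exists_flatten
      rw [List.length_append] at hl
      have h0 : ∀ i : Fin (k 0), ∃ T : Tree m 0, T.top :: T.rest = f i := by
        intro i
        have h1 := hf1 i
        have h2 := Forest.length_le_of_flatten f i
        cases hfi : f i with
        | nil => rw [hfi] at h1; exact absurd h1 (by simp [Forest])
        | cons s r =>
          rw [hfi] at h1 h2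
          rw [Forest, zero_add] at h1
          obtain ⟨T, hT1, hT2⟩ := ihn r.length (by simp only [List.length_cons] at h2; omega) s r le_rfl h1
          exact ⟨T, by rw [hT1, hT2]⟩
      choose T0 hT0 using h0
      have h1 : ∀ (β : Fin m) i, ∃ T : Tree m β.succ, T.top = ch β i ∧ T.rest = g' β i := by
        intro β i
        refine ih β i (g' β i) ?_ (hg'' β i)
        have h2 := Forest.length_le_of_flatten (g' β) i
        have h3 := Forest.length_le_of_flatten g β
        rw [← hg' β] at h2
        omega
      choose T1 hT1 hT1' using h1
      refine ⟨.node α h k (Fin.cases T0 T1), ?_, ?_⟩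
      · rw [Tree.top]
        simp only [Fin.cases_succ, hT1]
      · rw [Tree.rest]
        simp only [Fin.cases_zero, Fin.cases_succ, hT0, hT1']
        congr 3
        funext β
        exact (hg' β).symm

theorem sum_map_flatten_ofFn {X : Type*} {n : ℕ} (f : Fin n → List X) (g : X → ℕ) :
    ((List.ofFn f).flatten.map g).sum = ∑ i, ((f i).map g).sum := by
  rw [List.map_flatten, List.sum_flatten, List.map_ofFn, List.map_ofFn, List.sum_ofFn]
  rfl

theorem prod_map_flatten_ofFn {X : Type*} {n : ℕ} (f : Fin n → List X) (g : X → ℝ) :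
    ((List.ofFn f).flatten.map g).prod = ∏ i, ((f i).map g).prod := by
  rw [List.map_flatten, List.prod_flatten, List.map_ofFn, List.map_ofFn, List.prod_ofFn]
  rfl

theorem Tree.size_eq : ∀ {α : Fin (m + 1)} (T : Tree m α),
    T.size = T.top.zl + (T.rest.map Piece.zl).sum
  | _, .node α h k ch => by
      simp only [Tree.size, Tree.top, Piece.zl, Tree.rest, List.map_append, List.sum_append,
        sum_map_flatten_ofFn, List.map_cons, List.sum_cons, fun β i => Tree.size_eq (ch β i)]
      rw [Fin.sum_univ_succ]
      simp only [Finset.sum_add_distrib]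
      ring

theorem Tree.weight_eq (S : Spec m) : ∀ {α : Fin (m + 1)} (T : Tree m α),
    T.weight S = T.top.weight S * (T.rest.map (Piece.weight S)).prod
  | _, .node α h k ch => by
      simp only [Tree.weight, Tree.top, Piece.weight, Tree.rest, List.map_append, List.prod_append,
        prod_map_flatten_ofFn, List.map_cons, List.prod_cons, fun β i => Tree.weight_eq S (ch β i)]
      rw [Fin.prod_univ_succ]
      simp only [Finset.prod_mul_distrib]
      ring

theorem Tree.prod_cut (S : Spec m) (T : Tree m 0) :
    (T.cut.map (Piece.weight S)).prod = T.weight S := by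
  rw [Tree.cut, List.map_cons, List.prod_cons, ← Tree.weight_eq]

theorem Tree.cut_injective : Function.Injective (Tree.cut (m := m)) := by
  intro T T' h
  simp only [Tree.cut, List.cons.injEq] at h
  exact Tree.eq_of_top_rest T T' h.1 h.2

theorem Tree.isExcursion_cut {T : Tree m 0} {n : ℕ} : IsExcursion n T.cut ↔ T.size = n := by
  rw [isExcursion_iff, Tree.size_eq]
  simp [Tree.forest_cut T]
  simp [Tree.cut]

theorem Tree.bijOn_cut (n : ℕ) :
    Set.BijOn (Tree.cut (m := m)) {T | T.size = n} {t | IsExcursion n t} := by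
  refine ⟨fun T hT => Tree.isExcursion_cut.2 hT, Tree.cut_injective.injOn, fun l hl => ?_⟩
  have hl' : IsExcursion n l := hl
  have hf := ((isExcursion_iff n l).1 hl').2
  cases l with
  | nil => exact absurd hf (by simp [Forest])
  | cons s r =>
    rw [Forest, zero_add] at hf
    obtain ⟨T, h1, h2⟩ := Tree.exists_of_forest r.length s r le_rfl hf
    have : T.cut = s :: r := by rw [Tree.cut, h1, h2]
    exact ⟨T, by rw [← this] at hl'; exact Tree.isExcursion_cut.1 hl', this⟩

theorem exists_piece_al_zero {S : Spec m} (haper : Aperiodic S) :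
    ∃ t : Piece m 0, 0 < t.weight S ∧ t.al = 0 := by
  obtain ⟨T, hT, -⟩ := exists_tree haper 0
  have hw : ∀ t ∈ T.cut, 0 < t.weight S := by
    intro t ht
    refine lt_of_le_of_ne (Piece.weight_nonneg S t) fun h0 => ?_
    rw [← Tree.prod_cut, List.prod_eq_zero] at hT
    · exact lt_irrefl _ hT
    · rw [List.mem_map]; exact ⟨t, ht, h0.symm⟩
  by_contra hcon
  push Not at hcon
  have key : ∀ l : List (Piece m 0), (∀ t ∈ l, t.al ≠ 0) → 0 ≤ (endpoint l).2 := by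
    intro l
    induction l with
    | nil => intro _; exact le_rfl
    | cons t l ih =>
      intro h
      rw [endpoint_cons, Prod.snd_add]
      have h1 := ih fun t ht => h t (List.mem_cons_of_mem _ ht)
      have h2 := h t List.mem_cons_self
      simp only [Piece.vec]
      omega
  have h1 := key T.cut fun t ht => hcon t (hw t ht)
  have h2 := ((forest_iff 1 _).1 T.forest_cut).1
  omega

/-! ### The cyclic shift -/

/-- The time found by the pass of the cyclic shift. -/
def fm : List (Piece m 0) → ℤ → ℕ → ℤ → ℕ → ℕ
  | [], _, _, _, j => j
  | s :: t, y, i, b, j =>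
      if y + s.vec.2 < b then fm t (y + s.vec.2) (i + 1) (y + s.vec.2) (i + 1)
      else fm t (y + s.vec.2) (i + 1) b j

theorem law_firstMin (t : List (Piece m 0)) (y : ℤ) (i : ℕ) (b : ℤ) (j x : ℕ) :
    (firstMin t y i b j).law x = if x = fm t y i b j then 1 else 0 := by
  induction t generalizing y i b j with
  | nil => rw [firstMin, fm, Run.law_pure]; congr
  | cons s t ih =>
    rw [firstMin, Run.law_tick_bind, fm]
    split_ifs <;> simp_all

theorem law_cyc (t s : List (Piece m 0)) [Decidable (s = t.rotate (fm t 0 0 0 0))] :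
    (cyc t).law s = if s = t.rotate (fm t 0 0 0 0) then 1 else 0 := by
  rw [cyc, Run.law_bind, tsum_eq_single (fm t 0 0 0 0)]
  · rw [law_firstMin, if_pos rfl, one_mul, Run.law_tick_bind, Run.law_pure]
    congr
  · intro j hj
    rw [law_firstMin, if_neg hj, zero_mul]

/-- The ordinate of a walk at time `i`. -/
def ht (t : List (Piece m 0)) (i : ℕ) : ℤ := (endpoint (t.take i)).2

/-- `j` is the first time before `N` at which the ordinate is minimal. -/
def IsFirstMin (t : List (Piece m 0)) (N j : ℕ) : Prop :=
  j ≤ N ∧ (∀ i < j, ht t j < ht t i) ∧ ∀ i ≤ N, ht t j ≤ ht t i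

theorem IsFirstMin.unique {t : List (Piece m 0)} {N j j' : ℕ} (h : IsFirstMin t N j)
    (h' : IsFirstMin t N j') : j = j' := by
  rcases lt_trichotomy j j' with hlt | heq | hlt
  · exact absurd (h'.2.1 j hlt) (not_lt.2 (h.2.2 j' h'.1))
  · exact heq
  · exact absurd (h.2.1 j' hlt) (not_lt.2 (h'.2.2 j h.1))

theorem fm_spec_aux (post pre : List (Piece m 0)) (j : ℕ)
    (h : IsFirstMin (pre ++ post) pre.length j) :
    IsFirstMin (pre ++ post) (pre ++ post).length
      (fm post (ht (pre ++ post) pre.length) pre.length (ht (pre ++ post) j) j) := by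
  induction post generalizing pre j with
  | nil => simpa [fm] using h
  | cons s post ih =>
    have e : pre ++ s :: post = (pre ++ [s]) ++ post := by simp
    have hy : ht (pre ++ s :: post) pre.length + s.vec.2 = ht ((pre ++ [s]) ++ post)
        (pre ++ [s]).length := by
      rw [ht, ht, List.take_left' rfl, List.take_left' rfl, endpoint_append]
      simp [endpoint]
    rw [fm, hy]
    have hl : (pre ++ [s]).length = pre.length + 1 := by simp
    rw [← hl]
    split_ifs with hlt
    · rw [e]
      refine ih (pre ++ [s]) _ ⟨le_rfl, fun i hi => ?_, fun i hi => ?_⟩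
      · rw [e] at hlt h
        exact lt_of_lt_of_le hlt (h.2.2 i (by omega))
      · rcases hi.eq_or_lt with rfl | hi
        · exact le_rfl
        · rw [e] at hlt h
          exact (lt_of_lt_of_le hlt (h.2.2 i (by omega))).le
    · rw [e] at h hlt ⊢
      refine ih (pre ++ [s]) j ⟨by have := h.1; omega, h.2.1, fun i hi => ?_⟩
      rcases hi.eq_or_lt with rfl | hi
      · exact not_lt.1 hlt
      · exact h.2.2 i (by omega)

theorem fm_spec (t : List (Piece m 0)) : IsFirstMin t t.length (fm t 0 0 0 0) :=
  fm_spec_aux t [] 0 ⟨le_rfl, fun i hi => by omega, fun i hi => by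
    have : i = 0 := by simpa using hi
    rw [this]⟩

theorem ht_rotate {t : List (Piece m 0)} {j i : ℕ} (hj : j ≤ t.length) (hi : i ≤ t.length) :
    ht (t.rotate j) i = if i ≤ t.length - j then ht t (j + i) - ht t j
      else ht t t.length - ht t j + ht t (i - (t.length - j)) := by
  have hsplit : ∀ r, j + r ≤ t.length → ht t (j + r) = ht t j + (endpoint ((t.drop j).take r)).2 := by
    intro r _
    rw [ht, ht, List.take_add, endpoint_append, Prod.snd_add]
  rw [ht, List.rotate_eq_drop_append_take hj]
  split_ifs with h
  · rw [List.take_append_of_le_length (by simpa using h), hsplit i (by omega)]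
    ring
  · rw [List.take_append, endpoint_append, Prod.snd_add, List.take_of_length_le (by simp; omega),
      List.take_take, List.length_drop, min_eq_left (by omega)]
    have h1 := hsplit (t.length - j) (by omega)
    rw [List.take_of_length_le (l := t.drop j) (by simp), Nat.add_sub_cancel' hj] at h1
    rw [h1, ht, ht]
    ring

theorem endpoint_rotate (t : List (Piece m 0)) (j : ℕ) : endpoint (t.rotate j) = endpoint t :=
  ((List.rotate_perm t j).map _).sum_eq

theorem IsBridge.rotate {n : ℕ} {t : List (Piece m 0)} (h : IsBridge n t) (j : ℕ) :
    IsBridge n (t.rotate j) := by rw [IsBridge, endpoint_rotate]; exact h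

theorem IsBridge.ht_length {n : ℕ} {t : List (Piece m 0)} (h : IsBridge n t) : ht t t.length = -1 := by
  rw [ht, List.take_length, show endpoint t = _ from h]

theorem ht_zero (t : List (Piece m 0)) : ht t 0 = 0 := rfl

/-- The shift of a bridge at its first minimum is an excursion. -/
theorem IsBridge.isExcursion_rotate {n : ℕ} {t : List (Piece m 0)} (h : IsBridge n t) :
    1 ≤ fm t 0 0 0 0 ∧ IsExcursion n (t.rotate (fm t 0 0 0 0)) := by
  obtain ⟨h1, h2, h3⟩ := fm_spec t
  set j := fm t 0 0 0 0
  have hlen := h.ht_length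
  have hj : 1 ≤ j := by
    by_contra hc
    have h0 : j = 0 := by omega
    have := h3 t.length le_rfl
    rw [h0, ht_zero, hlen] at this
    omega
  refine ⟨hj, h.rotate j, fun i hi => ?_⟩
  rw [List.length_rotate] at hi
  have := ht_rotate h1 hi.le
  rw [ht] at this
  rw [this]
  split_ifs with hc
  · have := h3 (j + i) (by omega)
    omega
  · have := h2 (i - (t.length - j)) (by omega)
    rw [hlen]; omega

theorem IsExcursion.fm_rotate {n : ℕ} {t : List (Piece m 0)} (h : IsExcursion n t) {j : ℕ}
    (hj : 1 ≤ j) (hj' : j ≤ t.length) :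
    fm (t.rotate (t.length - j)) 0 0 0 0 = j := by
  have hlen := h.1.ht_length
  have hpos : ∀ i < t.length, 0 ≤ ht t i := h.2
  refine (fm_spec _).unique ?_
  rw [List.length_rotate]
  have hjj := ht_rotate (t := t) (j := t.length - j) (i := j) (by omega) hj'
  have e : t.length - (t.length - j) = j := by omega
  have e2 : t.length - j + j = t.length := by omega
  rw [e, if_pos le_rfl, e2, hlen] at hjj
  refine ⟨hj', fun i hi => ?_, fun i hi => ?_⟩
  · rw [hjj, ht_rotate (by omega) (by omega), e, if_pos hi.le]
    have := hpos (t.length - j + i) (by omega)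
    omega
  · rw [hjj, ht_rotate (by omega) hi, e]
    split_ifs with hc
    · rcases hc.eq_or_lt with rfl | hc
      · rw [e2, hlen]
      · have := hpos (t.length - j + i) (by omega)
        omega
    · rw [hlen]
      have := hpos (i - j) (by omega)
      omega

theorem rotate_sub_rotate {X : Type*} (t : List X) {j : ℕ} (hj : j ≤ t.length) :
    (t.rotate (t.length - j)).rotate j = t := by
  rw [List.rotate_rotate, Nat.sub_add_cancel hj, List.rotate_length]

theorem rotate_rotate_sub {X : Type*} (t : List X) {j : ℕ} (hj : j ≤ t.length) :
    (t.rotate j).rotate (t.length - j) = t := by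
  rw [List.rotate_rotate, Nat.add_sub_cancel' hj, List.rotate_length]

open scoped Classical in
/-- The cycle lemma: an excursion of length `k` is the shift of exactly `k` bridges. -/
theorem tsum_cyc (n : ℕ) (f : List (Piece m 0) → ℝ≥0∞) (h0 : ∀ b, ¬ IsBridge n b → f b = 0)
    (hrot : ∀ b j, f (b.rotate j) = f b) (t : List (Piece m 0)) :
    ∑' b, f b * (cyc b).law t = if IsExcursion n t then t.length * f t else 0 := by
  simp only [law_cyc]
  split_ifs with ht
  · set s : Finset (List (Piece m 0)) :=
      (Finset.Icc 1 t.length).image fun j => t.rotate (t.length - j) with hs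
    rw [tsum_eq_sum (s := s)]
    · rw [hs, Finset.sum_image]
      · rw [Finset.sum_congr rfl (g := fun _ => f t)]
        · simp
        · intro j hj
          rw [Finset.mem_Icc] at hj
          rw [ht.fm_rotate hj.1 hj.2, rotate_sub_rotate t hj.2, if_pos rfl, mul_one, hrot]
      · intro j hj j' hj' heq
        rw [Finset.coe_Icc] at hj hj'
        have h1 := ht.fm_rotate hj.1 hj.2
        have h2 := ht.fm_rotate hj'.1 hj'.2
        simp only at heq
        rw [heq, h2] at h1
        exact h1.symm
    · intro b hb
      by_cases hbr : IsBridge n b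
      · rw [if_neg, mul_zero]
        rintro rfl
        refine hb ?_
        rw [hs, Finset.mem_image]
        refine ⟨fm b 0 0 0 0, ?_, ?_⟩
        · rw [Finset.mem_Icc, List.length_rotate]
          exact ⟨hbr.isExcursion_rotate.1, (fm_spec b).1⟩
        · rw [List.length_rotate]
          exact rotate_rotate_sub b (fm_spec b).1
      · rw [h0 b hbr, zero_mul]
  · refine ENNReal.tsum_eq_zero.2 fun b => ?_
    by_cases hbr : IsBridge n b
    · rw [if_neg, mul_zero]
      rintro rfl
      exact ht hbr.isExcursion_rotate.2
    · rw [h0 b hbr, zero_mul]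

theorem mass_cyc (t : List (Piece m 0)) : (cyc t).mass = 1 := by
  classical
  rw [Run.mass]
  simp only [law_cyc]
  rw [tsum_ite_eq]

end CF

/-! ### The BBHL shuffle: uniformity -/

namespace CF

/-- A sum over lists, split according to the first entry. -/
theorem tsum_list {X : Type*} (f : List X → ℝ≥0∞) :
    ∑' l, f l = f [] + ∑' x, ∑' l, f (x :: l) := by
  let e : Unit ⊕ (X × List X) ≃ List X :=
    { toFun := Sum.elim (fun _ => []) fun p => p.1 :: p.2
      invFun := fun l => match l with
        | [] => .inl ()
        | x :: l => .inr (x, l)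
      left_inv := by rintro (_ | p) <;> rfl
      right_inv := by rintro (_ | ⟨x, l⟩) <;> rfl }
  rw [← e.tsum_eq, Summable.tsum_sum ENNReal.summable ENNReal.summable, ENNReal.tsum_prod',
    tsum_fintype, Fintype.sum_unique]
  rfl

namespace Run

variable {X Z V : Type}

theorem law_bind_assoc (x : Run Z) (f : Z → Run V) (g : V → Run X) (b : X) :
    ((x >>= f) >>= g).law b = (x >>= fun a => f a >>= g).law b := by
  simp only [law_bind, ← ENNReal.tsum_mul_right, ← ENNReal.tsum_mul_left]
  rw [ENNReal.tsum_comm]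
  exact tsum_congr fun a => tsum_congr fun c => by rw [mul_assoc]

theorem law_loop_unfold (body : Z → Run (Z ⊕ X)) (s : Z) (a : X) :
    (loop body s).law a = (body s >>= Sum.elim (loop body) pure).law a := by
  rw [law_sum_elim_bind, law_loop]
  have hm := law_loopUpTo_mono body
  rw [← (hm s a).iSup_nat_add 1]
  simp only [loopUpTo_succ, law_sum_elim_bind]
  rw [← ENNReal.iSup_add, ← ENNReal.tsum_iSup_of_monotone]
  · congr 1
    refine tsum_congr fun s' => ?_
    rw [law_loop, ENNReal.mul_iSup]
  · exact fun s' d e h => mul_le_mul_right (hm s' a h) _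

theorem law_randInt (j h : ℕ) : (randInt j).law h = if h ≤ j then ((j : ℝ≥0∞) + 1)⁻¹ else 0 := by
  simp only [law, randInt]
  by_cases hh : h ≤ j <;> simp [hh]

theorem mass_randInt (j : ℕ) : (randInt j).mass = 1 := by
  simp only [mass, law_randInt]
  rw [tsum_eq_sum (s := Finset.range (j + 1))]
  · rw [Finset.sum_congr rfl (g := fun _ => ((j : ℝ≥0∞) + 1)⁻¹)]
    · rw [Finset.sum_const, Finset.card_range, nsmul_eq_mul]
      push_cast
      exact ENNReal.mul_inv_cancel (by simp) (ENNReal.add_ne_top.2 ⟨ENNReal.natCast_ne_top j, by simp⟩)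
    · intro h hh
      rw [if_pos (by simpa [Nat.lt_succ_iff] using hh)]
  · intro h hh
    rw [if_neg (by simpa [Nat.lt_succ_iff] using hh)]

theorem cost_randInt (j : ℕ) : (randInt j).cost = Nat.log 2 (j + 1) + 1 := by
  have h : Det (randInt j) fun _ => Nat.log 2 (j + 1) + 1 := by
    intro h c hc
    by_contra hne
    exact hc (by simp only [randInt]; rw [if_neg (fun h => hne h.2)])
  rw [h.cost, ENNReal.tsum_mul_right, ← mass, mass_randInt, one_mul]
  push_cast; rfl

end Run

theorem swapIn_of_lt {ν : List Bool} {h : ℕ} (x : Bool) (hh : h < ν.length) :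
    swapIn ν x h = ν.set h x ++ [ν[h]] := by
  rw [swapIn, List.getElem?_eq_getElem hh]

theorem swapIn_of_le {ν : List Bool} {h : ℕ} (x : Bool) (hh : ν.length ≤ h) :
    swapIn ν x h = ν ++ [x] := by
  rw [swapIn, List.getElem?_eq_none hh]

theorem length_swapIn (ν : List Bool) (x : Bool) (h : ℕ) :
    (swapIn ν x h).length = ν.length + 1 := by
  rcases lt_or_ge h ν.length with hh | hh
  · rw [swapIn_of_lt x hh]; simp
  · rw [swapIn_of_le x hh]; simp

theorem swapIn_perm (ν : List Bool) (x : Bool) (h : ℕ) : (swapIn ν x h).Perm (x :: ν) := by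
  rcases lt_or_ge h ν.length with hh | hh
  · rw [swapIn_of_lt x hh]
    refine (List.perm_append_singleton _ _).trans ?_
    refine ((List.set_perm_cons_eraseIdx hh x).cons _).trans ?_
    refine (List.Perm.swap _ _ _).trans ?_
    exact (List.getElem_cons_eraseIdx_perm hh).cons _
  · rw [swapIn_of_le x hh]
    exact List.perm_append_singleton _ _

/-- The word on which the swap of the last entry with the entry of index `h` gives `μ`. -/
def swapOut (μ : List Bool) (h : ℕ) : List Bool := μ.dropLast.set h (μ.getLastD false)

theorem swapOut_append (ρ : List Bool) (y : Bool) (h : ℕ) : swapOut (ρ ++ [y]) h = ρ.set h y := by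
  simp [swapOut]

theorem swapIn_eq_iff {ν μ : List Bool} {x : Bool} {h : ℕ} :
    (h ≤ ν.length ∧ swapIn ν x h = μ) ↔ μ[h]? = some x ∧ ν = swapOut μ h := by
  constructor
  · rintro ⟨hle, rfl⟩
    rcases hle.lt_or_eq with hh | hh
    · rw [swapIn_of_lt x hh, swapOut_append]
      refine ⟨?_, ?_⟩
      · rw [List.getElem?_append_left (by simpa using hh), List.getElem?_set_self hh]
      · simp
    · rw [swapIn_of_le x hh.ge, swapOut_append, hh]
      refine ⟨by simp, ?_⟩
      rw [List.set_eq_of_length_le le_rfl]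
  · rintro ⟨h1, rfl⟩
    obtain ⟨ρ, y, rfl⟩ : ∃ ρ y, μ = ρ ++ [y] := by
      rcases List.eq_nil_or_concat μ with rfl | ⟨ρ, y, rfl⟩
      · simp at h1
      · exact ⟨ρ, y, by simp⟩
    rw [swapOut_append, List.length_set]
    have hlt : h < (ρ ++ [y]).length := (List.getElem?_eq_some_iff.1 h1).1
    have hle : h ≤ ρ.length := by simpa [Nat.lt_succ_iff] using hlt
    refine ⟨hle, ?_⟩
    rcases hle.lt_or_eq with hh | hh
    · rw [swapIn_of_lt x (by simpa using hh)]
      rw [List.getElem?_append_left hh, List.getElem?_eq_getElem hh] at h1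
      simp only [Option.some.injEq] at h1
      simp [← h1]
    · rw [hh] at h1 ⊢
      simp at h1
      rw [List.set_eq_of_length_le le_rfl, swapIn_of_le x le_rfl, h1]

theorem sum_getElem?_eq_count (μ : List Bool) (x : Bool) :
    ∑ h ∈ Finset.range μ.length, (if μ[h]? = some x then (1 : ℝ≥0∞) else 0) = μ.count x := by
  induction μ with
  | nil => simp
  | cons y μ ih =>
    rw [List.length_cons, Finset.sum_range_succ', List.count_cons]
    simp only [List.getElem?_cons_succ, ih, List.getElem?_cons_zero, Option.some.injEq]
    by_cases h : y = x <;> simp [h]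

/-- Weights on words that are invariant under the permutations of the letters. -/
def PermInv (g : List Bool → ℝ≥0∞) : Prop := ∀ w w', w.Perm w' → g w = g w'

/-- A random swap turns a permutation invariant weight into a permutation invariant weight. -/
theorem PermInv.swapIn {g : List Bool → ℝ≥0∞} (hg : PermInv g) (x : Bool) : PermInv fun μ =>
    ∑' ν : List Bool, ∑' h : ℕ, g ν * (Run.randInt ν.length).law h *
      (if CF.swapIn ν x h = μ then 1 else 0) := by
  have key : ∀ μ : List Bool, ∑' ν : List Bool, ∑' h : ℕ, g ν * (Run.randInt ν.length).law h *
      (if CF.swapIn ν x h = μ then 1 else 0) =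
      g (μ.erase x) * (μ.length : ℝ≥0∞)⁻¹ * μ.count x := by
    intro μ
    have h1 : ∀ ν h, g ν * (Run.randInt ν.length).law h * (if CF.swapIn ν x h = μ then 1 else 0) =
        if ν = swapOut μ h then (g (μ.erase x) * (μ.length : ℝ≥0∞)⁻¹ *
          (if μ[h]? = some x then (1 : ℝ≥0∞) else 0)) else 0 := by
      intro ν h
      rw [Run.law_randInt]
      by_cases hc : h ≤ ν.length ∧ CF.swapIn ν x h = μ
      · have hc' := swapIn_eq_iff.1 hc
        rw [if_pos hc.1, if_pos hc.2, if_pos hc'.2, if_pos hc'.1]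
        have hp : (x :: ν).Perm μ := by rw [← hc.2]; exact (swapIn_perm ν x h).symm
        have hp' := hp.erase x
        rw [List.erase_cons_head] at hp'
        rw [hg _ _ hp', ← hc.2, length_swapIn]
        push_cast; rfl
      · have hc' := fun hx => hc (swapIn_eq_iff.2 hx)
        by_cases h2 : ν = swapOut μ h
        · have h3 : ¬ μ[h]? = some x := fun h3 => hc' ⟨h3, h2⟩
          rw [if_pos h2, if_neg h3, mul_zero]
          by_cases h4 : h ≤ ν.length
          · rw [if_neg (fun h5 => hc ⟨h4, h5⟩), mul_zero]
          · rw [if_neg h4, mul_zero, zero_mul]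
        · rw [if_neg h2]
          by_cases h4 : h ≤ ν.length
          · rw [if_neg (fun h5 => hc ⟨h4, h5⟩), mul_zero]
          · rw [if_neg h4, mul_zero, zero_mul]
    simp only [h1]
    rw [ENNReal.tsum_comm]
    simp only [tsum_ite_eq]
    rw [ENNReal.tsum_mul_left, ← sum_getElem?_eq_count]
    congr 1
    refine tsum_eq_sum fun h hh => if_neg ?_
    rw [Finset.mem_range, not_lt] at hh
    rw [List.getElem?_eq_none hh]
    simp
  intro w w' hp
  simp only [key]
  rw [hg _ _ (hp.erase x), hp.length_eq, hp.count_eq]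

theorem PermInv.fill {g : List Bool → ℝ≥0∞} (hg : PermInv g) (x : Bool) (r : ℕ) :
    PermInv fun w => ∑' ν, g ν * (bbhlFill x r ν).law w := by
  induction r generalizing g with
  | zero =>
    intro w w' hp
    have : ∀ w, ∑' ν, g ν * (bbhlFill x 0 ν).law w = g w := by
      intro w
      rw [tsum_eq_single w]
      · rw [bbhlFill, Run.law_pure_self, mul_one]
      · intro ν hν
        rw [bbhlFill, Run.law_pure_of_ne hν.symm, mul_zero]
    simp only [this]
    exact hg w w' hp
  | succ r ih =>
    have := ih (hg.swapIn x)
    intro w w' hp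
    have key : ∀ w, ∑' ν, g ν * (bbhlFill x (r + 1) ν).law w =
        ∑' μ, (∑' ν : List Bool, ∑' h : ℕ, g ν * (Run.randInt ν.length).law h *
          (if CF.swapIn ν x h = μ then 1 else 0)) * (bbhlFill x r μ).law w := by
      intro w
      simp only [← ENNReal.tsum_mul_right]
      rw [ENNReal.tsum_comm]
      refine tsum_congr fun ν => ?_
      rw [ENNReal.tsum_comm, bbhlFill, Run.law_bind, ← ENNReal.tsum_mul_left]
      refine tsum_congr fun h => ?_
      rw [Run.law_tick_bind, tsum_eq_single (CF.swapIn ν x h)]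
      · rw [if_pos rfl]; ring
      · intro μ hμ
        rw [if_neg hμ.symm]; ring
    simp only [key]
    exact this w w' hp

theorem bbhlFill_support (x : Bool) (r : ℕ) (ν w : List Bool) (h : (bbhlFill x r ν).law w ≠ 0) :
    w.Perm (List.replicate r x ++ ν) := by
  induction r generalizing ν with
  | zero =>
    by_cases hw : w = ν
    · rw [hw]; simp
    · rw [bbhlFill, Run.law_pure_of_ne hw] at h; exact absurd rfl h
  | succ r ih =>
    rw [bbhlFill, Run.law_bind, Ne, ENNReal.tsum_eq_zero] at h
    push Not at h
    obtain ⟨i, hi⟩ := h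
    rw [Run.law_tick_bind] at hi
    have := ih _ (right_ne_zero_of_mul hi)
    refine this.trans (((swapIn_perm ν x i).append_left _).trans ?_)
    rw [List.replicate_succ]
    exact List.perm_middle

theorem mass_bbhlFill (x : Bool) (r : ℕ) (ν : List Bool) : (bbhlFill x r ν).mass = 1 := by
  induction r generalizing ν with
  | zero => exact Run.mass_pure ν
  | succ r ih =>
    rw [bbhlFill]
    refine Run.mass_bind_eq (Run.mass_randInt _) fun h _ => ?_
    rw [Run.mass_tick_bind]; exact ih _

/-- The result of reading one bit in the first phase. -/
def bbhlNext (x : Bool) (s : List Bool × ℕ × ℕ) : (List Bool × ℕ × ℕ) ⊕ (List Bool × Bool) :=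
  match x, s with
  | true, (ν, a + 1, b) => .inl (ν ++ [true], a, b)
  | true, (ν, 0, _) => .inr (ν, false)
  | false, (ν, a, b + 1) => .inl (ν ++ [false], a, b)
  | false, (ν, _, 0) => .inr (ν, true)

theorem bbhlDraw_eq (β : ℝ) (s : List Bool × ℕ × ℕ) :
    bbhlDraw β s = (Run.flip β >>= fun x => pure (bbhlNext x s)) := by
  rw [bbhlDraw]
  congr 1
  funext x
  obtain ⟨ν, a, b⟩ := s
  cases x <;> cases a <;> cases b <;> rfl

theorem mass_bbhlDraw {β : ℝ} (h0 : 0 ≤ β) (s : List Bool × ℕ × ℕ) : (bbhlDraw β s).mass = 1 := by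
  rw [bbhlDraw_eq]
  exact Run.mass_bind_eq (Run.mass_flip h0) fun x _ => Run.mass_pure _

theorem mass_bbhlLoop {β : ℝ} (h0 : 0 ≤ β) (s : List Bool × ℕ × ℕ) :
    (Run.loop (bbhlDraw β) s).mass = 1 := by
  refine Run.mass_loop_eq_one _ (fun s => (mass_bbhlDraw h0 s).le) (fun _ => True)
    (fun s => s.2.1 + s.2.2) (fun s _ => mass_bbhlDraw h0 s) (fun s s' _ h => ⟨trivial, ?_⟩) s trivial
  rw [bbhlDraw_eq, Run.law_bind, Ne, ENNReal.tsum_eq_zero] at h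
  push Not at h
  obtain ⟨x, hx⟩ := h
  have : Sum.inl s' = bbhlNext x s := by
    by_contra hc
    rw [Run.law_pure_of_ne hc, mul_zero] at hx
    exact hx rfl
  obtain ⟨ν, a, b⟩ := s
  cases x <;> cases a <;> cases b <;> simp [bbhlNext] at this <;> simp [this]

theorem law_bbhlLoop_unfold {β : ℝ} (h1 : β ≤ 1) (s : List Bool × ℕ × ℕ) (o : List Bool × Bool) :
    (Run.loop (bbhlDraw β) s).law o =
      ENNReal.ofReal β * ((Sum.elim (Run.loop (bbhlDraw β)) pure (bbhlNext true s)) : Run _).law o +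
      ENNReal.ofReal (1 - β) *
        ((Sum.elim (Run.loop (bbhlDraw β)) pure (bbhlNext false s)) : Run _).law o := by
  rw [Run.law_loop_unfold, bbhlDraw_eq, Run.law_bind_assoc, Run.law_bind, tsum_fintype,
    Fintype.sum_bool, Run.law_flip_true h1, Run.law_flip_false h1, Run.law_pure_bind,
    Run.law_pure_bind]

/-- The law of the first phase, started with `a` and `b` available letters, on words with `i` letters
`true` and `j` letters `false`. -/
def bbhlWeight (β : ℝ) (a b i j : ℕ) (x : Bool) : ℝ≥0∞ :=
  if x then (if j = b ∧ i ≤ a then ENNReal.ofReal (1 - β) ^ (b + 1) * ENNReal.ofReal β ^ i else 0)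
  else (if i = a ∧ j ≤ b then ENNReal.ofReal β ^ (a + 1) * ENNReal.ofReal (1 - β) ^ j else 0)

/-- The law of the first phase, started after the letters `ν` with `a` and `b` letters available, on the
words that extend `ν`. -/
theorem law_bbhlLoop {β : ℝ} (h1 : β ≤ 1) (n : ℕ) : ∀ (a b : ℕ) (ν w : List Bool) (x : Bool), a + b = n →
    (Run.loop (bbhlDraw β) (ν, a, b)).law (w, x) =
      if ν <+: w then bbhlWeight β a b ((w.drop ν.length).count true) ((w.drop ν.length).count false) x
      else 0 := by
  induction n with
  | zero =>
    intro a b ν w x hab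
    obtain ⟨rfl, rfl⟩ : a = 0 ∧ b = 0 := by omega
    rw [law_bbhlLoop_unfold h1]
    simp only [bbhlNext, Sum.elim_inr]
    by_cases hp : ν <+: w
    · obtain ⟨l, rfl⟩ := hp
      rw [if_pos (List.prefix_append _ _), List.drop_left]
      rcases l with _ | ⟨y, l⟩
      · cases x <;> simp [Run.law_pure, bbhlWeight]
      · cases x <;> cases y <;> simp [Run.law_pure, bbhlWeight]
    · have hne : w ≠ ν := fun h => hp (h ▸ List.prefix_rfl)
      rw [if_neg hp]
      simp [Run.law_pure, hne]
  | succ n ih =>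
    intro a b ν w x hab
    rw [law_bbhlLoop_unfold h1]
    have eT : ((Sum.elim (Run.loop (bbhlDraw β)) pure (bbhlNext true (ν, a, b))) : Run _).law (w, x) =
        if a = 0 then (if w = ν ∧ x = false then 1 else 0) else
          if ν ++ [true] <+: w then bbhlWeight β (a - 1) b ((w.drop (ν.length + 1)).count true)
            ((w.drop (ν.length + 1)).count false) x else 0 := by
      cases a with
      | zero => simp [bbhlNext, Run.law_pure]
      | succ a =>
        simp only [bbhlNext, Sum.elim_inl]
        rw [ih a b _ w x (by omega)]
        simp
    have eF : ((Sum.elim (Run.loop (bbhlDraw β)) pure (bbhlNext false (ν, a, b))) : Run _).law (w, x) =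
        if b = 0 then (if w = ν ∧ x = true then 1 else 0) else
          if ν ++ [false] <+: w then bbhlWeight β a (b - 1) ((w.drop (ν.length + 1)).count true)
            ((w.drop (ν.length + 1)).count false) x else 0 := by
      cases b with
      | zero => simp [bbhlNext, Run.law_pure]
      | succ b =>
        simp only [bbhlNext, Sum.elim_inl]
        rw [ih a b _ w x (by omega)]
        simp
    rw [eT, eF]
    by_cases hp : ν <+: w
    · obtain ⟨l, rfl⟩ := hp
      rw [if_pos (List.prefix_append _ _), List.drop_left]
      have hd : (ν ++ l).drop (ν.length + 1) = l.drop 1 := by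
        rw [← List.drop_drop, List.drop_left]
      simp only [hd, List.prefix_append_right_inj]
      rcases l with _ | ⟨y, l⟩
      · cases x <;> cases a <;> cases b <;> simp [bbhlWeight] at hab ⊢
      · cases x <;> cases y <;> cases a <;> cases b <;>
          simp [bbhlWeight, List.cons_prefix_cons] <;> split_ifs <;> ring
    · have hne : w ≠ ν := fun h => hp (h ▸ List.prefix_rfl)
      have hT : ∀ y, ¬ ν ++ [y] <+: w := fun y h => hp ((List.prefix_append _ _).trans h)
      rw [if_neg hp]
      simp [hne, hT]

theorem count_add_count (w : List Bool) : w.count true + w.count false = w.length := by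
  induction w with
  | nil => rfl
  | cons y w ih => cases y <;> simp <;> omega

theorem perm_of_count {w w' : List Bool} (h1 : w.count true = w'.count true)
    (h2 : w.count false = w'.count false) : w.Perm w' :=
  List.perm_iff_count.2 fun x => by cases x <;> assumption

/-- The number of words with given numbers of letters. -/
theorem tsum_words (a b : ℕ) :
    ∑' w : List Bool, (if w.count true = a ∧ w.count false = b then (1 : ℝ≥0∞) else 0) =
      ((a + b).choose a : ℕ) := by
  induction h : a + b generalizing a b with
  | zero =>
    obtain ⟨rfl, rfl⟩ : a = 0 ∧ b = 0 := by omega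
    rw [tsum_eq_single []]
    · simp
    · intro w hw
      rw [if_neg]
      rintro ⟨h1, h2⟩
      have := count_add_count w
      exact hw (List.length_eq_zero_iff.1 (by omega))
  | succ n ih =>
    rw [tsum_list, tsum_fintype, Fintype.sum_bool]
    have h0 : ¬ ((0 : ℕ) = a ∧ 0 = b) := by omega
    simp only [List.count_nil, List.count_cons_self,
      List.count_cons_of_ne (Bool.false_ne_true), List.count_cons_of_ne (Bool.false_ne_true.symm)]
    cases a with
    | zero =>
      cases b with
      | zero => omega
      | succ b =>
        have := ih 0 b (by omega)
        simp only [Nat.add_right_cancel_iff, Nat.add_eq_zero_iff, one_ne_zero, and_false, false_and,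
          if_false, tsum_zero, zero_add, this]
        simp
    | succ a =>
      cases b with
      | zero =>
        have := ih a 0 (by omega)
        simp only [Nat.add_right_cancel_iff, Nat.add_eq_zero_iff, one_ne_zero, and_false,
          if_false, tsum_zero, add_zero, this]
        have e : n = a := by omega
        simp [e]
      | succ b =>
        have i1 := ih a (b + 1) (by omega)
        have i2 := ih (a + 1) b (by omega)
        have e : n = a + (b + 1) := by omega
        have e2 : n = a + 1 + b := by omega
        simp only [Nat.add_right_cancel_iff, i1, i2]
        rw [Nat.choose_succ_succ]
        simp

theorem beta_mem (a b : ℕ) : 0 ≤ (a : ℝ) / (a + b) ∧ (a : ℝ) / (a + b) ≤ 1 := by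
  refine ⟨by positivity, div_le_one_of_le₀ ?_ (by positivity)⟩
  have : (0 : ℝ) ≤ b := Nat.cast_nonneg b
  linarith

theorem mass_bbhl (a b : ℕ) : (bbhl a b).mass = 1 := by
  rw [bbhl]
  exact Run.mass_bind_eq (mass_bbhlLoop (beta_mem a b).1 _) fun s _ => mass_bbhlFill _ _ _

/-- The BBHL shuffle is uniform. -/
theorem law_bbhl (a b : ℕ) (w : List Bool) : (bbhl a b).law w =
    if w.count true = a ∧ w.count false = b then (((a + b).choose a : ℕ) : ℝ≥0∞)⁻¹ else 0 := by
  set β := (a : ℝ) / (a + b) with hβ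
  have hβ1 := (beta_mem a b).2
  have hloop : ∀ ν x, (Run.loop (bbhlDraw β) ([], a, b)).law (ν, x) =
      bbhlWeight β a b (ν.count true) (ν.count false) x := by
    intro ν x
    rw [law_bbhlLoop hβ1 (a + b) a b [] ν x rfl, if_pos (List.nil_prefix), List.length_nil,
      List.drop_zero]
  have hlaw : ∀ w, (bbhl a b).law w = ∑ r ∈ Finset.range (a + b + 1), ∑ x : Bool, ∑' ν : List Bool,
      ((if a + b - ν.length = r then bbhlWeight β a b (ν.count true) (ν.count false) x else 0) *
        (bbhlFill x r ν).law w) := by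
    intro w
    rw [bbhl, Run.law_bind, ENNReal.tsum_prod']
    rw [Finset.sum_comm]
    rw [ENNReal.tsum_comm, tsum_fintype]
    refine Finset.sum_congr rfl fun x _ => ?_
    rw [← Summable.tsum_finsetSum (fun _ _ => ENNReal.summable)]
    refine tsum_congr fun ν => ?_
    rw [hloop, Finset.sum_eq_single (a + b - ν.length)]
    · rw [if_pos rfl]
    · intro r _ hr
      rw [if_neg hr.symm, zero_mul]
    · intro h
      exact absurd (Finset.mem_range.2 (by omega)) h
  have hperm : PermInv fun w => (bbhl a b).law w := by
    intro w w' hp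
    simp only [hlaw]
    refine Finset.sum_congr rfl fun r _ => Finset.sum_congr rfl fun x _ => ?_
    refine PermInv.fill (g := fun ν => if a + b - ν.length = r then
      bbhlWeight β a b (ν.count true) (ν.count false) x else 0) ?_ x r w w' hp
    intro v v' hv
    simp only [hv.length_eq, hv.count_eq]
  have hsupp : ∀ w, (bbhl a b).law w ≠ 0 → w.count true = a ∧ w.count false = b := by
    intro w hw
    rw [bbhl, Run.law_bind, Ne, ENNReal.tsum_eq_zero] at hw
    push Not at hw
    obtain ⟨⟨ν, x⟩, hs⟩ := hw
    have hl := left_ne_zero_of_mul hs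
    rw [← hβ, hloop] at hl
    have hp := bbhlFill_support _ _ _ _ (right_ne_zero_of_mul hs)
    have hc := count_add_count ν
    rw [hp.count_eq, hp.count_eq, List.count_append, List.count_append]
    cases x
    · simp only [bbhlWeight, Bool.false_eq_true, if_false] at hl
      have : ν.count true = a ∧ ν.count false ≤ b := by
        by_contra hcon
        rw [if_neg hcon] at hl; exact hl rfl
      simp [List.count_replicate]
      omega
    · simp only [bbhlWeight, if_true] at hl
      have : ν.count false = b ∧ ν.count true ≤ a := by
        by_contra hcon
        rw [if_neg hcon] at hl; exact hl rfl
      simp [List.count_replicate]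
      omega
  set w₀ := List.replicate a true ++ List.replicate b false with hw₀
  have hw₀c : w₀.count true = a ∧ w₀.count false = b := by simp [hw₀, List.count_replicate]
  have hconst : ∀ w, (bbhl a b).law w =
      (if w.count true = a ∧ w.count false = b then (1 : ℝ≥0∞) else 0) * (bbhl a b).law w₀ := by
    intro w
    split_ifs with h
    · rw [one_mul]
      exact hperm _ _ (perm_of_count (by rw [h.1, hw₀c.1]) (by rw [h.2, hw₀c.2]))
    · rw [zero_mul]
      by_contra hne
      exact h (hsupp w hne)
  have hm := mass_bbhl a b
  rw [Run.mass, tsum_congr hconst, ENNReal.tsum_mul_right, tsum_words] at hm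
  rw [hconst, ENNReal.eq_inv_of_mul_eq_one_left ((mul_comm _ _).trans hm)]
  split_ifs <;> simp

end CF

/-! ### The BBHL shuffle: average cost -/

namespace CF

theorem ert_bbhlFill_le (x : Bool) (N : ℕ) : ∀ (r : ℕ) (ν : List Bool), ν.length + r ≤ N →
    Run.ert (bbhlFill x r ν) (fun _ => 0) ≤ (r : ℝ≥0∞) * ((Nat.log 2 N + 2 : ℕ) : ℝ≥0∞)
  | 0, ν, _ => by rw [bbhlFill, Run.ert_pure]; exact zero_le
  | r + 1, ν, h => by
    rw [bbhlFill]
    refine (Run.ert_bind_le (fun i _ => ?_) _).trans ?_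
    · rw [Run.mass_tick_bind, mass_bbhlFill]
    · have hb : ∀ i, Run.ert (Run.tick 1 >>= fun _ => bbhlFill x r (swapIn ν x i)) (fun _ => 0) ≤
          1 + (r : ℝ≥0∞) * ((Nat.log 2 N + 2 : ℕ) : ℝ≥0∞) := by
        intro i
        refine (Run.ert_tick_bind_le 1 (by rw [mass_bbhlFill]) _).trans ?_
        rw [Nat.cast_one]
        exact add_le_add le_rfl (ert_bbhlFill_le x N r _ (by rw [length_swapIn]; omega))
      refine (Run.ert_mono _ hb).trans ((Run.ert_const_le _ (Run.mass_randInt _).le _).trans ?_)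
      rw [Run.cost_randInt]
      have hl : Nat.log 2 (ν.length + 1) ≤ Nat.log 2 N := Nat.log_mono_right (by omega)
      have : ((Nat.log 2 (ν.length + 1) : ℕ) : ℝ≥0∞) ≤ (Nat.log 2 N : ℕ) := by exact_mod_cast hl
      calc _ ≤ ((Nat.log 2 N : ℕ) : ℝ≥0∞) + 1 + (1 + (r : ℝ≥0∞) * ((Nat.log 2 N + 2 : ℕ) : ℝ≥0∞)) := by
            gcongr
        _ = _ := by push_cast; ring

/-- A potential `R` bounds the mean number of letters that remain to be inserted when the first phase
of the shuffle stops, as soon as it is superharmonic for the urn. -/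
theorem cost_bbhl_le (a b : ℕ) (R : ℕ → ℕ → ℝ) (hR0 : ∀ i j, 0 ≤ R i j)
    (hR : ∀ i j : ℕ, (a : ℝ) / (a + b) * (if i = 0 then (j : ℝ) else R (i - 1) j) +
      (1 - (a : ℝ) / (a + b)) * (if j = 0 then (i : ℝ) else R i (j - 1)) ≤ R i j) :
    (bbhl a b).cost ≤
      ENNReal.ofReal ((a + b + 1 : ℝ) + ((Nat.log 2 (a + b) + 2 : ℕ) : ℝ) * R a b) := by
  set β := (a : ℝ) / (a + b) with hβ
  obtain ⟨hβ0, hβ1⟩ := beta_mem a b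
  rw [← hβ] at hβ0 hβ1
  set K : ℝ := ((Nat.log 2 (a + b) + 2 : ℕ) : ℝ) with hK
  have hK0 : 0 ≤ K := Nat.cast_nonneg _
  -- `φ` bounds the cost of the second phase, and `I` is a loop invariant of the first one; `⊤` excludes
  -- the states that are never reached
  set φ : List Bool × Bool → ℝ≥0∞ := fun s => ENNReal.ofReal (K * ((a + b - s.1.length : ℕ) : ℝ)) with hφ
  set I : List Bool × ℕ × ℕ → ℝ≥0∞ := fun s => if s.1.length + s.2.1 + s.2.2 = a + b then
    ENNReal.ofReal ((s.2.1 + s.2.2 + 1 : ℝ) + K * R s.2.1 s.2.2) else ⊤ with hI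
  have hdraw : ∀ s, Run.ert (bbhlDraw β s) (Sum.elim I φ) ≤ I s := by
    rintro ⟨ν, i, j⟩
    by_cases hs : ν.length + i + j = a + b
    swap
    · rw [hI]; simp only [if_neg hs]; exact le_top
    rw [bbhlDraw_eq]
    refine (Run.ert_bind_le (fun x _ => (Run.mass_pure _).le) _).trans ?_
    simp only [Run.ert_pure]
    rw [Run.flip]
    refine (Run.ert_draw_le _ (Run.mass_flip hβ0).le _).trans ?_
    rw [tsum_fintype, Fintype.sum_bool]
    simp only [if_true, min_eq_left hβ1, Bool.false_eq_true, if_false]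
    have hT : Sum.elim I φ (bbhlNext true (ν, i, j)) ≤ ENNReal.ofReal ((i + j : ℝ) +
        K * (if i = 0 then (j : ℝ) else R (i - 1) j)) := by
      cases i with
      | zero =>
        simp only [bbhlNext, Sum.elim_inr, hφ, if_true]
        apply ENNReal.ofReal_le_ofReal
        have : a + b - ν.length = j := by omega
        rw [this]; push_cast
        have : (0 : ℝ) ≤ j := Nat.cast_nonneg j
        linarith
      | succ i =>
        simp only [bbhlNext, Sum.elim_inl, hI, Nat.succ_ne_zero, if_false, Nat.add_sub_cancel]
        rw [if_pos (by rw [List.length_append, List.length_singleton]; omega)]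
        apply ENNReal.ofReal_le_ofReal
        push_cast; linarith
    have hF : Sum.elim I φ (bbhlNext false (ν, i, j)) ≤ ENNReal.ofReal ((i + j : ℝ) +
        K * (if j = 0 then (i : ℝ) else R i (j - 1))) := by
      cases j with
      | zero =>
        simp only [bbhlNext, Sum.elim_inr, hφ, if_true]
        apply ENNReal.ofReal_le_ofReal
        have : a + b - ν.length = i := by omega
        rw [this]; push_cast
        have : (0 : ℝ) ≤ i := Nat.cast_nonneg i
        linarith
      | succ j =>
        simp only [bbhlNext, Sum.elim_inl, hI, Nat.succ_ne_zero, if_false, Nat.add_sub_cancel]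
        rw [if_pos (by rw [List.length_append, List.length_singleton]; omega)]
        apply ENNReal.ofReal_le_ofReal
        push_cast; linarith
    have hTn : 0 ≤ (if i = 0 then (j : ℝ) else R (i - 1) j) := by
      split_ifs
      · exact Nat.cast_nonneg j
      · exact hR0 _ _
    have hFn : 0 ≤ (if j = 0 then (i : ℝ) else R i (j - 1)) := by
      split_ifs
      · exact Nat.cast_nonneg i
      · exact hR0 _ _
    refine (add_le_add le_rfl (add_le_add (mul_le_mul_right hT _) (mul_le_mul_right hF _))).trans ?_
    have h1β : 0 ≤ 1 - β := sub_nonneg.2 hβ1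
    rw [← ENNReal.ofReal_mul hβ0, ← ENNReal.ofReal_mul h1β, ← ENNReal.ofReal_add (by positivity)
      (by positivity), ← ENNReal.ofReal_one, ← ENNReal.ofReal_add zero_le_one (by positivity)]
    simp only [hI, if_pos hs]
    apply ENNReal.ofReal_le_ofReal
    have := mul_le_mul_of_nonneg_left (hR i j) hK0
    linarith
  rw [Run.cost_eq_ert, bbhl]
  refine (Run.ert_bind_le (fun s _ => (mass_bbhlFill _ _ _).le) _).trans ?_
  have hfill : ∀ s : List Bool × Bool, (Run.loop (bbhlDraw β) ([], a, b)).law s ≠ 0 →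
      Run.ert (bbhlFill s.2 (a + b - s.1.length) s.1) (fun _ => 0) ≤ φ s := by
    rintro ⟨ν, x⟩ hs
    rw [law_bbhlLoop hβ1 (a + b) a b [] ν x rfl, if_pos List.nil_prefix, List.length_nil,
      List.drop_zero] at hs
    have hc := count_add_count ν
    have hle : ν.length ≤ a + b := by
      cases x
      · simp only [bbhlWeight, Bool.false_eq_true, if_false] at hs
        by_contra hcon
        rw [if_neg (by omega)] at hs; exact hs rfl
      · simp only [bbhlWeight, if_true] at hs
        by_contra hcon
        rw [if_neg (by omega)] at hs; exact hs rfl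
    refine (ert_bbhlFill_le x (a + b) (a + b - ν.length) ν (by omega)).trans_eq ?_
    simp only [hφ, hK]
    rw [mul_comm, ENNReal.ofReal_mul (Nat.cast_nonneg _), ENNReal.ofReal_natCast,
      ENNReal.ofReal_natCast]
  refine (Run.ert_mono_of_law _ hfill).trans ?_
  refine (Run.ert_loop_le _ (fun s => (mass_bbhlDraw hβ0 s).le) φ I hdraw _).trans_eq ?_
  simp [hI]

/-- The trivial bound, for unbalanced words: all the letters may have to be inserted by swaps. -/
theorem cost_bbhl_le_mul (a b : ℕ) : (bbhl a b).cost ≤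
    ENNReal.ofReal ((a + b + 1 : ℝ) + ((Nat.log 2 (a + b) + 2 : ℕ) : ℝ) * (a + b)) := by
  obtain ⟨hβ0, hβ1⟩ := beta_mem a b
  refine cost_bbhl_le a b (fun i j => i + j) (fun i j => by positivity) fun i j => ?_
  have hT : (if i = 0 then (j : ℝ) else ((i - 1 : ℕ) : ℝ) + j) ≤ i + j := by
    cases i <;> simp
  have hF : (if j = 0 then (i : ℝ) else (i : ℝ) + ((j - 1 : ℕ) : ℝ)) ≤ i + j := by
    cases j <;> simp
  calc _ ≤ (a : ℝ) / (a + b) * (i + j) + (1 - (a : ℝ) / (a + b)) * (i + j) := by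
        have := sub_nonneg.2 hβ1
        gcongr
    _ = _ := by ring

/-- If none of the two letters is rare, the first phase stops at mean distance `O(√(a + b))` of the
end: the square of the discrepancy of the urn, suitably compensated, is a martingale. -/
theorem cost_bbhl_le_sqrt (a b : ℕ) {δ : ℝ} (hδ : 0 < δ) (ha : δ * (a + b) ≤ a) (hb : δ * (a + b) ≤ b)
    (hab : 0 < a + b) : (bbhl a b).cost ≤
    ENNReal.ofReal ((a + b + 1 : ℝ) + ((Nat.log 2 (a + b) + 2 : ℕ) : ℝ) *
      (√(a + b) * (1 / 2 + 1 / (2 * δ ^ 2)))) := by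
  obtain ⟨hβ0, hβ1⟩ := beta_mem a b
  set β := (a : ℝ) / (a + b) with hβ
  have hN : (0 : ℝ) < a + b := by exact_mod_cast hab
  have hδ1 : δ ≤ β := (le_div_iff₀ hN).2 ha
  have hδ2 : δ ≤ 1 - β := by
    have : 1 - β = b / (a + b) := by rw [hβ]; field_simp; ring
    rw [this]; exact (le_div_iff₀ hN).2 hb
  have hs : 0 < √((a : ℝ) + b) := Real.sqrt_pos.2 hN
  -- `l` balances the two terms of the inequality `x ≤ 1 / (2 l) + (l / 2) x ^ 2`
  set l := (√((a : ℝ) + b))⁻¹ with hl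
  have hl0 : 0 < l := inv_pos.2 hs
  -- an affine function of the martingale `((1 - β) i - β j) ^ 2 + β (1 - β) (i + j)` of the urn
  set G : ℝ → ℝ → ℝ := fun i j => 1 / (2 * l) + l / (2 * δ ^ 2) *
    (((1 - β) * i - β * j) ^ 2 + β * (1 - β) * (i + j)) with hG
  have h1β : 0 ≤ 1 - β := sub_nonneg.2 hβ1
  have hmart : ∀ i j, β * G (i - 1) j + (1 - β) * G i (j - 1) = G i j := by
    intro i j; simp only [hG]; ring
  have hAM : ∀ x y : ℝ, 0 ≤ x → δ ^ 2 * x ^ 2 ≤ y → x ≤ 1 / (2 * l) + l / (2 * δ ^ 2) * y := by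
    intro x y _ hy
    have h1 : l / (2 * δ ^ 2) * (δ ^ 2 * x ^ 2) ≤ l / (2 * δ ^ 2) * y := by gcongr
    have h2 : x ≤ 1 / (2 * l) + l / 2 * x ^ 2 := by
      have : 1 / (2 * l) + l / 2 * x ^ 2 - x = (1 - l * x) ^ 2 / (2 * l) := by field_simp; ring
      have h3 : 0 ≤ (1 - l * x) ^ 2 / (2 * l) := by positivity
      linarith
    have h3 : l / (2 * δ ^ 2) * (δ ^ 2 * x ^ 2) = l / 2 * x ^ 2 := by field_simp
    linarith
  have hT : ∀ j : ℕ, 1 ≤ j → (j : ℝ) ≤ G (0 - 1) j := by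
    intro j hj
    have hj' : (1 : ℝ) ≤ j := by exact_mod_cast hj
    refine hAM j _ (Nat.cast_nonneg j) ?_
    have h1 : 0 ≤ β * (1 - β) * (0 - 1 + (j : ℝ)) := by
      have : (0 : ℝ) ≤ 0 - 1 + j := by linarith
      positivity
    have h2 : (δ * j) ^ 2 ≤ ((1 - β) + β * j) ^ 2 := by
      gcongr
      nlinarith
    nlinarith
  have hF : ∀ i : ℕ, 1 ≤ i → (i : ℝ) ≤ G i (0 - 1) := by
    intro i hi
    have hi' : (1 : ℝ) ≤ i := by exact_mod_cast hi
    refine hAM i _ (Nat.cast_nonneg i) ?_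
    have h1 : 0 ≤ β * (1 - β) * ((i : ℝ) + (0 - 1)) := by
      have : (0 : ℝ) ≤ i + (0 - 1) := by linarith
      positivity
    have h2 : (δ * i) ^ 2 ≤ (β + (1 - β) * i) ^ 2 := by
      gcongr
      nlinarith
    nlinarith
  refine (cost_bbhl_le a b (fun i j => G i j) (fun i j => by simp only [hG]; positivity)
    fun i j => ?_).trans (ENNReal.ofReal_le_ofReal ?_)
  · rcases Nat.eq_zero_or_pos i with rfl | hi
    · rcases Nat.eq_zero_or_pos j with rfl | hj
      · simp [hG]; positivity
      · have := hmart 0 j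
        have h1 := mul_le_mul_of_nonneg_left (hT j hj) hβ0
        simp only [if_true, hj.ne', if_false, Nat.cast_zero] at *
        rw [Nat.cast_pred hj]
        linarith
    · rcases Nat.eq_zero_or_pos j with rfl | hj
      · have := hmart i 0
        have h1 := mul_le_mul_of_nonneg_left (hF i hi) h1β
        simp only [if_true, hi.ne', if_false, Nat.cast_zero] at *
        rw [Nat.cast_pred hi]
        linarith
      · have := hmart i j
        simp only [hi.ne', hj.ne', if_false]
        rw [Nat.cast_pred hi, Nat.cast_pred hj]
        exact this.le
  · have h1 : G a b ≤ √((a : ℝ) + b) * (1 / 2 + 1 / (2 * δ ^ 2)) := by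
      have e1 : (1 - β) * (a : ℝ) - β * b = 0 := by rw [hβ]; field_simp; ring
      simp only [hG, e1]
      have e2 : l * (a + b) = √((a : ℝ) + b) := by
        rw [hl, inv_mul_eq_div, div_eq_iff hs.ne', Real.mul_self_sqrt hN.le]
      have e3 : 1 / (2 * l) = √((a : ℝ) + b) / 2 := by rw [hl]; field_simp
      have hb1 : β * (1 - β) ≤ 1 := by nlinarith
      have : l / (2 * δ ^ 2) * (0 ^ 2 + β * (1 - β) * (a + b)) =
          β * (1 - β) * (√((a : ℝ) + b) * (1 / (2 * δ ^ 2))) := by rw [← e2]; ring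
      rw [e3, this]
      have h5 : β * (1 - β) * (√((a : ℝ) + b) * (1 / (2 * δ ^ 2))) ≤
          1 * (√((a : ℝ) + b) * (1 / (2 * δ ^ 2))) := by gcongr
      linarith
    gcongr

/-! ### Deterministic and elementary programs -/

namespace Run

theorem law_mulAll (l : List ℝ) (y : ℝ) : (mulAll l).law y = if y = l.prod then 1 else 0 := by
  induction l generalizing y with
  | nil => rw [mulAll, law_pure, List.prod_nil]
  | cons x l ih =>
    rw [mulAll, law_bind, tsum_eq_single l.prod]
    · rw [ih, if_pos rfl, one_mul, law_tick_bind, law_pure, List.prod_cons]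
    · intro a ha
      rw [ih, if_neg ha, zero_mul]

theorem mass_mulAll (l : List ℝ) : (mulAll l).mass = 1 := by
  simp only [mass, law_mulAll, tsum_ite_eq]

theorem ert_mulAll_le (l : List ℝ) (φ : ℝ → ℝ≥0∞) :
    ert (mulAll l) φ ≤ l.length + φ l.prod := by
  induction l generalizing φ with
  | nil => rw [mulAll, ert_pure]; simp
  | cons x l ih =>
    rw [mulAll]
    refine (ert_bind_le (fun a _ => by rw [mass_tick_bind, mass_pure]) _).trans ((ih _).trans ?_)
    refine (add_le_add le_rfl (ert_tick_bind_le (f := fun _ => pure (x * l.prod)) 1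
      (mass_pure _).le _)).trans_eq ?_
    rw [ert_pure, List.length_cons, List.prod_cons]
    push_cast; ring

theorem mass_replicate {X : Type} {x : Run X} (hx : x.mass = 1) (n : ℕ) : (replicate x n).mass = 1 := by
  induction n with
  | zero => exact mass_pure _
  | succ n ih =>
    rw [replicate]
    exact mass_bind_eq hx fun a _ => mass_bind_eq ih fun l _ => mass_pure _

theorem cost_replicate_le {X : Type} {x : Run X} (hx : x.mass = 1) (n : ℕ) :
    (replicate x n).cost ≤ n * x.cost := by
  induction n with
  | zero => rw [replicate, cost_eq_ert, ert_pure]; exact zero_le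
  | succ n ih =>
    rw [replicate, cost_eq_ert]
    refine (ert_bind_le (fun a _ => (mass_bind_eq (mass_replicate hx n) fun l _ => mass_pure _).le) _).trans ?_
    have : ∀ a, ert (replicate x n >>= fun l => pure (a :: l)) (fun _ => 0) ≤ n * x.cost := by
      intro a
      refine (ert_bind_le (fun l _ => (mass_pure _).le) _).trans ?_
      simp only [ert_pure]
      rwa [← cost_eq_ert]
    refine (ert_mono _ this).trans ((ert_const_le _ hx.le _).trans_eq ?_)
    push_cast; ring

theorem law_replicate {X : Type} (x : Run X) (n : ℕ) (l : List X) :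
    (replicate x n).law l = if l.length = n then (l.map x.law).prod else 0 := by
  induction n generalizing l with
  | zero =>
    rw [replicate, law_pure]
    rcases l with _ | ⟨a, l⟩ <;> simp
  | succ n ih =>
    rw [replicate, law_bind]
    rcases l with _ | ⟨a, l⟩
    · rw [if_neg (by simp)]
      simp only [ENNReal.tsum_eq_zero, mul_eq_zero]
      refine fun a => Or.inr ?_
      rw [law_bind]
      simp [law_pure]
    · rw [tsum_eq_single a]
      · rw [law_bind, tsum_eq_single l]
        · rw [law_pure_self, mul_one, ih]
          simp
        · intro l' hl
          rw [law_pure_of_ne (by simp [hl.symm]), mul_zero]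
      · intro a' ha
        rw [law_bind, mul_eq_zero]
        right
        simp only [ENNReal.tsum_eq_zero, mul_eq_zero]
        exact fun l' => Or.inr (law_pure_of_ne (by simp [ha.symm]))

end Run

/-- The word obtained by interleaving two lists. -/
def merge {X : Type} : List Bool → List X → List X → List X
  | true :: ν, a :: s, t => a :: merge ν s t
  | false :: ν, s, b :: t => b :: merge ν s t
  | _, _, _ => []

open scoped Classical in
theorem law_interleave {X : Type} (ν : List Bool) (s t w : List X) :
    (interleave ν s t).law w = if w = merge ν s t then 1 else 0 := by
  induction ν generalizing s t w with
  | nil => simp only [interleave, merge, Run.law_pure]; congr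
  | cons x ν ih =>
    have aux : ∀ (a : X) (s t : List X),
        (Run.tick 1 >>= fun _ => interleave ν s t >>= fun l => pure (a :: l)).law w =
        if w = a :: merge ν s t then 1 else 0 := by
      intro a s t
      rw [Run.law_tick_bind, Run.law_bind, tsum_eq_single (merge ν s t)]
      · rw [ih, if_pos rfl, one_mul, Run.law_pure]; congr
      · intro l hl
        rw [ih, if_neg hl, zero_mul]
    cases x
    · rcases t with _ | ⟨b, t⟩
      · simp only [interleave, merge, Run.law_pure]; congr
      · simp only [interleave, merge]
        rw [aux]; congr
    · rcases s with _ | ⟨b, s⟩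
      · simp only [interleave, merge, Run.law_pure]; congr
      · simp only [interleave, merge]
        rw [aux]; congr

theorem mass_interleave {X : Type} (ν : List Bool) (s t : List X) : (interleave ν s t).mass = 1 := by
  classical
  simp only [Run.mass, law_interleave, tsum_ite_eq]

theorem ert_interleave_le {X : Type} (ν : List Bool) (s t : List X) (φ : List X → ℝ≥0∞) :
    Run.ert (interleave ν s t) φ ≤ ν.length + φ (merge ν s t) := by
  induction ν generalizing s t φ with
  | nil => simp [interleave, merge, Run.ert_pure]
  | cons x ν ih =>
    have aux : ∀ (a : X) (s t : List X),
        Run.ert (Run.tick 1 >>= fun _ => interleave ν s t >>= fun l => pure (a :: l)) φ ≤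
        (ν.length + 1 : ℕ) + φ (a :: merge ν s t) := by
      intro a s t
      refine (Run.ert_tick_bind_le 1 ?_ _).trans ?_
      · exact (Run.mass_bind_eq (mass_interleave _ _ _) fun l _ => Run.mass_pure _).le
      · refine (add_le_add le_rfl (Run.ert_bind_le (fun l _ => (Run.mass_pure _).le) _)).trans ?_
        simp only [Run.ert_pure]
        refine (add_le_add le_rfl (ih s t _)).trans_eq ?_
        push_cast; ring
    cases x
    · rcases t with _ | ⟨b, t⟩
      · simp [interleave, merge, Run.ert_pure]
      · simp only [interleave, merge, List.length_cons]
        exact aux _ _ _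
    · rcases s with _ | ⟨b, s⟩
      · simp [interleave, merge, Run.ert_pure]
      · simp only [interleave, merge, List.length_cons]
        exact aux _ _ _

theorem length_merge_le {X : Type} (ν : List Bool) (s t : List X) : (merge ν s t).length ≤ ν.length := by
  induction ν generalizing s t with
  | nil => simp [merge]
  | cons x ν ih =>
    cases x
    · rcases t with _ | ⟨b, t⟩
      · simp [merge]
      · simp only [merge, List.length_cons]; exact Nat.succ_le_succ (ih _ _)
    · rcases s with _ | ⟨b, s⟩
      · simp [merge]
      · simp only [merge, List.length_cons]; exact Nat.succ_le_succ (ih _ _)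

/-- The triples of which a given word is the interleaving, when the entries of the two lists are told
apart by a predicate. -/
theorem merge_eq_iff {X : Type} (p : X → Bool) (ν : List Bool) (s t w : List X)
    (hs : ∀ a ∈ s, p a = true) (ht : ∀ a ∈ t, p a = false) (h1 : ν.count true = s.length)
    (h2 : ν.count false = t.length) :
    w = merge ν s t ↔ s = w.filter p ∧ t = w.filter (fun a => !p a) ∧ ν = w.map p := by
  induction ν generalizing s t w with
  | nil =>
    have e1 : s = [] := List.length_eq_zero_iff.1 (by simpa using h1.symm)
    have e2 : t = [] := List.length_eq_zero_iff.1 (by simpa using h2.symm)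
    subst e1 e2
    rcases w with _ | ⟨a, w⟩ <;> simp [merge]
  | cons x ν ih =>
    cases x
    · rcases t with _ | ⟨b, t⟩
      · simp at h2
      · have hb : p b = false := ht b (by simp)
        have := fun w => ih s t w hs (fun a ha => ht a (by simp [ha])) (by simpa using h1) (by simpa using h2)
        simp only [merge]
        rcases w with _ | ⟨a, w⟩
        · simp
        · constructor
          · intro h
            rw [List.cons.injEq] at h
            obtain ⟨rfl, h⟩ := h
            obtain ⟨i1, i2, i3⟩ := (this w).1 h
            simp [hb, ← i1, ← i2, ← i3]
          · rintro ⟨i1, i2, i3⟩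
            rw [List.map_cons, List.cons.injEq] at i3
            rw [List.filter_cons_of_neg (by simp [← i3.1])] at i1
            rw [List.filter_cons_of_pos (by simp [← i3.1]), List.cons.injEq] at i2
            rw [List.cons.injEq]
            exact ⟨i2.1.symm, (this w).2 ⟨i1, i2.2, i3.2⟩⟩
    · rcases s with _ | ⟨b, s⟩
      · simp at h1
      · have hb : p b = true := hs b (by simp)
        have := fun w => ih s t w (fun a ha => hs a (by simp [ha])) ht (by simpa using h1) (by simpa using h2)
        simp only [merge]
        rcases w with _ | ⟨a, w⟩
        · simp
        · constructor
          · intro h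
            rw [List.cons.injEq] at h
            obtain ⟨rfl, h⟩ := h
            obtain ⟨i1, i2, i3⟩ := (this w).1 h
            simp [hb, ← i1, ← i2, ← i3]
          · rintro ⟨i1, i2, i3⟩
            rw [List.map_cons, List.cons.injEq] at i3
            rw [List.filter_cons_of_pos (by simp [← i3.1]), List.cons.injEq] at i1
            rw [List.filter_cons_of_neg (by simp [← i3.1])] at i2
            rw [List.cons.injEq]
            exact ⟨i1.1.symm, (this w).2 ⟨i1.2, i2, i3.2⟩⟩

end CF

/-! ### Final pieces and the other ones -/

namespace CF

variable {m : ℕ}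

theorem exists_v0 {S : Spec m} (haper : Aperiodic S) :
    ∃ t : Piece m 0, 0 < t.weight S ∧ t.zl = v0 S ∧ t.al = 0 := by
  obtain ⟨t, h1, h2⟩ := exists_piece_al_zero haper
  exact Nat.sInf_mem (s := {v | ∃ t : Piece m 0, 0 < t.weight S ∧ t.zl = v ∧ t.al = 0})
    ⟨t.zl, t, h1, rfl, h2⟩

theorem v0_le {S : Spec m} {t : Piece m 0} (ht : 0 < t.weight S) (h : t.al = 0) : v0 S ≤ t.zl :=
  Nat.sInf_le ⟨t, ht, rfl, h⟩

theorem one_le_v0 {S : Spec m} (haper : Aperiodic S) : 1 ≤ v0 S := by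
  obtain ⟨t, h1, h2, h3⟩ := exists_v0 haper
  have := t.one_le_leaves h1
  omega

theorem tilde_add (S : Spec m) (x y : ℤ × ℤ) : tilde S (x + y) = tilde S x + tilde S y := by
  simp only [tilde, Prod.fst_add, Prod.snd_add]; ring

theorem tilde_zero (S : Spec m) : tilde S 0 = 0 := by simp [tilde]

/-- The choice of `v_0` makes the walk monotone in the direction `ũ`. -/
theorem one_le_tilde {S : Spec m} (haper : Aperiodic S) {t : Piece m 0} (ht : 0 < t.weight S)
    (hf : ¬ IsFinal S t) : 1 ≤ tilde S t.vec := by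
  have h0 := one_le_v0 haper
  simp only [tilde, Piece.vec]
  rcases Nat.lt_trichotomy t.al 1 with h | h | h
  · have h : t.al = 0 := by omega
    have h1 := v0_le ht h
    have h2 : t.zl ≠ v0 S := fun h2 => hf ⟨h2, h⟩
    rw [h]; push_cast; omega
  · have h1 : t.zl ≠ 0 := fun h1 => t.not_unit ht ⟨h1, h⟩
    rw [h]; push_cast; omega
  · have : (1 : ℤ) ≤ (v0 S : ℤ) * ((t.al : ℤ) - 1) := by
      have a1 : (1 : ℤ) ≤ v0 S := by exact_mod_cast h0
      have a2 : (1 : ℤ) ≤ (t.al : ℤ) - 1 := by omega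
      nlinarith
    have : (0 : ℤ) ≤ t.zl := Int.natCast_nonneg _
    omega

theorem tilde_final {S : Spec m} {t : Piece m 0} (hf : IsFinal S t) : tilde S t.vec = 0 := by
  simp only [tilde, Piece.vec, hf.1, hf.2]; push_cast; ring

open scoped Classical in
/-- The weights of the pieces outside `𝒯_{v_0,0}`, normalised by the critical point: their sum is
`A_≠`. -/
def stepW (S : Spec m) (ζ θ : ℝ) (t : Piece m 0) : ℝ :=
  if IsFinal S t then 0 else t.weight S * ζ ^ t.zl * θ ^ t.al / θ

theorem stepW_of_not {S : Spec m} {ζ θ : ℝ} {t : Piece m 0} (h : ¬ IsFinal S t) :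
    stepW S ζ θ t = t.weight S * ζ ^ t.zl * θ ^ t.al / θ := if_neg h

theorem stepW_nonneg {S : Spec m} {ζ θ : ℝ} (hζ : 0 < ζ) (hθ : 0 < θ) (t : Piece m 0) :
    0 ≤ stepW S ζ θ t := by
  rw [stepW]
  split_ifs
  · exact le_rfl
  · exact div_nonneg (term_nonneg S hζ.le hθ.le t) hθ.le

theorem stepW_pos_iff {S : Spec m} {ζ θ : ℝ} (hζ : 0 < ζ) (hθ : 0 < θ) {t : Piece m 0} :
    0 < stepW S ζ θ t ↔ 0 < t.weight S ∧ ¬ IsFinal S t := by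
  constructor
  · intro h
    rw [stepW] at h
    split_ifs at h with hf
    · exact absurd h (lt_irrefl _)
    · refine ⟨lt_of_le_of_ne (t.weight_nonneg S) fun h0 => ?_, hf⟩
      rw [← h0] at h; simp at h
  · rintro ⟨h1, h2⟩
    rw [stepW_of_not h2]; positivity

theorem one_le_tilde_of_stepW {S : Spec m} (haper : Aperiodic S) {ζ θ : ℝ} (hζ : 0 < ζ) (hθ : 0 < θ)
    {t : Piece m 0} (h : stepW S ζ θ t ≠ 0) : 1 ≤ tilde S t.vec := by
  have := (stepW_pos_iff hζ hθ).1 (lt_of_le_of_ne (stepW_nonneg hζ hθ t) (Ne.symm h))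
  exact one_le_tilde haper this.1 this.2

theorem length_le_tilde {S : Spec m} (l : List (Piece m 0)) (h : ∀ t ∈ l, 1 ≤ tilde S t.vec) :
    (l.length : ℤ) ≤ tilde S (endpoint l) := by
  induction l with
  | nil => simp [endpoint_nil, tilde_zero]
  | cons t l ih =>
    rw [endpoint_cons, tilde_add, List.length_cons]
    have h1 := h t (by simp)
    have h2 := ih fun t ht => h t (by simp [ht])
    push_cast; omega

open scoped Classical in
theorem hasSum_final {S : Spec m} {z u : ℝ} (hz : 0 < z) (hu : 0 < u) (h : Ye S 0 z u ≠ ⊤) :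
    HasSum (fun t : Piece m 0 => if IsFinal S t then t.weight S else 0) (T0 S) := by
  refine Summable.hasSum ?_
  have hs := summable_of_Ye S hz.le hu.le h
  refine Summable.of_nonneg_of_le (fun t => ?_) (fun t => ?_) (hs.mul_right (z ^ v0 S)⁻¹)
  · split_ifs
    · exact t.weight_nonneg S
    · exact le_rfl
  · have hz' : 0 < z ^ v0 S := pow_pos hz _
    split_ifs with hf
    · rw [hf.1, hf.2, pow_zero, mul_one, mul_assoc, mul_inv_cancel₀ hz'.ne', mul_one]
    · exact mul_nonneg (term_nonneg S hz.le hu.le t) (inv_pos.2 hz').le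

open scoped Classical in
theorem hasSum_notFinal {S : Spec m} {z u : ℝ} (hz : 0 < z) (hu : 0 < u) (h : Ye S 0 z u ≠ ⊤) :
    HasSum (fun t : Piece m 0 => if IsFinal S t then 0 else t.weight S * z ^ t.zl * u ^ t.al)
      (Y S 0 z u - T0 S * z ^ v0 S) := by
  have h1 := ((summable_of_Ye S hz.le hu.le h).hasSum).sub ((hasSum_final hz hu h).mul_right (z ^ v0 S))
  refine (congrArg (HasSum · _) (funext fun t => ?_)).mpr h1
  split_ifs with hf
  · rw [hf.1, hf.2]; ring
  · ring

theorem T0_pos {S : Spec m} (haper : Aperiodic S) {z u : ℝ} (hz : 0 < z) (hu : 0 < u)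
    (h : Ye S 0 z u ≠ ⊤) : 0 < T0 S := by
  classical
  obtain ⟨t, h1, h2, h3⟩ := exists_v0 haper
  have hs := hasSum_final hz hu h
  have := le_hasSum hs t fun t _ => by
    split_ifs
    · exact t.weight_nonneg S
    · exact le_rfl
  rw [if_pos ⟨h2, h3⟩] at this
  exact h1.trans_le this

theorem IsCritical.Ye_ne_top {S : Spec m} {ζ θ : ℝ} (hc : IsCritical S ζ θ) : Ye S 0 ζ θ ≠ ⊤ :=
  Ye_ne_top_of_pos S hc.1.le hc.2.1.le (by rw [hc.Y_eq]; exact hc.2.1)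

/-- At a critical point the mean of `ℓ` is `1`, hence some piece of positive weight has `ℓ ≥ 2`. -/
theorem IsCritical.exists_two_le {S : Spec m} (haper : Aperiodic S) {ζ θ : ℝ} (hc : IsCritical S ζ θ) :
    ∃ t : Piece m 0, 0 < t.weight S ∧ 2 ≤ t.al := by
  by_contra hcon
  push Not at hcon
  obtain ⟨hs, h1⟩ := hc.sum_al
  have hY := hc.Y_eq
  have hζ := hc.1
  have hθ := hc.2.1
  rw [Y] at hY
  obtain ⟨t₀, ht₀, h0⟩ := exists_piece_al_zero haper
  have hlt : ∑' t : Piece m 0, θ * (t.weight S * ζ ^ t.zl * (t.al * θ ^ (t.al - 1))) <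
      ∑' t : Piece m 0, t.weight S * ζ ^ t.zl * θ ^ t.al := by
    refine Summable.tsum_lt_tsum (i := t₀) (fun t => ?_) ?_ (hs.mul_left θ) hc.summable
    · rcases (t.weight_nonneg S).eq_or_lt with h | h
      · simp [← h]
      · have := hcon t h
        have hW : 0 ≤ t.weight S * ζ ^ t.zl := by positivity
        interval_cases t.al
        · simp [hW]
        · simp [mul_comm]
    · rw [h0]; simp; positivity
  rw [tsum_mul_left, h1, hY, mul_one] at hlt
  exact lt_irrefl _ hlt

namespace Setup

variable (P : Setup m)

/-- The conditions under which the algorithm is well defined. -/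
structure Reg : Prop where
  aper : Aperiodic P.S
  crit : IsCritical P.S P.ζ P.θ
  fin : ∀ a β, Ye P.S β (P.z a) (P.u a) ≠ ⊤
  lt : v0 P.S < P.n
  κ_pos : 0 < P.κ

/-- The normalised weights of the pieces outside `𝒯_{v_0,0}`. -/
abbrev w (t : Piece m 0) : ℝ := stepW P.S P.ζ P.θ t

variable {P}

namespace Reg

variable (h : P.Reg)
include h

theorem ζ_pos : 0 < P.ζ := h.crit.1
theorem θ_pos : 0 < P.θ := h.crit.2.1
theorem z_pos (a : Bool) : 0 < P.z a := mul_pos h.ζ_pos (Real.exp_pos _)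
theorem u_pos (a : Bool) : 0 < P.u a := mul_pos h.θ_pos (Real.exp_pos _)
theorem w_nonneg (t : Piece m 0) : 0 ≤ P.w t := stepW_nonneg h.ζ_pos h.θ_pos t

theorem T0_pos : 0 < T0 P.S := CF.T0_pos h.aper h.ζ_pos h.θ_pos h.crit.Ye_ne_top

theorem A0_pos : 0 < P.A0 := by
  have := h.T0_pos; have := h.ζ_pos; have := h.θ_pos
  rw [A0]; positivity

theorem Ane_eq : P.Ane = 1 - P.A0 := by rw [Ane, h.crit.2.2.1]

theorem hasSum_w : HasSum P.w P.Ane := by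
  have h1 := (hasSum_notFinal h.ζ_pos h.θ_pos h.crit.Ye_ne_top).div_const P.θ
  have e : (Y P.S 0 P.ζ P.θ - T0 P.S * P.ζ ^ v0 P.S) / P.θ = P.Ane := by rw [Ane, A0, sub_div]
  rw [e] at h1
  refine (congrArg (HasSum · _) (funext fun t => ?_)).mpr h1
  simp only [w, stepW]; split_ifs <;> simp

theorem exists_w_pos : ∃ t, 0 < P.w t ∧ 2 ≤ t.al := by
  obtain ⟨t, h1, h2⟩ := h.crit.exists_two_le h.aper
  refine ⟨t, (stepW_pos_iff h.ζ_pos h.θ_pos).2 ⟨h1, fun hf => ?_⟩, h2⟩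
  rw [hf.2] at h2; omega

theorem Ane_pos : 0 < P.Ane := by
  obtain ⟨t, h1, -⟩ := h.exists_w_pos
  exact h1.trans_le (le_hasSum h.hasSum_w t fun t _ => h.w_nonneg t)

theorem one_le_tilde {t : Piece m 0} (ht : P.w t ≠ 0) : 1 ≤ tilde P.S t.vec :=
  one_le_tilde_of_stepW h.aper h.ζ_pos h.θ_pos ht

/-- The weights at the shifted parameters are obtained by an exponential tilting in the direction
`ũ`. -/
theorem tilt (a : Bool) (t : Piece m 0) : t.weight P.S * P.z a ^ t.zl * P.u a ^ t.al / P.u a =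
    t.weight P.S * P.ζ ^ t.zl * P.θ ^ t.al / P.θ * Real.exp (P.ξ a * tilde P.S t.vec) := by
  have e : Real.exp (P.ξ a * tilde P.S t.vec) = Real.exp (P.ξ a) ^ t.zl *
      Real.exp (v0 P.S * P.ξ a) ^ t.al / Real.exp (v0 P.S * P.ξ a) := by
    rw [← Real.exp_nat_mul, ← Real.exp_nat_mul, ← Real.exp_add, ← Real.exp_sub]
    congr 1
    simp only [tilde, Piece.vec]; push_cast; ring
  rw [e, z, u, mul_pow, mul_pow]
  have := h.θ_pos.ne'
  field_simp

theorem hasSum_tilt (a : Bool) :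
    HasSum (fun t => P.w t * Real.exp (P.ξ a * tilde P.S t.vec)) (P.massNe a) := by
  have h1 := (hasSum_notFinal (h.z_pos a) (h.u_pos a) (h.fin a 0)).div_const (P.u a)
  rw [sub_div] at h1
  refine (congrArg (HasSum · _) (funext fun t => ?_)).mpr h1
  simp only [w, stepW]
  split_ifs
  · simp
  · rw [h.tilt]

theorem massNe_pos (a : Bool) : 0 < P.massNe a := by
  obtain ⟨t, h1, -⟩ := h.exists_w_pos
  have := le_hasSum (h.hasSum_tilt a) t fun t _ => mul_nonneg (h.w_nonneg t) (Real.exp_pos _).le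
  exact lt_of_lt_of_le (mul_pos h1 (Real.exp_pos _)) this

theorem sum_massNe_pos : 0 < ∑ b, P.massNe b := Finset.sum_pos (fun b _ => h.massNe_pos b) (by simp)

theorem probTilde_eq (a : Bool) : P.probTilde a = P.Ane / ∑ b, P.massNe b := by
  have := (h.massNe_pos a).ne'
  rw [probTilde, prob]; field_simp

theorem F_eq (x : ℤ) : P.F x = P.Ane / (∑ b, P.massNe b) * ∑ a, Real.exp (P.ξ a * x) := by
  simp only [F, h.probTilde_eq, Finset.mul_sum]

theorem F_pos (x : ℤ) : 0 < P.F x := by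
  rw [h.F_eq]
  have := h.Ane_pos; have := h.sum_massNe_pos
  have : 0 < ∑ a, Real.exp (P.ξ a * x) := Finset.sum_pos (fun b _ => Real.exp_pos _) (by simp)
  positivity

theorem muNeAt_eq (a : Bool) (t : Piece m 0) :
    P.muNeAt a t = P.w t * Real.exp (P.ξ a * tilde P.S t.vec) / P.massNe a := by
  rw [muNeAt, w, stepW]
  split_ifs
  · simp
  · rw [← h.tilt, zpow_sub_one₀ (h.u_pos a).ne', zpow_natCast]; ring

theorem muNe_eq (t : Piece m 0) : P.muNe t = P.w t * P.F (tilde P.S t.vec) / P.Ane := by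
  have h1 := h.Ane_pos.ne'
  have h2 := h.sum_massNe_pos.ne'
  simp only [muNe, prob, h.muNeAt_eq, h.F_eq]
  rw [Fintype.sum_bool, Fintype.sum_bool] at *
  have h3 := (h.massNe_pos true).ne'
  have h4 := (h.massNe_pos false).ne'
  rw [Fintype.sum_bool]
  field_simp

theorem muNe_nonneg (t : Piece m 0) : 0 ≤ P.muNe t := by
  rw [h.muNe_eq]
  exact div_nonneg (mul_nonneg (h.w_nonneg t) (h.F_pos _).le) h.Ane_pos.le

theorem muNe_ne_zero {t : Piece m 0} (ht : P.muNe t ≠ 0) : P.w t ≠ 0 := by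
  rw [h.muNe_eq] at ht
  intro h0; rw [h0] at ht; simp at ht

theorem prob_nonneg (a : Bool) : 0 ≤ P.prob a := div_nonneg (h.massNe_pos a).le h.sum_massNe_pos.le

theorem mass_draw_prob : (Run.draw P.prob).mass = 1 := by
  have h2 := h.sum_massNe_pos
  rw [Run.mass_draw, tsum_fintype, ← ENNReal.ofReal_sum_of_nonneg fun a _ => h.prob_nonneg a]
  simp only [prob]
  rw [← Finset.sum_div, div_self h2.ne', ENNReal.ofReal_one]

theorem Y_pos' (a : Bool) (β : Fin (m + 1)) : 0 < Y P.S β (P.z a) (P.u a) :=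
  Y_pos h.aper (h.z_pos a) (h.u_pos a) (h.fin a β)

end Reg

open scoped Classical in
/-- The body of the loop of the single piece sampler. -/
def stepBody (P : Setup m) (a : Bool) : Run (Unit ⊕ Piece m 0) := do
  let t ← rewrite P.S (P.z a) (P.u a)
  Run.tick 1
  pure (if IsFinal P.S t then .inl () else .inr t)

theorem step_eq : P.step = (Run.draw P.prob >>= fun a => Run.loop (fun _ : Unit => P.stepBody a) ()) :=
  rfl

namespace Reg

variable (h : P.Reg)
include h

theorem mass_stepBody (a : Bool) : (P.stepBody a).mass = 1 := by
  refine Run.mass_bind_eq (mass_rewrite P.S (h.z_pos a).le (h.u_pos a).le (h.Y_pos' a)) fun t _ => ?_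
  rw [Run.mass_tick_bind, Run.mass_pure]

theorem law_stepBody (a : Bool) (t : Piece m 0) : (P.stepBody a).law (.inr t) =
    ENNReal.ofReal (P.muNeAt a t * (P.massNe a * P.u a / Y P.S 0 (P.z a) (P.u a))) := by
  classical
  rw [stepBody, Run.law_bind, tsum_eq_single t]
  · rw [Run.law_tick_bind, Run.law_pure, muNeAt]
    by_cases hf : IsFinal P.S t
    · simp [hf]
    · rw [if_neg hf, if_neg hf, if_pos rfl, mul_one,
        law_rewrite P.S (h.z_pos a).le (h.u_pos a).le fun β => (h.Y_pos' a β).ne', boltz]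
      congr 1
      have h1 := (h.massNe_pos a).ne'
      have h2 := (h.u_pos a).ne'
      rw [zpow_sub_one₀ h2, zpow_natCast]
      field_simp
  · intro t' ht'
    rw [Run.law_tick_bind, Run.law_pure_of_ne, mul_zero]
    split_ifs
    · simp
    · simpa using ht'.symm

theorem tsum_muNeAt (a : Bool) : ∑' t, ENNReal.ofReal (P.muNeAt a t) = 1 := by
  have h1 := (h.hasSum_tilt a).div_const (P.massNe a)
  rw [div_self (h.massNe_pos a).ne'] at h1
  have h2 : ∀ t, 0 ≤ P.muNeAt a t := fun t => by
    rw [h.muNeAt_eq]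
    exact div_nonneg (mul_nonneg (h.w_nonneg t) (Real.exp_pos _).le) (h.massNe_pos a).le
  simp only [← h.muNeAt_eq] at h1
  rw [← ENNReal.ofReal_tsum_of_nonneg h2 h1.summable, h1.tsum_eq, ENNReal.ofReal_one]

theorem law_stepLoop (a : Bool) (t : Piece m 0) :
    (Run.loop (fun _ : Unit => P.stepBody a) ()).law t = ENNReal.ofReal (P.muNeAt a t) := by
  rw [Run.law_loop_unit _ (h.mass_stepBody a)]
  simp only [h.law_stepBody]
  have h1 : 0 < P.massNe a * P.u a / Y P.S 0 (P.z a) (P.u a) :=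
    div_pos (mul_pos (h.massNe_pos a) (h.u_pos a)) (h.Y_pos' a 0)
  simp only [ENNReal.ofReal_mul' h1.le]
  rw [ENNReal.tsum_mul_right, h.tsum_muNeAt, one_mul, ENNReal.mul_div_cancel_right]
  · simpa using h1
  · exact ENNReal.ofReal_ne_top

theorem law_step (t : Piece m 0) : P.step.law t = ENNReal.ofReal (P.muNe t) := by
  have h2 : ∀ a, 0 ≤ P.muNeAt a t := fun a => by
    rw [h.muNeAt_eq]
    exact div_nonneg (mul_nonneg (h.w_nonneg t) (Real.exp_pos _).le) (h.massNe_pos a).le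
  rw [step_eq, Run.law_bind, tsum_fintype, muNe,
    ENNReal.ofReal_sum_of_nonneg fun a _ => mul_nonneg (h.prob_nonneg a) (h2 a)]
  refine Finset.sum_congr rfl fun a _ => ?_
  rw [Run.law_draw, h.law_stepLoop, ENNReal.ofReal_mul (h.prob_nonneg a)]

theorem mass_step : P.step.mass = 1 := by
  rw [step_eq]
  refine Run.mass_bind_eq h.mass_draw_prob fun a _ => ?_
  simp only [Run.mass, h.law_stepLoop, h.tsum_muNeAt]

theorem tilde_of_step {t : Piece m 0} (ht : P.step.law t ≠ 0) : 1 ≤ tilde P.S t.vec := by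
  rw [h.law_step] at ht
  refine h.one_le_tilde (h.muNe_ne_zero fun h0 => ht ?_)
  rw [h0, ENNReal.ofReal_zero]

end Reg

end Setup

end CF

/-! ### The laws of the walk and of the outputs -/

namespace CF

variable {m : ℕ}

namespace Setup

variable (P : Setup m)

open scoped Classical in
/-- The body of the loop of the walk. -/
def walkBody (s : List (Piece m 0) × (ℤ × ℤ)) :
    Run ((List (Piece m 0) × (ℤ × ℤ)) ⊕ (List (Piece m 0) × (ℤ × ℤ))) := do
  Run.tick 1
  if s.2 ∈ finalRegion P.S P.n then pure (.inr s)
  else do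
    let t ← P.step
    Run.tick 1
    pure (.inl (s.1 ++ [t], s.2 + t.vec))

theorem walk_eq : P.walk = Run.loop P.walkBody ([], 0) := rfl

theorem walkBody_of_mem {s : List (Piece m 0) × (ℤ × ℤ)} (hs : s.2 ∈ finalRegion P.S P.n) :
    P.walkBody s = (Run.tick 1 >>= fun _ => pure (.inr s)) := by
  rw [walkBody]; simp only [if_pos hs]

theorem walkBody_of_notMem {s : List (Piece m 0) × (ℤ × ℤ)} (hs : s.2 ∉ finalRegion P.S P.n) :
    P.walkBody s = (Run.tick 1 >>= fun _ => P.step >>= fun t => Run.tick 1 >>= fun _ =>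
      pure (.inl (s.1 ++ [t], s.2 + t.vec))) := by
  rw [walkBody]; simp only [if_neg hs]

/-- The distance to the final region. -/
def gap (s : List (Piece m 0) × (ℤ × ℤ)) : ℕ := ((P.n : ℤ) - v0 P.S - tilde P.S s.2).toNat

open scoped Classical in
/-- The probability that the walk started at `p` follows the given list of steps and stops at its
end. -/
def walkW : ℤ × ℤ → List (Piece m 0) → ℝ≥0∞
  | p, [] => if p ∈ finalRegion P.S P.n then 1 else 0
  | p, t :: l => if p ∈ finalRegion P.S P.n then 0 else P.step.law t * walkW (p + t.vec) l

variable {P}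

namespace Reg

variable (h : P.Reg)
include h

theorem mass_walkBody (s : List (Piece m 0) × (ℤ × ℤ)) : (P.walkBody s).mass = 1 := by
  by_cases hs : s.2 ∈ finalRegion P.S P.n
  · rw [walkBody_of_mem P hs, Run.mass_tick_bind, Run.mass_pure]
  · rw [walkBody_of_notMem P hs, Run.mass_tick_bind]
    refine Run.mass_bind_eq h.mass_step fun t _ => ?_
    rw [Run.mass_tick_bind, Run.mass_pure]

theorem gap_lt {s : List (Piece m 0) × (ℤ × ℤ)} (hs : s.2 ∉ finalRegion P.S P.n) {t : Piece m 0}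
    (ht : P.step.law t ≠ 0) (l : List (Piece m 0)) : P.gap (l, s.2 + t.vec) < P.gap s := by
  have h1 := h.tilde_of_step ht
  simp only [finalRegion, Set.mem_ofPred_eq, not_le] at hs
  simp only [gap, tilde_add]
  omega

omit h in
theorem law_walkBody_inl {s s' : List (Piece m 0) × (ℤ × ℤ)} (hs : (P.walkBody s).law (.inl s') ≠ 0) :
    s.2 ∉ finalRegion P.S P.n ∧ ∃ t, P.step.law t ≠ 0 ∧ s' = (s.1 ++ [t], s.2 + t.vec) := by
  by_cases hf : s.2 ∈ finalRegion P.S P.n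
  · rw [walkBody_of_mem P hf, Run.law_tick_bind, Run.law_pure_of_ne (by simp)] at hs
    exact absurd rfl hs
  · refine ⟨hf, ?_⟩
    rw [walkBody_of_notMem P hf, Run.law_tick_bind, Run.law_bind, Ne, ENNReal.tsum_eq_zero] at hs
    push Not at hs
    obtain ⟨t, ht⟩ := hs
    refine ⟨t, left_ne_zero_of_mul ht, ?_⟩
    by_contra hne
    rw [Run.law_tick_bind, Run.law_pure_of_ne (by simpa using hne), mul_zero] at ht
    exact ht rfl

theorem mass_walk : P.walk.mass = 1 := by
  rw [walk_eq]
  refine Run.mass_loop_eq_one _ (fun s => (h.mass_walkBody s).le) (fun _ => True) P.gap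
    (fun s _ => h.mass_walkBody s) (fun s s' _ hs => ⟨trivial, ?_⟩) _ trivial
  obtain ⟨hf, t, ht, rfl⟩ := law_walkBody_inl hs
  exact h.gap_lt hf ht _

open scoped Classical in
/-- The law of the walk started at `p` after the pieces `l`: only the lists that extend `l` have a positive
probability, and the position is then determined by the list. -/
theorem law_walkLoop (N : ℕ) : ∀ (l : List (Piece m 0)) (p : ℤ × ℤ) (w : List (Piece m 0)) (x : ℤ × ℤ),
    P.gap (l, p) ≤ N → (Run.loop P.walkBody (l, p)).law (w, x) =
      if l <+: w ∧ x = p + endpoint (w.drop l.length) then P.walkW p (w.drop l.length) else 0 := by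
  induction N with
  | zero =>
    intro l p w x hN
    have hf : p ∈ finalRegion P.S P.n := by
      simp only [gap] at hN
      simp only [finalRegion, Set.mem_ofPred_eq]; omega
    rw [Run.law_loop_unfold, walkBody_of_mem P hf, Run.law_bind_assoc, Run.law_tick_bind,
      Run.law_pure_bind, Sum.elim_inr, Run.law_pure]
    by_cases hp : l <+: w
    · obtain ⟨s, rfl⟩ := hp
      rw [List.drop_left]
      rcases s with _ | ⟨t, s⟩
      · simp [walkW, hf, endpoint_nil]
      · simp [walkW, hf]
    · have : w ≠ l := fun e => hp (e ▸ List.prefix_rfl)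
      simp [hp, this]
  | succ N ih =>
    intro l p w x hN
    by_cases hf : p ∈ finalRegion P.S P.n
    · rw [Run.law_loop_unfold, walkBody_of_mem P hf, Run.law_bind_assoc, Run.law_tick_bind,
        Run.law_pure_bind, Sum.elim_inr, Run.law_pure]
      by_cases hp : l <+: w
      · obtain ⟨s, rfl⟩ := hp
        rw [List.drop_left]
        rcases s with _ | ⟨t, s⟩
        · simp [walkW, hf, endpoint_nil]
        · simp [walkW, hf]
      · have : w ≠ l := fun e => hp (e ▸ List.prefix_rfl)
        simp [hp, this]
    · rw [Run.law_loop_unfold, walkBody_of_notMem P hf, Run.law_bind_assoc, Run.law_tick_bind,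
        Run.law_bind_assoc, Run.law_bind]
      have e : ∀ t, P.step.law t * ((Run.tick 1 >>= fun _ => pure (Sum.inl (l ++ [t], p + t.vec))) >>=
          Sum.elim (Run.loop P.walkBody) pure).law (w, x) = P.step.law t *
          if l ++ [t] <+: w ∧ x = p + t.vec + endpoint (w.drop (l.length + 1)) then
            P.walkW (p + t.vec) (w.drop (l.length + 1)) else 0 := by
        intro t
        by_cases ht : P.step.law t = 0
        · rw [ht, zero_mul, zero_mul]
        · have hg := h.gap_lt (s := (l, p)) hf ht (l ++ [t])
          rw [Run.law_bind_assoc, Run.law_tick_bind, Run.law_pure_bind, Sum.elim_inl,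
            ih _ _ _ _ (by simp only at hg; omega)]
          simp
      simp only [e]
      by_cases hp : l <+: w
      · obtain ⟨s, rfl⟩ := hp
        have hd : (l ++ s).drop (l.length + 1) = s.drop 1 := by
          rw [← List.drop_drop, List.drop_left]
        simp only [List.drop_left, hd, List.prefix_append_right_inj]
        rcases s with _ | ⟨t, s⟩
        · simp [walkW, hf]
        · rw [tsum_eq_single t]
          · simp only [List.drop_succ_cons, List.drop_zero, endpoint_cons, walkW, if_neg hf,
              List.cons_prefix_cons, List.nil_prefix, and_self, true_and, add_assoc]
            simp [List.prefix_append]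
          · intro t' ht'
            simp [List.cons_prefix_cons, ht']
      · have hT : ∀ t, ¬ l ++ [t] <+: w := fun t e => hp ((List.prefix_append _ _).trans e)
        simp [hp, hT]

theorem law_walk (s : List (Piece m 0) × (ℤ × ℤ)) [Decidable (s.2 = endpoint s.1)] :
    P.walk.law s = if s.2 = endpoint s.1 then P.walkW 0 s.1 else 0 := by
  rw [walk_eq]
  obtain ⟨w, x⟩ := s
  rw [h.law_walkLoop _ _ _ _ _ le_rfl]
  simp

theorem tilde_of_prod_step {l : List (Piece m 0)} (hl : (l.map P.step.law).prod ≠ 0) :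
    (l.length : ℤ) ≤ tilde P.S (endpoint l) := by
  refine length_le_tilde l fun t ht => h.tilde_of_step fun h0 => hl ?_
  exact List.prod_eq_zero (List.mem_map.2 ⟨t, ht, h0⟩)

/-- On the landing diagonal, the stopping condition is automatic. -/
theorem walkW_eq {l : List (Piece m 0)} : ∀ {p : ℤ × ℤ},
    tilde P.S (p + endpoint l) = (P.n : ℤ) - v0 P.S → P.walkW p l = (l.map P.step.law).prod := by
  induction l with
  | nil =>
    intro p hp
    rw [endpoint_nil, add_zero] at hp
    rw [walkW, if_pos (by simp only [finalRegion, Set.mem_ofPred_eq]; omega)]; rfl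
  | cons t l ih =>
    intro p hp
    rw [endpoint_cons, ← add_assoc] at hp
    rw [walkW, List.map_cons, List.prod_cons, ih hp]
    split_ifs with hf
    · by_contra hne
      have := h.tilde_of_prod_step (l := t :: l) (by simpa using Ne.symm hne)
      rw [endpoint_cons, List.length_cons] at this
      rw [add_assoc, tilde_add] at hp
      simp only [finalRegion, Set.mem_ofPred_eq] at hf
      push_cast at this
      omega
    · rfl

theorem prod_step (l : List (Piece m 0)) :
    (l.map P.step.law).prod = ENNReal.ofReal (l.map P.muNe).prod := by
  induction l with
  | nil => simp
  | cons t l ih =>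
    rw [List.map_cons, List.prod_cons, ih, h.law_step, ← ENNReal.ofReal_mul (h.muNe_nonneg t)]
    simp

theorem law_walk_landing {s : List (Piece m 0) × (ℤ × ℤ)} (hs : s.2 ∈ landing P.S P.n)
    [Decidable (s.2 = endpoint s.1)] :
    P.walk.law s = if s.2 = endpoint s.1 then ENNReal.ofReal (s.1.map P.muNe).prod else 0 := by
  rw [h.law_walk]
  split_ifs with he
  · rw [h.walkW_eq, h.prod_step]
    rw [zero_add, ← he]; exact hs.2.2
  · rfl

/-- Summation over the walks that reach the landing diagonal. -/
theorem tsum_walk_landing (f : List (Piece m 0) × (ℤ × ℤ) → ℝ≥0∞) [∀ p, Decidable (p ∈ landing P.S P.n)] :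
    ∑' s : List (Piece m 0) × (ℤ × ℤ), (if s.2 ∈ landing P.S P.n then P.walk.law s * f s else 0) =
    ∑' l : List (Piece m 0), if endpoint l ∈ landing P.S P.n then
      ENNReal.ofReal (l.map P.muNe).prod * f (l, endpoint l) else 0 := by
  classical
  rw [ENNReal.tsum_prod']
  refine tsum_congr fun l => ?_
  rw [tsum_eq_single (endpoint l)]
  · simp only
    split_ifs with hl
    · rw [h.law_walk_landing hl, if_pos rfl]
    · rfl
  · intro p hp
    simp only
    split_ifs with hl
    · rw [h.law_walk_landing hl, if_neg hp, zero_mul]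
    · rfl

end Reg

/-! ### Rejection -/

variable (P) in
/-- The weight of a list of pieces in the accepted runs. -/
def accW (l : List (Piece m 0)) : ℝ :=
  P.K * ((Nat.factorial (l.length + ((endpoint l).2 + 1).toNat - 1) : ℝ) /
    (Nat.factorial l.length * Nat.factorial ((endpoint l).2 + 1).toNat)) *
    P.A0 ^ ((endpoint l).2 + 1).toNat * (l.map P.w).prod

theorem prod_range_choose (k q : ℕ) :
    ((List.range q).map fun i : ℕ => ((k + 1 + i : ℝ) / (1 + i))).prod =
      (Nat.factorial (k + q) : ℝ) / (Nat.factorial k * Nat.factorial q) := by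
  induction q with
  | zero => simp; rw [div_self]; exact_mod_cast (Nat.factorial_pos k).ne'
  | succ q ih =>
    rw [List.range_succ, List.map_append, List.prod_append, ih]
    have h1 : (Nat.factorial k : ℝ) ≠ 0 := by exact_mod_cast (Nat.factorial_pos k).ne'
    have h2 : (Nat.factorial q : ℝ) ≠ 0 := by exact_mod_cast (Nat.factorial_pos q).ne'
    have h3 : (1 + q : ℝ) ≠ 0 := by positivity
    rw [← add_assoc, Nat.factorial_succ, Nat.factorial_succ]
    simp
    field_simp
    ring

namespace Reg

variable (h : P.Reg)
include h

theorem K_pos : 0 < P.K := by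
  have h1 : 0 < P.n := by have := h.lt; omega
  have := h.κ_pos
  rw [K]
  have : (0 : ℝ) < (P.n : ℝ) ^ (3 / 2 : ℝ) := Real.rpow_pos_of_pos (by exact_mod_cast h1) _
  positivity

theorem prod_inv_F (l : List (Piece m 0)) :
    0 < (l.map fun s => (P.F (tilde P.S s.vec))⁻¹).prod :=
  List.prod_pos fun a ha => by
    obtain ⟨t, _, rfl⟩ := List.mem_map.1 ha
    exact inv_pos.2 (h.F_pos _)

theorem rate_pos (l : List (Piece m 0)) : 0 < P.rate l := by
  have := h.K_pos; have := h.Ane_pos; have := h.A0_pos; have := h.prod_inv_F l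
  rw [rate]
  have e : ∀ i : ℕ, 0 < (Nat.factorial i : ℝ) := fun i => by exact_mod_cast Nat.factorial_pos i
  have := e (l.length + ((endpoint l).2 + 1).toNat - 1)
  have := e l.length
  have := e ((endpoint l).2 + 1).toNat
  positivity

/-- The acceptance rate cancels the factors `F`, so that the weight of an accepted walk depends on the
weights of its pieces at the critical point only. -/
theorem prod_muNe_mul_rate (l : List (Piece m 0)) : (l.map P.muNe).prod * P.rate l = P.accW l := by
  have e : (l.map P.muNe).prod * (P.Ane ^ l.length * (l.map fun s => (P.F (tilde P.S s.vec))⁻¹).prod) =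
      (l.map P.w).prod := by
    induction l with
    | nil => simp
    | cons t l ih =>
      simp only [List.map_cons, List.prod_cons, List.length_cons, pow_succ]
      rw [← ih, h.muNe_eq]
      have h1 := h.Ane_pos.ne'
      have h2 := (h.F_pos (tilde P.S t.vec)).ne'
      field_simp
  rw [rate, accW, ← e]
  ring

theorem accW_nonneg (l : List (Piece m 0)) : 0 ≤ P.accW l := by
  rw [← h.prod_muNe_mul_rate]
  refine mul_nonneg (List.prod_nonneg fun a ha => ?_) (h.rate_pos l).le
  obtain ⟨t, _, rfl⟩ := List.mem_map.1 ha
  exact h.muNe_nonneg t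

theorem pos_of_landing {l : List (Piece m 0)} (hl : endpoint l ∈ landing P.S P.n) : l ≠ [] := by
  rintro rfl
  have := hl.2.2
  rw [endpoint_nil, tilde_zero] at this
  have := h.lt
  omega

theorem evalRate_val {l : List (Piece m 0)} (hl : endpoint l ∈ landing P.S P.n) :
    P.K * (l.map fun s => P.Ane / P.F (tilde P.S s.vec)).prod *
      ((List.range ((endpoint l).2 + 1).toNat).map
        fun i : ℕ => P.A0 * ((l.length + 1 + i : ℝ) / (1 + i))).prod /
      (l.length + ((endpoint l).2 + 1).toNat) = P.rate l := by
  set q := ((endpoint l).2 + 1).toNat with hq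
  have hk : 0 < l.length := List.length_pos_iff.2 (h.pos_of_landing hl)
  have e1 : (l.map fun s => P.Ane / P.F (tilde P.S s.vec)).prod =
      P.Ane ^ l.length * (l.map fun s => (P.F (tilde P.S s.vec))⁻¹).prod := by
    simp only [div_eq_mul_inv]
    rw [List.prod_map_mul]; simp
  have e2 : ((List.range q).map fun i : ℕ => P.A0 * ((l.length + 1 + i : ℝ) / (1 + i))).prod =
      P.A0 ^ q * ((Nat.factorial (l.length + q) : ℝ) / (Nat.factorial l.length * Nat.factorial q)) := by
    rw [List.prod_map_mul, prod_range_choose]; simp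
  have e3 : (Nat.factorial (l.length + q) : ℝ) = (l.length + q) * Nat.factorial (l.length + q - 1) := by
    rw [← Nat.mul_factorial_pred (by omega : l.length + q ≠ 0)]; push_cast; rfl
  rw [e1, e2, e3, rate, ← hq]
  have : (0 : ℝ) < l.length + q := by
    have : (0 : ℝ) < l.length := by exact_mod_cast hk
    positivity
  field_simp

theorem law_evalRate {l : List (Piece m 0)} (hl : endpoint l ∈ landing P.S P.n) (r : ℝ) :
    (P.evalRate l ((endpoint l).2 + 1).toNat).law r = if r = P.rate l then 1 else 0 := by
  rw [evalRate, Run.law_bind, tsum_eq_single (l.map fun s => P.Ane / P.F (tilde P.S s.vec)).prod]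
  · rw [Run.law_mulAll, if_pos rfl, one_mul, Run.law_bind, tsum_eq_single
      ((List.range ((endpoint l).2 + 1).toNat).map
        fun i : ℕ => P.A0 * ((l.length + 1 + i : ℝ) / (1 + i))).prod]
    · rw [Run.law_mulAll, if_pos rfl, one_mul, Run.law_tick_bind, Run.law_pure, h.evalRate_val hl]
    · intro y hy
      rw [Run.law_mulAll, if_neg hy, zero_mul]
  · intro y hy
    rw [Run.law_mulAll, if_neg hy, zero_mul]

omit h in
theorem mass_evalRate (l : List (Piece m 0)) (q : ℕ) : (P.evalRate l q).mass = 1 := by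
  rw [evalRate]
  refine Run.mass_bind_eq (Run.mass_mulAll _) fun x _ => Run.mass_bind_eq (Run.mass_mulAll _) fun y _ => ?_
  rw [Run.mass_tick_bind, Run.mass_pure]

end Reg

end Setup

end CF

namespace CF

variable {m : ℕ}

namespace Setup

variable {P : Setup m}

variable (P) in
/-- The acceptance rates of the lists that the walk may produce are probabilities. -/
def RateLe : Prop := ∀ l : List (Piece m 0), (∀ t ∈ l, P.w t ≠ 0) →
  endpoint l ∈ landing P.S P.n → P.rate l ≤ 1

variable (P) in
/-- The probability that a run of the rejection loop is accepted. -/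
def accProb : ℝ≥0∞ := ∑' s, P.trial.law (some s)

variable (P) in
/-- The part of a run of the rejection loop that comes after the walk. -/
def tail (s : List (Piece m 0) × (ℤ × ℤ)) : Run (Option (List (Piece m 0) × ℕ)) :=
  P.evalRate s.1 (s.2.2 + 1).toNat >>= fun r => Run.flip r >>= fun b =>
    pure (if b then some (s.1, (s.2.2 + 1).toNat) else none)

open scoped Classical in
theorem trial_eq : P.trial = (P.walk >>= fun s =>
    if s.2 ∈ landing P.S P.n then P.tail s else pure none) := rfl

namespace Reg

variable (h : P.Reg)
include h

theorem law_walk_ne_zero {s : List (Piece m 0) × (ℤ × ℤ)} (hs : P.walk.law s ≠ 0)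
    (hl : s.2 ∈ landing P.S P.n) : s.2 = endpoint s.1 ∧ ∀ t ∈ s.1, P.w t ≠ 0 := by
  classical
  rw [h.law_walk_landing hl] at hs
  split_ifs at hs with he
  · refine ⟨he, fun t ht h0 => hs ?_⟩
    rw [List.prod_eq_zero, ENNReal.ofReal_zero]
    exact List.mem_map.2 ⟨t, ht, by rw [h.muNe_eq, h0]; simp⟩
  · exact absurd rfl hs

open scoped Classical in
theorem law_tail {l : List (Piece m 0)} (hl : endpoint l ∈ landing P.S P.n) (hr : P.rate l ≤ 1)
    (x : List (Piece m 0) × ℕ) : (P.tail (l, endpoint l)).law (some x) =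
      if x = (l, ((endpoint l).2 + 1).toNat) then ENNReal.ofReal (P.rate l) else 0 := by
  rw [tail, Run.law_bind, tsum_eq_single (P.rate l)]
  · rw [h.law_evalRate hl, if_pos rfl, one_mul, Run.law_bind, tsum_fintype, Fintype.sum_bool,
      Run.law_flip_true hr, Run.law_pure, Run.law_pure]
    by_cases hx : x = (l, ((endpoint l).2 + 1).toNat) <;> simp [hx]
  · intro r hr'
    rw [h.law_evalRate hl, if_neg hr', zero_mul]

theorem mass_tail {l : List (Piece m 0)} (hl : endpoint l ∈ landing P.S P.n) :
    (P.tail (l, endpoint l)).mass = 1 := by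
  refine Run.mass_bind_eq (mass_evalRate _ _) fun r hr => ?_
  rw [h.law_evalRate hl] at hr
  have hr' : r = P.rate l := by by_contra hne; rw [if_neg hne] at hr; exact hr rfl
  rw [hr']
  exact Run.mass_bind_eq (Run.mass_flip (h.rate_pos l).le) fun b _ => Run.mass_pure _

theorem mass_trial : P.trial.mass = 1 := by
  classical
  rw [trial_eq]
  refine Run.mass_bind_eq h.mass_walk fun s hs => ?_
  split_ifs with hl
  · obtain ⟨he, -⟩ := h.law_walk_ne_zero hs hl
    obtain ⟨l, p⟩ := s
    simp only at he hl
    subst he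
    exact h.mass_tail hl
  · exact Run.mass_pure _

open scoped Classical in
/-- A trial returns a walk to the landing diagonal with the probability `accW`. -/
theorem law_trial (hr : P.RateLe) (x : List (Piece m 0) × ℕ) : P.trial.law (some x) =
    if endpoint x.1 ∈ landing P.S P.n ∧ x.2 = ((endpoint x.1).2 + 1).toNat then
      ENNReal.ofReal (P.accW x.1) else 0 := by
  rw [trial_eq, Run.law_bind]
  have e : ∀ s : List (Piece m 0) × (ℤ × ℤ), P.walk.law s *
      (if s.2 ∈ landing P.S P.n then P.tail s else pure none : Run _).law (some x) =
      if s.2 ∈ landing P.S P.n then P.walk.law s *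
        (if x = (s.1, (s.2.2 + 1).toNat) then ENNReal.ofReal (P.rate s.1) else 0) else 0 := by
    intro s
    by_cases hl : s.2 ∈ landing P.S P.n
    · rw [if_pos hl, if_pos hl]
      by_cases hs : P.walk.law s = 0
      · rw [hs, zero_mul, zero_mul]
      · obtain ⟨he, hw⟩ := h.law_walk_ne_zero hs hl
        obtain ⟨l, p⟩ := s
        simp only at he hl hw
        subst he
        rw [h.law_tail hl (hr l hw hl)]
    · rw [if_neg hl, if_neg hl, Run.law_pure_of_ne (by simp), mul_zero]
  simp only [e]
  rw [h.tsum_walk_landing fun s => if x = (s.1, (s.2.2 + 1).toNat) then ENNReal.ofReal (P.rate s.1) else 0]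
  rw [tsum_eq_single x.1]
  · obtain ⟨l, q⟩ := x
    simp only [Prod.mk.injEq, true_and]
    by_cases hl : endpoint l ∈ landing P.S P.n
    · by_cases hq : q = ((endpoint l).2 + 1).toNat
      · rw [if_pos hl, if_pos hq, if_pos ⟨hl, hq⟩, ← ENNReal.ofReal_mul, h.prod_muNe_mul_rate]
        refine List.prod_nonneg fun a ha => ?_
        obtain ⟨t, _, rfl⟩ := List.mem_map.1 ha
        exact h.muNe_nonneg t
      · rw [if_pos hl, if_neg hq, if_neg (fun hc => hq hc.2), mul_zero]
    · rw [if_neg hl, if_neg (fun hc => hl hc.1)]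
  · intro l hl
    have : x ≠ (l, ((endpoint l).2 + 1).toNat) := fun hx => hl (by rw [hx])
    rw [if_neg this, mul_zero, ite_self]

open scoped Classical in
theorem accProb_eq (hr : P.RateLe) : P.accProb =
    ∑' l : List (Piece m 0), if endpoint l ∈ landing P.S P.n then ENNReal.ofReal (P.accW l) else 0 := by
  simp only [accProb, h.law_trial hr]
  rw [ENNReal.tsum_prod']
  refine tsum_congr fun l => ?_
  rw [tsum_eq_single ((endpoint l).2 + 1).toNat]
  · simp
  · intro q hq
    rw [if_neg (fun hc => hq hc.2)]

theorem accProb_le : P.accProb ≤ 1 := by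
  rw [accProb, ← h.mass_trial, Run.mass]
  exact ENNReal.tsum_comp_le_tsum_of_injective (Option.some_injective _) _

omit h in
theorem mass_drawFinal (h : P.Reg) : P.drawFinal.mass = 1 := by
  classical
  rw [drawFinal, Run.mass_draw]
  have h1 := (hasSum_final h.ζ_pos h.θ_pos h.crit.Ye_ne_top).div_const (T0 P.S)
  have e : ∀ t : Piece m 0, (if IsFinal P.S t then t.weight P.S / T0 P.S else 0) =
      (if IsFinal P.S t then t.weight P.S else 0) / T0 P.S := fun t => by split_ifs <;> simp
  simp only [e]
  rw [← ENNReal.ofReal_tsum_of_nonneg _ h1.summable, h1.tsum_eq, div_self h.T0_pos.ne', ENNReal.ofReal_one]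
  intro t
  have := h.T0_pos
  have := t.weight_nonneg P.S
  split_ifs <;> positivity

open scoped Classical in
theorem prod_law_drawFinal (f : List (Piece m 0)) : (f.map P.drawFinal.law).prod =
    if ∀ t ∈ f, IsFinal P.S t then ENNReal.ofReal ((f.map (Piece.weight P.S)).prod / T0 P.S ^ f.length)
    else 0 := by
  induction f with
  | nil => simp
  | cons t f ih =>
    rw [List.map_cons, List.prod_cons, ih, drawFinal, Run.law_draw]
    by_cases ht : IsFinal P.S t
    · by_cases hf : ∀ t ∈ f, IsFinal P.S t
      · rw [if_pos ht, if_pos hf, if_pos (by simpa using ⟨ht, hf⟩), ← ENNReal.ofReal_mul]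
        · simp only [List.map_cons, List.prod_cons, List.length_cons, pow_succ]
          congr 1
          field_simp
        · exact div_nonneg (t.weight_nonneg P.S) h.T0_pos.le
      · rw [if_neg hf, mul_zero, if_neg]
        exact fun hc => hf fun t ht => hc t (by simp [ht])
    · rw [if_neg ht, ENNReal.ofReal_zero, zero_mul, if_neg]
      exact fun hc => ht (hc t (by simp))

end Reg

variable (P) in
/-- The body of the rejection loop. -/
def rejectBody : Run (Unit ⊕ (List (Piece m 0) × ℕ)) := do
  match ← P.trial with
  | some s => pure (.inr s)
  | none => pure (.inl ())

variable (P) in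
/-- The rejection loop. -/
def accepted : Run (List (Piece m 0) × ℕ) := Run.loop (fun _ : Unit => P.rejectBody) ()

theorem bridgeSampler_eq : P.bridgeSampler = (P.accepted >>= fun s =>
    Run.replicate P.drawFinal s.2 >>= fun f => bbhl s.1.length s.2 >>= fun ν =>
      interleave ν s.1 f) := rfl

theorem rejectBody_eq : P.rejectBody = (P.trial >>= fun o => pure (o.elim (.inl ()) .inr)) := by
  rw [rejectBody]
  congr 1
  funext o
  cases o <;> rfl

namespace Reg

variable (h : P.Reg)
include h

theorem mass_rejectBody : P.rejectBody.mass = 1 := by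
  rw [rejectBody_eq]
  exact Run.mass_bind_eq h.mass_trial fun o _ => Run.mass_pure _

omit h in
theorem law_rejectBody (x : List (Piece m 0) × ℕ) : P.rejectBody.law (.inr x) = P.trial.law (some x) := by
  rw [rejectBody_eq, Run.law_bind, tsum_eq_single (some x)]
  · rw [Option.elim_some, Run.law_pure_self, mul_one]
  · intro o ho
    rw [Run.law_pure_of_ne, mul_zero]
    cases o with
    | none => simp
    | some y => simpa using fun hc => ho (by rw [hc])

theorem law_accepted (x : List (Piece m 0) × ℕ) :
    P.accepted.law x = P.trial.law (some x) / P.accProb := by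
  rw [accepted, Run.law_loop_unit _ h.mass_rejectBody]
  simp only [law_rejectBody]
  rfl

theorem mass_accepted (hp : P.accProb ≠ 0) : P.accepted.mass = 1 := by
  simp only [Run.mass, h.law_accepted, div_eq_mul_inv]
  rw [ENNReal.tsum_mul_right]
  exact ENNReal.mul_inv_cancel hp (ne_top_of_le_ne_top ENNReal.one_ne_top h.accProb_le)

theorem mass_bridgeSampler (hp : P.accProb ≠ 0) : P.bridgeSampler.mass = 1 := by
  rw [bridgeSampler_eq]
  refine Run.mass_bind_eq (h.mass_accepted hp) fun s _ => ?_
  refine Run.mass_bind_eq (Run.mass_replicate (mass_drawFinal h) _) fun f _ => ?_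
  exact Run.mass_bind_eq (mass_bbhl _ _) fun ν _ => mass_interleave _ _ _

theorem law_accepted_ne_zero (hr : P.RateLe) {x : List (Piece m 0) × ℕ} (hx : P.accepted.law x ≠ 0) :
    endpoint x.1 ∈ landing P.S P.n ∧ x.2 = ((endpoint x.1).2 + 1).toNat ∧ ∀ t ∈ x.1, P.w t ≠ 0 := by
  classical
  rw [h.law_accepted, div_eq_mul_inv, h.law_trial hr] at hx
  have := left_ne_zero_of_mul hx
  split_ifs at this with hc
  · refine ⟨hc.1, hc.2, fun t ht h0 => this ?_⟩
    rw [accW, List.prod_eq_zero (List.mem_map.2 ⟨t, ht, h0⟩)]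
    simp
  · exact absurd rfl this

end Reg

theorem endpoint_final {S : Spec m} (f : List (Piece m 0)) (hf : ∀ t ∈ f, IsFinal S t) :
    endpoint f = ((f.length * v0 S : ℤ), -(f.length : ℤ)) := by
  induction f with
  | nil => simp [endpoint_nil]; rfl
  | cons t f ih =>
    rw [endpoint_cons, ih fun t ht => hf t (by simp [ht])]
    have := hf t (by simp)
    simp only [Piece.vec, this.1, this.2, List.length_cons, Prod.mk_add_mk]
    push_cast
    congr 1 <;> ring

theorem endpoint_filter (p : Piece m 0 → Bool) (t : List (Piece m 0)) :
    endpoint t = endpoint (t.filter p) + endpoint (t.filter fun a => !p a) := by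
  induction t with
  | nil => rfl
  | cons a t ih =>
    rw [endpoint_cons, ih]
    cases ha : p a
    · rw [List.filter_cons_of_neg (by simp [ha]), List.filter_cons_of_pos (by simp [ha]), endpoint_cons]
      abel
    · rw [List.filter_cons_of_pos (by simp [ha]), List.filter_cons_of_neg (by simp [ha]), endpoint_cons]
      abel

theorem prod_filter (p : Piece m 0 → Bool) (g : Piece m 0 → ℝ) (t : List (Piece m 0)) :
    (t.map g).prod = ((t.filter p).map g).prod * ((t.filter fun a => !p a).map g).prod := by
  induction t with
  | nil => simp
  | cons a t ih =>
    rw [List.map_cons, List.prod_cons, ih]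
    cases ha : p a
    · rw [List.filter_cons_of_neg (by simp [ha]), List.filter_cons_of_pos (by simp [ha])]
      simp; ring
    · rw [List.filter_cons_of_pos (by simp [ha]), List.filter_cons_of_neg (by simp [ha])]
      simp; ring

theorem length_filter_add (p : Piece m 0 → Bool) (t : List (Piece m 0)) :
    t.length = (t.filter p).length + (t.filter fun a => !p a).length := by
  induction t with
  | nil => rfl
  | cons a t ih =>
    cases ha : p a <;> simp [ha, ih] <;> omega

theorem count_map_filter (p : Piece m 0 → Bool) (t : List (Piece m 0)) :
    (t.map p).count true = (t.filter p).length ∧ (t.map p).count false = (t.filter fun a => !p a).length := by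
  induction t with
  | nil => simp
  | cons a t ih =>
    cases ha : p a <;> simp [ha, ih]

/-- A list of pieces is a bridge if and only if the list of its non-final pieces lands on the
diagonal, at the ordinate prescribed by the number of the final pieces. -/
theorem isBridge_iff {S : Spec m} {n : ℕ} {l f : List (Piece m 0)} (hf : ∀ t ∈ f, IsFinal S t) :
    endpoint l + endpoint f = ((n : ℤ), -1) ↔
      endpoint l ∈ landing S n ∧ f.length = ((endpoint l).2 + 1).toNat := by
  rw [endpoint_final f hf]
  obtain ⟨⟨x, y⟩, hxy⟩ : ∃ p, p = endpoint l := ⟨_, rfl⟩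
  have h0 : 0 ≤ x := by
    have := endpoint_fst l
    rw [← hxy] at this
    simp only at this
    omega
  rw [← hxy]
  simp only [Prod.mk_add_mk, Prod.mk.injEq, landing, Set.mem_ofPred_eq, tilde]
  constructor
  · rintro ⟨h1, h2⟩
    have hy : y = f.length - 1 := by omega
    refine ⟨⟨h0, by omega, ?_⟩, by omega⟩
    rw [hy, ← h1]; ring
  · rintro ⟨⟨-, h1, h2⟩, h3⟩
    have hy : y = f.length - 1 := by omega
    refine ⟨?_, by omega⟩
    rw [hy] at h2
    linarith

variable (P) in
/-- The common factor of the law of the output for bridges. -/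
def bridgeConst : ℝ := P.K * P.ζ ^ P.n / P.θ

namespace Reg

variable (h : P.Reg)
include h

theorem bridgeConst_pos : 0 < P.bridgeConst := by
  have := h.K_pos; have := h.ζ_pos; have := h.θ_pos
  rw [bridgeConst]; positivity

theorem prod_w {l : List (Piece m 0)} (hl : ∀ t ∈ l, ¬ IsFinal P.S t) : (l.map P.w).prod * P.θ ^ l.length =
    (l.map (Piece.weight P.S)).prod * P.ζ ^ (l.map Piece.zl).sum * P.θ ^ (l.map Piece.al).sum := by
  induction l with
  | nil => simp
  | cons t l ih =>
    have := ih fun t ht => hl t (by simp [ht])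
    simp only [List.map_cons, List.prod_cons, List.length_cons, List.sum_cons, pow_add, pow_succ]
    rw [w, stepW_of_not (hl t (by simp))]
    have hθ := h.θ_pos.ne'
    calc _ = (t.weight P.S * P.ζ ^ t.zl * P.θ ^ t.al / P.θ * P.θ) * ((l.map P.w).prod * P.θ ^ l.length) := by
          ring
      _ = _ := by rw [this]; field_simp

omit h in
theorem endpoint_snd (l : List (Piece m 0)) :
    (endpoint l).2 = ((l.map Piece.al).sum : ℕ) - (l.length : ℤ) := by
  induction l with
  | nil => rfl
  | cons t l ih => simp [endpoint_cons, ih, Piece.vec]; ring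

/-- The accepted weight of the non-final pieces, multiplied by the weight of the final ones and of
their positions, is a function of the weight of the bridge. -/
theorem accW_mul {l f : List (Piece m 0)} (hl : ∀ t ∈ l, ¬ IsFinal P.S t)
    (hland : endpoint l ∈ landing P.S P.n) (hf : f.length = ((endpoint l).2 + 1).toNat) :
    P.accW l * ((f.map (Piece.weight P.S)).prod / T0 P.S ^ f.length) *
      (((l.length + f.length).choose l.length : ℕ) : ℝ)⁻¹ =
    P.bridgeConst * ((l.map (Piece.weight P.S)).prod * (f.map (Piece.weight P.S)).prod) /
      (l.length + f.length : ℕ) := by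
  have hk : 0 < l.length := List.length_pos_iff.2 (h.pos_of_landing hland)
  have hζ := h.ζ_pos.ne'
  have hθ := h.θ_pos.ne'
  have hT := h.T0_pos.ne'
  rw [accW, ← hf]
  set k := l.length
  set q := f.length
  have hsnd := endpoint_snd l
  have hfst := endpoint_fst l
  obtain ⟨-, h2, h3⟩ := hland
  simp only [tilde] at h3
  set V := (l.map Piece.zl).sum
  set L := (l.map Piece.al).sum
  have e1 : L + 1 = q + k := by omega
  have e2 : V + v0 P.S * q = P.n := by
    have e3 : (endpoint l).2 = (q : ℤ) - 1 := by omega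
    rw [hfst, e3] at h3
    zify
    linarith
  have hw := h.prod_w hl
  have hwe : (l.map P.w).prod = (l.map (Piece.weight P.S)).prod * P.ζ ^ V * P.θ ^ q / P.θ := by
    have e4 : P.θ ^ L * P.θ = P.θ ^ q * P.θ ^ k := by rw [← pow_succ, e1, pow_add]
    have hk' : P.θ ^ k ≠ 0 := pow_ne_zero _ hθ
    rw [eq_div_iff hθ]
    apply mul_right_cancel₀ hk'
    calc _ = ((l.map P.w).prod * P.θ ^ k) * P.θ := by ring
      _ = (l.map (Piece.weight P.S)).prod * P.ζ ^ V * (P.θ ^ L * P.θ) := by rw [hw]; ring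
      _ = _ := by rw [e4]; ring
  have hA : P.A0 ^ q = T0 P.S ^ q * P.ζ ^ (v0 P.S * q) / P.θ ^ q := by
    rw [A0, div_pow, mul_pow, pow_mul]
  have hch : (((k + q).choose k : ℕ) : ℝ) * (Nat.factorial k * Nat.factorial q) =
      (k + q : ℕ) * Nat.factorial (k + q - 1) := by
    have := Nat.add_choose_mul_factorial_mul_factorial k q
    rw [← Nat.mul_factorial_pred (by omega : k + q ≠ 0), ← Nat.choose_symm_add] at this
    rw [← mul_assoc]
    exact_mod_cast this
  have hc0 : (((k + q).choose k : ℕ) : ℝ) ≠ 0 := by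
    exact_mod_cast (Nat.choose_pos (Nat.le_add_right k q)).ne'
  have f1 : (Nat.factorial k : ℝ) ≠ 0 := by exact_mod_cast (Nat.factorial_pos k).ne'
  have f2 : (Nat.factorial q : ℝ) ≠ 0 := by exact_mod_cast (Nat.factorial_pos q).ne'
  have f3 : ((k + q : ℕ) : ℝ) ≠ 0 := by exact_mod_cast (by omega : k + q ≠ 0)
  have f4 : (Nat.factorial (k + q - 1) : ℝ) / (Nat.factorial k * Nat.factorial q) =
      (((k + q).choose k : ℕ) : ℝ) / (k + q : ℕ) := by
    rw [div_eq_div_iff (mul_ne_zero f1 f2) f3, mul_comm, hch.symm]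
  rw [f4, hwe, hA, bridgeConst, ← e2, pow_add]
  field_simp

open scoped Classical in
/-- The probability of a bridge is proportional to `∏ W / k`: a bridge `t` can only come from its own
non-final and final pieces and its own pattern of types, whose probabilities are multiplied by `accW_mul`. -/
theorem law_bridgeSampler (hr : P.RateLe) (t : List (Piece m 0)) :
    P.bridgeSampler.law t = if IsBridge P.n t then
      ENNReal.ofReal (P.bridgeConst * (t.map (Piece.weight P.S)).prod / t.length) / P.accProb else 0 := by
  set p : Piece m 0 → Bool := fun a => decide (¬ IsFinal P.S a) with hp
  set l := t.filter p with hl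
  set f := t.filter (fun a => !p a) with hf
  have hlp : ∀ a ∈ l, ¬ IsFinal P.S a := fun a ha => by
    have := (List.mem_filter.1 ha).2
    simpa [hp] using this
  have hfp : ∀ a ∈ f, IsFinal P.S a := fun a ha => by
    have := (List.mem_filter.1 ha).2
    simpa [hp] using this
  have hlen := length_filter_add p t
  rw [← hl, ← hf] at hlen
  -- only one way of obtaining `t` has positive probability
  have key : P.bridgeSampler.law t = P.accepted.law (l, f.length) * ((Run.replicate P.drawFinal f.length).law f *
      (bbhl l.length f.length).law (t.map p)) := by
    have hzero : ∀ (s : List (Piece m 0) × ℕ) (g : List (Piece m 0)) (ν : List Bool),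
        P.accepted.law s ≠ 0 → (Run.replicate P.drawFinal s.2).law g ≠ 0 →
        (bbhl s.1.length s.2).law ν ≠ 0 →
        (t = merge ν s.1 g ↔ s.1 = l ∧ g = f ∧ ν = t.map p) := by
      intro s g ν hs hg hν
      obtain ⟨h1, h2, h3⟩ := h.law_accepted_ne_zero hr hs
      rw [Run.law_replicate] at hg
      have hg1 : g.length = s.2 := by by_contra hc; rw [if_neg hc] at hg; exact hg rfl
      rw [if_pos hg1, h.prod_law_drawFinal] at hg
      have hg2 : ∀ t ∈ g, IsFinal P.S t := by
        by_contra hc; rw [if_neg hc] at hg; exact hg rfl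
      rw [law_bbhl] at hν
      have hν1 : ν.count true = s.1.length ∧ ν.count false = s.2 := by
        by_contra hc; rw [if_neg hc] at hν; exact hν rfl
      refine merge_eq_iff p ν s.1 g t (fun a ha => ?_) (fun a ha => ?_) hν1.1 (hν1.2.trans hg1.symm)
      · have := ((stepW_pos_iff h.ζ_pos h.θ_pos).1
          (lt_of_le_of_ne (h.w_nonneg a) (h3 a ha).symm)).2
        simp [hp, this]
      · simp [hp, hg2 a ha]
    have e : ∀ (s : List (Piece m 0) × ℕ) (g : List (Piece m 0)) (ν : List Bool),
        P.accepted.law s * ((Run.replicate P.drawFinal s.2).law g * ((bbhl s.1.length s.2).law ν *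
          (interleave ν s.1 g).law t)) =
        if s.1 = l ∧ g = f ∧ ν = t.map p then P.accepted.law s *
          ((Run.replicate P.drawFinal s.2).law g * (bbhl s.1.length s.2).law ν) else 0 := by
      intro s g ν
      by_cases h1 : P.accepted.law s = 0
      · simp [h1]
      by_cases h2 : (Run.replicate P.drawFinal s.2).law g = 0
      · simp [h2]
      by_cases h3 : (bbhl s.1.length s.2).law ν = 0
      · simp [h3]
      rw [law_interleave]
      simp only [hzero s g ν h1 h2 h3]
      split_ifs <;> simp
    rw [bridgeSampler_eq, Run.law_bind]
    simp only [Run.law_bind, ← ENNReal.tsum_mul_left, e]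
    rw [tsum_eq_single (l, f.length), tsum_eq_single f, tsum_eq_single (t.map p)]
    · simp
    · intro ν hν
      rw [if_neg (fun hc => hν hc.2.2)]
    · intro g hg
      simp only [ENNReal.tsum_eq_zero]
      intro ν
      rw [if_neg (fun hc => hg hc.2.1)]
    · intro s hs
      simp only [ENNReal.tsum_eq_zero]
      intro g ν
      split_ifs with hc
      · have : s.2 ≠ f.length := fun h2 => hs (Prod.ext hc.1 h2)
        rw [Run.law_replicate, if_neg (by rw [hc.2.1]; exact this.symm)]
        simp
      · rfl
  rw [key, h.law_accepted, h.law_trial hr, Run.law_replicate, if_pos rfl, h.prod_law_drawFinal, if_pos hfp,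
    law_bbhl, if_pos (count_map_filter p t)]
  have hb : IsBridge P.n t ↔ endpoint l ∈ landing P.S P.n ∧ f.length = ((endpoint l).2 + 1).toNat := by
    rw [IsBridge, endpoint_filter p t, isBridge_iff hfp]
  simp only [hb]
  split_ifs with hc
  · have hm := h.accW_mul hlp hc.1 hc.2
    have hcp : 0 < (((l.length + f.length).choose l.length : ℕ) : ℝ) := by
      exact_mod_cast Nat.choose_pos (Nat.le_add_right _ _)
    have e1 : ((((l.length + f.length).choose l.length : ℕ) : ℝ≥0∞))⁻¹ =
        ENNReal.ofReal ((((l.length + f.length).choose l.length : ℕ) : ℝ)⁻¹) := by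
      rw [ENNReal.ofReal_inv_of_pos hcp, ENNReal.ofReal_natCast]
    rw [e1, hlen, prod_filter p (Piece.weight P.S) t, ← hl, ← hf, ← hm]
    rw [ENNReal.ofReal_mul, ENNReal.ofReal_mul (h.accW_nonneg l)]
    · simp only [div_eq_mul_inv]; ring
    · refine mul_nonneg (h.accW_nonneg l) (div_nonneg (List.prod_nonneg fun a ha => ?_)
        (pow_nonneg h.T0_pos.le _))
      obtain ⟨t, _, rfl⟩ := List.mem_map.1 ha
      exact t.weight_nonneg P.S
  · simp

end Reg

end Setup

end CF

namespace CF

variable {m : ℕ}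

namespace Setup

variable {P : Setup m}

theorem treeSampler_eq : P.treeSampler = (P.bridgeSampler >>= fun t => cyc t) := rfl

namespace Reg

variable (h : P.Reg)
include h

open scoped Classical in
/-- The `k` rotations of a bridge have the same probability and are shifted to the same excursion, which
cancels the factor `1 / k`. -/
theorem law_treeSampler (hr : P.RateLe) (t : List (Piece m 0)) :
    P.treeSampler.law t = if IsExcursion P.n t then
      ENNReal.ofReal (P.bridgeConst * (t.map (Piece.weight P.S)).prod) / P.accProb else 0 := by
  rw [treeSampler_eq, Run.law_bind, tsum_cyc P.n]
  · split_ifs with ht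
    · have hne : t ≠ [] := by
        rintro rfl
        have := ht.1
        rw [IsBridge, endpoint_nil] at this
        simpa using congrArg Prod.snd this
      have hlen : 0 < t.length := List.length_pos_iff.2 hne
      rw [h.law_bridgeSampler hr, if_pos ht.1, ← ENNReal.ofReal_natCast, ← mul_div_assoc,
        ← ENNReal.ofReal_mul (Nat.cast_nonneg _)]
      congr 2
      have : (t.length : ℝ) ≠ 0 := by exact_mod_cast hlen.ne'
      field_simp
    · rfl
  · intro b hb
    rw [h.law_bridgeSampler hr, if_neg hb]
  · intro b j
    rw [h.law_bridgeSampler hr, h.law_bridgeSampler hr, List.length_rotate,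
      ((List.rotate_perm b j).map _).prod_eq]
    have : IsBridge P.n (b.rotate j) ↔ IsBridge P.n b := by rw [IsBridge, endpoint_rotate]; rfl
    simp only [this]

theorem mass_treeSampler (hp : P.accProb ≠ 0) : P.treeSampler.mass = 1 := by
  rw [treeSampler_eq]
  exact Run.mass_bind_eq (h.mass_bridgeSampler hp) fun t _ => mass_cyc t

/-- Since the algorithm halts almost surely, the normalising constant of the law of its output is
determined: the acceptance probability is proportional to `A_n`. -/
theorem accProb_eq_coeff (hr : P.RateLe) (hp : P.accProb ≠ 0) :
    P.accProb = ENNReal.ofReal (P.bridgeConst * coeff P.S 0 P.n) := by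
  classical
  have hm := h.mass_treeSampler hp
  have hpt : P.accProb ≠ ⊤ := ne_top_of_le_ne_top ENNReal.one_ne_top h.accProb_le
  have e1 : ∑' t : List (Piece m 0), P.treeSampler.law t =
      ∑' T : Tree m 0, P.treeSampler.law T.cut := by
    refine (Function.Injective.tsum_eq Tree.cut_injective ?_).symm
    intro t ht
    rw [Function.mem_support, h.law_treeSampler hr] at ht
    have hex : IsExcursion P.n t := by by_contra hc; rw [if_neg hc] at ht; exact ht rfl
    obtain ⟨T, -, hT⟩ := (Tree.bijOn_cut P.n).surjOn hex
    exact ⟨T, hT⟩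
  rw [Run.mass, e1] at hm
  simp only [h.law_treeSampler hr, Tree.isExcursion_cut, Tree.prod_cut] at hm
  have e2 : ∀ T : Tree m 0, (if T.size = P.n then
      ENNReal.ofReal (P.bridgeConst * T.weight P.S) / P.accProb else 0) =
      ENNReal.ofReal P.bridgeConst / P.accProb *
        ENNReal.ofReal (if T.size = P.n then T.weight P.S else 0) := by
    intro T
    split_ifs
    · rw [ENNReal.ofReal_mul h.bridgeConst_pos.le]; simp only [div_eq_mul_inv]; ring
    · simp
  simp only [e2] at hm
  rw [ENNReal.tsum_mul_left] at hm
  have hb : ENNReal.ofReal P.bridgeConst ≠ 0 := by simpa using h.bridgeConst_pos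
  have hsum : ∑' T : Tree m 0, ENNReal.ofReal (if T.size = P.n then T.weight P.S else 0) =
      ENNReal.ofReal (coeff P.S 0 P.n) := by
    have hnn : ∀ T : Tree m 0, 0 ≤ (if T.size = P.n then T.weight P.S else 0) := fun T => by
      split_ifs
      · exact T.weight_nonneg P.S
      · exact le_rfl
    have hfin : ∑' T : Tree m 0, ENNReal.ofReal (if T.size = P.n then T.weight P.S else 0) ≠ ⊤ := by
      intro htop
      rw [htop, ENNReal.mul_top] at hm
      · exact ENNReal.top_ne_one hm
      · exact ENNReal.div_ne_zero.2 ⟨hb, hpt⟩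
    have hs := ENNReal.summable_toReal hfin
    simp only [ENNReal.toReal_ofReal (hnn _)] at hs
    rw [coeff, ENNReal.ofReal_tsum_of_nonneg hnn hs]
  rw [hsum] at hm
  rw [ENNReal.ofReal_mul h.bridgeConst_pos.le]
  rw [div_eq_mul_inv, mul_right_comm, ← div_eq_mul_inv] at hm
  exact ((ENNReal.div_eq_one_iff hp hpt).1 hm).symm

theorem coeff_pos (hr : P.RateLe) (hp : P.accProb ≠ 0) : 0 < coeff P.S 0 P.n := by
  have h1 := h.accProb_eq_coeff hr hp
  by_contra hc
  rw [ENNReal.ofReal_of_nonpos] at h1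
  · exact hp h1
  · exact mul_nonpos_of_nonneg_of_nonpos h.bridgeConst_pos.le (not_lt.1 hc)

theorem law_bridgeSampler_eq (hr : P.RateLe) (hp : P.accProb ≠ 0) (t : List (Piece m 0)) :
    P.bridgeSampler.law t = ENNReal.ofReal (muCyc P.S P.n t) := by
  classical
  have hc := h.coeff_pos hr hp
  have hb := h.bridgeConst_pos
  rw [h.law_bridgeSampler hr, muCyc]
  split_ifs with ht
  · rw [h.accProb_eq_coeff hr hp, ← ENNReal.ofReal_div_of_pos (by positivity)]
    congr 1
    field_simp
  · simp

theorem law_treeSampler_eq (hr : P.RateLe) (hp : P.accProb ≠ 0) (t : List (Piece m 0))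
    [∀ T : Tree m 0, Decidable (T.cut = t)] :
    P.treeSampler.law t =
      ∑' T : Tree m 0, if T.cut = t then ENNReal.ofReal (mu P.S P.n T) else 0 := by
  classical
  have hc := h.coeff_pos hr hp
  have hb := h.bridgeConst_pos
  rw [h.law_treeSampler hr]
  split_ifs with ht
  · obtain ⟨T, hT, rfl⟩ := (Tree.bijOn_cut P.n).surjOn ht
    rw [tsum_eq_single T]
    · rw [if_pos rfl, Tree.prod_cut, h.accProb_eq_coeff hr hp, ← ENNReal.ofReal_div_of_pos (by positivity),
        mu, if_pos (show T.size = P.n from hT)]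
      congr 1
      field_simp
    · intro T' hT'
      rw [if_neg fun hc => hT' (Tree.cut_injective hc)]
  · refine (ENNReal.tsum_eq_zero.2 fun T => ?_).symm
    split_ifs with hT
    · rw [mu, if_neg, ENNReal.ofReal_zero]
      rintro hs
      rw [← hT] at ht
      exact ht (Tree.isExcursion_cut.2 hs)
    · rfl

theorem reachProb_le : P.reachProb ≤ 1 := by
  classical
  rw [reachProb, ← h.mass_walk, Run.mass]
  refine ENNReal.tsum_le_tsum fun s => ?_
  split_ifs
  · exact le_rfl
  · exact zero_le

open scoped Classical in
theorem meanRate_eq (hr : P.RateLe) : P.meanRate = P.accProb / P.reachProb := by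
  rw [meanRate, h.accProb_eq hr, h.tsum_walk_landing fun s => ENNReal.ofReal (P.rate s.1)]
  congr 1
  refine tsum_congr fun l => ?_
  split_ifs
  · rw [← h.prod_muNe_mul_rate, ENNReal.ofReal_mul]
    refine List.prod_nonneg fun a ha => ?_
    obtain ⟨t, _, rfl⟩ := List.mem_map.1 ha
    exact h.muNe_nonneg t
  · rfl

theorem accProb_le_reachProb (hr : P.RateLe) : P.accProb ≤ P.reachProb := by
  classical
  have e := h.tsum_walk_landing fun _ => 1
  simp only [mul_one] at e
  rw [h.accProb_eq hr, reachProb]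
  calc _ ≤ ∑' l : List (Piece m 0), if endpoint l ∈ landing P.S P.n then
        ENNReal.ofReal (l.map P.muNe).prod else 0 := ENNReal.tsum_le_tsum fun l => ?_
    _ = _ := e.symm
  split_ifs with hl
  · by_cases h0 : ∀ t ∈ l, P.w t ≠ 0
    · apply ENNReal.ofReal_le_ofReal
      rw [← h.prod_muNe_mul_rate]
      refine mul_le_of_le_one_right (List.prod_nonneg fun a ha => ?_) (hr l h0 hl)
      obtain ⟨t, _, rfl⟩ := List.mem_map.1 ha
      exact h.muNe_nonneg t
    · push Not at h0
      obtain ⟨t, ht, h0⟩ := h0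
      rw [accW, List.prod_eq_zero (List.mem_map.2 ⟨t, ht, h0⟩)]
      simp
  · exact zero_le

end Reg

end Setup

end CF

/-! ### Binomial probabilities -/

namespace CF

theorem stirlingSeq_bounds {n : ℕ} (hn : 1 ≤ n) :
    1 ≤ Stirling.stirlingSeq n ∧ Stirling.stirlingSeq n ≤ 2 := by
  constructor
  · refine le_trans ?_ (Stirling.sqrt_pi_le_stirlingSeq (by omega))
    rw [Real.one_le_sqrt]
    linarith [Real.pi_gt_three]
  · obtain ⟨n, rfl⟩ : ∃ i, n = i + 1 := ⟨n - 1, by omega⟩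
    refine (Stirling.stirlingSeq'_antitone (Nat.zero_le n)).trans ?_
    simp only [Function.comp_apply, Nat.succ_eq_add_one, zero_add, Stirling.stirlingSeq_one]
    rw [div_le_iff₀ (by positivity)]
    have h1 := Real.exp_one_lt_d9
    have h2 : (1.4 : ℝ) ≤ √2 := Real.le_sqrt_of_sq_le (by norm_num)
    linarith

/-- The binomial probability of `k` successes and `q` failures. -/
def binom (p r : ℝ) (k q : ℕ) : ℝ := ((k + q).choose k : ℕ) * p ^ k * r ^ q

/-- The exponential factor of a binomial probability. -/
def binomExp (p r : ℝ) (k q : ℕ) : ℝ :=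
  ((k + q : ℕ) * p / k) ^ k * ((k + q : ℕ) * r / q) ^ q

theorem factorial_eq_stirling {n : ℕ} (hn : 1 ≤ n) : (n.factorial : ℝ) =
    Stirling.stirlingSeq n * (√(2 * n) * (n / Real.exp 1) ^ n) := by
  have : (0 : ℝ) < n := by exact_mod_cast hn
  rw [Stirling.stirlingSeq, div_mul_cancel₀]
  positivity

theorem binom_eq {p r : ℝ} {k q : ℕ} (hk : 1 ≤ k) (hq : 1 ≤ q) :
    binom p r k q = Stirling.stirlingSeq (k + q) / (Stirling.stirlingSeq k * Stirling.stirlingSeq q) *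
      √((k + q) / (2 * k * q)) * binomExp p r k q := by
  have hk0 : (0 : ℝ) < k := by exact_mod_cast hk
  have hq0 : (0 : ℝ) < q := by exact_mod_cast hq
  have hch : (((k + q).choose k : ℕ) : ℝ) = (k + q).factorial / (k.factorial * q.factorial) := by
    rw [eq_div_iff (by positivity), Nat.choose_symm_add, ← mul_assoc]
    exact_mod_cast Nat.add_choose_mul_factorial_mul_factorial k q
  have s1 := (stirlingSeq_bounds hk).1
  have s2 := (stirlingSeq_bounds hq).1
  rw [binom, hch, factorial_eq_stirling hk, factorial_eq_stirling hq,
    factorial_eq_stirling (by omega : 1 ≤ k + q), binomExp]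
  have e1 : √(((k : ℝ) + q) / (2 * k * q)) = √(2 * ((k + q : ℕ) : ℝ)) / (√(2 * k) * √(2 * q)) := by
    rw [← Real.sqrt_mul (by positivity), ← Real.sqrt_div (by positivity)]
    congr 1
    push_cast; field_simp
  rw [e1, div_pow, div_pow, div_pow, div_pow, div_pow, mul_pow, mul_pow, pow_add, pow_add]
  have : Stirling.stirlingSeq k ≠ 0 := by linarith
  have : Stirling.stirlingSeq q ≠ 0 := by linarith
  have h3 : √(2 * (k : ℝ)) ≠ 0 := by positivity
  have h4 : √(2 * (q : ℝ)) ≠ 0 := by positivity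
  field_simp

theorem binomExp_le_one {p r : ℝ} (hp : 0 < p) (hr : 0 < r) (hpr : p + r = 1) {k q : ℕ} (hk : 1 ≤ k)
    (hq : 1 ≤ q) : binomExp p r k q ≤ 1 := by
  have hk0 : (0 : ℝ) < k := by exact_mod_cast hk
  have hq0 : (0 : ℝ) < q := by exact_mod_cast hq
  have h : ∀ (x : ℝ) (i : ℕ), 0 < i → 0 ≤ x → (x / i) ^ i ≤ Real.exp (x - i) := by
    intro x i hi hx
    have hi' : (0 : ℝ) < i := by exact_mod_cast hi
    calc (x / i) ^ i ≤ Real.exp (x / i - 1) ^ i := by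
          gcongr
          have := Real.add_one_le_exp (x / i - 1)
          linarith
      _ = _ := by rw [← Real.exp_nat_mul]; congr 1; field_simp
  rw [binomExp]
  calc _ ≤ Real.exp ((k + q : ℕ) * p - k) * Real.exp ((k + q : ℕ) * r - q) := by
        gcongr
        · exact h _ _ hk (by positivity)
        · exact h _ _ hq (by positivity)
    _ = 1 := by
        rw [← Real.exp_add, Real.exp_eq_one_iff]
        push_cast
        linear_combination ((k : ℝ) + q) * hpr

theorem le_binomExp {p r : ℝ} (hp : 0 < p) (hr : 0 < r) (hpr : p + r = 1) {k q : ℕ} (hk : 1 ≤ k)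
    (hq : 1 ≤ q) : Real.exp (-((k * r - q * p) ^ 2 / ((k + q) * p * r))) ≤ binomExp p r k q := by
  have hk0 : (0 : ℝ) < k := by exact_mod_cast hk
  have hq0 : (0 : ℝ) < q := by exact_mod_cast hq
  have h : ∀ (x : ℝ) (i : ℕ), 0 < i → 0 < x → Real.exp (i - i ^ 2 / x) ≤ (x / i) ^ i := by
    intro x i hi hx
    have hi' : (0 : ℝ) < i := by exact_mod_cast hi
    have h1 : Real.exp (1 - i / x) ≤ x / i := by
      have h2 := Real.add_one_le_exp (i / x - 1)
      have h3 : (i / x : ℝ) ≤ Real.exp (i / x - 1) := by linarith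
      have h4 : Real.exp (1 - i / x) = (Real.exp (i / x - 1))⁻¹ := by rw [← Real.exp_neg]; ring_nf
      rw [h4, ← inv_div (i : ℝ) x]
      exact inv_anti₀ (by positivity) h3
    calc _ = Real.exp (1 - i / x) ^ i := by rw [← Real.exp_nat_mul]; congr 1; field_simp
      _ ≤ _ := by gcongr
  rw [binomExp]
  have hN : (0 : ℝ) < (k + q : ℕ) := by exact_mod_cast (by omega : 0 < k + q)
  calc _ = Real.exp (k - k ^ 2 / ((k + q : ℕ) * p)) * Real.exp (q - q ^ 2 / ((k + q : ℕ) * r)) := by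
        rw [← Real.exp_add]
        congr 1
        have : (0 : ℝ) < k + q := by positivity
        have e : r = 1 - p := by linarith
        have : 1 - p ≠ 0 := by rw [← e]; exact hr.ne'
        push_cast
        rw [e]
        field_simp
        ring
    _ ≤ _ := by
        gcongr
        · exact h _ _ hk (by positivity)
        · exact h _ _ hq (by positivity)

theorem binom_le_sqrt {p r : ℝ} (hp : 0 < p) (hr : 0 < r) (hpr : p + r = 1) {δ : ℝ} (hδ : 0 < δ) {k q : ℕ}
    (hN : 1 ≤ k + q) (hk : δ * (k + q) ≤ k) (hq : δ * (k + q) ≤ q) :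
    binom p r k q ≤ 2 / δ / √(k + q) := by
  have hN0 : (0 : ℝ) < k + q := by exact_mod_cast hN
  have hk0 : (0 : ℝ) < k := lt_of_lt_of_le (by positivity) hk
  have hq0 : (0 : ℝ) < q := lt_of_lt_of_le (by positivity) hq
  have hk1 : 1 ≤ k := by exact_mod_cast hk0
  have hq1 : 1 ≤ q := by exact_mod_cast hq0
  have s1 := stirlingSeq_bounds hk1
  have s2 := stirlingSeq_bounds hq1
  have s3 := stirlingSeq_bounds hN
  have hE := binomExp_le_one hp hr hpr hk1 hq1
  have hE0 : 0 ≤ binomExp p r k q := by rw [binomExp]; positivity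
  rw [binom_eq hk1 hq1]
  have h1 : Stirling.stirlingSeq (k + q) / (Stirling.stirlingSeq k * Stirling.stirlingSeq q) ≤ 2 := by
    rw [div_le_iff₀ (by nlinarith)]
    nlinarith
  have h2 : √(((k : ℝ) + q) / (2 * k * q)) ≤ 1 / δ / √(k + q) := by
    rw [Real.sqrt_le_left (by positivity), div_pow, div_pow, Real.sq_sqrt hN0.le, one_pow,
      div_div, div_le_div_iff₀ (by positivity) (by positivity)]
    have : (δ * (k + q)) * (δ * (k + q)) ≤ k * q := by gcongr
    nlinarith [mul_pos hk0 hq0]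
  calc _ ≤ 2 * (1 / δ / √(k + q)) * 1 := by gcongr
    _ = _ := by ring

/-- A local lower bound, of order `(k + q) ^ (-1/2)` within a few standard deviations of the mean. -/
theorem le_binom {p r : ℝ} (hp : 0 < p) (hr : 0 < r) (hpr : p + r = 1) {k q : ℕ} (hk : 1 ≤ k)
    (hq : 1 ≤ q) : Real.exp (-((k * r - q * p) ^ 2 / ((k + q) * p * r))) / (8 * √(k + q)) ≤
      binom p r k q := by
  have hk0 : (0 : ℝ) < k := by exact_mod_cast hk
  have hq0 : (0 : ℝ) < q := by exact_mod_cast hq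
  have s1 := stirlingSeq_bounds hk
  have s2 := stirlingSeq_bounds hq
  have s3 := stirlingSeq_bounds (by omega : 1 ≤ k + q)
  rw [binom_eq hk hq]
  have h1 : 1 / 4 ≤ Stirling.stirlingSeq (k + q) / (Stirling.stirlingSeq k * Stirling.stirlingSeq q) := by
    rw [le_div_iff₀ (by nlinarith)]
    nlinarith
  have h2 : 1 / (2 * √((k : ℝ) + q)) ≤ √(((k : ℝ) + q) / (2 * k * q)) := by
    apply Real.le_sqrt_of_sq_le
    rw [div_pow, mul_pow, Real.sq_sqrt (by positivity), one_pow, div_le_div_iff₀ (by positivity) (by positivity)]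
    nlinarith [sq_nonneg ((k : ℝ) - q), mul_pos hk0 hq0]
  calc _ = 1 / 4 * (1 / (2 * √((k : ℝ) + q))) * Real.exp (-((k * r - q * p) ^ 2 / ((k + q) * p * r))) := by
        ring
    _ ≤ _ := by
        gcongr
        exact le_binomExp hp hr hpr hk hq

/-- Chernoff's bound, with the exponential moment at `s`. -/
theorem binom_mul_pow_le {p r : ℝ} (hp : 0 < p) (hr : 0 < r) {s : ℝ} (hs : 0 < s) (k q : ℕ) :
    binom p r k q * s ^ k ≤ (p * s + r) ^ (k + q) := by
  have h := add_pow (p * s) r (k + q)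
  rw [h]
  refine le_trans (le_of_eq ?_) (Finset.single_le_sum (f := fun i => (p * s) ^ i * r ^ (k + q - i) *
    ((k + q).choose i : ℝ)) (fun i _ => by positivity) (Finset.mem_range.2 (by omega : k < k + q + 1)))
  simp only [binom, Nat.add_sub_cancel_left, mul_pow]
  ring

theorem binom_symm (p r : ℝ) (k q : ℕ) : binom p r k q = binom r p q k := by
  rw [binom, binom, Nat.choose_symm_add, add_comm q k]; ring

theorem binom_le_of_unbalanced {p r : ℝ} (hp : 0 < p) (hr : 0 < r) (hpr : p + r = 1) {δ : ℝ} (hδ : 0 < δ)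
    (hδp : 1 - p / 2 ≤ Real.exp (-(2 * δ))) {k q : ℕ} (hN : 1 ≤ k + q) (hk : k < δ * (k + q)) :
    binom p r k q ≤ 2 / δ ^ 2 / ((k + q) * √(k + q)) := by
  have hN1 : (1 : ℝ) ≤ k + q := by exact_mod_cast hN
  have hb0 : 0 ≤ binom p r k q := by rw [binom]; positivity
  have h1 := binom_mul_pow_le hp hr (s := 1 / 2) (by norm_num) k q
  have e : p * (1 / 2) + r = 1 - p / 2 := by linarith
  rw [e] at h1
  have h2 : (1 - p / 2) ^ (k + q) ≤ Real.exp (-(2 * δ)) ^ (k + q) := by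
    apply pow_le_pow_left₀ _ hδp
    linarith
  rw [← Real.exp_nat_mul] at h2
  have h3 : binom p r k q ≤ Real.exp (-(δ * (k + q))) := by
    have h4 : (2 : ℝ) ^ k ≤ Real.exp (δ * (k + q)) := by
      calc (2 : ℝ) ^ k ≤ Real.exp 1 ^ k := by
            gcongr
            have := Real.add_one_le_exp (1 : ℝ)
            linarith
        _ = Real.exp k := by rw [← Real.exp_nat_mul, mul_one]
        _ ≤ _ := Real.exp_le_exp.2 hk.le
    calc binom p r k q = binom p r k q * (1 / 2) ^ k * 2 ^ k := by
          rw [mul_assoc, ← mul_pow]; norm_num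
      _ ≤ Real.exp (((k + q : ℕ) : ℝ) * -(2 * δ)) * Real.exp (δ * (k + q)) := by
          gcongr
          exact h1.trans h2
      _ = _ := by rw [← Real.exp_add]; congr 1; push_cast; ring
  refine h3.trans ?_
  have h5 := Real.quadratic_le_exp_of_nonneg (x := δ * (k + q)) (by positivity)
  have h6 : (δ * (k + q)) ^ 2 / 2 ≤ Real.exp (δ * (k + q)) := by
    have : 0 ≤ δ * (k + q) := by positivity
    linarith
  rw [Real.exp_neg]
  have h7 : ((k : ℝ) + q) * √(k + q) ≤ (k + q) ^ 2 := by
    have : √((k : ℝ) + q) ≤ k + q := Real.sqrt_le_left (by positivity) |>.2 (by nlinarith)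
    nlinarith
  calc (Real.exp (δ * (k + q)))⁻¹ ≤ ((δ * (k + q)) ^ 2 / 2)⁻¹ := by gcongr
    _ = 2 / δ ^ 2 / (k + q) ^ 2 := by field_simp
    _ ≤ _ := by gcongr

/-- A binomial probability is at most of order `(k + q) ^ (-1/2)`, and much smaller if one of the two
outcomes is rare. -/
theorem exists_binom_le {p r : ℝ} (hp : 0 < p) (hr : 0 < r) (hpr : p + r = 1) :
    ∃ δ C : ℝ, 0 < δ ∧ 0 < C ∧ ∀ k q : ℕ, 1 ≤ k + q → binom p r k q ≤ C / √(k + q) ∧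
      ((δ * (k + q) ≤ k ∧ δ * (k + q) ≤ q) ∨ binom p r k q ≤ C / ((k + q) * √(k + q))) := by
  -- with this `δ`, Chernoff's bound at `s = 1 / 2` decays like `exp (-δ (k + q))` after the loss of `2 ^ k`
  set δ := min p r / 4 with hδd
  have hδ : 0 < δ := by have := lt_min hp hr; positivity
  have aux : ∀ x, min p r ≤ x → 1 - x / 2 ≤ Real.exp (-(2 * δ)) := by
    intro x hx
    have := Real.add_one_le_exp (-(2 * δ))
    rw [hδd] at this ⊢
    linarith
  have hδ1 : δ ≤ 1 := by
    have : min p r ≤ p := min_le_left _ _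
    rw [hδd]; linarith
  refine ⟨δ, 2 / δ ^ 2, hδ, by positivity, fun k q hN => ?_⟩
  have hN1 : (1 : ℝ) ≤ k + q := by exact_mod_cast hN
  have h2 : 2 / δ ^ 2 / ((k + q) * √(k + q)) ≤ 2 / δ ^ 2 / √((k : ℝ) + q) := by
    have : 0 < √((k : ℝ) + q) := Real.sqrt_pos.2 (by linarith)
    gcongr
    exact le_mul_of_one_le_left this.le hN1
  by_cases hk : δ * (k + q) ≤ k
  · by_cases hq : δ * (k + q) ≤ q
    · refine ⟨(binom_le_sqrt hp hr hpr hδ hN hk hq).trans ?_, Or.inl ⟨hk, hq⟩⟩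
      gcongr
      exact pow_le_of_le_one hδ.le hδ1 two_ne_zero
    · have := binom_le_of_unbalanced hr hp (by linarith) hδ (aux r (min_le_right _ _)) (k := q) (q := k)
        (by omega) (by rw [add_comm (q : ℝ)]; linarith)
      rw [← binom_symm, add_comm (q : ℝ)] at this
      exact ⟨this.trans h2, Or.inr this⟩
  · have := binom_le_of_unbalanced hp hr hpr hδ (aux p (min_le_left _ _)) hN (by linarith)
    exact ⟨this.trans h2, Or.inr this⟩

/-! ### Hyperbolic cosines -/

theorem cosh_le_one_add {x : ℝ} (hx : 0 ≤ x) : Real.cosh x ≤ 1 + x ^ 2 / 2 * Real.exp x := by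
  have h1 : Real.exp x - 1 ≤ x * Real.exp x := by
    have := Real.one_sub_le_exp_neg x
    have h2 : Real.exp (-x) * Real.exp x = 1 := by rw [← Real.exp_add]; simp
    nlinarith [Real.exp_pos x]
  have h3 : 0 ≤ Real.exp x - 1 := by linarith [Real.add_one_le_exp x]
  have h4 : Real.cosh x - 1 = Real.exp (-x) * (Real.exp x - 1) ^ 2 / 2 := by
    have h2 : Real.exp (-x) * Real.exp x = 1 := by rw [← Real.exp_add]; simp
    rw [Real.cosh_eq]
    linear_combination (1 - Real.exp x / 2) * h2
  have h5 : Real.exp (-x) * (Real.exp x - 1) ^ 2 ≤ Real.exp (-x) * (x * Real.exp x) ^ 2 := by gcongr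
  have h6 : Real.exp (-x) * (x * Real.exp x) ^ 2 = x ^ 2 * Real.exp x := by
    rw [Real.exp_neg]; field_simp
  linarith

theorem one_add_sq_div_two_le_cosh (x : ℝ) : 1 + x ^ 2 / 2 ≤ Real.cosh x := by
  have h0 : ∀ y : ℝ, y ^ 2 ≤ Real.sinh y ^ 2 := by
    intro y
    rcases le_total 0 y with h | h
    · exact pow_le_pow_left₀ h (Real.self_le_sinh_iff.2 h) 2
    · have := pow_le_pow_left₀ (neg_nonneg.2 h) (Real.self_le_sinh_iff.2 (neg_nonneg.2 h)) 2
      rwa [Real.sinh_neg, neg_sq, neg_sq] at this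
  have h3 := Real.cosh_two_mul (x / 2)
  rw [mul_div_cancel₀ x two_ne_zero, Real.cosh_sq] at h3
  have := h0 (x / 2)
  linarith

/-- By convexity, the product of the hyperbolic cosines is at least the one for equal steps; the
bound on it is quadratic in the mean square of the steps. -/
theorem le_prod_cosh (l : List ℝ) (hl : l ≠ []) :
    (1 + l.sum ^ 2 / (8 * l.length)) ^ 2 ≤ (l.map Real.cosh).prod := by
  have hsq : ∀ x : ℝ, (1 + x ^ 2 / 8) ^ 2 ≤ Real.cosh x := by
    intro x
    have h1 : 1 + (x / 2) ^ 2 / 2 ≤ Real.cosh (x / 2) := one_add_sq_div_two_le_cosh (x / 2)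
    have h2 : Real.cosh (x / 2) ^ 2 ≤ Real.cosh x := by
      have h3 := Real.cosh_two_mul (x / 2)
      rw [mul_div_cancel₀ x two_ne_zero] at h3
      rw [h3]; nlinarith [sq_nonneg (Real.sinh (x / 2))]
    refine le_trans ?_ h2
    refine pow_le_pow_left₀ (by positivity) ?_ 2
    linarith
  have h1 : ∀ l : List ℝ, (l.map fun x => 1 + x ^ 2 / 8).prod ^ 2 ≤ (l.map Real.cosh).prod := by
    intro l
    induction l with
    | nil => simp
    | cons x l ih =>
      simp only [List.map_cons, List.prod_cons, mul_pow]
      exact mul_le_mul (hsq x) ih (sq_nonneg _) (Real.cosh_pos x).le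
  have h2 : ∀ (c : ℝ) (l : List ℝ), 1 + (2 * c * l.sum - l.length * c ^ 2) / 8 ≤
      (l.map fun x => 1 + x ^ 2 / 8).prod ∧ 1 ≤ (l.map fun x => 1 + x ^ 2 / 8).prod := by
    intro c l
    induction l with
    | nil => simp
    | cons x l ih =>
      obtain ⟨i1, i2⟩ := ih
      simp only [List.map_cons, List.prod_cons, List.sum_cons, List.length_cons]
      push_cast
      constructor
      · nlinarith [sq_nonneg (x - c), sq_nonneg x]
      · nlinarith [sq_nonneg x]
  have hk : (0 : ℝ) < l.length := by exact_mod_cast List.length_pos_iff.2 hl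
  have h3 := (h2 (l.sum / l.length) l).1
  have h4 : (2 * (l.sum / l.length) * l.sum - l.length * (l.sum / l.length) ^ 2) / 8 =
      l.sum ^ 2 / (8 * l.length) := by field_simp; ring
  rw [h4] at h3
  exact (pow_le_pow_left₀ (by positivity) h3 2).trans (h1 l)

end CF

/-! ### Bounds on the acceptance rate -/

namespace CF

variable {m : ℕ}

/-- A critical point around which the generating functions of the pieces converge, even with a
variable `x` marking the number of steps of the rewriting process: the shift of the parameters may
be as large as `ξ`. -/
structure Env (S : Spec m) (ζ θ ξ x : ℝ) : Prop where
  aper : Aperiodic S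
  crit : IsCritical S ζ θ
  ξ_pos : 0 < ξ
  one_lt : 1 < x
  fin : ∀ α, ∑' t : Piece m α, t.gw (nodeW S x (ζ * Real.exp ξ) (θ * Real.exp (v0 S * ξ))) ≠ ⊤

/-- The neighbourhood of the critical point in which the generating functions are finite, translated into
an exponential shift of both parameters. -/
theorem exists_env {S : Spec m} (hnl : Nonlinear S) (hirr : Irreducible S) (haper : Aperiodic S) :
    ∃ ζ θ ξ x, Env S ζ θ ξ x := by
  obtain ⟨ζ, θ, z₁, u₁, x₁, hc, hz, hu, hx, hfin⟩ := exists_critical hnl hirr haper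
  have hζ := hc.1
  have hθ := hc.2.1
  have hv : (1 : ℝ) ≤ v0 S := by exact_mod_cast one_le_v0 haper
  have hv0 : (0 : ℝ) < v0 S := by linarith
  have h1 : 0 < Real.log (z₁ / ζ) := Real.log_pos ((one_lt_div hζ).2 hz)
  have h2 : 0 < Real.log (u₁ / θ) / v0 S := div_pos (Real.log_pos ((one_lt_div hθ).2 hu)) hv0
  set ξ := min (Real.log (z₁ / ζ)) (Real.log (u₁ / θ) / v0 S)
  have hz' : ζ * Real.exp ξ ≤ z₁ := by
    have : Real.exp ξ ≤ z₁ / ζ := (Real.le_log_iff_exp_le (div_pos (hζ.trans hz) hζ)).1 (min_le_left _ _)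
    rwa [le_div_iff₀ hζ, mul_comm] at this
  have hu' : θ * Real.exp (v0 S * ξ) ≤ u₁ := by
    have h3 : v0 S * ξ ≤ Real.log (u₁ / θ) := by
      have : ξ ≤ Real.log (u₁ / θ) / v0 S := min_le_right _ _
      rwa [le_div_iff₀ hv0, mul_comm] at this
    have := (Real.le_log_iff_exp_le (div_pos (hθ.trans hu) hθ)).1 h3
    rwa [le_div_iff₀ hθ, mul_comm] at this
  refine ⟨ζ, θ, ξ, x₁, haper, hc, lt_min h1 h2, hx, fun α => ne_top_of_le_ne_top (hfin α) ?_⟩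
  have hx0 : 0 ≤ x₁ := by linarith
  refine ENNReal.tsum_le_tsum fun t => ?_
  rw [Piece.gw_nodeW S hx0 (by positivity) (by positivity),
    Piece.gw_nodeW S hx0 (hζ.trans hz).le (hθ.trans hu).le]
  apply ENNReal.ofReal_le_ofReal
  have := t.weight_nonneg S
  have := hζ.trans hz
  gcongr

/-- The exponential moments of the steps. -/
def expMoment (S : Spec m) (ζ θ ξ : ℝ) : ℝ :=
  ∑' t : Piece m 0, stepW S ζ θ t * Real.exp (ξ * tilde S t.vec)

theorem stepW_mul_exp {S : Spec m} {ζ θ : ℝ} (hθ : 0 < θ) (ξ : ℝ) (t : Piece m 0)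
    (hf : ¬ IsFinal S t) : stepW S ζ θ t * Real.exp (ξ * tilde S t.vec) =
    t.weight S * (ζ * Real.exp ξ) ^ t.zl * (θ * Real.exp (v0 S * ξ)) ^ t.al /
      (θ * Real.exp (v0 S * ξ)) := by
  have e : Real.exp (ξ * tilde S t.vec) = Real.exp ξ ^ t.zl *
      Real.exp (v0 S * ξ) ^ t.al / Real.exp (v0 S * ξ) := by
    rw [← Real.exp_nat_mul, ← Real.exp_nat_mul, ← Real.exp_add, ← Real.exp_sub]
    congr 1
    simp only [tilde, Piece.vec]; push_cast; ring
  rw [stepW_of_not hf, e, mul_pow, mul_pow]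
  have := hθ.ne'
  field_simp

namespace Env

variable {S : Spec m} {ζ θ ξ x : ℝ} (E : Env S ζ θ ξ x)
include E

theorem ζ_pos : 0 < ζ := E.crit.1
theorem θ_pos : 0 < θ := E.crit.2.1

theorem Ye_ne_top {z u : ℝ} (hz : 0 ≤ z) (hu : 0 ≤ u) (hz' : z ≤ ζ * Real.exp ξ)
    (hu' : u ≤ θ * Real.exp (v0 S * ξ)) (α : Fin (m + 1)) : Ye S α z u ≠ ⊤ :=
  ne_top_of_le_ne_top (E.fin α) (Ye_le_tsum_gw S E.one_lt.le hz hu hz' hu' α)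

theorem summable_exp :
    Summable fun t : Piece m 0 => stepW S ζ θ t * Real.exp (ξ * tilde S t.vec) := by
  have hζ := E.ζ_pos
  have hθ := E.θ_pos
  have h1 := (summable_of_Ye S (by positivity) (by positivity)
    (E.Ye_ne_top (by positivity) (by positivity) le_rfl le_rfl 0)).div_const (θ * Real.exp (v0 S * ξ))
  refine h1.of_nonneg_of_le (fun t => mul_nonneg (stepW_nonneg hζ hθ t) (Real.exp_pos _).le) fun t => ?_
  by_cases hf : IsFinal S t
  · rw [stepW, if_pos hf, zero_mul]
    exact div_nonneg (term_nonneg S (by positivity) (by positivity) t) (by positivity)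
  · rw [stepW_mul_exp hθ ξ t hf]

theorem expMoment_nonneg : 0 ≤ expMoment S ζ θ ξ :=
  tsum_nonneg fun t => mul_nonneg (stepW_nonneg E.ζ_pos E.θ_pos t) (Real.exp_pos _).le

/-- Polynomial moments of the steps are bounded by exponential ones. -/
theorem sq_tilde_le {t : Piece m 0} (ht : stepW S ζ θ t ≠ 0) :
    (tilde S t.vec : ℝ) ^ 2 ≤ 8 / ξ ^ 2 * Real.exp (ξ * tilde S t.vec / 2) := by
  have h1 : (1 : ℝ) ≤ tilde S t.vec := by
    exact_mod_cast one_le_tilde_of_stepW E.aper E.ζ_pos E.θ_pos ht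
  have hξ := E.ξ_pos
  have h2 := Real.quadratic_le_exp_of_nonneg (x := ξ * tilde S t.vec / 2) (by positivity)
  have h3 : (ξ * tilde S t.vec / 2) ^ 2 / 2 ≤ Real.exp (ξ * tilde S t.vec / 2) := by
    have : 0 ≤ ξ * tilde S t.vec / 2 := by positivity
    linarith
  calc (tilde S t.vec : ℝ) ^ 2 = 8 / ξ ^ 2 * ((ξ * tilde S t.vec / 2) ^ 2 / 2) := by field_simp; ring
    _ ≤ _ := by gcongr

end Env

namespace Setup

variable {P : Setup m} {ξ₁ x₁ : ℝ}

variable (P) in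
/-- The target of the coordinate `ũ`. -/
def M : ℝ := (P.n : ℝ) - v0 P.S

theorem ξ_true : P.ξ true = P.ε / √P.M := by simp [ξ, M]

theorem ξ_false : P.ξ false = -(P.ε / √P.M) := by simp [ξ, M]

theorem Reg.of_env (E : Env P.S P.ζ P.θ ξ₁ x₁) (hlt : v0 P.S < P.n) (hκ : 0 < P.κ) (hε : 0 < P.ε)
    (hξ : P.ε / √P.M ≤ ξ₁) : P.Reg := by
  have hζ := E.ζ_pos
  have hθ := E.θ_pos
  have hx : ∀ a, P.ξ a ≤ ξ₁ := by
    have h0 : 0 ≤ P.ε / √P.M := by positivity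
    rintro (_ | _)
    · rw [ξ_false]; linarith
    · rwa [ξ_true]
  refine ⟨E.aper, E.crit, fun a β => E.Ye_ne_top ?_ ?_ ?_ ?_ β, hlt, hκ⟩
  · rw [z]; positivity
  · rw [u]; positivity
  · rw [z]; have := hx a; gcongr
  · rw [u]; have := hx a; gcongr

namespace Reg

variable (h : P.Reg)
include h

theorem M_pos : 0 < P.M := by
  have : (v0 P.S : ℝ) < P.n := by exact_mod_cast h.lt
  rw [M]; linarith

theorem one_le_M : 1 ≤ P.M := by
  have : (v0 P.S : ℝ) + 1 ≤ P.n := by exact_mod_cast h.lt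
  rw [M]; linarith

theorem add_eq_one : P.Ane + P.A0 = 1 := by rw [h.Ane_eq]; ring

/-- The normalisation of `F` is close to that of the critical weights. -/
theorem sum_massNe_le (E : Env P.S P.ζ P.θ ξ₁ x₁) (hε : 0 < P.ε) (hξ : P.ε / √P.M ≤ ξ₁ / 2) :
    (∑ b, P.massNe b) / (2 * P.Ane) ≤
      1 + 4 * P.ε ^ 2 * expMoment P.S P.ζ P.θ ξ₁ / (ξ₁ ^ 2 * P.Ane) / P.M := by
  have hM := h.M_pos
  have hA := h.Ane_pos
  have hξ1 := E.ξ_pos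
  have hs := (h.hasSum_tilt true).add (h.hasSum_tilt false)
  have hb : HasSum (fun t => 2 * P.w t + (P.ε / √P.M) ^ 2 * (8 / ξ₁ ^ 2) *
      (P.w t * Real.exp (ξ₁ * tilde P.S t.vec)))
      (2 * P.Ane + (P.ε / √P.M) ^ 2 * (8 / ξ₁ ^ 2) * expMoment P.S P.ζ P.θ ξ₁) :=
    (h.hasSum_w.mul_left 2).add (E.summable_exp.hasSum.mul_left _)
  have hle := hasSum_le (fun t => ?_) hs hb
  · rw [Fintype.sum_bool]
    rw [div_pow, Real.sq_sqrt hM.le] at hle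
    rw [div_le_iff₀ (by positivity)]
    refine hle.trans (le_of_eq ?_)
    field_simp
    ring
  · by_cases hw : P.w t = 0
    · simp [hw]
    · have h1 : (1 : ℝ) ≤ tilde P.S t.vec := by exact_mod_cast h.one_le_tilde hw
      have hq := E.sq_tilde_le hw
      have hc := cosh_le_one_add (x := P.ε / √P.M * tilde P.S t.vec) (by positivity)
      rw [ξ_true, ξ_false, ← mul_add]
      have e1 : Real.exp (P.ε / √P.M * tilde P.S t.vec) + Real.exp (-(P.ε / √P.M) * tilde P.S t.vec) =
          2 * Real.cosh (P.ε / √P.M * tilde P.S t.vec) := by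
        rw [Real.cosh_eq, neg_mul]; ring
      rw [e1]
      have e2 : Real.exp (P.ε / √P.M * tilde P.S t.vec) ≤ Real.exp (ξ₁ * tilde P.S t.vec / 2) := by
        apply Real.exp_le_exp.2
        calc _ ≤ ξ₁ / 2 * tilde P.S t.vec := by gcongr
          _ = _ := by ring
      have e3 : (P.ε / √P.M * tilde P.S t.vec) ^ 2 * Real.exp (P.ε / √P.M * tilde P.S t.vec) ≤
          (P.ε / √P.M) ^ 2 * (8 / ξ₁ ^ 2) * Real.exp (ξ₁ * tilde P.S t.vec) := by
        calc _ = (P.ε / √P.M) ^ 2 * ((tilde P.S t.vec : ℝ) ^ 2 * Real.exp (P.ε / √P.M * tilde P.S t.vec)) := by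
              ring
          _ ≤ (P.ε / √P.M) ^ 2 * ((8 / ξ₁ ^ 2 * Real.exp (ξ₁ * tilde P.S t.vec / 2)) *
              Real.exp (ξ₁ * tilde P.S t.vec / 2)) := by gcongr
          _ = _ := by
              rw [mul_assoc (8 / ξ₁ ^ 2), ← Real.exp_add]; ring_nf
      have h0 := h.w_nonneg t
      calc P.w t * (2 * Real.cosh (P.ε / √P.M * tilde P.S t.vec)) ≤
          P.w t * (2 + (P.ε / √P.M) ^ 2 * (8 / ξ₁ ^ 2) * Real.exp (ξ₁ * tilde P.S t.vec)) := by
            gcongr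
            linarith
        _ = _ := by ring

theorem F_eq_cosh (y : ℤ) :
    P.F y = 2 * P.Ane / (∑ b, P.massNe b) * Real.cosh (P.ε / √P.M * y) := by
  rw [h.F_eq, Fintype.sum_bool, Fintype.sum_bool, ξ_true, ξ_false, Real.cosh_eq, neg_mul]
  ring

omit h in
theorem sum_tilde (l : List (Piece m 0)) (c : ℝ) :
    (l.map fun t => c * (tilde P.S t.vec : ℝ)).sum = c * (tilde P.S (endpoint l) : ℝ) := by
  induction l with
  | nil => simp [endpoint_nil, tilde_zero]
  | cons t l ih => rw [List.map_cons, List.sum_cons, ih, endpoint_cons, tilde_add]; push_cast; ring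

theorem length_le_M {l : List (Piece m 0)} (hl : ∀ t ∈ l, P.w t ≠ 0)
    (hland : endpoint l ∈ landing P.S P.n) : (l.length : ℝ) ≤ P.M := by
  have h1 := length_le_tilde (S := P.S) l fun t ht => h.one_le_tilde (hl t ht)
  rw [hland.2.2] at h1
  have : ((l.length : ℤ) : ℝ) ≤ (((P.n : ℤ) - v0 P.S : ℤ) : ℝ) := by exact_mod_cast h1
  rw [M]; push_cast at this; exact this

/-- The product of the factors `F` is bounded from below, and large for the walks with few steps. -/
theorem prod_inv_F_le (E : Env P.S P.ζ P.θ ξ₁ x₁) (hε : 0 < P.ε) (hξ : P.ε / √P.M ≤ ξ₁ / 2)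
    {l : List (Piece m 0)} (hl : ∀ t ∈ l, P.w t ≠ 0) (hland : endpoint l ∈ landing P.S P.n) :
    (l.map fun s => (P.F (tilde P.S s.vec))⁻¹).prod ≤
      Real.exp (4 * P.ε ^ 2 * expMoment P.S P.ζ P.θ ξ₁ / (ξ₁ ^ 2 * P.Ane)) *
        ((1 + P.ε ^ 2 * P.M / (8 * l.length)) ^ 2)⁻¹ := by
  set C := 4 * P.ε ^ 2 * expMoment P.S P.ζ P.θ ξ₁ / (ξ₁ ^ 2 * P.Ane) with hC
  have hM := h.M_pos
  have hA := h.Ane_pos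
  have hC0 : 0 ≤ C := by
    have := E.expMoment_nonneg; have := E.ξ_pos
    positivity
  set ρ := (∑ b, P.massNe b) / (2 * P.Ane) with hρ
  have hρ0 : 0 < ρ := div_pos h.sum_massNe_pos (by positivity)
  have hρ1 : ρ ≤ 1 + C / P.M := h.sum_massNe_le E hε hξ
  have e1 : ∀ l : List (Piece m 0), (l.map fun s => (P.F (tilde P.S s.vec))⁻¹).prod = ρ ^ l.length *
      ((l.map fun t => P.ε / √P.M * (tilde P.S t.vec : ℝ)).map Real.cosh).prod⁻¹ := by
    intro l
    induction l with
    | nil => simp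
    | cons t l ih =>
      simp only [List.map_cons, List.prod_cons, List.length_cons]
      rw [ih, h.F_eq_cosh, mul_inv, mul_inv, inv_div, ← hρ]
      ring
  rw [e1]
  have hk := h.length_le_M hl hland
  have h1 : ρ ^ l.length ≤ Real.exp C := by
    calc ρ ^ l.length ≤ Real.exp (C / P.M) ^ l.length := by
          gcongr
          have := Real.add_one_le_exp (C / P.M)
          linarith
      _ = Real.exp (l.length * (C / P.M)) := by rw [← Real.exp_nat_mul]
      _ ≤ Real.exp C := by
          apply Real.exp_le_exp.2
          rw [mul_div_assoc', div_le_iff₀ hM, mul_comm]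
          gcongr
  have h2 := le_prod_cosh (l.map fun t => P.ε / √P.M * (tilde P.S t.vec : ℝ))
    (by simpa using h.pos_of_landing hland)
  rw [sum_tilde, List.length_map, hland.2.2] at h2
  have e3 : (P.ε / √P.M * (((P.n : ℤ) - v0 P.S : ℤ) : ℝ)) ^ 2 = P.ε ^ 2 * P.M := by
    have : (((P.n : ℤ) - v0 P.S : ℤ) : ℝ) = P.M := by rw [M]; push_cast; rfl
    rw [this, mul_pow, div_pow, Real.sq_sqrt hM.le]; field_simp
  rw [e3] at h2
  have hk0 : (0 : ℝ) < l.length := by exact_mod_cast List.length_pos_iff.2 (h.pos_of_landing hland)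
  have hp : 0 < (1 + P.ε ^ 2 * P.M / (8 * l.length)) ^ 2 := by positivity
  have hp2 := inv_anti₀ hp h2
  have hp3 := inv_nonneg.2 (hp.le.trans h2)
  gcongr

omit h in
theorem K_eq : P.K = P.κ * (P.n * √P.n) := by
  have hn : (0 : ℝ) ≤ P.n := Nat.cast_nonneg _
  rw [K, show (3 / 2 : ℝ) = 1 + 1 / 2 by norm_num, Real.rpow_add_of_nonneg hn zero_le_one (by norm_num),
    Real.rpow_one, Real.sqrt_eq_rpow]

omit h in
theorem factorial_ratio {k q : ℕ} (hk : 0 < k) (p r : ℝ) :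
    (Nat.factorial (k + q - 1) : ℝ) / (Nat.factorial k * Nat.factorial q) * p ^ k * r ^ q =
      binom p r k q / (k + q) := by
  have hch : (((k + q).choose k : ℕ) : ℝ) * (Nat.factorial k * Nat.factorial q) =
      (k + q : ℕ) * Nat.factorial (k + q - 1) := by
    have := Nat.add_choose_mul_factorial_mul_factorial k q
    rw [← Nat.mul_factorial_pred (by omega : k + q ≠ 0), ← Nat.choose_symm_add] at this
    rw [← mul_assoc]
    exact_mod_cast this
  have hk0 : (0 : ℝ) < k := by exact_mod_cast hk
  have hkq : (0 : ℝ) < k + q := by positivity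
  rw [binom]
  push_cast at hch
  have f1 : (Nat.factorial k : ℝ) ≠ 0 := by exact_mod_cast (Nat.factorial_pos k).ne'
  have f2 : (Nat.factorial q : ℝ) ≠ 0 := by exact_mod_cast (Nat.factorial_pos q).ne'
  field_simp
  linear_combination (-(p ^ k * r ^ q)) * hch

theorem rate_eq {l : List (Piece m 0)} (hland : endpoint l ∈ landing P.S P.n) :
    P.rate l = P.κ * (P.n * √P.n) * (binom P.Ane P.A0 l.length ((endpoint l).2 + 1).toNat /
      (l.length + ((endpoint l).2 + 1).toNat)) * (l.map fun s => (P.F (tilde P.S s.vec))⁻¹).prod := by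
  rw [← factorial_ratio (List.length_pos_iff.2 (h.pos_of_landing hland)), ← K_eq, rate]
  ring

end Reg

theorem pow_three_half_le {c x : ℝ} (hc : 0 < c) (hx : 0 ≤ x) :
    x * √x ≤ (1 / min 1 c ^ 2) * (1 + c * x) ^ 2 := by
  have hm : 0 < min 1 c := lt_min one_pos hc
  rw [one_div, inv_mul_eq_div, le_div_iff₀ (by positivity)]
  have h1 : min 1 c * (1 + x) ≤ 1 + c * x := by
    have := min_le_left 1 c
    have := mul_le_mul_of_nonneg_right (min_le_right 1 c) hx
    linarith
  have h2 : x * √x ≤ (1 + x) ^ 2 := by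
    have : √x ≤ 1 + x := Real.sqrt_le_left (by positivity) |>.2 (by nlinarith)
    nlinarith [Real.sqrt_nonneg x]
  calc x * √x * min 1 c ^ 2 ≤ (1 + x) ^ 2 * min 1 c ^ 2 := by gcongr
    _ = (min 1 c * (1 + x)) ^ 2 := by ring
    _ ≤ _ := by gcongr

/-- The acceptance rates are bounded, and they are much smaller for the walks in which the numbers
of pieces of the two types are unbalanced. -/
theorem exists_rate_le {S : Spec m} {ζ θ : ℝ} (E : Env S ζ θ ξ₁ x₁) {ε : ℝ} (hε : 0 < ε) :
    ∃ δ C : ℝ, 0 < δ ∧ 0 < C ∧ ∀ P : Setup m, P.Reg → P.S = S → P.ζ = ζ → P.θ = θ → P.ε = ε →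
      ε / √P.M ≤ ξ₁ / 2 → ∀ l : List (Piece m 0), (∀ t ∈ l, P.w t ≠ 0) →
      endpoint l ∈ landing P.S P.n → P.rate l ≤ C * P.κ ∧
      ((δ * (l.length + ((endpoint l).2 + 1).toNat) ≤ l.length ∧
        δ * (l.length + ((endpoint l).2 + 1).toNat) ≤ ((endpoint l).2 + 1).toNat) ∨
      P.rate l * (l.length + ((endpoint l).2 + 1).toNat) ≤ C * P.κ) := by
  -- `A_≠` and `A_0` depend on the specification and the critical point only, not on `ε`, `κ` and `n`: they
  -- are read off from any instance
  by_cases hne : ∃ P : Setup m, P.Reg ∧ P.S = S ∧ P.ζ = ζ ∧ P.θ = θ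
  swap
  · exact ⟨1, 1, one_pos, one_pos, fun P h h1 h2 h3 => absurd ⟨P, h, h1, h2, h3⟩ hne⟩
  obtain ⟨P₀, h₀, hS, hζ, hθ⟩ := hne
  obtain ⟨δ, C, hδ, hC, hbin⟩ := exists_binom_le h₀.Ane_pos h₀.A0_pos h₀.add_eq_one
  set G := Real.exp (4 * ε ^ 2 * expMoment S ζ θ ξ₁ / (ξ₁ ^ 2 * P₀.Ane)) with hG
  set v : ℝ := 1 + v0 S with hv
  set D := 1 / min 1 (ε ^ 2 / 8) ^ 2 with hD
  have hv0 : 0 < v := by positivity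
  have hm : 0 < min 1 (ε ^ 2 / 8) := lt_min one_pos (by positivity)
  have hD0 : 0 < D := by positivity
  refine ⟨δ, v * √v * C * G * D, hδ, by positivity, fun P h h1 h2 h3 h4 hξ l hl hland => ?_⟩
  have hA0 : P.A0 = P₀.A0 := by rw [A0, A0, h1, h2, h3, hS, hζ, hθ]
  have hAne : P.Ane = P₀.Ane := by rw [h.Ane_eq, h₀.Ane_eq, hA0]
  have E' : Env P.S P.ζ P.θ ξ₁ x₁ := by rw [h1, h2, h3]; exact E
  have hF := h.prod_inv_F_le E' (h4 ▸ hε) (h4 ▸ hξ) hl hland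
  have hG' : Real.exp (4 * P.ε ^ 2 * expMoment P.S P.ζ P.θ ξ₁ / (ξ₁ ^ 2 * P.Ane)) = G := by
    rw [h1, h2, h3, h4, hAne]
  rw [hG', h4] at hF
  rw [h.rate_eq hland]
  have hk := List.length_pos_iff.2 (h.pos_of_landing hland)
  obtain ⟨b1, b2⟩ := hbin l.length ((endpoint l).2 + 1).toNat (by omega)
  rw [← hA0, ← hAne] at b1 b2
  set k := l.length
  set q := ((endpoint l).2 + 1).toNat
  set N : ℝ := (k : ℝ) + q
  have hk0 : (0 : ℝ) < k := by exact_mod_cast hk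
  have hN : 0 < N := by positivity
  have hM := h.M_pos
  have hκ := h.κ_pos
  set FF := (l.map fun s => (P.F (tilde P.S s.vec))⁻¹).prod
  have hF0 : 0 < FF := h.prod_inv_F l
  have hbn : 0 ≤ binom P.Ane P.A0 k q := by
    have := h.Ane_pos; have := h.A0_pos
    rw [binom]; positivity
  have hn : (P.n : ℝ) ≤ v * P.M := by
    have := h.one_le_M
    have e : (P.n : ℝ) = P.M + v0 S := by rw [M, h1]; ring
    rw [hv, e, add_mul, one_mul]
    have := mul_le_mul_of_nonneg_left this (Nat.cast_nonneg (α := ℝ) (v0 S))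
    linarith
  have hnn : (P.n : ℝ) * √P.n ≤ v * √v * (P.M * √P.M) := by
    calc (P.n : ℝ) * √P.n ≤ (v * P.M) * √(v * P.M) := by gcongr
      _ = _ := by rw [Real.sqrt_mul hv0.le]; ring
  -- the loss of a factor `(M / N) ^ (3 / 2)` is compensated by the factors `F`
  have hcomp : P.M * √P.M / (N * √N) * ((1 + ε ^ 2 * P.M / (8 * k)) ^ 2)⁻¹ ≤ D := by
    have hx : P.M / N ≤ P.M / k := by
      gcongr
      exact le_add_of_nonneg_right (Nat.cast_nonneg q)
    have h5 := pow_three_half_le (c := ε ^ 2 / 8) (by positivity) (x := P.M / N) (by positivity)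
    rw [← div_eq_mul_inv, div_le_iff₀ (by positivity)]
    calc P.M * √P.M / (N * √N) = P.M / N * √(P.M / N) := by
          rw [Real.sqrt_div hM.le]; field_simp
      _ ≤ D * (1 + ε ^ 2 / 8 * (P.M / N)) ^ 2 := h5
      _ ≤ D * (1 + ε ^ 2 / 8 * (P.M / k)) ^ 2 := by gcongr
      _ = _ := by congr 3; field_simp
  have hmain : ∀ B : ℝ, 0 ≤ B → B ≤ C / (N * √N) →
      P.κ * (P.n * √P.n) * B * FF ≤ v * √v * C * G * D * P.κ := by
    intro B hB0 hB
    calc P.κ * (P.n * √P.n) * B * FF ≤ P.κ * (v * √v * (P.M * √P.M)) * (C / (N * √N)) *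
          (G * ((1 + ε ^ 2 * P.M / (8 * k)) ^ 2)⁻¹) := by gcongr
      _ = P.κ * (v * √v) * C * G * (P.M * √P.M / (N * √N) * ((1 + ε ^ 2 * P.M / (8 * k)) ^ 2)⁻¹) := by
          ring
      _ ≤ P.κ * (v * √v) * C * G * D := by gcongr
      _ = _ := by ring
  constructor
  · refine hmain _ (by positivity) ?_
    calc binom P.Ane P.A0 k q / N ≤ C / √N / N := by gcongr
      _ = _ := by field_simp
  · rcases b2 with b2 | b2
    · exact Or.inl b2
    · right
      have := hmain _ hbn b2
      calc _ = P.κ * (P.n * √P.n) * binom P.Ane P.A0 k q * FF := by field_simp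
        _ ≤ _ := this

end Setup

end CF

/-! ### Renewal theory -/

namespace CF

open Filter Topology

variable {X : Type} (g : X → ℝ≥0∞) (s : X → ℕ)

/-- The total weight, with an additional factor `f`, of the lists of total size `M`. -/
def hits (M : ℕ) (f : List X → ℝ≥0∞) : ℝ≥0∞ :=
  ∑' l : List X, if (l.map s).sum = M then (l.map g).prod * f l else 0

/-- The renewal sequence: the probability that a sum of independent steps hits `M`. -/
def renewal (M : ℕ) : ℝ≥0∞ := hits g s M fun _ => 1

/-- The tail of the law of the steps. -/
def tailProb (i : ℕ) : ℝ≥0∞ := ∑' t, if i < s t then g t else 0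

theorem hits_rec (M : ℕ) (f : List X → ℝ≥0∞) : hits g s M f = (if M = 0 then f [] else 0) +
    ∑' t, g t * (if s t ≤ M then hits g s (M - s t) (fun l => f (t :: l)) else 0) := by
  rw [hits, tsum_list]
  congr 1
  · simp [eq_comm]
  · refine tsum_congr fun t => ?_
    split_ifs with ht
    · rw [hits, ← ENNReal.tsum_mul_left]
      refine tsum_congr fun l => ?_
      have : ((t :: l).map s).sum = M ↔ (l.map s).sum = M - s t := by
        rw [List.map_cons, List.sum_cons]; omega
      by_cases h : (l.map s).sum = M - s t
      · rw [if_pos h, if_pos (this.2 h), List.map_cons, List.prod_cons, mul_assoc]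
      · rw [if_neg h, if_neg (mt this.1 h), mul_zero]
    · rw [mul_zero]
      refine ENNReal.tsum_eq_zero.2 fun l => if_neg ?_
      rw [List.map_cons, List.sum_cons]; omega

theorem hits_mono {M : ℕ} {f f' : List X → ℝ≥0∞}
    (h : ∀ l, (l.map s).sum = M → (l.map g).prod * f l ≤ (l.map g).prod * f' l) :
    hits g s M f ≤ hits g s M f' := by
  refine ENNReal.tsum_le_tsum fun l => ?_
  split_ifs with hl
  · exact h l hl
  · exact le_rfl

theorem hits_add (M : ℕ) (f f' : List X → ℝ≥0∞) :
    hits g s M (fun l => f l + f' l) = hits g s M f + hits g s M f' := by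
  rw [hits, hits, hits, ← ENNReal.tsum_add]
  refine tsum_congr fun l => ?_
  split_ifs
  · rw [mul_add]
  · rw [add_zero]

theorem hits_const_mul (M : ℕ) (c : ℝ≥0∞) (f : List X → ℝ≥0∞) :
    hits g s M (fun l => c * f l) = c * hits g s M f := by
  rw [hits, hits, ← ENNReal.tsum_mul_left]
  refine tsum_congr fun l => ?_
  split_ifs
  · ring
  · rw [mul_zero]

variable {g s} (hg : ∑' t, g t = 1) (hs : ∀ t, g t ≠ 0 → 1 ≤ s t)

include hs in
theorem hits_zero (f : List X → ℝ≥0∞) : hits g s 0 f = f [] := by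
  rw [hits_rec, if_pos rfl, ENNReal.tsum_eq_zero.2, add_zero]
  intro t
  by_cases h : g t = 0
  · rw [h, zero_mul]
  · have := hs t h
    rw [if_neg (by omega), mul_zero]

theorem renewal_rec {M : ℕ} (hM : M ≠ 0) :
    renewal g s M = ∑' t, g t * (if s t ≤ M then renewal g s (M - s t) else 0) := by
  rw [renewal, hits_rec, if_neg hM, zero_add]
  rfl

include hg hs in
/-- The last renewal time up to `M` has a distribution of total mass one. -/
theorem sum_renewal_mul_tailProb (M : ℕ) :
    ∑ p ∈ Finset.HasAntidiagonal.antidiagonal M, renewal g s p.1 * tailProb g s p.2 = 1 := by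
  induction M using Nat.strong_induction_on with
  | _ M ih =>
    rw [Finset.Nat.sum_antidiagonal_eq_sum_range_succ fun i j => renewal g s i * tailProb g s j]
    have e : ∀ i ∈ Finset.range (M + 1), renewal g s i * tailProb g s (M - i) =
        (if i = 0 then tailProb g s M else 0) +
        ∑' t, g t * (if s t ≤ i then renewal g s (i - s t) * tailProb g s (M - i) else 0) := by
      intro i _
      rw [renewal, hits_rec, add_mul, ← ENNReal.tsum_mul_right]
      congr 1
      · split_ifs with h
        · rw [h, one_mul, Nat.sub_zero]
        · rw [zero_mul]
      · refine tsum_congr fun t => ?_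
        split_ifs
        · rw [mul_assoc]; rfl
        · simp
    rw [Finset.sum_congr rfl e, Finset.sum_add_distrib, ← Summable.tsum_finsetSum fun _ _ => ENNReal.summable]
    simp only [← Finset.mul_sum]
    rw [Finset.sum_ite_eq' (Finset.range (M + 1)) 0 fun _ => tailProb g s M, if_pos (by simp), tailProb, ← ENNReal.tsum_add, ← hg]
    refine tsum_congr fun t => ?_
    by_cases h0 : g t = 0
    · simp [h0]
    have h1 := hs t h0
    by_cases ht : s t ≤ M
    · rw [if_neg (by omega), zero_add]
      have e2 : M + 1 = s t + (M - s t + 1) := by omega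
      rw [e2, Finset.sum_range_add, Finset.sum_eq_zero, zero_add]
      · have := ih (M - s t) (by omega)
        rw [Finset.Nat.sum_antidiagonal_eq_sum_range_succ fun i j => renewal g s i * tailProb g s j] at this
        rw [Finset.sum_congr rfl, this, mul_one]
        intro j _
        rw [if_pos (by omega), Nat.add_sub_cancel_left, Nat.sub_add_eq]
      · intro i hi
        rw [Finset.mem_range] at hi
        rw [if_neg (by omega)]
    · rw [if_pos (by omega), Finset.sum_eq_zero, mul_zero, add_zero]
      intro i hi
      rw [Finset.mem_range] at hi
      rw [if_neg (by omega)]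

include hg hs in
theorem tailProb_zero : tailProb g s 0 = 1 := by
  rw [tailProb, ← hg]
  refine tsum_congr fun t => ?_
  by_cases h0 : g t = 0
  · simp [h0]
  · rw [if_pos (show 0 < s t from hs t h0)]

include hg hs in
theorem renewal_le_one (M : ℕ) : renewal g s M ≤ 1 := by
  have h := sum_renewal_mul_tailProb hg hs M
  rw [← h]
  have := Finset.single_le_sum (f := fun p : ℕ × ℕ => renewal g s p.1 * tailProb g s p.2)
    (fun _ _ => zero_le) (Finset.HasAntidiagonal.mem_antidiagonal.2 (show (M, 0).1 + (M, 0).2 = M from add_zero M))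
  simpa [tailProb_zero hg hs] using this

theorem tsum_tailProb : ∑' i, tailProb g s i = ∑' t, g t * s t := by
  simp only [tailProb]
  rw [ENNReal.tsum_comm]
  refine tsum_congr fun t => ?_
  rw [tsum_eq_sum (s := Finset.range (s t))]
  · rw [Finset.sum_congr rfl fun i hi => if_pos (Finset.mem_range.1 hi), Finset.sum_const,
      Finset.card_range, nsmul_eq_mul, mul_comm]
  · intro i hi
    rw [if_neg (by simpa using hi)]

include hs in
theorem renewal_mul_le (a b : ℕ) : renewal g s a * renewal g s b ≤ renewal g s (a + b) := by
  induction a using Nat.strong_induction_on with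
  | _ a ih =>
    rcases Nat.eq_zero_or_pos a with rfl | ha
    · rw [zero_add]
      have : renewal g s 0 = 1 := hits_zero hs _
      rw [this, one_mul]
    · rw [renewal_rec ha.ne', renewal_rec (M := a + b) (by omega), ← ENNReal.tsum_mul_right]
      refine ENNReal.tsum_le_tsum fun t => ?_
      by_cases h0 : g t = 0
      · simp [h0]
      have h1 := hs t h0
      split_ifs with h2 h3
      · rw [mul_assoc]
        gcongr
        refine (ih (a - s t) (by omega)).trans_eq ?_
        congr 1; omega
      · omega
      · rw [mul_zero, zero_mul]; exact zero_le
      · simp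

include hs in
theorem exists_renewal_ne_zero (hgcd : Nat.setGcd {i | ∃ t, g t ≠ 0 ∧ s t = i} = 1) :
    ∃ e, ∀ i ≥ e, renewal g s i ≠ 0 := by
  obtain ⟨e, he⟩ := Nat.exists_mem_closure_of_ge {i | ∃ t, g t ≠ 0 ∧ s t = i}
  have h0 : renewal g s 0 = 1 := hits_zero hs _
  refine ⟨e, fun i hi => ?_⟩
  have hm := he i hi (by rw [hgcd]; exact one_dvd i)
  clear hi
  induction hm using AddSubmonoid.closure_induction with
  | mem i hi =>
    obtain ⟨t, ht, rfl⟩ := hi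
    have h1 := hs t ht
    rw [renewal_rec (by omega)]
    refine (lt_of_lt_of_le ?_ (ENNReal.le_tsum t)).ne'
    rw [if_pos le_rfl, Nat.sub_self, h0, mul_one]
    exact pos_iff_ne_zero.2 ht
  | zero => rw [h0]; exact one_ne_zero
  | add x y _ _ hx hy =>
    have := renewal_mul_le hs x y
    exact (lt_of_lt_of_le (pos_iff_ne_zero.2 (mul_ne_zero hx hy)) this).ne'

include hg hs in
/-- If the steps are aperiodic and have a finite mean, the renewal sequence is bounded from below. -/
theorem exists_le_renewal (hmean : ∑' t, g t * s t ≠ ⊤)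
    (hgcd : Nat.setGcd {i | ∃ t, g t ≠ 0 ∧ s t = i} = 1) :
    ∃ c : ℝ≥0∞, c ≠ 0 ∧ ∃ M₀, ∀ M ≥ M₀, c ≤ renewal g s M := by
  obtain ⟨e, he⟩ := exists_renewal_ne_zero hs hgcd
  rw [← tsum_tailProb] at hmean
  have ht := ENNReal.tendsto_sum_nat_add _ hmean
  -- the gaps longer than `L` contribute at most `1 / 2`, so `M - e` is preceded by a likely renewal time
  -- within distance `L`, and the renewals beyond `e` fill what is missing
  obtain ⟨L, hL1, hL⟩ := ((ht.eventually_le_const (u := 1 / 2) (by simp)).and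
    (eventually_ge_atTop 1)).exists
  have hne : (Finset.range L).Nonempty := ⟨0, Finset.mem_range.2 hL⟩
  obtain ⟨j₀, hj₀, hmin⟩ := Finset.exists_min_image (Finset.range L) (fun j => renewal g s (e + j)) hne
  refine ⟨1 / 2 / L * renewal g s (e + j₀), mul_ne_zero ?_ (he _ (Nat.le_add_right e j₀)), e + L, fun M hM => ?_⟩
  · exact ENNReal.div_ne_zero.2 ⟨by simp, ENNReal.natCast_ne_top L⟩
  have hQ := sum_renewal_mul_tailProb hg hs (M - e)
  rw [← Finset.Nat.sum_antidiagonal_swap, Finset.Nat.sum_antidiagonal_eq_sum_range_succ_mk] at hQ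
  simp only [Prod.fst_swap, Prod.snd_swap] at hQ
  have e2 : (M - e).succ = L + (M - e + 1 - L) := by omega
  rw [e2, Finset.sum_range_add] at hQ
  have hsmall : ∑ i ∈ Finset.range (M - e + 1 - L),
      renewal g s (M - e - (L + i)) * tailProb g s (L + i) ≤ 1 / 2 := by
    refine le_trans ?_ hL1
    refine le_trans ?_ (ENNReal.sum_le_tsum (Finset.range (M - e + 1 - L)))
    refine Finset.sum_le_sum fun i _ => ?_
    rw [add_comm i L]
    exact mul_le_of_le_one_left zero_le (renewal_le_one hg hs _)
  have hbig : 1 / 2 ≤ ∑ i ∈ Finset.range L, renewal g s (M - e - i) := by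
    have h1 : ∑ i ∈ Finset.range L, renewal g s (M - e - i) * tailProb g s i ≤
        ∑ i ∈ Finset.range L, renewal g s (M - e - i) := by
      refine Finset.sum_le_sum fun i _ => mul_le_of_le_one_right zero_le ?_
      rw [← tailProb_zero hg hs]
      refine ENNReal.tsum_le_tsum fun t => ?_
      split_ifs
      · exact le_rfl
      · omega
      · exact zero_le
      · exact le_rfl
    have h2 : (1 : ℝ≥0∞) ≤ ∑ i ∈ Finset.range L, renewal g s (M - e - i) + 1 / 2 := by
      refine hQ.symm.trans_le ?_
      exact add_le_add h1 hsmall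
    have h3 : (1 / 2 : ℝ≥0∞) + 1 / 2 ≤ ∑ i ∈ Finset.range L, renewal g s (M - e - i) + 1 / 2 := by
      rwa [ENNReal.add_halves]
    exact (ENNReal.add_le_add_iff_right (by simp)).1 h3
  obtain ⟨i, hi, hle⟩ := ENNReal.exists_le_of_sum_le (s := Finset.range L) (f := fun _ => 1 / 2 / (L : ℝ≥0∞))
    (g := fun i => renewal g s (M - e - i)) hne (by
      rw [Finset.sum_const, Finset.card_range, nsmul_eq_mul,
        ENNReal.mul_div_cancel (by exact_mod_cast (by omega : L ≠ 0)) (ENNReal.natCast_ne_top L)]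
      exact hbig)
  rw [Finset.mem_range] at hi
  have e3 : M = (M - e - i) + (e + i) := by omega
  calc _ ≤ renewal g s (M - e - i) * renewal g s (e + i) :=
        mul_le_mul' hle (hmin i (Finset.mem_range.2 hi))
    _ ≤ renewal g s ((M - e - i) + (e + i)) := renewal_mul_le hs _ _
    _ = _ := by rw [← e3]

include hg hs in
/-- A bound on the second moment of a centred functional on the lists that hit `M`. It is stated for all
the starting values `a`, so that the induction on the first step goes through. -/
theorem hits_sq_le {d : X → ℝ} {v : ℝ} (hv : 0 ≤ v)
    (hd : ∀ a : ℝ, ∑' t, g t * ENNReal.ofReal ((a + d t) ^ 2) ≤ ENNReal.ofReal (a ^ 2 + v)) (M : ℕ) :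
    ∀ a : ℝ, hits g s M (fun l => ENNReal.ofReal ((a + (l.map d).sum) ^ 2)) ≤
      ENNReal.ofReal (a ^ 2 + v * M) := by
  induction M using Nat.strong_induction_on with
  | _ M ih =>
    intro a
    rcases Nat.eq_zero_or_pos M with rfl | hM
    · rw [hits_zero hs]; simp
    · rw [hits_rec, if_neg hM.ne', zero_add]
      have e : (M : ℝ) = ((M - 1 : ℕ) : ℝ) + 1 := by rw [← Nat.cast_succ]; congr 1; omega
      calc _ ≤ ∑' t, g t * (ENNReal.ofReal ((a + d t) ^ 2) + ENNReal.ofReal (v * ((M - 1 : ℕ) : ℝ))) := by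
            refine ENNReal.tsum_le_tsum fun t => ?_
            by_cases h0 : g t = 0
            · simp [h0]
            have h1 := hs t h0
            gcongr
            split_ifs with ht
            · have := ih (M - s t) (by omega) (a + d t)
              simp only [List.map_cons, List.sum_cons, ← add_assoc]
              refine this.trans ?_
              rw [← ENNReal.ofReal_add (sq_nonneg _) (by positivity)]
              apply ENNReal.ofReal_le_ofReal
              gcongr
            · exact zero_le
        _ ≤ ENNReal.ofReal (a ^ 2 + v) + ENNReal.ofReal (v * ((M - 1 : ℕ) : ℝ)) := by
            simp only [mul_add]
            rw [ENNReal.tsum_add, ENNReal.tsum_mul_right, hg, one_mul]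
            gcongr
            exact hd a
        _ = _ := by
            rw [← ENNReal.ofReal_add (by positivity) (by positivity), e]
            congr 1
            ring

open scoped Classical in
include hg hs in
/-- Chebyshev's inequality on the lists that hit `M`. -/
theorem hits_chebyshev {d : X → ℝ} {v : ℝ} (hv : 0 ≤ v)
    (hd : ∀ a : ℝ, ∑' t, g t * ENNReal.ofReal ((a + d t) ^ 2) ≤ ENNReal.ofReal (a ^ 2 + v)) {M : ℕ}
    (hM : 0 < M) {B : ℝ} (hB : 0 < B) :
    hits g s M (fun l => if B * √M < |(l.map d).sum| then 1 else 0) ≤ ENNReal.ofReal (v / B ^ 2) := by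
  have hM' : (0 : ℝ) < M := by exact_mod_cast hM
  have h := hits_sq_le hg hs hv hd M 0
  simp only [zero_add] at h
  have h2 : hits g s M (fun l => ENNReal.ofReal (B ^ 2 * M) *
      (if B * √M < |(l.map d).sum| then 1 else 0)) ≤ ENNReal.ofReal (0 ^ 2 + v * M) := by
    refine le_trans (hits_mono g s fun l _ => ?_) h
    gcongr
    split_ifs with hl
    · rw [mul_one]
      apply ENNReal.ofReal_le_ofReal
      rw [← sq_abs (l.map d).sum]
      calc B ^ 2 * M = (B * √M) ^ 2 := by rw [mul_pow, Real.sq_sqrt hM'.le]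
        _ ≤ _ := by gcongr
    · rw [mul_zero]; exact zero_le
  rw [hits_const_mul] at h2
  have h3 : ENNReal.ofReal (B ^ 2 * M) ≠ 0 := by simp; positivity
  have h4 := ENNReal.mul_le_iff_le_inv h3 ENNReal.ofReal_ne_top |>.1 h2
  refine h4.trans_eq ?_
  rw [← ENNReal.ofReal_inv_of_pos (by positivity), ← ENNReal.ofReal_mul (by positivity)]
  congr 1
  field_simp
  ring

open scoped Classical in
include hg hs in
/-- With a probability bounded from below, a sum of independent steps hits `M`, and two given centred
functionals are then of order `√M`. -/
theorem exists_le_hits (hmean : ∑' t, g t * s t ≠ ⊤)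
    (hgcd : Nat.setGcd {i | ∃ t, g t ≠ 0 ∧ s t = i} = 1) {d d' : X → ℝ} {v v' : ℝ} (hv : 0 ≤ v)
    (hd : ∀ a : ℝ, ∑' t, g t * ENNReal.ofReal ((a + d t) ^ 2) ≤ ENNReal.ofReal (a ^ 2 + v)) (hv' : 0 ≤ v')
    (hd' : ∀ a : ℝ, ∑' t, g t * ENNReal.ofReal ((a + d' t) ^ 2) ≤ ENNReal.ofReal (a ^ 2 + v')) :
    ∃ c B : ℝ, 0 < c ∧ 0 < B ∧ ∃ M₀, ∀ M ≥ M₀, ENNReal.ofReal c ≤ hits g s M (fun l =>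
      if |(l.map d).sum| ≤ B * √M ∧ |(l.map d').sum| ≤ B * √M then 1 else 0) := by
  obtain ⟨c, hc, M₀, hM₀⟩ := exists_le_renewal hg hs hmean hgcd
  have hctop : c ≠ ⊤ := ne_top_of_le_ne_top ENNReal.one_ne_top
    ((hM₀ M₀ le_rfl).trans (renewal_le_one hg hs M₀))
  set r := c.toReal with hr
  have hr0 : 0 < r := ENNReal.toReal_pos hc hctop
  have hcr : c = ENNReal.ofReal r := (ENNReal.ofReal_toReal hctop).symm
  -- `B` makes the sum of the two Chebyshev bounds at most half of the renewal probability
  set B := √(2 * (v + v' + 1) / r) with hB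
  have hB2 : B ^ 2 = 2 * (v + v' + 1) / r := Real.sq_sqrt (by positivity)
  have hB0 : 0 < B := Real.sqrt_pos.2 (by positivity)
  refine ⟨r / 2, B, by positivity, hB0, max M₀ 1, fun M hM => ?_⟩
  have hM1 : 0 < M := by have := le_of_max_le_right hM; omega
  have h1 := hits_chebyshev hg hs hv hd hM1 hB0
  have h2 := hits_chebyshev hg hs hv' hd' hM1 hB0
  have h3 := (hM₀ M (le_of_max_le_left hM))
  set good : List X → ℝ≥0∞ := fun l =>
    if |(l.map d).sum| ≤ B * √M ∧ |(l.map d').sum| ≤ B * √M then 1 else 0 with hgood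
  have h4 : renewal g s M ≤ hits g s M good + (ENNReal.ofReal (v / B ^ 2) + ENNReal.ofReal (v' / B ^ 2)) := by
    refine le_trans ?_ (add_le_add le_rfl (add_le_add h1 h2))
    rw [← hits_add, ← hits_add]
    refine hits_mono g s fun l _ => ?_
    gcongr
    simp only [hgood]
    by_cases a1 : |(l.map d).sum| ≤ B * √M
    · by_cases a2 : |(l.map d').sum| ≤ B * √M
      · rw [if_pos ⟨a1, a2⟩]; exact le_self_add
      · rw [if_pos (not_le.1 a2)]; exact le_add_self.trans le_add_self
    · rw [if_pos (not_le.1 a1)]; exact le_self_add.trans le_add_self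
  have h5 : ENNReal.ofReal (v / B ^ 2) + ENNReal.ofReal (v' / B ^ 2) ≤ ENNReal.ofReal (r / 2) := by
    rw [← ENNReal.ofReal_add (by positivity) (by positivity)]
    apply ENNReal.ofReal_le_ofReal
    rw [← add_div, hB2, div_div_eq_mul_div, div_le_div_iff₀ (by positivity) (by positivity)]
    nlinarith
  have h6 : ENNReal.ofReal (r / 2) + ENNReal.ofReal (r / 2) ≤ hits g s M good + ENNReal.ofReal (r / 2) := by
    rw [← ENNReal.ofReal_add (by positivity) (by positivity), add_halves, ← hcr]
    exact h3.trans (h4.trans (add_le_add le_rfl h5))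
  exact (ENNReal.add_le_add_iff_right ENNReal.ofReal_ne_top).1 h6

end CF

/-! ### The acceptance probability -/

namespace CF

variable {m : ℕ}

/-- The second moment of `a + d` for a centred variable `d`. -/
theorem tsum_ofReal_mul_sq {X : Type} {g d : X → ℝ} (hg0 : ∀ t, 0 ≤ g t) (hg : HasSum g 1)
    (hd : HasSum (fun t => g t * d t) 0) (hd2 : Summable fun t => g t * d t ^ 2) (a : ℝ) :
    ∑' t, ENNReal.ofReal (g t) * ENNReal.ofReal ((a + d t) ^ 2) =
      ENNReal.ofReal (a ^ 2 + ∑' t, g t * d t ^ 2) := by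
  have h := ((hg.mul_right (a ^ 2)).add (hd.mul_left (2 * a))).add hd2.hasSum
  have e : ∀ t, g t * a ^ 2 + 2 * a * (g t * d t) + g t * d t ^ 2 = g t * (a + d t) ^ 2 :=
    fun t => by ring
  simp only [e, one_mul, mul_zero, add_zero] at h
  rw [← h.tsum_eq, ENNReal.ofReal_tsum_of_nonneg (fun t => mul_nonneg (hg0 t) (sq_nonneg _)) h.summable]
  exact tsum_congr fun t => (ENNReal.ofReal_mul (hg0 t)).symm

/-- The period of the steps in the direction `ũ` is one. -/
theorem setGcd_tilde {S : Spec m} (haper : Aperiodic S) {ζ θ : ℝ} (hζ : 0 < ζ) (hθ : 0 < θ)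
    (hne : ∃ t, stepW S ζ θ t ≠ 0) :
    Nat.setGcd {i | ∃ t, stepW S ζ θ t ≠ 0 ∧ (tilde S t.vec).toNat = i} = 1 := by
  set A := {i | ∃ t, stepW S ζ θ t ≠ 0 ∧ (tilde S t.vec).toNat = i}
  have hdvd : ∀ t, stepW S ζ θ t ≠ 0 → (Nat.setGcd A : ℤ) ∣ tilde S t.vec := by
    intro t ht
    have h1 := one_le_tilde_of_stepW haper hζ hθ ht
    have := Nat.setGcd_dvd_of_mem (s := A) ⟨t, ht, rfl⟩
    rw [← Int.toNat_of_nonneg (by omega : 0 ≤ tilde S t.vec)]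
    exact_mod_cast this
  obtain ⟨t₀, ht₀⟩ := hne
  have h1 := one_le_tilde_of_stepW haper hζ hθ ht₀
  have h0 : Nat.setGcd A ≠ 0 := by
    intro h
    have := hdvd t₀ ht₀
    rw [h, Nat.cast_zero, zero_dvd_iff] at this
    omega
  by_contra hne1
  obtain ⟨n, hn, hmod⟩ := haper 0 (Nat.setGcd A) (v0 S) (by omega)
  obtain ⟨T, hT, hw⟩ := exists_tree_of_coeff_ne_zero hn
  apply hmod
  have hall : ∀ l : List (Piece m 0), (∀ t ∈ l, t.weight S ≠ 0) →
      (Nat.setGcd A : ℤ) ∣ tilde S (endpoint l) := by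
    intro l hl
    induction l with
    | nil => simp [endpoint_nil, tilde_zero]
    | cons t l ih =>
      rw [endpoint_cons, tilde_add]
      refine dvd_add ?_ (ih fun s hs => hl s (by simp [hs]))
      by_cases hf : IsFinal S t
      · rw [tilde_final hf]; exact dvd_zero _
      · refine hdvd t ((stepW_pos_iff hζ hθ).2 ⟨lt_of_le_of_ne (t.weight_nonneg S) ?_, hf⟩).ne'
        exact (hl t (by simp)).symm
  have := hall T.cut fun t ht h0 => hw.ne' (by
    rw [← Tree.prod_cut]
    exact List.prod_eq_zero (List.mem_map.2 ⟨t, ht, h0⟩))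
  rw [(Tree.isExcursion_cut.2 hT).1, tilde] at this
  rw [Nat.ModEq.comm, Nat.modEq_iff_dvd]
  simpa [sub_eq_add_neg] using this

namespace Env

variable {S : Spec m} {ζ θ ξ x : ℝ} (E : Env S ζ θ ξ x)
include E

theorem summable_sq : Summable fun t : Piece m 0 => stepW S ζ θ t * (tilde S t.vec : ℝ) ^ 2 := by
  refine (E.summable_exp.mul_left (8 / ξ ^ 2)).of_nonneg_of_le
    (fun t => mul_nonneg (stepW_nonneg E.ζ_pos E.θ_pos t) (sq_nonneg _)) fun t => ?_
  by_cases ht : stepW S ζ θ t = 0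
  · simp [ht]
  have h0 := stepW_nonneg (S := S) E.ζ_pos E.θ_pos t
  have h1 : (1 : ℝ) ≤ tilde S t.vec := by
    exact_mod_cast one_le_tilde_of_stepW E.aper E.ζ_pos E.θ_pos ht
  have hξ := E.ξ_pos
  calc _ ≤ stepW S ζ θ t * (8 / ξ ^ 2 * Real.exp (ξ * tilde S t.vec / 2)) := by
        gcongr; exact E.sq_tilde_le ht
    _ ≤ stepW S ζ θ t * (8 / ξ ^ 2 * Real.exp (ξ * tilde S t.vec)) := by
        gcongr
        have : 0 ≤ ξ * tilde S t.vec := by positivity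
        linarith
    _ = _ := by ring

theorem summable_of_le_sq {f : Piece m 0 → ℝ} {C : ℝ} (hf0 : ∀ t, 0 ≤ f t)
    (hf : ∀ t, stepW S ζ θ t ≠ 0 → f t ≤ C * (tilde S t.vec : ℝ) ^ 2) :
    Summable fun t : Piece m 0 => stepW S ζ θ t * f t := by
  refine (E.summable_sq.mul_left C).of_nonneg_of_le
    (fun t => mul_nonneg (stepW_nonneg E.ζ_pos E.θ_pos t) (hf0 t)) fun t => ?_
  by_cases ht : stepW S ζ θ t = 0
  · simp [ht]
  have h0 := stepW_nonneg (S := S) E.ζ_pos E.θ_pos t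
  calc _ ≤ stepW S ζ θ t * (C * (tilde S t.vec : ℝ) ^ 2) := by gcongr; exact hf t ht
    _ = _ := by ring

end Env

theorem abs_al_sub_one_le {S : Spec m} (t : Piece m 0) (hv : 1 ≤ v0 S) (h : 1 ≤ tilde S t.vec) :
    |(t.al : ℝ) - 1| ≤ tilde S t.vec := by
  have : |(t.al : ℤ) - 1| ≤ tilde S t.vec := by
    rw [abs_le]
    refine ⟨by omega, ?_⟩
    rw [tilde, Piece.vec]
    rcases Nat.eq_zero_or_pos t.al with h0 | h0
    · rw [tilde, Piece.vec, h0] at h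
      simp only [h0] at h ⊢; push_cast at h ⊢; omega
    · have h2 : (0 : ℤ) ≤ (t.al : ℤ) - 1 := by omega
      have h3 : (1 : ℤ) * ((t.al : ℤ) - 1) ≤ v0 S * ((t.al : ℤ) - 1) := by
        apply mul_le_mul_of_nonneg_right _ h2
        exact_mod_cast hv
      simp only
      omega
  exact_mod_cast this

namespace Setup

variable {P : Setup m} {ξ₁ x₁ : ℝ}

namespace Reg

variable (h : P.Reg)
include h

/-- Criticality: the mean of the ordinate `ℓ - 1` vanishes if the final pieces, for which it is `-1`, are
included, so that the other pieces contribute `A_0`. -/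
theorem hasSum_w_al : HasSum (fun t => P.w t * ((t.al : ℝ) - 1)) P.A0 := by
  classical
  have hθ := h.θ_pos.ne'
  have h1 : HasSum (fun t : Piece m 0 => t.weight P.S * P.ζ ^ t.zl * (t.al * P.θ ^ (t.al - 1))) 1 := by
    have := h.crit.sum_al
    rw [← this.2]; exact this.1.hasSum
  have h2 : HasSum (fun t : Piece m 0 => t.weight P.S * P.ζ ^ t.zl * P.θ ^ t.al / P.θ) 1 := by
    have := ((summable_of_Ye P.S h.ζ_pos.le h.θ_pos.le h.crit.Ye_ne_top).hasSum).div_const P.θ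
    have e : (∑' t : Piece m 0, t.weight P.S * P.ζ ^ t.zl * P.θ ^ t.al) / P.θ = 1 := h.crit.2.2.1
    rwa [e] at this
  have h3 := ((hasSum_final h.ζ_pos h.θ_pos h.crit.Ye_ne_top).mul_right (P.ζ ^ v0 P.S / P.θ))
  have e3 : T0 P.S * (P.ζ ^ v0 P.S / P.θ) = P.A0 := by rw [A0]; ring
  rw [e3] at h3
  have h4 := (h1.sub h2).add h3
  rw [sub_self, zero_add] at h4
  refine (congrArg (HasSum · _) (funext fun t => ?_)).mpr h4
  have e : (t.al : ℝ) * P.θ ^ (t.al - 1) = t.al * P.θ ^ t.al / P.θ := by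
    rcases Nat.eq_zero_or_pos t.al with h0 | h0
    · simp [h0]
    · obtain ⟨j, hj⟩ := Nat.exists_eq_add_of_lt h0
      rw [hj]; simp [pow_succ]; field_simp
  rw [e, w, stepW]
  split_ifs with hf
  · rw [hf.1, hf.2]; simp; ring
  · ring

/-- The walks to the landing diagonal whose numbers of pieces of the two types are typical have
a weight of the expected order in the accepted runs. -/
theorem le_accW {μ B M : ℝ} (hμ : 1 ≤ μ) (hB : 0 < B) (hM : P.M = M) (hM1 : 2 * B ≤ √M)
    (hM2 : 2 * B * μ / P.A0 ≤ √M) {l : List (Piece m 0)} (hl : ∀ t ∈ l, P.w t ≠ 0)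
    (htil : (tilde P.S (endpoint l) : ℝ) = M)
    (h1 : |(l.map fun t : Piece m 0 => P.A0 - P.Ane * ((t.al : ℝ) - 1)).sum| ≤ B * √M)
    (h2 : |(l.map fun t : Piece m 0 => (tilde P.S t.vec : ℝ) - μ).sum| ≤ B * √M) :
    endpoint l ∈ landing P.S P.n ∧
    P.κ * (Real.exp (-((4 * B ^ 2 + 4) * μ / (P.Ane * P.A0))) / (8 * ((2 + (1 + B) / P.Ane) *
      √(2 + (1 + B) / P.Ane)))) * (l.map fun t => P.w t / P.Ane).prod ≤ P.accW l := by
  have hMpos : 0 < M := hM ▸ h.M_pos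
  have hM1' : 1 ≤ M := hM ▸ h.one_le_M
  have hp := h.Ane_pos
  have hr := h.A0_pos
  have hpr := h.add_eq_one
  have s1 : ∀ l : List (Piece m 0), (l.map fun t : Piece m 0 => P.A0 - P.Ane * ((t.al : ℝ) - 1)).sum =
      l.length * P.A0 - P.Ane * ((endpoint l).2 : ℝ) := by
    intro l
    induction l with
    | nil => simp [endpoint_nil]
    | cons t l ih =>
      rw [List.map_cons, List.sum_cons, ih, endpoint_cons]
      simp only [List.length_cons, Prod.snd_add, Piece.vec]
      push_cast; ring
  have s2 : ∀ l : List (Piece m 0), (l.map fun t : Piece m 0 => (tilde P.S t.vec : ℝ) - μ).sum =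
      (tilde P.S (endpoint l) : ℝ) - l.length * μ := by
    intro l
    induction l with
    | nil => simp [endpoint_nil, tilde_zero]
    | cons t l ih =>
      rw [List.map_cons, List.sum_cons, ih, endpoint_cons, tilde_add]
      simp only [List.length_cons]
      push_cast; ring
  rw [s1, abs_le] at h1
  rw [s2, htil, abs_le] at h2
  set k : ℝ := (l.length : ℝ)
  set L := (endpoint l).2
  have hsq : √M * √M = M := Real.mul_self_sqrt hMpos.le
  have hs0 : 0 < √M := Real.sqrt_pos.2 hMpos
  have hs1 : 1 ≤ √M := Real.one_le_sqrt.2 hM1'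
  -- the number `k` of pieces is comparable to `M`
  have hkμ : M / 2 ≤ k * μ := by
    have : 2 * B * √M ≤ M := by nlinarith
    linarith [h2.2]
  have hkM : k ≤ M := by
    have h5 := length_le_tilde (S := P.S) l fun t ht => h.one_le_tilde (hl t ht)
    have : ((l.length : ℤ) : ℝ) ≤ (tilde P.S (endpoint l) : ℝ) := by exact_mod_cast h5
    rw [htil] at this; exact_mod_cast this
  have hk0 : 0 < k := by
    by_contra hk
    have : k * μ ≤ 0 := mul_nonpos_of_nonpos_of_nonneg (not_lt.1 hk) (by linarith)
    linarith
  -- the drift `A_0 / A_≠` of the ordinate is positive, so the walk ends in the upper half plane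
  have hL0 : 0 ≤ P.Ane * (L : ℝ) := by
    rw [div_le_iff₀ hr] at hM2
    have h6 : B * √M * μ ≤ k * P.A0 * μ := by
      calc B * √M * μ = 2 * B * μ * √M / 2 := by ring
        _ ≤ √M * P.A0 * √M / 2 := by gcongr
        _ = M / 2 * P.A0 := by linear_combination (P.A0 / 2) * hsq
        _ ≤ k * μ * P.A0 := by gcongr
        _ = _ := by ring
    have := le_of_mul_le_mul_right h6 (by linarith)
    linarith [h1.2]
  have hL : (0 : ℝ) ≤ L := nonneg_of_mul_nonneg_right hL0 hp
  have hLz : 0 ≤ L := by exact_mod_cast hL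
  have hland : endpoint l ∈ landing P.S P.n := by
    refine ⟨?_, by omega, ?_⟩
    · rw [endpoint_fst]; positivity
    · rw [← hM, Setup.M] at htil
      exact_mod_cast htil
  refine ⟨hland, ?_⟩
  have hq : ((((endpoint l).2 + 1).toNat : ℕ) : ℝ) = (L : ℝ) + 1 := by
    have : ((((endpoint l).2 + 1).toNat : ℕ) : ℤ) = L + 1 := Int.toNat_of_nonneg (by omega)
    exact_mod_cast this
  have hq1 : 1 ≤ ((endpoint l).2 + 1).toNat := by omega
  have hk1 : 1 ≤ l.length := by
    have : (0 : ℝ) < l.length := hk0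
    exact_mod_cast this
  have hb := le_binom hp hr hpr hk1 hq1
  have e1 : P.accW l = P.K * (binom P.Ane P.A0 l.length ((endpoint l).2 + 1).toNat /
      (l.length + ((endpoint l).2 + 1).toNat)) * (l.map fun t => P.w t / P.Ane).prod := by
    have e2 : ∀ l : List (Piece m 0), (l.map P.w).prod =
        P.Ane ^ l.length * (l.map fun t => P.w t / P.Ane).prod := by
      intro l
      induction l with
      | nil => simp
      | cons t l ih =>
        simp only [List.map_cons, List.prod_cons, List.length_cons, pow_succ]
        rw [ih]
        have := hp.ne'
        field_simp
    rw [← factorial_ratio (by omega), accW, e2]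
    ring
  rw [e1, K_eq]
  rw [hq] at hb ⊢
  set q : ℝ := (L : ℝ) + 1
  set N : ℝ := k + q
  set H := 2 + (1 + B) / P.Ane with hH
  have hH0 : 0 < H := by positivity
  have hN0 : 0 < N := by positivity
  -- the total number `N = k + q` of pieces is at most of order `M`
  have hNH : N ≤ H * M := by
    have hr1 : P.A0 ≤ 1 := by linarith
    have h7 : P.Ane * L ≤ M * (1 + B) := by
      have : k * P.A0 ≤ M * 1 := by gcongr
      have : B * √M ≤ B * M := by gcongr; nlinarith
      linarith [h1.1]
    have h8 : (L : ℝ) ≤ M * (1 + B) / P.Ane := by rw [le_div_iff₀ hp]; linarith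
    have e : H * M = M + M + M * (1 + B) / P.Ane := by rw [hH]; ring
    simp only [N, q]
    linarith
  -- the number of final pieces is within `O(√M)` of its mean, so the exponent in `le_binom` is bounded
  have hDN : (k * P.A0 - q * P.Ane) ^ 2 / (N * P.Ane * P.A0) ≤
      (4 * B ^ 2 + 4) * μ / (P.Ane * P.A0) := by
    have hD : (k * P.A0 - q * P.Ane) ^ 2 ≤ (2 * B ^ 2 + 2) * M := by
      have e : k * P.A0 - q * P.Ane = (k * P.A0 - P.Ane * L) - P.Ane := by simp only [q]; ring
      rw [e]
      have h9 : (k * P.A0 - P.Ane * L) ^ 2 ≤ B ^ 2 * M := by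
        calc _ = |k * P.A0 - P.Ane * L| ^ 2 := (sq_abs _).symm
          _ ≤ (B * √M) ^ 2 := by
            gcongr
            exact abs_le.2 h1
          _ = _ := by rw [mul_pow, Real.sq_sqrt hMpos.le]
      have h10 : P.Ane ^ 2 ≤ 1 := by
        have : P.Ane ≤ 1 := by linarith
        exact pow_le_one₀ hp.le this
      nlinarith [sq_nonneg ((k * P.A0 - P.Ane * L) + P.Ane)]
    rw [div_le_div_iff₀ (by positivity) (by positivity)]
    have h11 : M ≤ 2 * μ * N := by
      have : k * μ ≤ N * μ := by
        gcongr
        simp only [N, q]; linarith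
      linarith
    calc _ ≤ (2 * B ^ 2 + 2) * M * (P.Ane * P.A0) := by gcongr
      _ ≤ (2 * B ^ 2 + 2) * (2 * μ * N) * (P.Ane * P.A0) := by gcongr
      _ = _ := by ring
  have hprod : 0 ≤ (l.map fun t => P.w t / P.Ane).prod := List.prod_nonneg fun a ha => by
    obtain ⟨t, _, rfl⟩ := List.mem_map.1 ha
    exact div_nonneg (h.w_nonneg t) hp.le
  have hκ := h.κ_pos
  have hMn : M ≤ P.n := by
    rw [← hM, Setup.M]; have := Nat.cast_nonneg (α := ℝ) (v0 P.S); linarith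
  set E0 := (4 * B ^ 2 + 4) * μ / (P.Ane * P.A0)
  refine mul_le_mul_of_nonneg_right ?_ hprod
  have hb2 : Real.exp (-E0) / (8 * √N) ≤ binom P.Ane P.A0 l.length ((endpoint l).2 + 1).toNat := by
    refine le_trans ?_ hb
    gcongr
  calc P.κ * (Real.exp (-E0) / (8 * (H * √H))) =
      P.κ * (M * √M) * (Real.exp (-E0) / (8 * √(H * M)) / (H * M)) := by
        rw [Real.sqrt_mul hH0.le]; field_simp
    _ ≤ P.κ * (P.n * √P.n) * (Real.exp (-E0) / (8 * √N) / N) := by gcongr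
    _ ≤ _ := by gcongr

end Reg

/-- The acceptance probability is bounded from below: with a probability bounded from below the walk
reaches the landing diagonal with typical numbers of pieces of the two types. -/
theorem exists_le_accProb {S : Spec m} {ζ θ : ℝ} (E : Env S ζ θ ξ₁ x₁) :
    ∃ c : ℝ, 0 < c ∧ ∃ n₀ : ℕ, ∀ P : Setup m, P.Reg → P.S = S → P.ζ = ζ → P.θ = θ → P.RateLe →
      n₀ ≤ P.n → ENNReal.ofReal (c * P.κ) ≤ P.accProb := by
  classical
  -- the law of the pieces at the critical point is read off from any instance
  by_cases hne : ∃ P : Setup m, P.Reg ∧ P.S = S ∧ P.ζ = ζ ∧ P.θ = θ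
  swap
  · exact ⟨1, one_pos, 0, fun P h h1 h2 h3 => absurd ⟨P, h, h1, h2, h3⟩ hne⟩
  obtain ⟨P₀, h₀, hS, hζ, hθ⟩ := hne
  have hp := h₀.Ane_pos
  have hr := h₀.A0_pos
  have hpr := h₀.add_eq_one
  have hw : ∀ t, P₀.w t = stepW S ζ θ t := fun t => by rw [w, hS, hζ, hθ]
  have hw0 := h₀.w_nonneg
  have hsw : HasSum (stepW S ζ θ) P₀.Ane := by
    have := h₀.hasSum_w
    rwa [show P₀.w = stepW S ζ θ from funext hw] at this
  have hswa := h₀.hasSum_w_al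
  set p := P₀.Ane
  set r := P₀.A0
  have h1 : ∀ t, P₀.w t ≠ 0 → (1 : ℝ) ≤ tilde S t.vec := fun t ht => by
    rw [← hS]; exact_mod_cast h₀.one_le_tilde ht
  simp only [hw] at hw0 hswa h1
  -- the mean of `ũ`
  set τ : Piece m 0 → ℝ := fun t => tilde S t.vec
  have hsum1 : Summable fun t => stepW S ζ θ t * τ t := by
    have := E.summable_of_le_sq (f := fun t => |τ t|) (C := 1) (fun t => abs_nonneg _) fun t ht => by
      have := h1 t ht
      simp only [τ]
      rw [abs_of_nonneg (by linarith)]; nlinarith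
    refine this.congr fun t => ?_
    by_cases ht : stepW S ζ θ t = 0
    · simp [ht]
    · rw [abs_of_nonneg (zero_le_one.trans (h1 t ht))]
  set μ := (∑' t, stepW S ζ θ t * τ t) / p with hμ
  have hμ1 : 1 ≤ μ := by
    rw [hμ, one_le_div hp]
    refine hasSum_le (fun t => ?_) hsw hsum1.hasSum
    by_cases ht : stepW S ζ θ t = 0
    · simp [ht]
    · exact le_mul_of_one_le_right (hw0 t) (h1 t ht)
  set g : Piece m 0 → ℝ := fun t => stepW S ζ θ t / p
  have hg0 : ∀ t, 0 ≤ g t := fun t => div_nonneg (hw0 t) hp.le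
  have hg : HasSum g 1 := by
    have := hsw.div_const p
    rwa [div_self hp.ne'] at this
  -- two centred functionals: one measures the balance between final and other pieces, the other one the
  -- number of steps needed to reach the diagonal
  set d : Piece m 0 → ℝ := fun t => r - p * ((t.al : ℝ) - 1)
  set d' : Piece m 0 → ℝ := fun t => τ t - μ
  have hd : HasSum (fun t => g t * d t) 0 := by
    have := (hg.mul_right r).sub hswa
    rw [one_mul, sub_self] at this
    refine (congrArg (HasSum · _) (funext fun t => ?_)).mpr this
    simp only [g, d]; have := hp.ne'; field_simp
  have hd' : HasSum (fun t => g t * d' t) 0 := by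
    have := (hsum1.hasSum.div_const p).sub (hg.mul_right μ)
    rw [one_mul, ← hμ, sub_self] at this
    refine (congrArg (HasSum · _) (funext fun t => ?_)).mpr this
    simp only [g, d']; ring
  have hdiv : ∀ f : Piece m 0 → ℝ, (Summable fun t => stepW S ζ θ t * f t) →
      Summable fun t => g t * f t := fun f hf =>
    (hf.div_const p).congr fun t => by simp only [g]; ring
  have hd2 : Summable fun t => g t * d t ^ 2 := by
    refine hdiv _ (E.summable_of_le_sq (C := 1) (fun t => sq_nonneg _) fun t ht => ?_)
    have h2 := abs_al_sub_one_le (S := S) t (one_le_v0 E.aper) (by exact_mod_cast h1 t ht)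
    rw [one_mul, ← sq_abs]
    gcongr
    calc |r - p * ((t.al : ℝ) - 1)| ≤ |r| + |p * ((t.al : ℝ) - 1)| := abs_sub _ _
      _ = r + p * |(t.al : ℝ) - 1| := by rw [abs_mul, abs_of_pos hp, abs_of_pos hr]
      _ ≤ r * tilde S t.vec + p * tilde S t.vec := by
          have := h1 t ht
          gcongr
          exact le_mul_of_one_le_right hr.le this
      _ = _ := by rw [← add_mul, add_comm, hpr, one_mul]
  have hd2' : Summable fun t => g t * d' t ^ 2 := by
    refine hdiv _ (E.summable_of_le_sq (C := 1 + μ ^ 2) (fun t => sq_nonneg _) fun t ht => ?_)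
    have h2 := h1 t ht
    have h3 : (1 : ℝ) ≤ (tilde S t.vec : ℝ) ^ 2 := one_le_pow₀ h2
    have h4 : 0 ≤ μ * (tilde S t.vec : ℝ) := by positivity
    have h5 : μ ^ 2 ≤ μ ^ 2 * (tilde S t.vec : ℝ) ^ 2 := le_mul_of_one_le_right (sq_nonneg _) h3
    simp only [d', τ]
    nlinarith
  set s : Piece m 0 → ℕ := fun t => (tilde S t.vec).toNat
  have hgne : ∀ t, ENNReal.ofReal (g t) ≠ 0 ↔ stepW S ζ θ t ≠ 0 := fun t => by
    rw [Ne, ENNReal.ofReal_eq_zero, not_le]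
    constructor
    · intro h h0; simp [g, h0] at h
    · intro h; exact div_pos (lt_of_le_of_ne (hw0 t) h.symm) hp
  have hsτ : ∀ t, stepW S ζ θ t ≠ 0 → ((s t : ℕ) : ℤ) = tilde S t.vec := fun t ht =>
    Int.toNat_of_nonneg (by have : (1 : ℤ) ≤ tilde S t.vec := by exact_mod_cast h1 t ht
                            omega)
  have hsτ' : ∀ t, stepW S ζ θ t ≠ 0 → ((s t : ℕ) : ℝ) = τ t := fun t ht => by
    simp only [τ]; exact_mod_cast congrArg (Int.cast (R := ℝ)) (hsτ t ht)
  obtain ⟨c, B, hc, hB, M₀, hhits⟩ := exists_le_hits (g := fun t => ENNReal.ofReal (g t)) (s := s)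
    (by rw [← ENNReal.ofReal_tsum_of_nonneg hg0 hg.summable, hg.tsum_eq, ENNReal.ofReal_one])
    (fun t ht => by
      have ht := (hgne t).1 ht
      have := hsτ' t ht
      have := h1 t ht
      have h6 : (1 : ℝ) ≤ s t := by rw [hsτ' t ht]; exact h1 t ht
      exact_mod_cast h6)
    (by
      have e : ∀ t, ENNReal.ofReal (g t) * (s t : ℕ) = ENNReal.ofReal (g t * τ t) := fun t => by
        by_cases ht : stepW S ζ θ t = 0
        · simp [g, ht]
        · rw [← hsτ' t ht, ENNReal.ofReal_mul (hg0 t), ENNReal.ofReal_natCast]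
      simp only [e]
      exact (hdiv _ hsum1).tsum_ofReal_ne_top)
    (by
      simp only [hgne]
      obtain ⟨t, ht, -⟩ := h₀.exists_w_pos
      rw [hw] at ht
      exact setGcd_tilde E.aper E.ζ_pos E.θ_pos ⟨t, ht.ne'⟩)
    (tsum_nonneg fun t => mul_nonneg (hg0 t) (sq_nonneg _))
    (fun a => (tsum_ofReal_mul_sq hg0 hg hd hd2 a).le)
    (tsum_nonneg fun t => mul_nonneg (hg0 t) (sq_nonneg _))
    (fun a => (tsum_ofReal_mul_sq hg0 hg hd' hd2' a).le)
  set H := 2 + (1 + B) / p with hH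
  set E0 := (4 * B ^ 2 + 4) * μ / (p * r) with hE0
  have hH0 : 0 < H := by positivity
  refine ⟨Real.exp (-E0) / (8 * (H * √H)) * c, by positivity,
    v0 S + M₀ + ⌈(2 * B) ^ 2⌉₊ + ⌈(2 * B * μ / r) ^ 2⌉₊, fun P h hS' hζ' hθ' hrate hn => ?_⟩
  have hA0 : P.A0 = r := by simp only [r]; rw [A0, A0, hS, hζ, hθ, hS', hζ', hθ']
  have hAne : P.Ane = p := by simp only [p]; rw [h.Ane_eq, h₀.Ane_eq]; rw [hA0]
  have hw' : ∀ t, P.w t = stepW S ζ θ t := fun t => by rw [w, hS', hζ', hθ']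
  have hM : P.M = ((P.n - v0 S : ℕ) : ℝ) := by
    rw [M, Nat.cast_sub (by omega), hS']
  have hM0 : M₀ ≤ P.n - v0 S := by omega
  have hsq : ∀ y : ℝ, v0 S + ⌈y ^ 2⌉₊ ≤ P.n → y ≤ √((P.n - v0 S : ℕ) : ℝ) := by
    intro y hy
    refine Real.le_sqrt_of_sq_le ((Nat.le_ceil _).trans ?_)
    exact_mod_cast (by omega : ⌈y ^ 2⌉₊ ≤ P.n - v0 S)
  have hM1 := hsq (2 * B) (by omega)
  have hM2 := hsq (2 * B * μ / r) (by omega)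
  rw [h.accProb_eq hrate]
  have hκ := h.κ_pos
  have e : ENNReal.ofReal (Real.exp (-E0) / (8 * (H * √H)) * c * P.κ) =
      ENNReal.ofReal (P.κ * (Real.exp (-E0) / (8 * (H * √H)))) * ENNReal.ofReal c := by
    rw [← ENNReal.ofReal_mul (by positivity)]; congr 1; ring
  rw [e]
  refine (mul_le_mul_right (hhits _ hM0) _).trans ?_
  rw [← hits_const_mul, hits]
  refine ENNReal.tsum_le_tsum fun l => ?_
  by_cases hl : ∀ t ∈ l, stepW S ζ θ t ≠ 0
  swap
  · push Not at hl
    obtain ⟨t, htl, ht⟩ := hl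
    have : (l.map fun t => ENNReal.ofReal (g t)).prod = 0 :=
      List.prod_eq_zero (List.mem_map.2 ⟨t, htl, by simp [g, ht]⟩)
    rw [this, zero_mul, ite_self]; exact zero_le
  by_cases hsum : (l.map s).sum = P.n - v0 S
  swap
  · rw [if_neg hsum]; exact zero_le
  rw [if_pos hsum]
  by_cases hgood : |(l.map d).sum| ≤ B * √((P.n - v0 S : ℕ) : ℝ) ∧ |(l.map d').sum| ≤ B * √((P.n - v0 S : ℕ) : ℝ)
  swap
  · rw [if_neg hgood, mul_zero, mul_zero]; exact zero_le
  rw [if_pos hgood, mul_one]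
  have htil : ∀ l : List (Piece m 0), (∀ t ∈ l, stepW S ζ θ t ≠ 0) →
      (((l.map s).sum : ℕ) : ℤ) = tilde S (endpoint l) := by
    intro l hl
    induction l with
    | nil => simp [endpoint_nil, tilde_zero]
    | cons t l ih =>
      rw [endpoint_cons, tilde_add, ← ih fun s hs => hl s (by simp [hs]), ← hsτ t (hl t (by simp))]
      simp
  have htil' : (tilde P.S (endpoint l) : ℝ) = ((P.n - v0 S : ℕ) : ℝ) := by
    rw [hS', ← htil l hl, hsum]; simp
  have hfin := h.le_accW hμ1 hB hM hM1 (by rw [hA0]; exact hM2) (fun t ht => by rw [hw']; exact hl t ht)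
    htil' (by rw [hA0, hAne]; exact hgood.1) (by rw [hS']; exact hgood.2)
  rw [if_pos hfin.1]
  have e2 : ∀ l : List (Piece m 0), (l.map fun t => ENNReal.ofReal (g t)).prod =
      ENNReal.ofReal (l.map fun t => P.w t / P.Ane).prod := by
    intro l
    induction l with
    | nil => simp
    | cons t l ih =>
      rw [List.map_cons, List.map_cons, List.prod_cons, List.prod_cons, ih, ENNReal.ofReal_mul, hw', hAne]
      rw [hw', hAne]; exact hg0 t
  rw [e2, mul_comm, ← ENNReal.ofReal_mul (by positivity)]
  refine ENNReal.ofReal_le_ofReal ?_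
  rw [hE0, hH, ← hA0, ← hAne]
  exact hfin.2

end Setup

end CF

/-! ### The cost of the pieces, of the walk, and of the rejection loop -/

namespace CF

variable {m : ℕ}

namespace Run

variable {X : Type}

/-- The cost of a rejection loop. -/
theorem ert_loop_unit_le (body : Unit → Run (Unit ⊕ X)) (h : (body ()).mass = 1)
    (hp : ∑' b, (body ()).law (.inr b) ≠ 0) (φ : X → ℝ≥0∞) :
    ert (loop body ()) φ ≤
      ert (body ()) (Sum.elim (fun _ => 0) φ) / ∑' b, (body ()).law (.inr b) := by
  set p := ∑' b, (body ()).law (.inr b) with hpdef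
  set r := (body ()).law (.inl ()) with hr
  have hrp : r + p = 1 := by rw [← h, mass_sum, tsum_fintype]; simp [hr, hpdef]
  have hpt : p ≠ ⊤ := ne_top_of_le_ne_top ENNReal.one_ne_top (hrp ▸ le_add_self)
  have e : ∀ I, ert (body ()) (Sum.elim (fun _ => I) φ) =
      r * I + ((body ()).cost + ∑' b, (body ()).law (.inr b) * φ b) := fun I => by
    rw [ert_eq, Summable.tsum_sum (by exact ENNReal.summable) (by exact ENNReal.summable), tsum_fintype]
    simp [hr]; ring
  set J := ert (body ()) (Sum.elim (fun _ => 0) φ) with hJ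
  refine ert_loop_le body (fun _ => h.le) φ (fun _ => J / p) (fun _ => ?_) ()
  have hJ' := e 0
  rw [← hJ, mul_zero, zero_add] at hJ'
  have e2 : J / p = r * (J / p) + J := by
    conv_lhs => rw [← one_mul (J / p), ← hrp, add_mul, ENNReal.mul_div_cancel hp hpt]
  change ert (body ()) (Sum.elim (fun _ => J / p) φ) ≤ J / p
  rw [e, ← hJ', ← e2]

theorem ert_tick_pure_le (k : ℕ) (a : X) (φ : X → ℝ≥0∞) :
    ert (tick k >>= fun _ => (pure a : Run X)) φ ≤ k + φ a :=
  (ert_tick_bind_le k (f := fun _ => pure a) (mass_pure a).le φ).trans_eq (by rw [ert_pure])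

end Run

namespace Setup

variable {P : Setup m} {ξ₁ x₁ : ℝ}

namespace Reg

variable (h : P.Reg)
include h

/-- The cost of the loop that samples a piece, in terms of the generating functions. -/
theorem cost_stepLoop_le (E : Env P.S P.ζ P.θ ξ₁ x₁) (hξ : ∀ a, P.ξ a ≤ ξ₁) (a : Bool) :
    (Run.loop (fun _ : Unit => P.stepBody a) ()).cost ≤
      (∑' t : Piece m 0, t.gw (nodeW P.S x₁ (P.ζ * Real.exp ξ₁) (P.θ * Real.exp (v0 P.S * ξ₁)))) *
        ENNReal.ofReal (1 / (x₁ - 1) + 1) * ENNReal.ofReal (1 / (P.massNe a * P.u a)) := by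
  have hY := h.Y_pos' a 0
  have hx := E.one_lt
  have hζ := h.ζ_pos
  have hθ := h.θ_pos
  have hz := h.z_pos a
  have hu := h.u_pos a
  have hM := h.massNe_pos a
  have hp : ∑' t, (P.stepBody a).law (.inr t) =
      ENNReal.ofReal (P.massNe a * P.u a / Y P.S 0 (P.z a) (P.u a)) := by
    simp only [h.law_stepBody]
    rw [← one_mul (ENNReal.ofReal (P.massNe a * P.u a / _)), ← h.tsum_muNeAt a, ← ENNReal.tsum_mul_right]
    exact tsum_congr fun t => ENNReal.ofReal_mul' (by positivity)
  have hp0 : 0 < P.massNe a * P.u a / Y P.S 0 (P.z a) (P.u a) := by positivity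
  rw [Run.cost_eq_ert]
  refine (Run.ert_loop_unit_le _ (h.mass_stepBody a)
    (by rw [hp]; exact (ENNReal.ofReal_pos.2 hp0).ne') _).trans ?_
  rw [hp]
  have h1 : Run.ert (P.stepBody a) (Sum.elim (fun _ => 0) fun _ => 0) ≤
      (rewrite P.S (P.z a) (P.u a)).cost + 1 := by
    classical
    refine (Run.ert_bind_le (fun t _ => by rw [Run.mass_tick_bind, Run.mass_pure]) _).trans ?_
    refine le_trans (Run.ert_mono _ fun t => ?_) (Run.ert_const_le _
      (mass_rewrite P.S hz.le hu.le (h.Y_pos' a)).le 1)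
    refine (Run.ert_tick_pure_le _ _ _).trans ?_
    split_ifs <;> simp
  set Yr := Y P.S 0 (P.z a) (P.u a)
  have hexp : Real.exp (P.ξ a) ≤ Real.exp ξ₁ := Real.exp_le_exp.2 (hξ a)
  have hexp2 : Real.exp (v0 P.S * P.ξ a) ≤ Real.exp (v0 P.S * ξ₁) := by
    have := hξ a
    gcongr
  have hz' : P.z a ≤ P.ζ * Real.exp ξ₁ := by rw [z]; gcongr
  have hu' : P.u a ≤ P.θ * Real.exp (v0 P.S * ξ₁) := by rw [u]; gcongr
  set G : Piece m 0 → ℝ≥0∞ := fun t =>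
    t.gw (nodeW P.S x₁ (P.ζ * Real.exp ξ₁) (P.θ * Real.exp (v0 P.S * ξ₁))) with hG
  have hterm : ∀ t : Piece m 0, ENNReal.ofReal (boltz P.S (P.z a) (P.u a) t) * ((t.ct : ℕ) + 1) ≤
      ENNReal.ofReal (1 / Yr) * (G t * ENNReal.ofReal (1 / (x₁ - 1) + 1)) := by
    intro t
    have hw := t.weight_nonneg P.S
    have hb := one_add_mul_le_pow (show (-2 : ℝ) ≤ x₁ - 1 by linarith) t.ct
    rw [add_sub_cancel] at hb
    have hc : (t.ct : ℝ) + 1 ≤ x₁ ^ t.ct * (1 / (x₁ - 1) + 1) := by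
      have h2 : (t.ct : ℝ) ≤ x₁ ^ t.ct * (1 / (x₁ - 1)) := by
        rw [mul_one_div, le_div_iff₀ (by linarith)]; linarith
      have h3 : 1 ≤ x₁ ^ t.ct := one_le_pow₀ hx.le
      linarith
    have h5 : 0 ≤ 1 / (x₁ - 1) + 1 := by
      have : 0 < x₁ - 1 := by linarith
      positivity
    rw [hG]
    simp only
    rw [Piece.gw_nodeW P.S (by linarith) (by positivity) (by positivity), ← ENNReal.ofReal_mul
      (by positivity), ← ENNReal.ofReal_mul (by positivity), ← ENNReal.ofReal_natCast,
      ← ENNReal.ofReal_one, ← ENNReal.ofReal_add (by positivity) one_pos.le,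
      ← ENNReal.ofReal_mul (boltz_nonneg P.S hz.le hu.le t), boltz]
    apply ENNReal.ofReal_le_ofReal
    calc _ ≤ t.weight P.S * (P.ζ * Real.exp ξ₁) ^ t.zl * (P.θ * Real.exp (v0 P.S * ξ₁)) ^ t.al / Yr *
          (x₁ ^ t.ct * (1 / (x₁ - 1) + 1)) := by gcongr
      _ = _ := by ring
  have h2 : (rewrite P.S (P.z a) (P.u a)).cost + 1 ≤
      ENNReal.ofReal (1 / Yr) * ((∑' t, G t) * ENNReal.ofReal (1 / (x₁ - 1) + 1)) := by
    have hm := mass_rewrite P.S hz.le hu.le (h.Y_pos' a)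
    simp only [Run.mass, law_rewrite P.S hz.le hu.le fun β => (h.Y_pos' a β).ne'] at hm
    rw [cost_rewrite P.S hz.le hu.le fun β => (h.Y_pos' a β).ne', ← hm, ← ENNReal.tsum_add,
      ← ENNReal.tsum_mul_right, ← ENNReal.tsum_mul_left]
    refine ENNReal.tsum_le_tsum fun t => ?_
    rw [← mul_add_one]
    exact hterm t
  calc _ ≤ ENNReal.ofReal (1 / Yr) * ((∑' t, G t) * ENNReal.ofReal (1 / (x₁ - 1) + 1)) /
        ENNReal.ofReal (P.massNe a * P.u a / Yr) := by gcongr; exact h1.trans h2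
    _ = _ := by
      rw [div_eq_mul_inv, ← ENNReal.ofReal_inv_of_pos hp0, mul_comm (ENNReal.ofReal (1 / Yr)), mul_assoc,
        ← ENNReal.ofReal_mul (by positivity)]
      congr 2
      have := hM.ne'; have := hu.ne'; have := hY.ne'
      field_simp

end Reg

theorem abs_ξ_le (hε : 0 < P.ε) (hξ : P.ε / √P.M ≤ ξ₁) (a : Bool) : |P.ξ a| ≤ ξ₁ := by
  have h0 : 0 ≤ P.ε / √P.M := by positivity
  cases a
  · rw [ξ_false, abs_neg, abs_of_nonneg h0]; exact hξ
  · rw [ξ_true, abs_of_nonneg h0]; exact hξ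

/-- The mean cost of a piece is bounded. -/
theorem exists_cost_step_le {S : Spec m} {ζ θ : ℝ} (E : Env S ζ θ ξ₁ x₁) :
    ∃ C : ℝ≥0∞, C ≠ ⊤ ∧ ∀ P : Setup m, P.Reg → P.S = S → P.ζ = ζ → P.θ = θ → 0 < P.ε →
      P.ε / √P.M ≤ ξ₁ → P.step.cost ≤ C := by
  have hζ := E.ζ_pos
  have hθ := E.θ_pos
  have hx := E.one_lt
  obtain ⟨t₀, ht₀, hal⟩ := E.crit.exists_two_le E.aper
  have hw : 0 < stepW S ζ θ t₀ := (stepW_pos_iff hζ hθ).2 ⟨ht₀, fun hf => by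
    have := hf.2; omega⟩
  set b := stepW S ζ θ t₀ * Real.exp (-(ξ₁ * |(tilde S t₀.vec : ℝ)|)) *
    (θ * Real.exp (-(v0 S * ξ₁))) with hb
  have hb0 : 0 < b := by positivity
  set D := (∑' t : Piece m 0, t.gw (nodeW S x₁ (ζ * Real.exp ξ₁) (θ * Real.exp (v0 S * ξ₁)))) *
    ENNReal.ofReal (1 / (x₁ - 1) + 1) * ENNReal.ofReal (1 / b) with hD
  refine ⟨1 + D, ?_, fun P h hS hζ' hθ' hε hξ => ?_⟩
  · exact ENNReal.add_ne_top.2 ⟨ENNReal.one_ne_top, ENNReal.mul_ne_top (ENNReal.mul_ne_top (E.fin 0)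
      ENNReal.ofReal_ne_top) ENNReal.ofReal_ne_top⟩
  have hE : Env P.S P.ζ P.θ ξ₁ x₁ := by rw [hS, hζ', hθ']; exact E
  have habs := abs_ξ_le hε hξ
  have hle : ∀ a, (Run.loop (fun _ : Unit => P.stepBody a) ()).cost ≤ D := by
    intro a
    refine (h.cost_stepLoop_le hE (fun a => (le_abs_self _).trans (habs a)) a).trans ?_
    rw [hS, hζ', hθ', hD]
    have hM0 := (h.massNe_pos a).le
    gcongr
    rw [hb]
    have h1 : stepW S ζ θ t₀ * Real.exp (-(ξ₁ * |(tilde S t₀.vec : ℝ)|)) ≤ P.massNe a := by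
      refine le_trans ?_ (le_hasSum (h.hasSum_tilt a) t₀ fun t _ =>
        mul_nonneg (h.w_nonneg t) (Real.exp_pos _).le)
      rw [w, hS, hζ', hθ']
      gcongr
      rw [neg_le]
      calc -(P.ξ a * (tilde S t₀.vec : ℝ)) ≤ |P.ξ a * (tilde S t₀.vec : ℝ)| := neg_le_abs _
        _ = |P.ξ a| * |(tilde S t₀.vec : ℝ)| := abs_mul _ _
        _ ≤ _ := by gcongr; exact habs a
    have h2 : θ * Real.exp (-(v0 S * ξ₁)) ≤ P.u a := by
      rw [u, hθ', hS]
      gcongr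
      have := (abs_le.1 (habs a)).1
      rw [← mul_neg]
      gcongr
    gcongr
  rw [step_eq, Run.cost_eq_ert]
  refine (Run.ert_bind_le (fun a _ => Run.mass_loop_le _ (fun _ => (h.mass_stepBody a).le) _) _).trans ?_
  refine (Run.ert_mono _ (ψ := fun _ => D) fun a => ?_).trans ((Run.ert_const_le _ h.mass_draw_prob.le _).trans_eq ?_)
  · rw [← Run.cost_eq_ert]; exact hle a
  · rw [Run.cost_draw, h.mass_draw_prob]

namespace Reg

variable (h : P.Reg)
include h

theorem cost_walk_le {C : ℝ≥0∞} (hC : P.step.cost ≤ C) : P.walk.cost ≤ P.n * (C + 2) := by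
  have hv := one_le_v0 h.aper
  rw [walk_eq, Run.cost_eq_ert]
  refine (Run.ert_loop_le _ (fun s => (h.mass_walkBody s).le) _
    (fun s => ((P.gap s : ℝ≥0∞) + 1) * (C + 2)) (fun s => ?_) _).trans ?_
  · by_cases hs : s.2 ∈ finalRegion P.S P.n
    · rw [walkBody_of_mem P hs]
      refine (Run.ert_tick_pure_le _ _ _).trans ?_
      rw [Sum.elim_inr, add_zero, Nat.cast_one]
      calc (1 : ℝ≥0∞) ≤ 1 * 2 := by norm_num
        _ ≤ _ := mul_le_mul' le_add_self le_add_self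
    · rw [walkBody_of_notMem P hs]
      set φ : (List (Piece m 0) × (ℤ × ℤ)) ⊕ (List (Piece m 0) × (ℤ × ℤ)) → ℝ≥0∞ :=
        Sum.elim (fun s => ((P.gap s : ℝ≥0∞) + 1) * (C + 2)) fun _ => 0 with hφ
      set b : Piece m 0 → Run ((List (Piece m 0) × (ℤ × ℤ)) ⊕ (List (Piece m 0) × (ℤ × ℤ))) :=
        fun t => Run.tick 1 >>= fun _ => pure (.inl (s.1 ++ [t], s.2 + t.vec)) with hb
      have hm : ∀ t, (b t).mass = 1 := fun t => by
        rw [hb]; simp only [Run.mass_tick_bind, Run.mass_pure]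
      have h2 : ∀ t, P.step.law t ≠ 0 → Run.ert (b t) φ ≤ 1 + (P.gap s : ℝ≥0∞) * (C + 2) := by
        intro t ht
        refine (Run.ert_tick_pure_le _ _ _).trans ?_
        rw [hφ, Sum.elim_inl, Nat.cast_one]
        gcongr
        exact_mod_cast h.gap_lt hs ht _
      have h1 : Run.ert (P.step >>= b) φ ≤ C + (1 + (P.gap s : ℝ≥0∞) * (C + 2)) :=
        (Run.ert_bind_le (fun t _ => (hm t).le) φ).trans ((Run.ert_mono_of_law _ h2).trans
          ((Run.ert_const_le _ h.mass_step.le _).trans (add_le_add hC le_rfl)))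
      refine (Run.ert_tick_bind_le (f := fun _ => P.step >>= b) 1
        (Run.mass_bind_eq h.mass_step fun t _ => hm t).le _).trans ((add_le_add le_rfl h1).trans_eq ?_)
      push_cast; ring
  · gcongr
    have := h.lt
    have : P.gap (([] : List (Piece m 0)), (0 : ℤ × ℤ)) + 1 ≤ P.n := by
      simp only [gap, tilde_zero]; omega
    exact_mod_cast this

theorem toNat_le_n {l : List (Piece m 0)} (hl : endpoint l ∈ landing P.S P.n) :
    ((endpoint l).2 + 1).toNat ≤ P.n := by
  obtain ⟨h1, h2, h3⟩ := hl
  have hv : (1 : ℤ) ≤ v0 P.S := by exact_mod_cast one_le_v0 h.aper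
  rw [tilde] at h3
  have : (v0 P.S : ℤ) * ((endpoint l).2 + 1) ≤ P.n := by linarith
  have h4 : (endpoint l).2 + 1 ≤ v0 P.S * ((endpoint l).2 + 1) := le_mul_of_one_le_left (by omega) hv
  omega

theorem length_le_n {l : List (Piece m 0)} (hl : ∀ t ∈ l, P.w t ≠ 0)
    (hland : endpoint l ∈ landing P.S P.n) : l.length ≤ P.n := by
  have h1 := h.length_le_M hl hland
  rw [M] at h1
  have h2 : (0 : ℝ) ≤ v0 P.S := Nat.cast_nonneg _
  exact_mod_cast h1.trans (by linarith : (P.n : ℝ) - v0 P.S ≤ P.n)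

/-- A trial needs at most `n` pieces, and the evaluation of the rate one multiplication for each factor. -/
theorem cost_trial_le {C : ℝ≥0∞} (hC : P.step.cost ≤ C) : P.trial.cost ≤ P.n * (C + 6) := by
  classical
  have hn : 1 ≤ P.n := by have := h.lt; omega
  rw [trial_eq, Run.cost_eq_ert]
  have hmass : ∀ s, P.walk.law s ≠ 0 →
      (if s.2 ∈ landing P.S P.n then P.tail s else pure none : Run _).mass = 1 := fun s hs => by
    split_ifs with hl
    · have he := (h.law_walk_ne_zero hs hl).1
      obtain ⟨l, x⟩ := s
      simp only at he hl
      rw [he] at hl ⊢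
      exact h.mass_tail hl
    · exact Run.mass_pure _
  refine (Run.ert_bind_le (fun s hs => (hmass s hs).le) _).trans ?_
  refine (Run.ert_mono_of_law _ (ψ := fun _ => (P.n : ℝ≥0∞) * 4) fun s hs => ?_).trans
    ((Run.ert_const_le _ h.mass_walk.le _).trans ?_)
  · split_ifs with hl
    swap
    · rw [Run.ert_pure]; exact zero_le
    obtain ⟨he, hw⟩ := h.law_walk_ne_zero hs hl
    obtain ⟨l, x⟩ := s
    simp only at he hl hw
    subst he
    have hk := h.length_le_n hw hl
    have hq := h.toNat_le_n hl
    have hflip : ∀ r, (P.evalRate l ((endpoint l).2 + 1).toNat).law r ≠ 0 → (Run.flip r).mass = 1 := by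
      intro r hr
      rw [h.law_evalRate hl] at hr
      rw [show r = P.rate l by by_contra hne; rw [if_neg hne] at hr; exact hr rfl]
      exact Run.mass_flip (h.rate_pos l).le
    rw [tail]
    refine (Run.ert_bind_le (fun r hr => (Run.mass_bind_eq (hflip r hr) fun b _ => Run.mass_pure _).le)
      _).trans ?_
    refine (Run.ert_mono_of_law _ (ψ := fun _ => 1) fun r hr => ?_).trans
      ((Run.ert_const_le _ (mass_evalRate _ _).le 1).trans ?_)
    · refine (Run.ert_bind_le (fun b _ => (Run.mass_pure _).le) _).trans ?_
      simp only [Run.ert_pure]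
      rw [← Run.cost_eq_ert, Run.flip, Run.cost_draw]
      exact (hflip r hr).le
    · have h1 : (P.evalRate l ((endpoint l).2 + 1).toNat).cost ≤
          (l.length : ℝ≥0∞) + (((endpoint l).2 + 1).toNat + 1) := by
        rw [Run.cost_eq_ert, evalRate]
        refine (Run.ert_bind_le (fun r _ => ?_) _).trans ((Run.ert_mulAll_le _ _).trans ?_)
        · refine (Run.mass_bind_eq (Run.mass_mulAll _) fun y _ => ?_).le
          rw [Run.mass_tick_bind, Run.mass_pure]
        · rw [List.length_map]
          gcongr
          refine (Run.ert_bind_le (fun r _ => ?_) _).trans ((Run.ert_mulAll_le _ _).trans ?_)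
          · rw [Run.mass_tick_bind, Run.mass_pure]
          · rw [List.length_map, List.length_range]
            gcongr
            refine (Run.ert_tick_bind_le 1 (f := fun _ => pure _) (Run.mass_pure _).le _).trans ?_
            rw [Run.ert_pure]; simp
      refine (add_le_add h1 le_rfl).trans ?_
      have h2 : l.length + (((endpoint l).2 + 1).toNat + 1) + 1 ≤ P.n * 4 := by omega
      exact_mod_cast h2
  · refine (add_le_add (h.cost_walk_le hC) le_rfl).trans_eq ?_
    ring

end Reg

/-! ### The cost of the shuffle -/

theorem log_two_add_two_le {N : ℕ} (hN : 1 ≤ N) : ((Nat.log 2 N + 2 : ℕ) : ℝ) ≤ 4 * √N := by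
  have h1 : 2 ^ Nat.log 2 N ≤ N := Nat.pow_log_le_self 2 (by omega)
  set j := Nat.log 2 N
  have h2 : ((2 ^ (j / 2) : ℕ) : ℝ) ≤ √N := by
    refine Real.le_sqrt_of_sq_le ?_
    have : (2 ^ (j / 2)) ^ 2 ≤ N := by
      rw [← pow_mul]
      exact (Nat.pow_le_pow_right (by norm_num) (by omega)).trans h1
    exact_mod_cast this
  have h3 : j / 2 < 2 ^ (j / 2) := Nat.lt_two_pow_self
  have h4 : j + 2 ≤ 4 * 2 ^ (j / 2) := by omega
  calc ((j + 2 : ℕ) : ℝ) ≤ ((4 * 2 ^ (j / 2) : ℕ) : ℝ) := by exact_mod_cast h4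
    _ = 4 * ((2 ^ (j / 2) : ℕ) : ℝ) := by push_cast; ring
    _ ≤ _ := by gcongr

/-- The shuffle is expensive in the unbalanced cases only, whose acceptance rate is small. -/
theorem mul_cost_bbhl_le {k q n : ℕ} (hk : 1 ≤ k) (hn : k + q ≤ 2 * n) {r D δ : ℝ} (hr : 0 ≤ r) (hδ : 0 < δ)
    (hrD : r ≤ D) (h : (δ * (k + q) ≤ k ∧ δ * (k + q) ≤ q) ∨ r * (k + q) ≤ D) :
    ENNReal.ofReal r * (bbhl k q).cost ≤ ENNReal.ofReal (D * (32 + 8 / δ ^ 2) * n) := by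
  have hN1 : (1 : ℝ) ≤ k + q := by exact_mod_cast (by omega : 1 ≤ k + q)
  have hlog := log_two_add_two_le (N := k + q) (by omega)
  push_cast at hlog
  have hN2 : (k + q : ℝ) ≤ 2 * n := by exact_mod_cast hn
  set N : ℝ := (k : ℝ) + q
  have hsq : √N * √N = N := Real.mul_self_sqrt (by linarith)
  have hs1 : 1 ≤ √N := Real.one_le_sqrt.2 hN1
  have hD : 0 ≤ D := hr.trans hrD
  rcases h with h | h
  · refine (mul_le_mul_right (cost_bbhl_le_sqrt k q hδ h.1 h.2 (by omega)) _).trans ?_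
    rw [← ENNReal.ofReal_mul hr]
    apply ENNReal.ofReal_le_ofReal
    push_cast
    set c := 1 / 2 + 1 / (2 * δ ^ 2) with hc
    have hc0 : 0 ≤ c := by positivity
    have h1 : N + 1 + ((Nat.log 2 (k + q) : ℝ) + 2) * (√N * c) ≤ (2 + 4 * c) * N := by
      calc _ ≤ N + N + 4 * √N * (√N * c) := by gcongr
        _ = _ := by linear_combination 4 * c * hsq
    calc _ ≤ D * ((2 + 4 * c) * (2 * n)) := by
          refine mul_le_mul hrD (h1.trans ?_) (by positivity) hD
          gcongr
      _ = D * (8 + 4 / δ ^ 2) * n := by rw [hc]; field_simp; ring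
      _ ≤ _ := by
        gcongr
        · norm_num
        · norm_num
  · refine (mul_le_mul_right (cost_bbhl_le_mul k q) _).trans ?_
    rw [← ENNReal.ofReal_mul hr]
    apply ENNReal.ofReal_le_ofReal
    push_cast
    have h1 : N + 1 + ((Nat.log 2 (k + q) : ℝ) + 2) * N ≤ 6 * (N * N) := by
      have h2 : √N ≤ N := by nlinarith
      have h3 : ((Nat.log 2 (k + q) : ℝ) + 2) * N ≤ 4 * N * N := by
        refine mul_le_mul_of_nonneg_right (hlog.trans ?_) (by linarith)
        linarith
      nlinarith
    calc _ ≤ r * (6 * (N * N)) := by gcongr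
      _ = 6 * (r * N) * N := by ring
      _ ≤ 6 * D * (2 * n) := by gcongr
      _ = D * 12 * n := by ring
      _ ≤ _ := by
        gcongr
        have : 0 ≤ 8 / δ ^ 2 := by positivity
        linarith

theorem ert_firstMin_le (t : List (Piece m 0)) (y : ℤ) (i : ℕ) (b : ℤ) (j : ℕ) (c : ℝ≥0∞) :
    Run.ert (firstMin t y i b j) (fun _ => c) ≤ t.length + c := by
  have hmass : ∀ (t : List (Piece m 0)) (y : ℤ) (i : ℕ) (b : ℤ) (j : ℕ), (firstMin t y i b j).mass = 1 :=
    fun t y i b j => by simp only [Run.mass, law_firstMin, tsum_ite_eq]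
  induction t generalizing y i b j with
  | nil => rw [firstMin, Run.ert_pure]; simp
  | cons s t ih =>
    rw [firstMin]
    refine (Run.ert_tick_bind_le 1 (f := fun _ => if y + s.vec.2 < b then
      firstMin t (y + s.vec.2) (i + 1) (y + s.vec.2) (i + 1)
      else firstMin t (y + s.vec.2) (i + 1) b j) (by split_ifs <;> rw [hmass]) _).trans ?_
    have e : (1 : ℕ) + (t.length + c) = ((s :: t).length : ℝ≥0∞) + c := by
      rw [List.length_cons]; push_cast; ring
    rw [← e]
    gcongr
    split_ifs
    · exact ih _ _ _ _
    · exact ih _ _ _ _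

theorem cost_cyc_le (t : List (Piece m 0)) : (cyc t).cost ≤ 2 * t.length := by
  rw [cyc, Run.cost_eq_ert]
  refine (Run.ert_bind_le (fun j _ => by rw [Run.mass_tick_bind, Run.mass_pure]) _).trans ?_
  refine (Run.ert_mono _ (ψ := fun _ => (t.length : ℝ≥0∞)) fun j => ?_).trans
    ((ert_firstMin_le t 0 0 0 0 _).trans_eq (two_mul _).symm)
  refine (Run.ert_tick_bind_le _ (f := fun _ => pure (t.rotate j)) (Run.mass_pure _).le _).trans ?_
  rw [Run.ert_pure, add_zero]

/-! ### The cost of the algorithm -/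

variable (P) in
/-- The part of the sampler of bridges that comes after the rejection loop: the final pieces, the shuffle
and the interleaving. -/
def finish (s : List (Piece m 0) × ℕ) : Run (List (Piece m 0)) :=
  (Run.replicate P.drawFinal s.2 >>= fun f => bbhl s.1.length s.2 >>= fun ν => interleave ν s.1 f)

namespace Reg

variable (h : P.Reg)
include h

theorem mass_finish (s : List (Piece m 0) × ℕ) : (P.finish s).mass = 1 :=
  Run.mass_bind_eq (Run.mass_replicate (mass_drawFinal h) _) fun _ _ =>
    Run.mass_bind_eq (mass_bbhl _ _) fun _ _ => mass_interleave _ _ _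

theorem ert_finish_le (s : List (Piece m 0) × ℕ) : Run.ert (P.finish s) (fun t => (cyc t).cost) ≤
    (bbhl s.1.length s.2).cost + 4 * (s.1.length + s.2) := by
  have hd : P.drawFinal.cost = 1 := by
    have e := mass_drawFinal h
    rw [drawFinal] at e ⊢
    rw [Run.cost_draw, e]
  refine (Run.ert_bind_le (fun f _ => (Run.mass_bind_eq (mass_bbhl _ _) fun _ _ =>
    mass_interleave _ _ _).le) _).trans ?_
  refine (Run.ert_mono _ (ψ := fun _ => (bbhl s.1.length s.2).cost + 3 * (s.1.length + s.2)) fun f =>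
    ?_).trans ((Run.ert_const_le _ (Run.mass_replicate (mass_drawFinal h) _).le _).trans ?_)
  · refine (Run.ert_bind_le (fun ν _ => (mass_interleave _ _ _).le) _).trans ?_
    refine (Run.ert_mono_of_law _ (ψ := fun _ => 3 * ((s.1.length : ℝ≥0∞) + s.2)) fun ν hν => ?_).trans
      (Run.ert_const_le _ (mass_bbhl _ _).le _)
    have hlen : ν.length = s.1.length + s.2 := by
      rw [law_bbhl] at hν
      have hc : ν.count true = s.1.length ∧ ν.count false = s.2 := by
        by_contra hc; rw [if_neg hc] at hν; exact hν rfl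
      rw [← hc.1, ← hc.2, List.count_true_add_count_false]
    refine (ert_interleave_le _ _ _ _).trans ((add_le_add le_rfl (cost_cyc_le _)).trans ?_)
    have h1 : ((merge ν s.1 f).length : ℝ≥0∞) ≤ ν.length := by exact_mod_cast length_merge_le ν s.1 f
    calc (ν.length : ℝ≥0∞) + 2 * (merge ν s.1 f).length ≤ ν.length + 2 * ν.length := by gcongr
      _ = _ := by rw [hlen]; push_cast; ring
  · have h2 := Run.cost_replicate_le (mass_drawFinal h) s.2
    rw [hd, mul_one] at h2
    calc _ ≤ (s.2 : ℝ≥0∞) + ((bbhl s.1.length s.2).cost + 3 * (s.1.length + s.2)) := by gcongr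
      _ ≤ ((s.1.length : ℝ≥0∞) + s.2) + ((bbhl s.1.length s.2).cost + 3 * (s.1.length + s.2)) := by
        gcongr; exact le_add_self
      _ = _ := by ring

/-- The mean, over the runs of the rejection loop, of the cost of what comes after acceptance. -/
theorem tsum_trial_le (hr : P.RateLe) {B : ℝ≥0∞} {ψ : List (Piece m 0) × ℕ → ℝ≥0∞}
    (hψ : ∀ l : List (Piece m 0), (∀ t ∈ l, P.w t ≠ 0) → endpoint l ∈ landing P.S P.n →
      ENNReal.ofReal (P.rate l) * ψ (l, ((endpoint l).2 + 1).toNat) ≤ B) :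
    ∑' x, P.trial.law (some x) * ψ x ≤ B := by
  classical
  have e : ∑' x, P.trial.law (some x) * ψ x = ∑' l : List (Piece m 0), if endpoint l ∈ landing P.S P.n then
      ENNReal.ofReal (P.accW l) * ψ (l, ((endpoint l).2 + 1).toNat) else 0 := by
    simp only [h.law_trial hr]
    rw [ENNReal.tsum_prod']
    refine tsum_congr fun l => ?_
    rw [tsum_eq_single ((endpoint l).2 + 1).toNat]
    · by_cases hl : endpoint l ∈ landing P.S P.n <;> simp [hl]
    · intro q hq; rw [if_neg fun hc => hq hc.2, zero_mul]
  rw [e]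
  calc _ ≤ ∑' l : List (Piece m 0), if endpoint l ∈ landing P.S P.n then
        ENNReal.ofReal (l.map P.muNe).prod * B else 0 := by
        refine ENNReal.tsum_le_tsum fun l => ?_
        split_ifs with hl
        swap
        · exact le_rfl
        rw [← h.prod_muNe_mul_rate, ENNReal.ofReal_mul' (h.rate_pos l).le, mul_assoc]
        by_cases hw : ∀ t ∈ l, P.w t ≠ 0
        · gcongr; exact hψ l hw hl
        · push Not at hw
          obtain ⟨t, ht, h0⟩ := hw
          rw [List.prod_eq_zero (List.mem_map.2 ⟨t, ht, by rw [h.muNe_eq, h0, zero_mul, zero_div]⟩)]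
          simp
    _ = _ := (h.tsum_walk_landing fun _ => B).symm
    _ ≤ ∑' s, P.walk.law s * B := by
        refine ENNReal.tsum_le_tsum fun s => ?_
        split_ifs
        · exact le_rfl
        · exact zero_le
    _ = B := by
        rw [ENNReal.tsum_mul_right]
        have : ∑' s, P.walk.law s = 1 := h.mass_walk
        rw [this, one_mul]

/-- The rejected trials multiply the cost of a trial by the inverse of the acceptance probability; the cost
`B` of what follows is paid with the probability of acceptance only. -/
theorem cost_treeSampler_le (hr : P.RateLe) (hp : P.accProb ≠ 0) {C B : ℝ≥0∞} (hC : P.step.cost ≤ C)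
    (hB : ∀ l : List (Piece m 0), (∀ t ∈ l, P.w t ≠ 0) → endpoint l ∈ landing P.S P.n →
      ENNReal.ofReal (P.rate l) * ((bbhl l.length ((endpoint l).2 + 1).toNat).cost +
        4 * (l.length + ((endpoint l).2 + 1).toNat)) ≤ B) :
    P.treeSampler.cost ≤ (P.n * (C + 6) + B) / P.accProb := by
  rw [treeSampler_eq, Run.cost_eq_ert]
  refine (Run.ert_bind_le (fun t _ => (mass_cyc t).le) _).trans ?_
  simp only [← Run.cost_eq_ert]
  have e : P.bridgeSampler = (P.accepted >>= P.finish) := rfl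
  rw [e]
  refine (Run.ert_bind_le (fun s _ => (h.mass_finish s).le) _).trans ?_
  have hp' : ∑' x, P.rejectBody.law (.inr x) = P.accProb := by simp only [law_rejectBody]; rfl
  refine (Run.ert_loop_unit_le _ h.mass_rejectBody (by rw [hp']; exact hp) _).trans ?_
  rw [hp']
  gcongr
  set ψ : List (Piece m 0) × ℕ → ℝ≥0∞ := fun s => Run.ert (P.finish s) fun t => (cyc t).cost
  rw [rejectBody_eq]
  refine (Run.ert_bind_le (fun o _ => (Run.mass_pure _).le) _).trans ?_
  simp only [Run.ert_pure]
  rw [Run.ert_eq]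
  refine add_le_add (h.cost_trial_le hC) ?_
  have e2 : ∑' o, P.trial.law o * Sum.elim (fun _ => 0) ψ
      (o.elim (.inl ()) .inr : Unit ⊕ (List (Piece m 0) × ℕ)) = ∑' x, P.trial.law (some x) * ψ x := by
    rw [← (Option.some_injective _).tsum_eq]
    · rfl
    · intro o ho
      cases o with
      | none => simp at ho
      | some x => exact ⟨x, rfl⟩
  rw [e2]
  refine h.tsum_trial_le hr fun l hl hland => le_trans ?_ (hB l hl hland)
  gcongr
  exact h.ert_finish_le _

end Reg

/-- The average cost of the algorithm is linear. -/
theorem exists_cost_treeSampler_le {S : Spec m} {ζ θ : ℝ} (E : Env S ζ θ ξ₁ x₁) {δ D : ℝ} (hδ : 0 < δ)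
    (hD : 0 < D) : ∃ C : ℝ, 0 < C ∧ ∀ P : Setup m, P.Reg → P.S = S → P.ζ = ζ → P.θ = θ → 0 < P.ε →
      P.ε / √P.M ≤ ξ₁ → P.RateLe → P.accProb ≠ 0 →
      (∀ l : List (Piece m 0), (∀ t ∈ l, P.w t ≠ 0) →
        endpoint l ∈ landing P.S P.n → P.rate l ≤ D ∧
        ((δ * (l.length + ((endpoint l).2 + 1).toNat) ≤ l.length ∧
          δ * (l.length + ((endpoint l).2 + 1).toNat) ≤ ((endpoint l).2 + 1).toNat) ∨
        P.rate l * (l.length + ((endpoint l).2 + 1).toNat) ≤ D)) →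
      P.treeSampler.cost ≤ ENNReal.ofReal (C * P.n) / P.accProb := by
  obtain ⟨C₁, hC₁, hstep⟩ := exists_cost_step_le E
  refine ⟨C₁.toReal + 6 + (D * (32 + 8 / δ ^ 2) + 8), by positivity,
    fun P h hS hζ hθ hε hξ hr hp hrate => ?_⟩
  refine (h.cost_treeSampler_le hr hp (B := ENNReal.ofReal ((D * (32 + 8 / δ ^ 2) + 8) * P.n))
    (hstep P h hS hζ hθ hε hξ) fun l hl hland => ?_).trans ?_
  · obtain ⟨h1, h2⟩ := hrate l hl hland
    have hk := h.length_le_n hl hland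
    have hq := h.toNat_le_n hland
    have hr0 := h.rate_pos l
    have hb := mul_cost_bbhl_le (n := P.n) (q := ((endpoint l).2 + 1).toNat)
      (List.length_pos_iff.2 (h.pos_of_landing hland)) (by omega) hr0.le hδ h1 h2
    rw [mul_add, add_mul, ENNReal.ofReal_add (by positivity) (by positivity)]
    refine add_le_add hb ?_
    have h3 : ENNReal.ofReal (P.rate l) ≤ 1 := ENNReal.ofReal_le_one.2 (hr l hl hland)
    refine (mul_le_of_le_one_left zero_le h3).trans ?_
    have e : ENNReal.ofReal (8 * P.n) = ((8 * P.n : ℕ) : ℝ≥0∞) := by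
      rw [← ENNReal.ofReal_natCast]; push_cast; rfl
    rw [e]
    exact_mod_cast (by omega : 4 * (l.length + ((endpoint l).2 + 1).toNat) ≤ 8 * P.n)
  · gcongr
    rw [add_mul (C₁.toReal + 6), ENNReal.ofReal_add (by positivity) (by positivity)]
    refine add_le_add ?_ le_rfl
    rw [ENNReal.ofReal_mul (by positivity), ENNReal.ofReal_add (by positivity) (by norm_num),
      ENNReal.ofReal_toReal hC₁, ENNReal.ofReal_natCast, mul_comm]
    simp

end Setup

end CF

/-! ### Entropy -/

namespace CF

open Filter Topology

variable {m : ℕ}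

/-- The specification with the inverse weights. -/
def Spec.inv (S : Spec m) : Spec m where
  φ α h k := (S.φ α h k)⁻¹
  nonneg α h k := inv_nonneg.2 (S.nonneg α h k)
  finite α := by simpa using S.finite α
  no_empty_node α := by rw [S.no_empty_node, inv_zero]
  nilpotent := by
    obtain ⟨N, hN⟩ := S.nilpotent
    set L : Matrix (Fin (m + 1)) (Fin (m + 1)) ℝ :=
      Matrix.of fun α β : Fin (m + 1) => S.φ α 0 (Pi.single β 1) with hL
    set L' : Matrix (Fin (m + 1)) (Fin (m + 1)) ℝ :=
      Matrix.of fun α β : Fin (m + 1) => (S.φ α 0 (Pi.single β 1))⁻¹ with hL'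
    have h0 : ∀ α β, 0 ≤ L α β := fun α β => S.nonneg _ _ _
    set C := ∑ p : Fin (m + 1) × Fin (m + 1), (L' p.1 p.2) ^ 2
    have hC : 0 ≤ C := Finset.sum_nonneg fun p _ => sq_nonneg _
    have h1 : ∀ α β, 0 ≤ L' α β ∧ L' α β ≤ C * L α β := by
      intro α β
      refine ⟨inv_nonneg.2 (S.nonneg _ _ _), ?_⟩
      have h2 : (L' α β) ^ 2 ≤ C := Finset.single_le_sum
        (f := fun p : Fin (m + 1) × Fin (m + 1) => (L' p.1 p.2) ^ 2) (fun p _ => sq_nonneg _)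
        (Finset.mem_univ (α, β))
      refine le_trans (le_of_eq ?_) (mul_le_mul_of_nonneg_right h2 (h0 α β))
      change (S.φ α 0 (Pi.single β 1))⁻¹ = (S.φ α 0 (Pi.single β 1))⁻¹ ^ 2 * S.φ α 0 (Pi.single β 1)
      by_cases hz : S.φ α 0 (Pi.single β 1) = 0
      · rw [hz]; simp
      · field_simp
    have h2 : ∀ (i : ℕ) (α β), 0 ≤ (L ^ i) α β ∧ 0 ≤ (L' ^ i) α β ∧ (L' ^ i) α β ≤ C ^ i * (L ^ i) α β := by
      intro i
      induction i with
      | zero =>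
        intro α β
        have : 0 ≤ (1 : Matrix (Fin (m + 1)) (Fin (m + 1)) ℝ) α β := by
          rw [Matrix.one_apply]; split_ifs <;> norm_num
        simpa using this
      | succ i ih =>
        intro α β
        simp only [pow_succ L, pow_succ L', Matrix.mul_apply]
        refine ⟨Finset.sum_nonneg fun γ _ => mul_nonneg (ih α γ).1 (h0 γ β),
          Finset.sum_nonneg fun γ _ => mul_nonneg (ih α γ).2.1 (h1 γ β).1, ?_⟩
        rw [Finset.mul_sum]
        refine Finset.sum_le_sum fun γ _ => ?_
        calc _ ≤ (C ^ i * (L ^ i) α γ) * (C * L γ β) :=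
              mul_le_mul (ih α γ).2.2 (h1 γ β).2 (h1 γ β).1
                (mul_nonneg (pow_nonneg hC i) (ih α γ).1)
          _ = _ := by ring
    refine ⟨N, Matrix.ext fun α β => le_antisymm ?_ (h2 N α β).2.1⟩
    have := (h2 N α β).2.2
    rw [hN] at this
    simpa using this

theorem Tree.weight_inv (S : Spec m) : ∀ {α : Fin (m + 1)} (T : Tree m α),
    T.weight S.inv = (T.weight S)⁻¹
  | _, .node α h k ch => by
      simp only [Tree.weight, fun β i => Tree.weight_inv S (ch β i), mul_inv, Finset.prod_inv_distrib]
      rfl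

/-- The weights of the trees decrease at most exponentially: otherwise there would not be
supersolutions of the specification with the inverse weights. -/
theorem exists_le_weight (S : Spec m) : ∃ z y : ℝ, 0 < z ∧ 0 < y ∧
    ∀ T : Tree m 0, T.weight S ≠ 0 → z ^ T.size ≤ y * T.weight S := by
  obtain ⟨z, y, hz, hy⟩ := exists_feas S.inv
  refine ⟨z, y 0, hz, hy.1 0, fun T hT => ?_⟩
  have h := Tree.weight_mul_pow_le S.inv hz.le (fun β => (hy.1 β).le) hy.2 T
  have hp : 0 < T.weight S := lt_of_le_of_ne (T.weight_nonneg S) hT.symm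
  rwa [Tree.weight_inv, inv_mul_le_iff₀ hp, mul_comm] at h

/-- An upper bound on the probabilities gives a lower bound on the entropy. The sum that defines the
entropy converges, because the probabilities are bounded from below. -/
theorem le_entropy {S : Spec m} {n : ℕ} (hc : 0 < coeff S 0 n) {a : ℝ}
    (ha : ∀ T : Tree m 0, T.size = n → T.weight S ≤ coeff S 0 n * Real.exp (-a)) : a ≤ entropy S n := by
  classical
  have hmu0 : ∀ T : Tree m 0, 0 ≤ mu S n T := fun T => by
    rw [mu]; split_ifs
    · exact div_nonneg (T.weight_nonneg S) hc.le
    · exact le_rfl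
  have hsum : HasSum (mu S n) 1 := by
    have h1 : Summable fun T : Tree m 0 => if T.size = n then T.weight S else 0 := by
      by_contra h
      rw [coeff, tsum_eq_zero_of_not_summable] at hc
      · exact lt_irrefl _ hc
      · convert h
    have h2 := h1.hasSum.div_const (coeff S 0 n)
    have e : (∑' T : Tree m 0, if T.size = n then T.weight S else 0) / coeff S 0 n = 1 := by
      rw [div_eq_one_iff_eq hc.ne', coeff]
    rw [e] at h2
    refine (congrArg (HasSum · _) (funext fun T => ?_)).mpr h2
    rw [mu]; split_ifs <;> simp
  obtain ⟨z, y, hz, hy, hzy⟩ := exists_le_weight S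
  have hpos : ∀ T : Tree m 0, mu S n T ≠ 0 → T.size = n ∧ T.weight S ≠ 0 ∧
      mu S n T = T.weight S / coeff S 0 n := by
    intro T hT
    rw [mu] at hT ⊢
    split_ifs at hT ⊢ with hs
    · exact ⟨hs, fun h0 => hT (by rw [h0, zero_div]), rfl⟩
    · exact absurd rfl hT
  have hle : ∀ T, mu S n T * a ≤ Real.negMulLog (mu S n T) := by
    intro T
    by_cases hT : mu S n T = 0
    · simp [hT]
    obtain ⟨hs, hw, he⟩ := hpos T hT
    have h1 : mu S n T ≤ Real.exp (-a) := by
      rw [he, div_le_iff₀ hc, mul_comm]; exact ha T hs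
    have h2 := Real.log_le_log (lt_of_le_of_ne (hmu0 T) (Ne.symm hT)) h1
    rw [Real.log_exp] at h2
    rw [Real.negMulLog, neg_mul, ← mul_neg]
    exact mul_le_mul_of_nonneg_left (by linarith) (hmu0 T)
  have hle2 : ∀ T, Real.negMulLog (mu S n T) ≤ mu S n T * -Real.log (z ^ n / (y * coeff S 0 n)) := by
    intro T
    by_cases hT : mu S n T = 0
    · simp [hT]
    obtain ⟨hs, hw, he⟩ := hpos T hT
    have h1 : z ^ n / (y * coeff S 0 n) ≤ mu S n T := by
      have h3 := hzy T hw
      rw [hs] at h3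
      rw [he, div_le_div_iff₀ (by positivity) hc]
      calc z ^ n * coeff S 0 n ≤ y * T.weight S * coeff S 0 n := by gcongr
        _ = _ := by ring
    have h2 := Real.log_le_log (by positivity) h1
    rw [Real.negMulLog, neg_mul, ← mul_neg]
    exact mul_le_mul_of_nonneg_left (by linarith) (hmu0 T)
  have hs : Summable fun T => Real.negMulLog (mu S n T) := by
    have h1 : Summable fun T => Real.negMulLog (mu S n T) - mu S n T * a :=
      ((hsum.summable.mul_right (-Real.log (z ^ n / (y * coeff S 0 n)))).sub
        (hsum.summable.mul_right a)).of_nonneg_of_le (fun T => sub_nonneg.2 (hle T))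
        fun T => sub_le_sub_right (hle2 T) _
    refine (h1.add (hsum.summable.mul_right a)).congr fun T => ?_
    ring
  have := hasSum_le hle (hsum.mul_right a) hs.hasSum
  rwa [one_mul] at this

/-- The weight of every single tree is exponentially small with respect to `ζ ^ (-n)`: this holds for
the weights of the pieces, by interpolation between the critical point and the exponential moment. -/
theorem Env.exists_weight_le {S : Spec m} {ζ θ ξ x : ℝ} (E : Env S ζ θ ξ x) {P₀ : Setup m} (h₀ : P₀.Reg)
    (hS : P₀.S = S) (hζ' : P₀.ζ = ζ) (hθ' : P₀.θ = θ) :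
    ∃ s : ℝ, 0 < s ∧ ∀ T : Tree m 0, T.weight S * (ζ * Real.exp s) ^ T.size ≤ θ := by
  have hζ := E.ζ_pos
  have hθ := E.θ_pos
  have hξ := E.ξ_pos
  have hp := h₀.Ane_pos
  have hr := h₀.A0_pos
  have hpr := h₀.add_eq_one
  set G := expMoment S ζ θ ξ * Real.exp (ξ * v0 S)
  have hlim : ∀ q : ℝ, 0 ≤ q → q < 1 → ∀ D : ℝ, ∀ᶠ N : ℕ in atTop, q ^ N * D ≤ 1 := fun q h0 h1 D => by
    have := (tendsto_pow_atTop_nhds_zero_of_lt_one h0 h1).mul_const D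
    rw [zero_mul] at this
    exact this.eventually_le_const one_pos
  -- the weights at the critical point are at most `A_≠ < 1` or `A_0 < 1`: a high power of them absorbs the
  -- exponential moment at `ξ`, and its root is a bound at `s = ξ / (N + 1)`
  obtain ⟨N, hN1, hN2⟩ := ((hlim P₀.Ane hp.le (by linarith) G).and
    (hlim P₀.A0 hr.le (by linarith) (Real.exp (ξ * v0 S)))).exists
  have hN : (0 : ℝ) < (N + 1 : ℕ) := by positivity
  set s := ξ / (N + 1 : ℕ) with hs
  have hs0 : 0 < s := by positivity
  have hNs : ((N + 1 : ℕ) : ℝ) * s = ξ := by rw [hs]; field_simp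
  have hw0 := stepW_nonneg (S := S) hζ hθ
  have hw : HasSum (stepW S ζ θ) P₀.Ane := by
    have := h₀.hasSum_w
    rwa [show P₀.w = stepW S ζ θ from funext fun t => by rw [Setup.w, hS, hζ', hθ']] at this
  have hpiece : ∀ t : Piece m 0, t.weight S * (ζ * Real.exp s) ^ t.zl * θ ^ t.al / θ ≤ 1 := by
    intro t
    have hpow : ∀ a : ℝ, 0 ≤ a → a ^ (N + 1) ≤ 1 → a ≤ 1 := fun a ha h =>
      (pow_le_one_iff_of_nonneg ha (by omega)).1 h
    have ht0 := t.weight_nonneg S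
    refine hpow _ (by positivity) ?_
    have e : t.weight S * (ζ * Real.exp s) ^ t.zl * θ ^ t.al / θ =
        (t.weight S * ζ ^ t.zl * θ ^ t.al / θ) * Real.exp (s * t.zl) := by
      rw [mul_pow, ← Real.exp_nat_mul, mul_comm s]; ring
    have e2 : Real.exp (s * t.zl) ^ (N + 1) = Real.exp (ξ * t.zl) := by
      rw [← Real.exp_nat_mul, ← mul_assoc, hNs]
    rw [e, mul_pow, e2]
    by_cases hf : IsFinal S t
    · have h1 : t.weight S * ζ ^ t.zl * θ ^ t.al / θ ≤ P₀.A0 := by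
        classical
        have h2 := le_hasSum (hasSum_final hζ hθ E.crit.Ye_ne_top) t fun t _ => by
          split_ifs
          · exact t.weight_nonneg S
          · exact le_rfl
        rw [if_pos hf] at h2
        rw [hf.1, hf.2, Setup.A0, hS, hζ', hθ', pow_zero, mul_one]
        gcongr
      rw [hf.1] at h1 ⊢
      calc _ ≤ P₀.A0 ^ (N + 1) * Real.exp (ξ * v0 S) := by gcongr
        _ = P₀.A0 * (P₀.A0 ^ N * Real.exp (ξ * v0 S)) := by ring
        _ ≤ 1 * 1 := by gcongr; linarith
        _ = 1 := one_mul 1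
    · rw [← stepW_of_not hf]
      by_cases hz : stepW S ζ θ t = 0
      · rw [hz]; simp
      have h1 : stepW S ζ θ t ≤ P₀.Ane := le_hasSum hw t fun t _ => hw0 t
      have h2 : stepW S ζ θ t * Real.exp (ξ * tilde S t.vec) ≤ expMoment S ζ θ ξ :=
        le_hasSum E.summable_exp.hasSum t fun t _ => mul_nonneg (hw0 t) (Real.exp_pos _).le
      have h3 : (t.zl : ℝ) ≤ tilde S t.vec + v0 S := by
        simp only [tilde, Piece.vec]; push_cast
        have : (0 : ℝ) ≤ v0 S * t.al := by positivity
        linarith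
      have := hw0 t
      calc _ ≤ stepW S ζ θ t ^ (N + 1) * Real.exp (ξ * (tilde S t.vec + v0 S)) := by gcongr
        _ = stepW S ζ θ t ^ N * ((stepW S ζ θ t * Real.exp (ξ * tilde S t.vec)) *
            Real.exp (ξ * v0 S)) := by
          rw [mul_add, Real.exp_add]; ring
        _ ≤ P₀.Ane ^ N * G := mul_le_mul (pow_le_pow_left₀ this h1 N)
            (mul_le_mul_of_nonneg_right h2 (Real.exp_pos _).le) (by positivity) (by positivity)
        _ ≤ 1 := hN1
  refine ⟨s, hs0, fun T => ?_⟩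
  have hlist : ∀ l : List (Piece m 0), (l.map (Piece.weight S)).prod *
      (ζ * Real.exp s) ^ (l.map Piece.zl).sum * θ ^ (l.map Piece.al).sum ≤ θ ^ l.length := by
    intro l
    induction l with
    | nil => simp
    | cons t l ih =>
      have h1 := hpiece t
      rw [div_le_one hθ] at h1
      have h3 : 0 ≤ t.weight S := t.weight_nonneg S
      simp only [List.map_cons, List.prod_cons, List.sum_cons, List.length_cons, pow_succ, pow_add]
      calc _ = ((l.map (Piece.weight S)).prod * (ζ * Real.exp s) ^ (l.map Piece.zl).sum *
            θ ^ (l.map Piece.al).sum) * (t.weight S * (ζ * Real.exp s) ^ t.zl * θ ^ t.al) := by ring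
        _ ≤ _ := mul_le_mul ih h1 (by positivity) (by positivity)
  have hex := (Tree.isExcursion_cut (T := T).2 rfl).1
  have hfst := congrArg Prod.fst hex
  have hsnd := congrArg Prod.snd hex
  rw [endpoint_fst] at hfst
  rw [Setup.Reg.endpoint_snd] at hsnd
  have h1 : (T.cut.map Piece.zl).sum = T.size := Int.ofNat_inj.1 hfst
  have h2 : (T.cut.map Piece.al).sum + 1 = T.cut.length := by omega
  have h3 := hlist T.cut
  rw [Tree.prod_cut, h1, ← h2, pow_succ, mul_comm (θ ^ _) θ] at h3
  exact le_of_mul_le_mul_right h3 (pow_pos hθ _)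

namespace Setup

variable {ξ₁ x₁ : ℝ}

/-- The entropy is at least linear, since the acceptance probability gives a lower bound on `A_n`. -/
theorem exists_le_entropy {S : Spec m} {ζ θ : ℝ} (E : Env S ζ θ ξ₁ x₁) {c : ℝ} (hc : 0 < c) :
    ∃ s : ℝ, 0 < s ∧ ∃ n₀ : ℕ, ∀ P : Setup m, P.Reg → P.S = S → P.ζ = ζ → P.θ = θ → P.RateLe →
      n₀ ≤ P.n → ENNReal.ofReal (c * P.κ) ≤ P.accProb → s * P.n ≤ entropy P.S P.n := by
  -- the bound on the weights only involves the specification and the critical point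
  by_cases hne : ∃ P : Setup m, P.Reg ∧ P.S = S ∧ P.ζ = ζ ∧ P.θ = θ
  swap
  · exact ⟨1, one_pos, 0, fun P h h1 h2 h3 => absurd ⟨P, h, h1, h2, h3⟩ hne⟩
  obtain ⟨P₀, h₀, hS, hζ, hθ⟩ := hne
  obtain ⟨s, hs, hw⟩ := E.exists_weight_le h₀ hS hζ hθ
  have hlim : ∀ᶠ n : ℕ in atTop, (n : ℝ) ^ 2 * Real.exp (-(s / 2 * n)) ≤ c := by
    have h1 := (Real.tendsto_pow_mul_exp_neg_atTop_nhds_zero 2).comp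
      ((tendsto_natCast_atTop_atTop (R := ℝ)).const_mul_atTop (show 0 < s / 2 by positivity))
    have h2 : 0 < (s / 2) ^ 2 * c := by positivity
    filter_upwards [h1.eventually_le_const h2] with n hn
    simp only [Function.comp_apply] at hn
    rw [mul_pow, mul_assoc] at hn
    exact le_of_mul_le_mul_left hn (by positivity)
  obtain ⟨n₀, hn₀⟩ := eventually_atTop.1 hlim
  refine ⟨s / 2, by positivity, n₀, fun P h hS' hζ' hθ' hr hn hacc => ?_⟩
  have hκ := h.κ_pos
  have hp : P.accProb ≠ 0 := (lt_of_lt_of_le (ENNReal.ofReal_pos.2 (by positivity)) hacc).ne'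
  have hA := h.coeff_pos hr hp
  refine le_entropy hA fun T hT => ?_
  have h1 := hw T
  rw [h.accProb_eq_coeff hr hp, ENNReal.ofReal_le_ofReal_iff (mul_pos h.bridgeConst_pos hA).le,
    bridgeConst, Reg.K_eq, hζ', hθ'] at hacc
  have hζ0 := E.ζ_pos
  have hθ0 := E.θ_pos
  have hn1 : (1 : ℝ) ≤ P.n := by exact_mod_cast (by have := h.lt; omega : 1 ≤ P.n)
  have h2 : c * θ ≤ (P.n : ℝ) ^ 2 * ζ ^ P.n * coeff P.S 0 P.n := by
    have h3 : √(P.n : ℝ) ≤ P.n := Real.sqrt_le_left (by linarith) |>.2 (by nlinarith)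
    have h4 : c * P.κ ≤ P.κ * ((P.n : ℝ) ^ 2 * ζ ^ P.n * coeff P.S 0 P.n / θ) := by
      calc _ ≤ _ := hacc
        _ ≤ P.κ * (P.n * P.n) * ζ ^ P.n / θ * coeff P.S 0 P.n := by gcongr
        _ = _ := by ring
    have h5 : c ≤ (P.n : ℝ) ^ 2 * ζ ^ P.n * coeff P.S 0 P.n / θ := by
      rw [mul_comm] at h4
      exact le_of_mul_le_mul_left h4 hκ
    rwa [le_div_iff₀ hθ0] at h5
  have h6 := hn₀ P.n hn
  rw [hT, mul_pow, ← Real.exp_nat_mul, mul_comm (P.n : ℝ) s, ← hS'] at h1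
  have hexp : Real.exp (s * P.n) = Real.exp (s / 2 * P.n) * Real.exp (s / 2 * P.n) := by
    rw [← Real.exp_add]; congr 1; ring
  have hE0 := Real.exp_pos (s / 2 * P.n)
  rw [Real.exp_neg, ← div_eq_mul_inv, div_le_iff₀ hE0] at h6
  rw [Real.exp_neg, ← div_eq_mul_inv, le_div_iff₀ hE0]
  have hζn : 0 < ζ ^ P.n := pow_pos hζ0 _
  have key : c * ζ ^ P.n * Real.exp (s / 2 * P.n) * (T.weight P.S * Real.exp (s / 2 * P.n)) ≤
      c * ζ ^ P.n * Real.exp (s / 2 * P.n) * coeff P.S 0 P.n := by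
    calc _ = c * (T.weight P.S * (ζ ^ P.n * Real.exp (s * P.n))) := by rw [hexp]; ring
      _ ≤ c * θ := by gcongr
      _ ≤ _ := h2
      _ ≤ (c * Real.exp (s / 2 * P.n)) * ζ ^ P.n * coeff P.S 0 P.n := by gcongr
      _ = _ := by ring
  exact le_of_mul_le_mul_left key (by positivity)

end Setup

end CF

end

open scoped Classical in
theorem mainTheorem1 {m : ℕ} (S : CF.Spec m) (hnl : CF.Nonlinear S) (hirr : CF.Irreducible S)
    (haper : CF.Aperiodic S) :
    (∀ n : ℕ, Set.BijOn (CF.Tree.cut (m := m)) {T | T.size = n} {t | CF.IsExcursion n t}) ∧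
    (∀ T : CF.Tree m 0, (T.cut.map (CF.Piece.weight S)).prod = T.weight S) ∧
    ∃ ζ θ : ℝ, CF.IsCritical S ζ θ ∧ (∀ ζ' θ' : ℝ, CF.IsCritical S ζ' θ' → ζ' = ζ ∧ θ' = θ) ∧
      ∀ ε : ℝ, 0 < ε → ∃ κ : ℝ, 0 < κ ∧ ∃ c C : ℝ, 0 < c ∧ 0 < C ∧ ∃ n₀ : ℕ, ∀ n : ℕ, n₀ ≤ n →
        ∀ P : CF.Setup m, P = ⟨S, ζ, θ, ε, κ, n⟩ →
        0 < CF.coeff S 0 n ∧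
        (∀ t, P.step.law t = ENNReal.ofReal (P.muNe t)) ∧
        (∀ t : List (CF.Piece m 0), (∀ s ∈ t, 0 < s.weight S ∧ ¬ CF.IsFinal S s) →
          CF.endpoint t ∈ CF.landing S n → 0 ≤ P.rate t ∧ P.rate t ≤ 1) ∧
        (∀ t, P.bridgeSampler.law t = ENNReal.ofReal (CF.muCyc S n t)) ∧
        (∀ t, P.treeSampler.law t =
          ∑' T : CF.Tree m 0, if T.cut = t then ENNReal.ofReal (CF.mu S n T) else 0) ∧
        ENNReal.ofReal c ≤ P.reachProb ∧ P.reachProb ≤ 1 ∧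
        ENNReal.ofReal c ≤ P.meanRate ∧ P.meanRate ≤ 1 ∧
        P.treeSampler.cost ≤ ENNReal.ofReal (C * n) ∧
        P.treeSampler.cost ≤ ENNReal.ofReal (C * CF.entropy S n) := by
  refine ⟨CF.Tree.bijOn_cut, CF.Tree.prod_cut S, ?_⟩
  obtain ⟨ζ, θ, ξ₁, x₁, E⟩ := CF.exists_env hnl hirr haper
  refine ⟨ζ, θ, E.crit, fun ζ' θ' hc => E.crit.unique (CF.exists_piece_al_zero haper) hc, fun ε hε => ?_⟩
  obtain ⟨δ, D, hδ, hD, hrate⟩ := CF.Setup.exists_rate_le E hε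
  obtain ⟨c, hc, n₁, hacc⟩ := CF.Setup.exists_le_accProb E
  have hκ : 0 < 1 / D := by positivity
  have hDκ : D * (1 / D) = 1 := mul_one_div_cancel hD.ne'
  obtain ⟨C, hC, hcost⟩ := CF.Setup.exists_cost_treeSampler_le E hδ one_pos
  obtain ⟨s, hs, n₂, hent⟩ := CF.Setup.exists_le_entropy E hc
  have hξ := E.ξ_pos
  have hcκ : 0 < c * (1 / D) := by positivity
  -- `κ = 1 / D` makes all the rates at most `1`; the term `1 / s` in the constant converts `n` into entropy
  refine ⟨1 / D, hκ, c * (1 / D), C / (c * (1 / D)) * (1 + 1 / s), hcκ, by positivity,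
    n₁ + n₂ + CF.v0 S + ⌈(2 * ε / ξ₁) ^ 2⌉₊ + 1, fun n hn P hP => ?_⟩
  have hS : P.S = S := by rw [hP]
  have hζ : P.ζ = ζ := by rw [hP]
  have hθ : P.θ = θ := by rw [hP]
  have hPε : P.ε = ε := by rw [hP]
  have hPκ : P.κ = 1 / D := by rw [hP]
  have hPn : P.n = n := by rw [hP]
  have hlt : CF.v0 P.S < P.n := by rw [hS, hPn]; omega
  -- the shift of the parameters is small with respect to the domain of convergence
  have hξ₁ : ε / √P.M ≤ ξ₁ / 2 := by
    have hM : (⌈(2 * ε / ξ₁) ^ 2⌉₊ : ℝ) ≤ P.M := by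
      have : ((⌈(2 * ε / ξ₁) ^ 2⌉₊ + CF.v0 S : ℕ) : ℝ) ≤ n := by exact_mod_cast (by omega)
      push_cast at this
      rw [CF.Setup.M, hS, hPn]; linarith
    have h1 : 2 * ε / ξ₁ ≤ √P.M := Real.le_sqrt_of_sq_le ((Nat.le_ceil _).trans hM)
    have h2 : 0 < √P.M := lt_of_lt_of_le (by positivity) h1
    rw [div_le_iff₀ hξ] at h1
    rw [div_le_iff₀ h2]
    linarith
  have hξ₂ : P.ε / √P.M ≤ ξ₁ := by rw [hPε]; linarith
  have hE : CF.Env P.S P.ζ P.θ ξ₁ x₁ := by rw [hS, hζ, hθ]; exact E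
  have h : P.Reg := CF.Setup.Reg.of_env hE hlt (hPκ ▸ hκ) (hPε ▸ hε) hξ₂
  have hb := hrate P h hS hζ hθ hPε hξ₁
  rw [hPκ, hDκ] at hb
  have hr : P.RateLe := fun l hl hland => (hb l hl hland).1
  have ha := hacc P h hS hζ hθ hr (by rw [hPn]; omega)
  have hen := hent P h hS hζ hθ hr (by rw [hPn]; omega) ha
  rw [hPκ] at ha
  rw [hS, hPn] at hen
  have hp : P.accProb ≠ 0 := (lt_of_lt_of_le (ENNReal.ofReal_pos.2 hcκ) ha).ne'
  have hco : P.treeSampler.cost ≤ ENNReal.ofReal (C / (c * (1 / D)) * n) := by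
    refine (hcost P h hS hζ hθ (hPε ▸ hε) hξ₂ hr hp hb).trans ?_
    rw [hPn]
    refine (ENNReal.div_le_div_left ha _).trans_eq ?_
    rw [← ENNReal.ofReal_div_of_pos hcκ]
    congr 1; ring
  have hreach := h.accProb_le_reachProb hr
  have hle : P.treeSampler.cost ≤ ENNReal.ofReal (C / (c * (1 / D)) * (1 + 1 / s) * (n : ℝ)) ∧
      P.treeSampler.cost ≤ ENNReal.ofReal (C / (c * (1 / D)) * (1 + 1 / s) * CF.entropy S n) := by
    have hn0 : (0 : ℝ) ≤ n := Nat.cast_nonneg n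
    have h1 : (0 : ℝ) ≤ 1 / s := by positivity
    have h2 : (n : ℝ) ≤ 1 / s * CF.entropy S n := by
      rw [one_div_mul_eq_div, le_div_iff₀ hs]; linarith
    have h3 : 0 ≤ CF.entropy S n := le_trans (by positivity) hen
    constructor
    · refine hco.trans (ENNReal.ofReal_le_ofReal ?_)
      gcongr
      exact le_mul_of_one_le_right (by positivity) (by linarith)
    · refine hco.trans (ENNReal.ofReal_le_ofReal ?_)
      rw [mul_assoc]
      gcongr
      linarith
  refine ⟨?_, h.law_step, fun t ht hland => ⟨(h.rate_pos t).le, hr t (fun x hx => ?_) (by rwa [hS, hPn])⟩,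
    fun t => ?_, fun t => ?_, ha.trans hreach, h.reachProb_le, ?_, ?_, hle.1, hle.2⟩
  · rw [← hPn, ← hS]; exact h.coeff_pos hr hp
  · refine ((CF.stepW_pos_iff h.ζ_pos h.θ_pos).2 ?_).ne'
    rw [hS]; exact ht x hx
  · rw [h.law_bridgeSampler_eq hr hp, hS, hPn]
  · rw [h.law_treeSampler_eq hr hp, hS, hPn]
  · rw [h.meanRate_eq hr]
    refine ha.trans ?_
    rw [ENNReal.le_div_iff_mul_le (Or.inr hp) (Or.inr (ne_top_of_le_ne_top ENNReal.one_ne_top h.accProb_le))]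
    exact mul_le_of_le_one_right zero_le h.reachProb_le
  · rw [h.meanRate_eq hr]
    exact ENNReal.div_le_of_le_mul (by rw [one_mul]; exact hreach)
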